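/- Let $k$ be a field and let $M$ be a smooth algebraic variety over $k$, that is, a smooth separated scheme of finite type over $k$ (not assumed irreducible). Let $l\ge 0$ and let $Y_1,\dots,Y_l$ be closed subschemes of $M$ that are smooth over $k$ and whose scheme-theoretic intersection $\iota\colon Z=Y_1\cap\dots\cap Y_l\hookrightarrow M$ (the closed subscheme with ideal sheaf $\mathcal I_Z=\mathcal I_{Y_1}+\dots+\mathcal I_{Y_l}$) is smooth over $k$. Let $N_{Y_i}$ and $N_Z$ be the normal bundles of $Y_i$ and $Z$ in $M$, where $N_Y=\mathcal Hom_{\mathcal O_M}(\mathcal I_Y,\mathcal O_Y)$, regarded as a sheaf on $Y$. The inclusions $\mathcal I_{Y_i}\subseteq\mathcal I_Z$ and the identifications $N_{Y_i}|_Z\cong\mathcal Hom_{\mathcal O_M}(\mathcal I_{Y_i},\mathcal O_Z)$ embed $N_Z$ as a subsheaf of $\bigoplus_{i=1}^l N_{Y_i}|_Z$. Then for every $q\ge 0$ there is an isomorphism of $\mathcal O_M$-modules $$\mathrm{Tor}_q^{\mathcal O_M}(\mathcal O_{Y_1},\dots,\mathcal O_{Y_l})\;\cong\;\iota_*\,\Lambda^q\Big(\Big(\bigoplus_{i=1}^l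 N_{Y_i}|_Z\Big)\Big/N_Z\Big)^{*}.$$ Here $\mathrm{Tor}_q^{\mathcal O_M}(F_1,\dots,F_l)$ is the $q$-th homology sheaf of the derived tensor product $F_1\otimes^{L}\cdots\otimes^{L}F_l$ over $\mathcal O_M$ (the multitor), that is, the sheaf associated with $U\mapsto \mathrm{Tor}_q^{\mathcal O_M(U)}(F_1(U),\dots,F_l(U))$, the $q$-th homology of the tensor product of free resolutions of the modules $F_i(U)$; the dual and the exterior power are taken over $\mathcal O_Z$. For $l=0$ we read $Z=M$ and the empty tensor product as $\mathcal O_M$. -/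

import Mathlib

open CategoryTheory MonoidalCategory Limits AlgebraicGeometry

universe u

noncomputable section

namespace MultiTor

/-! ### Multitors of presheaves of modules -/

section Presheaf

variable {C : Type u} [SmallCategory C] (R : Cᵒᵖ ⥤ CommRingCat.{u})

/-- Presheaves of modules over a presheaf of commutative rings. -/
abbrev PMod := PresheafOfModules.{u} (R ⋙ forget₂ CommRingCat RingCat)

instance : MonoidalPreadditive (PMod R) where
  whiskerLeft_zero := by
    intros; ext U : 1; exact MonoidalPreadditive.whiskerLeft_zero (C := ModuleCat (R.obj U))
  zero_whiskerRight := by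
    intros; ext U : 1; exact MonoidalPreadditive.zero_whiskerRight (C := ModuleCat (R.obj U))
  whiskerLeft_add := by
    intros; ext U : 1; exact MonoidalPreadditive.whiskerLeft_add (C := ModuleCat (R.obj U)) _ _
  add_whiskerRight := by
    intros; ext U : 1; exact MonoidalPreadditive.add_whiskerRight (C := ModuleCat (R.obj U)) _ _

instance : (curriedTensor (PMod R)).Additive where

instance (F : PMod R) : ((curriedTensor (PMod R)).obj F).Additive where

/-- Every presheaf of modules `F` is functorially a quotient of the free presheaf of modules
`U ↦ R(U)^(F(U))` on its underlying presheaf of sets. -/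
def freeCover : Abelian.LeftResolution (𝟭 (PMod R)) where
  F := (PresheafOfModules.toPresheaf (R ⋙ forget₂ CommRingCat RingCat) ⋙
      (Functor.whiskeringRight _ _ _).obj (forget Ab)) ⋙ PresheafOfModules.free _
  π := (PresheafOfModules.freeAdjunction (R ⋙ forget₂ CommRingCat RingCat)).counit
  epi_π_app F := by
    refine PresheafOfModules.epi_of_surjective fun U x ↦ ?_
    refine ⟨ModuleCat.freeMk x, ?_⟩
    exact ModuleCat.freeDesc_apply _ _

variable {R}

/-- The functorial resolution of `F` by presheaves of free modules; over an object `U` it is a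
free resolution of the `R(U)`-module `F(U)`. -/
def freeResolution (F : PMod R) : ChainComplex (PMod R) ℕ :=
  (freeCover R).chainComplex F

/-- The (total) tensor product of finitely many chain complexes. -/
def tensorComplex : (l : ℕ) → (Fin l → ChainComplex (PMod R) ℕ) → ChainComplex (PMod R) ℕ
  | 0, _ => HomologicalComplex.tensorUnit (PMod R) (ComplexShape.down ℕ)
  | l + 1, K => HomologicalComplex.tensorObj (K 0) (tensorComplex l fun i ↦ K i.succ)

/-- The presheaf `U ↦ Tor_q^{R(U)}(F₁(U), …, F_l(U))`. -/
def presheafTor (q : ℕ) {l : ℕ} (F : Fin l → PMod R) : PMod R :=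
  (tensorComplex l fun i ↦ freeResolution (F i)).homology q

end Presheaf

/-! ### Sheaves of modules on schemes -/

section Sheaf

variable {X : Scheme.{u}}

/-- The sheaf of modules associated with a presheaf of modules. -/
def sheafify (F : PMod X.presheaf) : X.Modules :=
  (PresheafOfModules.sheafification (𝟙 X.ringCatSheaf.obj)).obj F

/-- The morphism of sheaves associated with a morphism of presheaves. -/
def sheafifyMap {F G : PMod X.presheaf} (φ : F ⟶ G) : sheafify F ⟶ sheafify G :=
  (PresheafOfModules.sheafification (𝟙 X.ringCatSheaf.obj)).map φ

/-- The multitor sheaf `Tor_q^{𝒪_X}(F₁, …, F_l)`: the sheaf associated with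
`U ↦ Tor_q^{𝒪_X(U)}(F₁(U), …, F_l(U))`. -/
def torSheaf (q : ℕ) {l : ℕ} (F : Fin l → X.Modules) : X.Modules :=
  sheafify (presheafTor q fun i ↦ (F i).val)

/-- The structure sheaf `𝒪_X`, as a module over itself. -/
abbrev structureSheaf (X : Scheme.{u}) : X.Modules := SheafOfModules.unit X.ringCatSheaf

/-! #### Exterior powers -/

/-- The restriction map of an `𝒪_X`-module, as a semilinear map. -/
def res (F : X.Modules) {U V : X.Opens} (h : V ≤ U) :
    Γ(F, U) →ₛₗ[(X.presheaf.map (homOfLE h).op).hom] Γ(F, V) where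
  toFun s := F.presheaf.map (homOfLE h).op s
  map_add' := by simp
  map_smul' := by simp

/-- The alternating map `(m₁, …, m_q) ↦ φ m₁ ∧ ⋯ ∧ φ m_q` for a semilinear map `φ`. -/
def extAlt {A B : Type u} [CommRing A] [CommRing B] {σ : A →+* B} {M N : Type u}
    [AddCommGroup M] [Module A M] [AddCommGroup N] [Module B N] (q : ℕ) (φ : M →ₛₗ[σ] N) :
    letI : Module A (⋀[B]^q N) := Module.compHom _ σ
    M [⋀^Fin q]→ₗ[A] ⋀[B]^q N :=
  letI : Module A (⋀[B]^q N) := Module.compHom _ σ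
  have key (m : Fin q → M) (j : Fin q) (x : M) [DecidableEq (Fin q)] :
      (fun i ↦ φ (Function.update m j x i)) = Function.update (fun i ↦ φ (m i)) j (φ x) := by
    funext i
    exact Function.apply_update (fun _ ↦ φ) m j x i
  { toFun := fun m ↦ exteriorPower.ιMulti B q fun i ↦ φ (m i)
    map_update_add' := fun m j x y ↦ by
      simp only [key, map_add, AlternatingMap.map_update_add]
    map_update_smul' := fun m j c x ↦ by
      simp only [key, map_smulₛₗ, AlternatingMap.map_update_smul]
      rfl
    map_eq_zero_of_eq' := fun m i j h hij ↦
      (exteriorPower.ιMulti B q).map_eq_zero_of_eq _ (congrArg φ h) hij }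

/-- The semilinear map `⋀^q M → ⋀^q N` induced by a semilinear map `φ : M → N`,
`m₁ ∧ ⋯ ∧ m_q ↦ φ m₁ ∧ ⋯ ∧ φ m_q`. -/
def extMap {A B : Type u} [CommRing A] [CommRing B] {σ : A →+* B} {M N : Type u}
    [AddCommGroup M] [Module A M] [AddCommGroup N] [Module B N] (q : ℕ) (φ : M →ₛₗ[σ] N) :
    ⋀[A]^q M →ₛₗ[σ] ⋀[B]^q N :=
  letI : Module A (⋀[B]^q N) := Module.compHom _ σ
  { toFun := exteriorPower.alternatingMapLinearEquiv (extAlt q φ)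
    map_add' := map_add _
    map_smul' := fun r x ↦ map_smul (exteriorPower.alternatingMapLinearEquiv (extAlt q φ)) r x }

lemma extMap_ιMulti {A B : Type u} [CommRing A] [CommRing B] {σ : A →+* B} {M N : Type u}
    [AddCommGroup M] [Module A M] [AddCommGroup N] [Module B N] (q : ℕ) (φ : M →ₛₗ[σ] N)
    (m : Fin q → M) :
    extMap q φ (exteriorPower.ιMulti A q m) = exteriorPower.ιMulti B q fun i ↦ φ (m i) := by
  let _ : Module A (⋀[B]^q N) := Module.compHom _ σ
  exact exteriorPower.alternatingMapLinearEquiv_apply_ιMulti (extAlt q φ) m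

lemma extMap_id {A : Type u} [CommRing A] {σ : A →+* A} {M : Type u} [AddCommGroup M]
    [Module A M] (q : ℕ) (φ : M →ₛₗ[σ] M) (hσ : ∀ a, σ a = a) (h : ∀ m, φ m = m)
    (x : ⋀[A]^q M) : extMap q φ x = x := by
  have hx : x ∈ Submodule.span A (Set.range (exteriorPower.ιMulti A q (M := M))) := by
    rw [exteriorPower.ιMulti_span]; trivial
  induction hx using Submodule.span_induction with
  | mem x hx => obtain ⟨m, rfl⟩ := hx; simp only [extMap_ιMulti, h]
  | zero => exact map_zero _
  | add x y _ _ hx hy => rw [map_add, hx, hy]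
  | smul a x _ hx => rw [map_smulₛₗ, hx, hσ]

lemma extMap_comp {A B D : Type u} [CommRing A] [CommRing B] [CommRing D] {σ : A →+* B}
    {τ : B →+* D} {ρ : A →+* D} {M N P : Type u} [AddCommGroup M] [Module A M]
    [AddCommGroup N] [Module B N] [AddCommGroup P] [Module D P] (q : ℕ)
    (φ : M →ₛₗ[σ] N) (ψ : N →ₛₗ[τ] P) (χ : M →ₛₗ[ρ] P) (hρ : ∀ a, ρ a = τ (σ a))
    (h : ∀ m, χ m = ψ (φ m)) (x : ⋀[A]^q M) : extMap q χ x = extMap q ψ (extMap q φ x) := by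
  have hx : x ∈ Submodule.span A (Set.range (exteriorPower.ιMulti A q (M := M))) := by
    rw [exteriorPower.ιMulti_span]; trivial
  induction hx using Submodule.span_induction with
  | mem x hx => obtain ⟨m, rfl⟩ := hx; simp only [extMap_ιMulti, h]
  | zero => simp only [map_zero]
  | add x y _ _ hx hy => simp only [map_add, hx, hy]
  | smul a x _ hx => simp only [map_smulₛₗ, hx, hρ]

lemma ring_res_res {U V W : X.Opens} (h : V ≤ U) (h' : W ≤ V) (r : Γ(X, U)) :
    X.presheaf.map (homOfLE (h'.trans h)).op r =
      X.presheaf.map (homOfLE h').op (X.presheaf.map (homOfLE h).op r) := by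
  rw [← ConcreteCategory.comp_apply, ← Functor.map_comp]
  rfl

lemma ring_res_self {U : X.Opens} (h : U ≤ U) (r : Γ(X, U)) :
    X.presheaf.map (homOfLE h).op r = r :=
  ConcreteCategory.congr_hom (X.presheaf.map_id (.op U)) r

lemma res_res (F : X.Modules) {U V W : X.Opens} (h : V ≤ U) (h' : W ≤ V) (s : Γ(F, U)) :
    res F (h'.trans h) s = res F h' (res F h s) :=
  ConcreteCategory.congr_hom (F.presheaf.map_comp (homOfLE h).op (homOfLE h').op) s

lemma res_self (F : X.Modules) {U : X.Opens} (h : U ≤ U) (s : Γ(F, U)) : res F h s = s :=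
  ConcreteCategory.congr_hom (F.presheaf.map_id (.op U)) s

/-- The presheaf `U ↦ ⋀^q F(U)` (exterior power over `𝒪_X(U)`). -/
def presheafExt (q : ℕ) (F : X.Modules) : PMod X.presheaf :=
  letI P : X.Opensᵒᵖ ⥤ Ab.{u} :=
    { obj := fun U ↦ AddCommGrpCat.of (⋀[Γ(X, U.unop)]^q Γ(F, U.unop))
      map := fun f ↦ AddCommGrpCat.ofHom (extMap q (res F f.unop.le)).toAddMonoidHom
      map_id := fun _ ↦ AddCommGrpCat.hom_ext <| AddMonoidHom.ext <|
        extMap_id q (res F le_rfl) (ring_res_self _) (res_self F _)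
      map_comp := fun f g ↦ AddCommGrpCat.hom_ext <| AddMonoidHom.ext <|
        extMap_comp q (res F f.unop.le) (res F g.unop.le) (res F (g.unop.le.trans f.unop.le))
          (ring_res_res _ _) (res_res F _ _) }
  letI (U : X.Opensᵒᵖ) : Module ((X.presheaf ⋙ forget₂ CommRingCat RingCat).obj U) (P.obj U) :=
    inferInstanceAs (Module Γ(X, U.unop) (⋀[Γ(X, U.unop)]^q Γ(F, U.unop)))
  PresheafOfModules.ofPresheaf P fun _ _ f r m ↦ (extMap q (res F f.unop.le)).map_smulₛₗ r m

/-- The exterior power `⋀^q F` of an `𝒪_X`-module. -/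
def extPower (q : ℕ) (F : X.Modules) : X.Modules := sheafify (presheafExt q F)

/-! #### Sheaves of homomorphisms -/

/-- The homomorphisms `F|_U → G|_U` of `𝒪_U`-modules: families of `𝒪_X(V)`-linear maps
`F(V) → G(V)`, for `V ⊆ U` open, compatible with restriction. -/
def localHom (F G : X.Modules) (U : X.Opens) :
    AddSubgroup (∀ V : {V : X.Opens // V ≤ U}, Γ(F, V.1) →ₗ[Γ(X, V.1)] Γ(G, V.1)) where
  carrier := {φ | ∀ (V W : {V : X.Opens // V ≤ U}) (h : W.1 ≤ V.1) (s : Γ(F, V.1)),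
    φ W (res F h s) = res G h (φ V s)}
  add_mem' hφ hψ V W h s := by simp [hφ V W h s, hψ V W h s]
  zero_mem' V W h s := by simp
  neg_mem' hφ V W h s := by simp [hφ V W h s]

/-- Sections of `𝒪_X` over `U` act on `Hom(F|_U, G|_U)` through their restrictions. -/
instance (F G : X.Modules) (U : X.Opens) : SMul Γ(X, U) (localHom F G U) where
  smul r φ := ⟨fun V ↦ X.presheaf.map (homOfLE V.2).op r • φ.1 V, fun V W h s ↦ by
    rw [LinearMap.smul_apply, LinearMap.smul_apply, map_smulₛₗ, φ.2 V W h s]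
    congr 1
    exact ring_res_res V.2 h r⟩

lemma localHom_ext {F G : X.Modules} {U : X.Opens} {φ ψ : localHom F G U}
    (h : ∀ V s, φ.1 V s = ψ.1 V s) : φ = ψ :=
  Subtype.ext <| funext fun V ↦ LinearMap.ext (h V)

lemma localHom_smul_apply {F G : X.Modules} {U : X.Opens} (r : Γ(X, U)) (φ : localHom F G U)
    (V : {V : X.Opens // V ≤ U}) (s : Γ(F, V.1)) :
    (r • φ).1 V s = X.presheaf.map (homOfLE V.2).op r • φ.1 V s := rfl

lemma localHom_add_apply {F G : X.Modules} {U : X.Opens} (φ ψ : localHom F G U)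
    (V : {V : X.Opens // V ≤ U}) (s : Γ(F, V.1)) : (φ + ψ).1 V s = φ.1 V s + ψ.1 V s := rfl

lemma localHom_zero_apply {F G : X.Modules} {U : X.Opens}
    (V : {V : X.Opens // V ≤ U}) (s : Γ(F, V.1)) : (0 : localHom F G U).1 V s = 0 := rfl

instance (F G : X.Modules) (U : X.Opens) : Module Γ(X, U) (localHom F G U) where
  one_smul φ := localHom_ext fun V s ↦ by rw [localHom_smul_apply, map_one, one_smul]
  mul_smul r r' φ := localHom_ext fun V s ↦ by
    rw [localHom_smul_apply, localHom_smul_apply, localHom_smul_apply, map_mul, mul_smul]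
  smul_zero r := localHom_ext fun V s ↦ by
    rw [localHom_smul_apply, localHom_zero_apply, smul_zero]
  smul_add r φ ψ := localHom_ext fun V s ↦ by
    rw [localHom_smul_apply, localHom_add_apply, localHom_add_apply, localHom_smul_apply,
      localHom_smul_apply, smul_add]
  add_smul r r' φ := localHom_ext fun V s ↦ by
    rw [localHom_smul_apply, localHom_add_apply, localHom_smul_apply, localHom_smul_apply,
      map_add, add_smul]
  zero_smul φ := localHom_ext fun V s ↦ by
    rw [localHom_smul_apply, localHom_zero_apply, map_zero, zero_smul]

/-- Restriction of homomorphisms from `U` to `V ⊆ U`. -/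
def localHomRes (F G : X.Modules) {U V : X.Opens} (h : V ≤ U) :
    localHom F G U →ₛₗ[(X.presheaf.map (homOfLE h).op).hom] localHom F G V where
  toFun φ := ⟨fun W ↦ φ.1 ⟨W.1, W.2.trans h⟩, fun W W' h' s ↦ φ.2 ⟨W.1, _⟩ ⟨W'.1, _⟩ h' s⟩
  map_add' φ ψ := rfl
  map_smul' r φ := by
    refine localHom_ext fun W s ↦ ?_
    rw [localHom_smul_apply]
    change X.presheaf.map (homOfLE (W.2.trans h)).op r • _ = _
    rw [ring_res_res h W.2]
    rfl

/-- The presheaf `U ↦ Hom(F|_U, G|_U)`. -/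
def presheafHom (F G : X.Modules) : PMod X.presheaf :=
  letI P : X.Opensᵒᵖ ⥤ Ab.{u} :=
    { obj := fun U ↦ AddCommGrpCat.of (localHom F G U.unop)
      map := fun f ↦ AddCommGrpCat.ofHom (localHomRes F G f.unop.le).toAddMonoidHom
      map_id := fun _ ↦ rfl
      map_comp := fun _ _ ↦ rfl }
  letI (U : X.Opensᵒᵖ) : Module ((X.presheaf ⋙ forget₂ CommRingCat RingCat).obj U) (P.obj U) :=
    inferInstanceAs (Module Γ(X, U.unop) (localHom F G U.unop))
  PresheafOfModules.ofPresheaf P fun _ _ f r m ↦ (localHomRes F G f.unop.le).map_smulₛₗ r m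

/-- The sheaf of homomorphisms `ℋom(F, G)` of `𝒪_X`-modules. -/
def sheafHom (F G : X.Modules) : X.Modules := sheafify (presheafHom F G)

lemma app_res {F G : X.Modules} (g : F ⟶ G) {U V : X.Opens} (h : V ≤ U) (s : Γ(F, U)) :
    g.app V (res F h s) = res G h (g.app U s) :=
  ConcreteCategory.congr_hom (g.mapPresheaf.naturality (homOfLE h).op) s

/-- The morphism of presheaves `Hom(F|_U, G|_U) → Hom(F|_U, G'|_U)`, `φ ↦ g ∘ φ`. -/
def presheafHomPostcomp (F : X.Modules) {G G' : X.Modules} (g : G ⟶ G') :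
    presheafHom F G ⟶ presheafHom F G' :=
  PresheafOfModules.homMk
    { app := fun U ↦ AddCommGrpCat.ofHom <| AddMonoidHom.mk'
        (fun φ : localHom F G U.unop ↦ (⟨fun V ↦
          { toFun := fun s ↦ g.app V.1 (φ.1 V s)
            map_add' := by simp
            map_smul' := by simp }, fun V W h s ↦
              (congrArg (g.app W.1) (φ.2 V W h s)).trans (app_res g h _)⟩ :
            localHom F G' U.unop))
        (fun φ ψ ↦ localHom_ext fun V s ↦ map_add (g.app V.1).hom (φ.1 V s) (ψ.1 V s))
      naturality := fun _ _ _ ↦ rfl }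
    (fun U r φ ↦ localHom_ext (U := U.unop) fun V s ↦
      g.app_smul (X.presheaf.map (homOfLE V.2).op r) (φ.1 V s))

/-- The morphism of presheaves `Hom(F|_U, G|_U) → Hom(F'|_U, G|_U)`, `φ ↦ φ ∘ f`. -/
def presheafHomPrecomp {F F' : X.Modules} (f : F' ⟶ F) (G : X.Modules) :
    presheafHom F G ⟶ presheafHom F' G :=
  PresheafOfModules.homMk
    { app := fun U ↦ AddCommGrpCat.ofHom <| AddMonoidHom.mk'
        (fun φ : localHom F G U.unop ↦ (⟨fun V ↦
          { toFun := fun s ↦ φ.1 V (f.app V.1 s)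
            map_add' := by simp
            map_smul' := by simp }, fun V W h s ↦
              (congrArg (φ.1 W) (app_res f h s)).trans (φ.2 V W h _)⟩ :
            localHom F' G U.unop))
        (fun _ _ ↦ rfl)
      naturality := fun _ _ _ ↦ rfl }
    (fun _ _ _ ↦ rfl)

/-- Postcomposition `ℋom(F, G) → ℋom(F, G')` with `g : G → G'`. -/
def sheafHomPostcomp (F : X.Modules) {G G' : X.Modules} (g : G ⟶ G') :
    sheafHom F G ⟶ sheafHom F G' :=
  sheafifyMap (presheafHomPostcomp F g)

/-- Precomposition `ℋom(F, G) → ℋom(F', G)` with `f : F' → F`. -/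
def sheafHomPrecomp {F F' : X.Modules} (f : F' ⟶ F) (G : X.Modules) :
    sheafHom F G ⟶ sheafHom F' G :=
  sheafifyMap (presheafHomPrecomp f G)

/-- The dual `F^* = ℋom(F, 𝒪_X)`. -/
def dual (F : X.Modules) : X.Modules := sheafHom F (structureSheaf X)

end Sheaf

/-! ### Normal sheaves -/

section Normal

variable {M Y Z : Scheme.{u}}

/-- The morphism `𝒪_M → i_* 𝒪_Y`, restriction of functions. -/
def toPushforward (i : Y ⟶ M) :
    structureSheaf M ⟶ (Scheme.Modules.pushforward i).obj (structureSheaf Y) :=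
  SheafOfModules.unitToPushforwardObjUnit i.toRingCatSheafHom

/-- The ideal sheaf `ℐ_Y = ker (𝒪_M → i_* 𝒪_Y)`. -/
def idealSheaf (i : Y ⟶ M) : M.Modules := kernel (toPushforward i)

/-- For `Z ⊆ Y ⊆ M`, the restriction of functions `𝒪_Y → 𝒪_Z`, as a morphism of
`𝒪_M`-modules. -/
def pushforwardRes (j : Z ⟶ Y) (i : Y ⟶ M) (k : Z ⟶ M) (h : j ≫ i = k) :
    (Scheme.Modules.pushforward i).obj (structureSheaf Y) ⟶
      (Scheme.Modules.pushforward k).obj (structureSheaf Z) :=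
  (Scheme.Modules.pushforward i).map (toPushforward j) ≫
    (Scheme.Modules.pushforwardComp j i).hom.app _ ≫
    (Scheme.Modules.pushforwardCongr h).hom.app _

lemma toPushforward_comp (j : Z ⟶ Y) (i : Y ⟶ M) (k : Z ⟶ M) (h : j ≫ i = k) :
    toPushforward i ≫ pushforwardRes j i k h = toPushforward k := by
  subst h
  refine Scheme.Modules.hom_ext _ _ fun U ↦ ?_
  ext r
  change (structureSheaf Z).presheaf.map (eqToHom rfl).op (j.app (i ⁻¹ᵁ U) (i.app U r)) =
    (j ≫ i).app U r
  rw [eqToHom_refl, op_id, CategoryTheory.Functor.map_id]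
  rfl

/-- For `Z ⊆ Y ⊆ M`, the inclusion `ℐ_Y → ℐ_Z`. -/
def idealSheafMap (j : Z ⟶ Y) (i : Y ⟶ M) (k : Z ⟶ M) (h : j ≫ i = k) :
    idealSheaf i ⟶ idealSheaf k :=
  kernel.lift _ (kernel.ι (toPushforward i)) (by
    rw [← toPushforward_comp j i k h]
    exact (kernel.condition_assoc _ _).trans zero_comp)

/-- The normal sheaf `N_{Y/M} = ℋom_{𝒪_M}(ℐ_Y, 𝒪_Y)` of a closed subscheme `i : Y → M`,
as a sheaf of modules on `Y`. -/
def normalSheaf (i : Y ⟶ M) : Y.Modules :=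
  (Scheme.Modules.pullback i).obj
    (sheafHom (idealSheaf i) ((Scheme.Modules.pushforward i).obj (structureSheaf Y)))

/-- For `Z ⊆ Y ⊆ M`, the sheaf `ℋom_{𝒪_M}(ℐ_Y, 𝒪_Z)`, as a sheaf of modules on `Z`. -/
def normalSheafInto (i : Y ⟶ M) (k : Z ⟶ M) : Z.Modules :=
  (Scheme.Modules.pullback k).obj
    (sheafHom (idealSheaf i) ((Scheme.Modules.pushforward k).obj (structureSheaf Z)))

/-- The canonical map `N_{Y/M}|_Z → ℋom_{𝒪_M}(ℐ_Y, 𝒪_Z)`, induced by `𝒪_Y → 𝒪_Z`. It is an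
isomorphism when `Y` and `M` are smooth. -/
def normalSheafRestrict (j : Z ⟶ Y) (i : Y ⟶ M) (k : Z ⟶ M) (h : j ≫ i = k) :
    (Scheme.Modules.pullback j).obj (normalSheaf i) ⟶ normalSheafInto i k :=
  (Scheme.Modules.pullbackComp j i).hom.app _ ≫ (Scheme.Modules.pullbackCongr h).hom.app _ ≫
    (Scheme.Modules.pullback k).map (sheafHomPostcomp _ (pushforwardRes j i k h))

/-- The canonical map `N_{Z/M} → ℋom_{𝒪_M}(ℐ_Y, 𝒪_Z)`, induced by `ℐ_Y ⊆ ℐ_Z`. -/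
def normalSheafMap (j : Z ⟶ Y) (i : Y ⟶ M) (k : Z ⟶ M) (h : j ≫ i = k) :
    normalSheaf k ⟶ normalSheafInto i k :=
  (Scheme.Modules.pullback k).map (sheafHomPrecomp (idealSheafMap j i k h) _)

end Normal

/-! ### Families of closed subschemes -/

section Family

variable {M : Scheme.{u}} {l : ℕ} (Y : Fin l → M.IdealSheafData)

/-- The scheme-theoretic intersection `Z = Y₁ ∩ ⋯ ∩ Y_l`, whose ideal is the sum of the ideals
of the `Y_i`. -/
abbrev inter : M.IdealSheafData := ⨆ i, Y i

/-- The inclusion `Z → Y_i`. -/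
abbrev interInclusion (i : Fin l) : (inter Y).subscheme ⟶ (Y i).subscheme :=
  Scheme.IdealSheafData.inclusion (le_iSup Y i)

lemma interInclusion_comp (i : Fin l) :
    interInclusion Y i ≫ (Y i).subschemeι = (inter Y).subschemeι := by
  simp

instance (X : Scheme.{u}) : HasFiniteBiproducts X.Modules := Abelian.hasFiniteBiproducts

/-- The sheaf `⨁ N_{Y_i}|_Z` on `Z`. -/
def sumNormal : (inter Y).subscheme.Modules :=
  ⨁ fun i ↦ (Scheme.Modules.pullback (interInclusion Y i)).obj (normalSheaf (Y i).subschemeι)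

/-- The sheaf `⨁ ℋom(ℐ_{Y_i}, 𝒪_Z)` on `Z`. -/
def sumNormalInto : (inter Y).subscheme.Modules :=
  ⨁ fun i ↦ normalSheafInto (Y i).subschemeι (inter Y).subschemeι

/-- The canonical map `⨁ N_{Y_i}|_Z → ⨁ ℋom(ℐ_{Y_i}, 𝒪_Z)`. -/
def sumNormalRestrict : sumNormal Y ⟶ sumNormalInto Y :=
  biproduct.map fun i ↦ normalSheafRestrict _ _ _ (interInclusion_comp Y i)

/-- The canonical map `N_Z → ⨁ ℋom(ℐ_{Y_i}, 𝒪_Z)`. -/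
def normalToSum : normalSheaf (inter Y).subschemeι ⟶ sumNormalInto Y :=
  biproduct.lift fun i ↦ normalSheafMap _ _ _ (interInclusion_comp Y i)

/-- The quotient `(⨁ N_{Y_i}|_Z) / N_Z`. The submodule `N_Z` of `⨁ N_{Y_i}|_Z` consists of the
sections whose image in `⨁ ℋom(ℐ_{Y_i}, 𝒪_Z)` comes from `N_Z = ℋom(ℐ_Z, 𝒪_Z)`, by restriction
along `ℐ_{Y_i} ⊆ ℐ_Z`. -/
def normalQuotient : (inter Y).subscheme.Modules :=
  cokernel (Limits.pullback.fst (sumNormalRestrict Y) (normalToSum Y))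

end Family

end MultiTor

end

/-!
Both sheaves are covered by one and the same presheaf, with the same relations. For an open subset
`U` let `C(U)` be the set of families `z` of functions on `U` such that `z a` vanishes on `Y a` and
the sum of the `z a` is zero; the covering presheaf is the presheaf of free modules on the `q`-tuples
of elements of `C(U)`.

*The map to the multitor.* On a free resolution of `𝒪_{Y a}` multiplication by `z a` is
null-homotopic. The null-homotopies of the factors add up, with signs, to an operator of degree one
on the tensor product of the resolutions, and this operator commutes with the differential up to
sign, because the sum of the `z a` is zero. Applying the operators of a `q`-tuple to the element
`1 ⊗ ⋯ ⊗ 1` gives a cycle of degree `q`. Its class does not depend on the null-homotopies, which are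
unique up to homotopy, so that it is compatible with restrictions (`wordHom`).

*The map to the exterior power.* A family `z` acts on the normal sheaves of the `Y a` by the sum of
the evaluations at the `z a`. On the normal sheaf of the intersection `Z` this is evaluation at the
sum, which is zero, so `z` defines a section of the dual of the quotient (`exists_quotHom`,
`QuotData.cycHom`). A `q`-tuple is sent to the wedge product of these sections
(`QuotData.wedgeHom`).

*Comparison.* A point outside `Z` has a neighborhood on which `1` is a sum of functions `z a` as above,
and both sheaves vanish there (`presheafTor_subsingleton`). Near a point of `Z`, smoothness of the
`Y a` and of `Z` gives generators `f j` of the ideals of the `Y a` that are regular in any order,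
some of which, with index in a set `S`, generate the ideal of `Z` and are regular in any order, too
(`exists_isChart`): elements with linearly independent differentials define a flat map to an affine
space. The tensor product of the resolutions is then equivalent to the Koszul complex on all `f j`,
compatibly with the operators. The generators with index in `S` can be eliminated, and what remains is
the Koszul complex over `𝒪_Z` of elements that act by zero, that is, an exterior algebra on the
superfluous generators, where `z` operates as multiplication by the vector of its coefficients
(`ODG.wordComb_spec`). On the other hand, the classes of the coefficient homomorphisms of the
superfluous generators and the homomorphisms given by the relations that express these generators
in terms of `S` are dual bases of the quotient and its dual, and `z` defines the homomorphism with
the same vector of coefficients (`QuotData.cycHom_eq_sum_frameCyc`). Hence both maps are surjective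
over small affine open subsets, with the same kernel (`QuotData.isGood_of_isChart`), and the two
sheaves are isomorphic (`nonempty_sheafify_iso`).
-/

noncomputable section

namespace MultiTor

/-! ### Differential graded modules with a base point -/

section DGModules

open TensorProduct

/-- A differential module over `A` with a parity involution `ε`, a family of submodules `gr n`
(the elements of degree `n`) and a distinguished cycle `one` of degree `0`. A chain complex is
encoded by the direct sum of its terms; this makes the tensor product of complexes the plain tensor
product of modules. The `gr n` are not required to decompose the module. -/
structure DG (A : Type u) [CommRing A] where
  X : Type u
  [grp : AddCommGroup X]
  [mod : Module A X]
  d : X →ₗ[A] X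
  ε : X →ₗ[A] X
  gr : ℕ → Submodule A X
  one : X
  d_d : ∀ x, d (d x) = 0
  ε_ε : ∀ x, ε (ε x) = x
  d_ε : ∀ x, d (ε x) = -ε (d x)
  ε_one : ε one = one
  d_one : d one = 0
  one_mem : one ∈ gr 0
  ε_gr : ∀ n x, x ∈ gr n → ε x = (-1 : A) ^ n • x

attribute [instance] DG.grp DG.mod

namespace DG

variable {A A' A'' : Type u} [CommRing A] [CommRing A'] [CommRing A''] {σ : A →+* A'}

lemma ε_mem (X : DG A) (n : ℕ) (x : X.X) (hx : x ∈ X.gr n) : X.ε x ∈ X.gr n := by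
  rw [X.ε_gr n x hx]
  exact Submodule.smul_mem _ _ hx

/-- A module in degree `0`. -/
def deg0 {N : Type u} [AddCommGroup N] [Module A N] (one : N) : DG A where
  X := N
  d := 0
  ε := LinearMap.id
  gr n := if n = 0 then ⊤ else ⊥
  one := one
  d_d _ := rfl
  ε_ε _ := rfl
  d_ε _ := by simp
  ε_one := rfl
  d_one := rfl
  one_mem := by simp
  ε_gr n x h := by
    obtain rfl | hn := eq_or_ne n 0
    · simp
    · have : x = 0 := by simpa [hn] using h
      simp [this]

/-- The tensor product of differential modules, with the usual sign rule. -/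
def tensor (X Y : DG A) : DG A where
  X := X.X ⊗[A] Y.X
  d := map X.d LinearMap.id + map X.ε Y.d
  ε := map X.ε Y.ε
  gr n := Submodule.span A {t | ∃ p q, p + q = n ∧ ∃ x ∈ X.gr p, ∃ y ∈ Y.gr q, t = x ⊗ₜ y}
  one := X.one ⊗ₜ Y.one
  d_d t := by
    induction t with
    | zero => simp
    | tmul x y => simp [X.d_d, Y.d_d, X.d_ε, TensorProduct.neg_tmul]
    | add t t' h h' => simp only [map_add, h, h', add_zero]
  ε_ε t := by
    induction t with
    | zero => simp
    | tmul x y => simp [X.ε_ε, Y.ε_ε]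
    | add t t' h h' => simp only [map_add, h, h']
  d_ε t := by
    induction t with
    | zero => simp
    | tmul x y => simp [X.d_ε, Y.d_ε, TensorProduct.neg_tmul, TensorProduct.tmul_neg, add_comm]
    | add t t' h h' => simp only [map_add, h, h', neg_add]
  ε_one := by simp [X.ε_one, Y.ε_one]
  d_one := by simp [X.d_one, Y.d_one]
  one_mem := Submodule.subset_span ⟨0, 0, rfl, _, X.one_mem, _, Y.one_mem, rfl⟩
  ε_gr n t ht := by
    induction ht using Submodule.span_induction with
    | mem t ht =>
      obtain ⟨p, q, hpq, x, hx, y, hy, rfl⟩ := ht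
      rw [map_tmul, X.ε_gr _ _ hx, Y.ε_gr _ _ hy, smul_tmul_smul, ← pow_add, hpq]
    | zero => rw [map_zero, smul_zero]
    | add t t' _ _ h h' => rw [map_add, h, h', smul_add]
    | smul a t _ h => rw [map_smul, h, smul_comm]

/-- The pure tensor `x ⊗ y`, as an element of the tensor product of differential modules. -/
def tm {X Y : DG A} : X.X →ₗ[A] Y.X →ₗ[A] (tensor X Y).X := TensorProduct.mk A X.X Y.X

/-- The tensor product of two semilinear maps. -/
def tmap {X Y : DG A} {X' Y' : DG A'} (a : X.X →ₛₗ[σ] X'.X) (b : Y.X →ₛₗ[σ] Y'.X) :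
    (tensor X Y).X →ₛₗ[σ] (tensor X' Y').X := TensorProduct.map a b

lemma tmap_tm {X Y : DG A} {X' Y' : DG A'} (a : X.X →ₛₗ[σ] X'.X) (b : Y.X →ₛₗ[σ] Y'.X)
    (x : X.X) (y : Y.X) : tmap a b (tm x y) = tm (a x) (b y) := rfl

lemma tensor_induction {X Y : DG A} {P : (tensor X Y).X → Prop} (t : (tensor X Y).X)
    (h0 : P 0) (hmk : ∀ (x : X.X) (y : Y.X), P (tm x y))
    (hadd : ∀ t t', P t → P t' → P (t + t')) : P t :=
  TensorProduct.induction_on t h0 hmk hadd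

lemma tensor_one (X Y : DG A) : (tensor X Y).one = tm X.one Y.one := rfl

lemma tensor_ε_tm {X Y : DG A} (x : X.X) (y : Y.X) :
    (tensor X Y).ε (tm x y) = tm (X.ε x) (Y.ε y) := rfl

lemma tensor_d_tm {X Y : DG A} (x : X.X) (y : Y.X) :
    (tensor X Y).d (tm x y) = tm (X.d x) y + tm (X.ε x) (Y.d y) := rfl

lemma tm_mem {X Y : DG A} {p q n : ℕ} (hpq : p + q = n) {x : X.X} (hx : x ∈ X.gr p) {y : Y.X}
    (hy : y ∈ Y.gr q) : tm x y ∈ (tensor X Y).gr n :=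
  Submodule.subset_span (M := X.X ⊗[A] Y.X) ⟨p, q, hpq, x, hx, y, hy, rfl⟩

lemma tensor_gr_induction {X Y : DG A} {n : ℕ} {P : (tensor X Y).X → Prop} (t : (tensor X Y).X)
    (ht : t ∈ (tensor X Y).gr n) (h0 : P 0)
    (hmk : ∀ p q, p + q = n → ∀ x ∈ X.gr p, ∀ y ∈ Y.gr q, P (tm x y))
    (hadd : ∀ t t', P t → P t' → P (t + t')) (hsmul : ∀ (a : A) t, P t → P (a • t)) : P t := by
  induction ht using Submodule.span_induction with
  | mem t ht =>
    obtain ⟨p, q, hpq, x, hx, y, hy, rfl⟩ := ht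
    exact hmk p q hpq x hx y hy
  | zero => exact h0
  | add t t' _ _ h h' => exact hadd _ _ h h'
  | smul a t _ h => exact hsmul _ _ h

/-- The cone of multiplication by `f`, that is, the tensor product with the Koszul complex of the
single element `f`. -/
def cone (f : A) (C : DG A) : DG A where
  X := C.X × C.X
  d := ((C.d ∘ₗ LinearMap.fst A C.X C.X) + f • LinearMap.snd A C.X C.X).prod
    (-(C.d ∘ₗ LinearMap.snd A C.X C.X))
  ε := (C.ε ∘ₗ LinearMap.fst A C.X C.X).prod (-(C.ε ∘ₗ LinearMap.snd A C.X C.X))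
  gr n := (C.gr n).prod (match n with | 0 => ⊥ | m + 1 => C.gr m)
  one := (C.one, 0)
  d_d t := by ext <;> simp [C.d_d]
  ε_ε t := by ext <;> simp [C.ε_ε]
  d_ε t := by ext <;> simp [C.d_ε]; abel
  ε_one := by ext <;> simp [C.ε_one]
  d_one := by ext <;> simp [C.d_one]
  one_mem := ⟨C.one_mem, zero_mem _⟩
  ε_gr n t ht := Prod.ext (C.ε_gr _ _ ht.1) (by
    obtain _ | n := n
    · have h : t.2 = 0 := ht.2
      change -C.ε t.2 = _ • t.2
      rw [h, map_zero, neg_zero, smul_zero]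
    · have h := C.ε_gr _ _ ht.2
      change -C.ε t.2 = _ • t.2
      rw [h, pow_succ, mul_neg_one, neg_smul])

/-- The elements of a cone, as pairs. -/
def pr {f : A} {C : DG A} (u v : C.X) : (cone f C).X := (u, v)

section pr

variable {f : A} {C : DG A}

lemma exists_pr (t : (cone f C).X) : ∃ u v, t = pr u v := ⟨t.1, t.2, rfl⟩

lemma pr_add (u v u' v' : C.X) : (pr u v + pr u' v' : (cone f C).X) = pr (u + u') (v + v') := rfl

lemma pr_sub (u v u' v' : C.X) : (pr u v - pr u' v' : (cone f C).X) = pr (u - u') (v - v') := rfl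

lemma neg_pr (u v : C.X) : (-pr u v : (cone f C).X) = pr (-u) (-v) := rfl

lemma smul_pr (a : A) (u v : C.X) : (a • pr u v : (cone f C).X) = pr (a • u) (a • v) := rfl

lemma pr_zero : (pr 0 0 : (cone f C).X) = 0 := rfl

lemma pr_inj {u v u' v' : C.X} : (pr u v : (cone f C).X) = pr u' v' ↔ u = u' ∧ v = v' :=
  Prod.mk_inj

lemma cone_one : (cone f C).one = pr C.one 0 := rfl

lemma cone_d (u v : C.X) : (cone f C).d (pr u v) = pr (C.d u + f • v) (-C.d v) := rfl

lemma cone_ε (u v : C.X) : (cone f C).ε (pr u v) = pr (C.ε u) (-C.ε v) := rfl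

lemma pr_mem_gr_zero {u v : C.X} : (pr u v : (cone f C).X) ∈ (cone f C).gr 0 ↔
    u ∈ C.gr 0 ∧ v = 0 := Iff.rfl

lemma pr_mem_gr_succ {u v : C.X} {n : ℕ} : (pr u v : (cone f C).X) ∈ (cone f C).gr (n + 1) ↔
    u ∈ C.gr (n + 1) ∧ v ∈ C.gr n := Iff.rfl

end pr

/-! #### Contracting homotopies and morphisms -/

/-- `h` is a homotopy of degree one from zero to multiplication by `w`. -/
structure IsHtpy (X : DG A) (w : A) (h : X.X →ₗ[A] X.X) : Prop where
  d_add (x : X.X) : X.d (h x) + h (X.d x) = w • x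
  ε_comm (x : X.X) : X.ε (h x) = -h (X.ε x)
  gr (n : ℕ) (x : X.X) : x ∈ X.gr n → h x ∈ X.gr (n + 1)

/-- Semilinear chain maps that preserve parity, and the base point up to a boundary. -/
structure IsMor {X : DG A} {Y : DG A'} (a : X.X →ₛₗ[σ] Y.X) : Prop where
  d_comm (x : X.X) : a (X.d x) = Y.d (a x)
  ε_comm (x : X.X) : a (X.ε x) = Y.ε (a x)
  one : ∃ y, a X.one = Y.one + Y.d y

/-- The map `a` intertwines the operators `h` and `h'` up to a homotopy. -/
def Intertwines {X : DG A} {Y : DG A'} (a : X.X →ₛₗ[σ] Y.X) (h : X.X →ₗ[A] X.X)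
    (h' : Y.X →ₗ[A'] Y.X) : Prop :=
  ∃ s : X.X →ₛₗ[σ] Y.X, (∀ x, s (X.ε x) = Y.ε (s x)) ∧
    ∀ x, a (h x) - h' (a x) = Y.d (s x) - s (X.d x)

/-- The map `a` is a bijection on homology, stated in terms of cycles and boundaries. -/
structure QI {X : DG A} {Y : DG A'} (a : X.X →ₛₗ[σ] Y.X) : Prop where
  inj (x : X.X) : X.d x = 0 → ∀ y, a x = Y.d y → ∃ x', x = X.d x'
  surj (y : Y.X) : Y.d y = 0 → ∃ x y', X.d x = 0 ∧ y = a x + Y.d y'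

/-- The operator on a tensor product induced by operators on the factors. -/
def tensorOp {X Y : DG A} (h : X.X →ₗ[A] X.X) (h' : Y.X →ₗ[A] Y.X) :
    (tensor X Y).X →ₗ[A] (tensor X Y).X :=
  tmap h LinearMap.id + tmap X.ε h'

lemma tensorOp_tm {X Y : DG A} (h : X.X →ₗ[A] X.X) (h' : Y.X →ₗ[A] Y.X) (x : X.X) (y : Y.X) :
    tensorOp h h' (tm x y) = tm (h x) y + tm (X.ε x) (h' y) := rfl

lemma IsHtpy.tensor {X Y : DG A} {w w' : A} {h : X.X →ₗ[A] X.X} {h' : Y.X →ₗ[A] Y.X}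
    (H : X.IsHtpy w h) (H' : Y.IsHtpy w' h') :
    (tensor X Y).IsHtpy (w + w') (tensorOp h h') where
  d_add t := by
    induction t using tensor_induction with
    | h0 => simp only [map_zero, smul_zero, add_zero]
    | hmk x y =>
      have e1 := congrArg (tm · y) (H.d_add x)
      have e2 := congrArg (tm (Y := Y) x ·) (H'.d_add y)
      simp only [map_add, LinearMap.add_apply, map_smul, LinearMap.smul_apply] at e1 e2
      simp only [tensorOp_tm, tensor_d_tm, map_add, H.ε_comm, X.ε_ε, X.d_ε, add_smul, ← e1, ← e2,
        map_neg, LinearMap.neg_apply]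
      abel
    | hadd t t' h h' => simp only [map_add, smul_add, ← h, ← h']; abel
  ε_comm t := by
    induction t using tensor_induction with
    | h0 => simp only [map_zero, neg_zero]
    | hmk x y =>
      simp only [tensorOp_tm, tensor_ε_tm, map_add, H.ε_comm, H'.ε_comm, map_neg,
        LinearMap.neg_apply, neg_add]
    | hadd t t' h h' => simp only [map_add, h, h', neg_add]
  gr n t ht := by
    refine tensor_gr_induction (P := fun t ↦ tensorOp h h' t ∈ (DG.tensor X Y).gr (n + 1)) t ht
      ?c0 ?cmk ?cadd ?csmul
    case c0 => rw [map_zero]; exact zero_mem _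
    case cmk =>
      intro p q hpq x hx y hy
      exact add_mem (tm_mem (by omega) (H.gr _ _ hx) hy)
        (tm_mem (by omega) (X.ε_mem _ _ hx) (H'.gr _ _ hy))
    case cadd => intro t t' h h'; rw [map_add]; exact add_mem h h'
    case csmul => intro a t h; rw [map_smul]; exact Submodule.smul_mem _ _ h

lemma IsMor.tensor {X Y : DG A} {X' Y' : DG A'} {a : X.X →ₛₗ[σ] X'.X} {b : Y.X →ₛₗ[σ] Y'.X}
    (ha : IsMor a) (hb : IsMor b) : IsMor (tmap a b) where
  d_comm t := by
    induction t using tensor_induction with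
    | h0 => simp only [map_zero]
    | hmk x y => simp only [tmap_tm, tensor_d_tm, map_add, ha.d_comm, hb.d_comm, ha.ε_comm]
    | hadd t t' h h' => simp only [map_add, h, h']
  ε_comm t := by
    induction t using tensor_induction with
    | h0 => simp only [map_zero]
    | hmk x y => simp only [tmap_tm, tensor_ε_tm, ha.ε_comm, hb.ε_comm]
    | hadd t t' h h' => simp only [map_add, h, h']
  one := by
    obtain ⟨y, hy⟩ := ha.one
    obtain ⟨z, hz⟩ := hb.one
    refine ⟨tm y (b Y.one) + tm X'.one z, ?_⟩
    simp only [tensor_one, tmap_tm, map_add, tensor_d_tm, Y'.d_one, Y'.d_d, map_zero, add_zero,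
      X'.ε_one, X'.d_one, LinearMap.zero_apply, zero_add, hy, hz, LinearMap.add_apply]
    abel

lemma Intertwines.tensor {X Y : DG A} {X' Y' : DG A'} {a : X.X →ₛₗ[σ] X'.X}
    {b : Y.X →ₛₗ[σ] Y'.X} (ha : IsMor a) (hb : IsMor b)
    {h : X.X →ₗ[A] X.X} {h' : X'.X →ₗ[A'] X'.X} {g : Y.X →ₗ[A] Y.X} {g' : Y'.X →ₗ[A'] Y'.X}
    (H : Intertwines a h h') (G : Intertwines b g g') :
    Intertwines (tmap a b) (tensorOp h g) (tensorOp h' g') := by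
  obtain ⟨s, hs, e⟩ := H
  obtain ⟨r, hr, e'⟩ := G
  refine ⟨tmap s b + tmap a r, fun t ↦ ?_, fun t ↦ ?_⟩
  · induction t using tensor_induction with
    | h0 => simp only [map_zero]
    | hmk x y =>
      simp only [tensor_ε_tm, LinearMap.add_apply, tmap_tm, map_add, hs, hr, ha.ε_comm, hb.ε_comm]
    | hadd t t' h h' => simp only [map_add, h, h']
  · induction t using tensor_induction with
    | h0 => simp only [map_zero, sub_zero]
    | hmk x y =>
      have e1 := congrArg (tm · (b y)) (e x)
      have e2 := congrArg (tm (Y := Y') (a (X.ε x)) ·) (e' y)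
      simp only [map_sub, LinearMap.sub_apply, sub_eq_iff_eq_add] at e1 e2
      simp only [LinearMap.add_apply, tmap_tm, tensorOp_tm, tensor_d_tm, map_add,
        ← ha.ε_comm, ← hb.d_comm, ← ha.d_comm, ← hs, e1, e2]
      abel
    | hadd t t' h h' =>
      simp only [map_add] at h h' ⊢
      rw [add_sub_add_comm, h, h']
      abel

/-! #### Words in the operators -/

/-- The element obtained from the base point by applying the operators of a list. -/
def word (X : DG A) (hs : List (X.X →ₗ[A] X.X)) : X.X := hs.foldr (fun h x ↦ h x) X.one

lemma d_word (X : DG A) (hs : List (X.X →ₗ[A] X.X)) (H : ∀ h ∈ hs, X.IsHtpy 0 h) :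
    X.d (X.word hs) = 0 := by
  induction hs with
  | nil => exact X.d_one
  | cons h hs ih =>
    have := (H h (by simp)).d_add (X.word hs)
    rw [ih fun h' hh' ↦ H h' (by simp [hh'])] at this
    rwa [map_zero, add_zero, zero_smul] at this

lemma word_mem (X : DG A) (hs : List (X.X →ₗ[A] X.X)) (H : ∀ h ∈ hs, X.IsHtpy 0 h) :
    X.word hs ∈ X.gr hs.length := by
  induction hs with
  | nil => exact X.one_mem
  | cons h hs ih => exact (H h (by simp)).gr _ _ (ih fun h' hh' ↦ H h' (by simp [hh']))

/-- Morphisms that intertwine two families of operators send words to words, up to boundaries. -/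
lemma IsMor.word {X : DG A} {Y : DG A'} {a : X.X →ₛₗ[σ] Y.X} (ha : IsMor a) {ι : Type*}
    (h : ι → X.X →ₗ[A] X.X) (h' : ι → Y.X →ₗ[A'] Y.X) (l : List ι)
    (H : ∀ i ∈ l, X.IsHtpy 0 (h i)) (H' : ∀ i ∈ l, Y.IsHtpy 0 (h' i))
    (I : ∀ i ∈ l, Intertwines a (h i) (h' i)) :
    ∃ y, a (X.word (l.map h)) = Y.word (l.map h') + Y.d y := by
  induction l with
  | nil => exact ha.one
  | cons i l ih =>
    obtain ⟨y, hy⟩ := ih (fun j hj ↦ H j (by simp [hj])) (fun j hj ↦ H' j (by simp [hj]))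
      (fun j hj ↦ I j (by simp [hj]))
    obtain ⟨s, -, hs⟩ := I i (by simp)
    have hc : X.d (X.word (l.map h)) = 0 := X.d_word _ fun g hg ↦ by
      obtain ⟨j, hj, rfl⟩ := List.mem_map.1 hg
      exact H j (by simp [hj])
    have e := hs (X.word (l.map h))
    have e' := (H' i (by simp)).d_add y
    rw [hc, map_zero, sub_zero, hy, map_add, sub_eq_iff_eq_add] at e
    rw [zero_smul, add_comm, add_eq_zero_iff_eq_neg] at e'
    refine ⟨s (X.word (l.map h)) - h' i y, ?_⟩
    change a (h i (X.word (l.map h))) = h' i (Y.word (l.map h')) + _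
    rw [e, e', map_sub]
    abel

end DG
end DGModules

section Sources
namespace DG
open TensorProduct
variable {A A' : Type u} [CommRing A] [CommRing A'] {σ : A →+* A'}

/-! #### Homotopies and lifts on complexes of projective modules -/

lemma exists_semilinear_lift {P : Type u} [AddCommGroup P] [Module A P] [Module.Projective A P]
    {Y : Type u} [AddCommGroup Y] [Module A' Y] (d : Y →ₗ[A'] Y) (S : Submodule A' Y)
    (g : P →ₛₗ[σ] Y) (hg : ∀ x, ∃ y ∈ S, d y = g x) :
    ∃ h : P →ₛₗ[σ] Y, ∀ x, h x ∈ S ∧ d (h x) = g x := by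
  let _ : Module A Y := Module.compHom Y σ
  have hsmul (a : A) (y : Y) : a • y = σ a • y := rfl
  choose y hy using hg
  obtain ⟨s, hs⟩ := Module.projective_def.1 ‹Module.Projective A P›
  let h : P →ₗ[A] Y := Finsupp.linearCombination A y ∘ₗ s
  refine ⟨{ toFun := h, map_add' := map_add h, map_smul' := map_smul h }, fun x ↦ ⟨?_, ?_⟩⟩
  · change Finsupp.linearCombination A y (s x) ∈ S
    rw [Finsupp.linearCombination_apply]
    exact Submodule.sum_mem _ fun p _ ↦ S.smul_mem _ (hy p).1
  · change d (Finsupp.linearCombination A y (s x)) = g x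
    conv_rhs => rw [← hs x]
    rw [Finsupp.linearCombination_apply, Finsupp.linearCombination_apply, Finsupp.sum, Finsupp.sum,
      map_sum, map_sum]
    refine Finset.sum_congr rfl fun p _ ↦ ?_
    rw [hsmul, map_smul, (hy p).2, map_smulₛₗ, id]

/-- A differential module is exact in positive degrees. -/
def ExactPos (Y : DG A) : Prop :=
  ∀ n, ∀ y ∈ Y.gr (n + 1), Y.d y = 0 → ∃ y' ∈ Y.gr (n + 2), Y.d y' = y

variable (P : ℕ → Type u) [∀ n, AddCommGroup (P n)] [∀ n, Module A (P n)]
  (dP : ∀ n, P (n + 1) →ₗ[A] P n)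

variable {P dP} in
/-- The recursion behind the comparison of complexes: a map `φ₀` out of the term of degree `0` of
a complex of projective modules extends to a solution of `d φₙ₊₁ = Eₙ + c φₙ d`, as soon as the
equations are consistent and the target is exact. -/
lemma exists_extension [∀ n, Module.Projective A (P n)] (hdP : ∀ n x, dP n (dP (n + 1) x) = 0)
    {Y : DG A'} (hY : Y.ExactPos) (r : ℕ) (c : A') (E : ∀ n, P (n + 1) →ₛₗ[σ] Y.X)
    (hE : ∀ n x, E n x ∈ Y.gr (n + r)) (φ₀ : P 0 →ₛₗ[σ] Y.X) (hφ₀ : ∀ x, φ₀ x ∈ Y.gr r)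
    (h₁ : ∀ x, ∃ y ∈ Y.gr (r + 1), Y.d y = E 0 x + c • φ₀ (dP 0 x))
    (hdE : ∀ n x, Y.d (E (n + 1) x) + c • E n (dP (n + 1) x) = 0) :
    ∃ φ : ∀ n, P n →ₛₗ[σ] Y.X, φ 0 = φ₀ ∧ (∀ n x, φ n x ∈ Y.gr (n + r)) ∧
      ∀ n x, Y.d (φ (n + 1) x) = E n x + c • φ n (dP n x) := by
  -- The induction carries the fact that the next equation can be solved.
  let St (n : ℕ) := {φ : P n →ₛₗ[σ] Y.X // (∀ x, φ x ∈ Y.gr (n + r)) ∧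
    ∀ x, ∃ y ∈ Y.gr (n + 1 + r), Y.d y = E n x + c • φ (dP n x)}
  have step (n : ℕ) (φ : St n) : ∃ ψ : St (n + 1),
      ∀ x, Y.d (ψ.1 x) = E n x + c • φ.1 (dP n x) := by
    obtain ⟨ψ, hψ⟩ := exists_semilinear_lift Y.d (Y.gr (n + 1 + r))
      (E n + c • (φ.1.comp (dP n))) φ.2.2
    refine ⟨⟨ψ, fun x ↦ (hψ x).1, fun x ↦ ?_⟩, fun x ↦ (hψ x).2⟩
    have hm : E (n + 1) x + c • ψ (dP (n + 1) x) ∈ Y.gr (n + r + 1) := by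
      have e : n + r + 1 = n + 1 + r := by omega
      rw [e]
      exact add_mem (hE _ _) (Submodule.smul_mem _ _ (hψ _).1)
    obtain ⟨y, hy, h⟩ := hY _ _ hm (by
      rw [map_add, map_smul, (hψ _).2]
      simp only [LinearMap.add_apply, LinearMap.smul_apply, LinearMap.comp_apply, hdP, map_zero,
        smul_zero, add_zero]
      exact hdE n x)
    exact ⟨y, by convert! hy using 2; omega, h⟩
  choose nxt hnxt using step
  let φ (n : ℕ) : St n := Nat.rec ⟨φ₀, by simpa using hφ₀, by
    simpa [add_comm] using h₁⟩ (fun n ↦ nxt n) n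
  exact ⟨fun n ↦ (φ n).1, rfl, fun n ↦ (φ n).2.1, fun n x ↦ hnxt n (φ n) x⟩

/-- The total differential of a chain complex, on the direct sum of its terms. -/
def seqD : DirectSum ℕ P →ₗ[A] DirectSum ℕ P :=
  DirectSum.toModule A ℕ _ fun n ↦ match n with
    | 0 => 0
    | n + 1 => DirectSum.lof A ℕ P n ∘ₗ dP n

/-- The involution `(-1)ⁿ` in degree `n`. -/
def seqε (A : Type u) [CommRing A] (P : ℕ → Type u) [∀ n, AddCommGroup (P n)]
    [∀ n, Module A (P n)] :
    DirectSum ℕ P →ₗ[A] DirectSum ℕ P :=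
  DirectSum.toModule A ℕ _ fun n ↦ (-1 : A) ^ n • DirectSum.lof A ℕ P n

lemma seqD_zero (x : P 0) : seqD P dP (DirectSum.lof A ℕ P 0 x) = 0 := by
  simp [seqD]

lemma seqD_succ (n : ℕ) (x : P (n + 1)) :
    seqD P dP (DirectSum.lof A ℕ P (n + 1) x) = DirectSum.lof A ℕ P n (dP n x) := by
  simp [seqD]

lemma seqε_lof (n : ℕ) (x : P n) :
    seqε A P (DirectSum.lof A ℕ P n x) = (-1 : A) ^ n • DirectSum.lof A ℕ P n x := by
  simp [seqε]

/-- The semilinear map out of a direct sum given by its restrictions to the summands. -/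
def seqDesc {Y : Type u} [AddCommGroup Y] [Module A' Y] (φ : ∀ n, P n →ₛₗ[σ] Y) :
    DirectSum ℕ P →ₛₗ[σ] Y where
  toFun := DirectSum.toAddMonoid fun n ↦ (φ n).toAddMonoidHom
  map_add' := map_add _
  map_smul' a x := by
    induction x using DirectSum.induction_on with
    | zero => simp only [smul_zero, map_zero]
    | of n x =>
      have : a • DirectSum.of P n x = DirectSum.of P n (a • x) :=
        ((DirectSum.lof A ℕ P n).map_smul a x).symm
      rw [this, DirectSum.toAddMonoid_of, DirectSum.toAddMonoid_of]
      exact (φ n).map_smulₛₗ a x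
    | add x y hx hy => simp only [smul_add, map_add, hx, hy]

variable {P} in
lemma seqDesc_lof {Y : Type u} [AddCommGroup Y] [Module A' Y] (φ : ∀ n, P n →ₛₗ[σ] Y) (n : ℕ)
    (x : P n) : seqDesc P φ (DirectSum.lof A ℕ P n x) = φ n x :=
  DirectSum.toAddMonoid_of (fun n ↦ (φ n).toAddMonoidHom) n x

/-- The differential module given by a chain complex. -/
def ofSeq (hdP : ∀ n x, dP n (dP (n + 1) x) = 0) (one : P 0) : DG A where
  X := DirectSum ℕ P
  d := seqD P dP
  ε := seqε A P
  gr n := LinearMap.range (DirectSum.lof A ℕ P n)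
  one := DirectSum.lof A ℕ P 0 one
  d_d x := by
    suffices h : seqD P dP ∘ₗ seqD P dP = 0 from LinearMap.congr_fun h x
    refine DirectSum.linearMap_ext _ fun n ↦ LinearMap.ext fun x ↦ ?_
    obtain _ | _ | n := n <;>
    simp only [LinearMap.comp_apply, seqD_zero, seqD_succ, hdP, map_zero, LinearMap.zero_apply]
  ε_ε x := by
    suffices h : seqε A P ∘ₗ seqε A P = LinearMap.id from LinearMap.congr_fun h x
    refine DirectSum.linearMap_ext _ fun n ↦ LinearMap.ext fun x ↦ ?_
    simp only [LinearMap.comp_apply, seqε_lof, map_smul, smul_smul, ← mul_pow, neg_mul_neg, one_mul,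
      one_pow, one_smul, LinearMap.id_apply]
  d_ε x := by
    suffices h : seqD P dP ∘ₗ seqε A P = -(seqε A P ∘ₗ seqD P dP) from LinearMap.congr_fun h x
    refine DirectSum.linearMap_ext _ fun n ↦ LinearMap.ext fun x ↦ ?_
    obtain _ | n := n
    · simp only [LinearMap.comp_apply, seqε_lof, map_smul, seqD_zero, LinearMap.neg_apply, map_zero,
        smul_zero, neg_zero]
    · simp only [LinearMap.comp_apply, seqε_lof, map_smul, seqD_succ, LinearMap.neg_apply, pow_succ,
        mul_neg_one, neg_smul, map_neg]
  ε_one := by rw [seqε_lof, pow_zero, one_smul]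
  d_one := seqD_zero _ _ _
  one_mem := ⟨_, rfl⟩
  ε_gr n x hx := by
    obtain ⟨x, rfl⟩ := hx
    exact seqε_lof _ n x

section

variable {P dP} {hdP : ∀ n x, dP n (dP (n + 1) x) = 0} {one : P 0}

/-- The inclusion of a term of a chain complex in its total module. -/
def of (n : ℕ) : P n →ₗ[A] (ofSeq P dP hdP one).X := DirectSum.lof A ℕ P n

lemma ofSeq_d_zero (x : P 0) : (ofSeq P dP hdP one).d (of 0 x) = 0 := seqD_zero _ _ _

lemma ofSeq_d_succ (n : ℕ) (x : P (n + 1)) :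
    (ofSeq P dP hdP one).d (of (n + 1) x) = of n (dP n x) := seqD_succ _ _ _ _

lemma ofSeq_ε (n : ℕ) (x : P n) :
    (ofSeq P dP hdP one).ε (of n x) = (-1 : A) ^ n • of n x := seqε_lof _ _ _

lemma of_mem (n : ℕ) (x : P n) : of n x ∈ (ofSeq P dP hdP one).gr n := ⟨x, rfl⟩

lemma of_injective (n : ℕ) : Function.Injective (of n : P n → (ofSeq P dP hdP one).X) :=
  DirectSum.of_injective n

lemma ofSeq_induction {p : (ofSeq P dP hdP one).X → Prop} (x : (ofSeq P dP hdP one).X)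
    (h0 : p 0) (hof : ∀ n x, p (of n x)) (hadd : ∀ x y, p x → p y → p (x + y)) : p x :=
  DirectSum.induction_on x h0 hof hadd

/-- The semilinear map out of the total module given by its restrictions to the terms. -/
def ofSeqDesc {Y : Type u} [AddCommGroup Y] [Module A' Y] (φ : ∀ n, P n →ₛₗ[σ] Y) :
    (ofSeq P dP hdP one).X →ₛₗ[σ] Y := seqDesc P φ

lemma ofSeqDesc_of {Y : Type u} [AddCommGroup Y] [Module A' Y] (φ : ∀ n, P n →ₛₗ[σ] Y) (n : ℕ)
    (x : P n) : ofSeqDesc (dP := dP) (hdP := hdP) (one := one) φ (of n x) = φ n x :=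
  seqDesc_lof φ n x

lemma exactPos_ofSeq (hex : ∀ n x, dP n x = 0 → ∃ y, dP (n + 1) y = x) :
    (ofSeq P dP hdP one).ExactPos := by
  rintro n _ ⟨x, rfl⟩ hx
  obtain ⟨y, rfl⟩ := hex n x (of_injective (hdP := hdP) (one := one) (dP := dP) n (by
    rw [← ofSeq_d_succ, map_zero]; exact hx))
  exact ⟨of (n + 2) y, of_mem _ _, ofSeq_d_succ _ _⟩

variable [∀ n, Module.Projective A (P n)]

/-- If `w` annihilates the homology of degree zero of a projective resolution, then multiplication
by `w` is null-homotopic. -/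
lemma exists_isHtpy (hex : ∀ n x, dP n x = 0 → ∃ y, dP (n + 1) y = x) (w : A)
    (hw : ∀ x : P 0, ∃ y, dP 0 y = w • x) : ∃ h, (ofSeq P dP hdP one).IsHtpy w h := by
  set Y := ofSeq P dP hdP one with hYdef
  have lift₀ := exists_semilinear_lift (σ := RingHom.id A) Y.d (Y.gr 1)
    (w • (of 0 : P 0 →ₗ[A] Y.X)) fun x ↦ by
      obtain ⟨y, hy⟩ := hw x
      exact ⟨of 1 y, of_mem _ _, by rw [ofSeq_d_succ, hy]; simp⟩
  obtain ⟨φ₀, hφ₀⟩ := lift₀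
  obtain ⟨φ, rfl, hφ, hφd⟩ := exists_extension (σ := RingHom.id A) hdP
    (exactPos_ofSeq (hdP := hdP) (one := one) hex) 1 (-1 : A)
    (fun n ↦ w • (of (n + 1) : P (n + 1) →ₗ[A] Y.X)) (fun n x ↦ Submodule.smul_mem _ _ (of_mem _ _))
    φ₀ (fun x ↦ (hφ₀ x).1) (fun x ↦ by
      refine exactPos_ofSeq hex 0 _ (add_mem (Submodule.smul_mem _ _ (of_mem _ _))
        (Submodule.smul_mem _ _ (hφ₀ _).1)) ?_
      rw [map_add, map_smul, (hφ₀ _).2, LinearMap.smul_apply, map_smul, ofSeq_d_succ]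
      simp)
    (fun n x ↦ by
      rw [LinearMap.smul_apply, map_smul, ofSeq_d_succ]
      simp)
  refine ⟨ofSeqDesc φ, fun x ↦ ?_, fun x ↦ ?_, ?_⟩
  · induction x using ofSeq_induction with
    | h0 => simp only [map_zero, smul_zero, add_zero]
    | hof n x =>
      obtain _ | n := n
      · rw [ofSeqDesc_of, ofSeq_d_zero, map_zero, add_zero, (hφ₀ x).2, LinearMap.smul_apply]
      · rw [ofSeqDesc_of, ofSeq_d_succ, ofSeqDesc_of, hφd, LinearMap.smul_apply, neg_smul, one_smul,
          neg_add_cancel_right]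
    | hadd x y hx hy => simp only [map_add, smul_add, ← hx, ← hy]; abel
  · induction x using ofSeq_induction with
    | h0 => simp only [map_zero, neg_zero]
    | hof n x =>
      rw [ofSeqDesc_of, ofSeq_ε, map_smul, ofSeqDesc_of, Y.ε_gr _ _ (hφ n x), pow_succ,
        mul_neg_one, neg_smul]
    | hadd x y hx hy => simp only [map_add, hx, hy, neg_add]
  · rintro n _ ⟨x, rfl⟩
    have := hφ n x
    rwa [← ofSeqDesc_of (dP := dP) (hdP := hdP) (one := one) φ n x] at this

/-- A graded chain map from a complex of projective modules to an exact one intertwines any two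
homotopies of corresponding weights. -/
lemma intertwines_of_exactPos {Y : DG A'} (hY : Y.ExactPos)
    (a : (ofSeq P dP hdP one).X →ₛₗ[σ] Y.X)
    (had : ∀ x, a ((ofSeq P dP hdP one).d x) = Y.d (a x))
    (hag : ∀ n x, a (of n x) ∈ Y.gr n) {w : A} {h : (ofSeq P dP hdP one).X →ₗ[A] _}
    {h' : Y.X →ₗ[A'] Y.X} (H : (ofSeq P dP hdP one).IsHtpy w h) (H' : Y.IsHtpy (σ w) h') :
    Intertwines a h h' := by
  have hag' (n : ℕ) (x) (hx : x ∈ (ofSeq P dP hdP one).gr n) : a x ∈ Y.gr n := by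
    obtain ⟨x, rfl⟩ := hx
    exact hag n x
  -- The difference `a h - h' a` anticommutes with the differentials and has degree one, so that it
  -- is null-homotopic by exactness of the target.
  let D : (ofSeq P dP hdP one).X →ₛₗ[σ] Y.X := a.comp h - h'.comp a
  have hD (x) : D x = a (h x) - h' (a x) := rfl
  have hDg (n : ℕ) (x : P n) : D (of n x) ∈ Y.gr (n + 1) :=
    sub_mem (hag' _ _ (H.gr _ _ (of_mem _ _))) (H'.gr _ _ (hag _ _))
  have hdD (x) : Y.d (D x) = -D ((ofSeq P dP hdP one).d x) := by
    have e1 := congrArg a (H.d_add x)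
    have e2 := H'.d_add (a x)
    rw [map_smulₛₗ, ← e2, map_add, had] at e1
    rw [hD, hD, map_sub, had, neg_sub, sub_eq_sub_iff_add_eq_add, e1, add_comm]
  obtain ⟨φ₀, hφ₀⟩ := exists_semilinear_lift Y.d (Y.gr 2) (D.comp (of 0)) fun x ↦
    hY 0 _ (hDg 0 x) (by
      rw [LinearMap.comp_apply, hdD, ofSeq_d_zero, map_zero, neg_zero])
  obtain ⟨φ, rfl, hφ, hφd⟩ := exists_extension (σ := σ) hdP hY 2 (1 : A')
    (fun n ↦ D.comp (of (n + 1))) (fun n x ↦ hDg _ _) φ₀ (fun x ↦ (hφ₀ x).1)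
    (fun x ↦ by
      refine hY 1 _ (add_mem (hDg 1 x) (Submodule.smul_mem _ _ (hφ₀ _).1)) ?_
      rw [map_add, map_smul, (hφ₀ _).2, LinearMap.comp_apply, LinearMap.comp_apply, hdD,
        ofSeq_d_succ, one_smul, neg_add_cancel])
    (fun n x ↦ by
      rw [LinearMap.comp_apply, LinearMap.comp_apply, hdD, ofSeq_d_succ, one_smul, neg_add_cancel])
  refine ⟨ofSeqDesc φ, fun x ↦ ?_, fun x ↦ ?_⟩
  · induction x using ofSeq_induction with
    | h0 => simp only [map_zero]
    | hof n x =>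
      rw [ofSeqDesc_of, ofSeq_ε, map_smulₛₗ, ofSeqDesc_of, Y.ε_gr _ _ (hφ n x), pow_add]
      simp
    | hadd x y hx hy => simp only [map_add, hx, hy]
  · rw [← hD]
    induction x using ofSeq_induction with
    | h0 => simp only [map_zero, sub_zero]
    | hof n x =>
      obtain _ | n := n
      · rw [ofSeqDesc_of, ofSeq_d_zero, map_zero, sub_zero, (hφ₀ x).2]; rfl
      · rw [ofSeqDesc_of, ofSeq_d_succ, ofSeqDesc_of, hφd, one_smul, add_sub_cancel_right]; rfl
    | hadd x y hx hy => simp only [map_add, hx, hy]; abel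

/-- The comparison map from a complex of projective modules to an exact one. -/
lemma exists_comparison {Y : DG A} (hY : Y.ExactPos) (φ₀ : P 0 →ₗ[A] Y.X)
    (hφ₀ : ∀ x, φ₀ x ∈ Y.gr 0) (h₁ : ∀ x, ∃ y ∈ Y.gr 1, Y.d y = φ₀ (dP 0 x))
    (hd : ∀ x, Y.d (φ₀ x) = 0)
    (hone : ∃ y, φ₀ one = Y.one + Y.d y) :
    ∃ a : (ofSeq P dP hdP one).X →ₗ[A] Y.X, IsMor a ∧ (∀ n x, a (of n x) ∈ Y.gr n) ∧
      ∀ x, a (of 0 x) = φ₀ x := by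
  obtain ⟨φ, rfl, hφ, hφd⟩ := exists_extension (σ := RingHom.id A) hdP hY 0 (1 : A)
    (fun n ↦ 0) (fun n x ↦ zero_mem _) φ₀ hφ₀ (fun x ↦ by simpa using h₁ x) (fun n x ↦ by simp)
  refine ⟨ofSeqDesc φ, ⟨fun x ↦ ?_, fun x ↦ ?_, ?_⟩, fun n x ↦ ?_, fun x ↦ ofSeqDesc_of _ _ _⟩
  · induction x using ofSeq_induction with
    | h0 => simp only [map_zero]
    | hof n x =>
      obtain _ | n := n
      · rw [ofSeq_d_zero, map_zero, ofSeqDesc_of, hd]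
      · rw [ofSeqDesc_of, ofSeq_d_succ, ofSeqDesc_of, hφd, one_smul, LinearMap.zero_apply, zero_add]
    | hadd x y hx hy => simp only [map_add, hx, hy]
  · induction x using ofSeq_induction with
    | h0 => simp only [map_zero]
    | hof n x => rw [ofSeqDesc_of, ofSeq_ε, map_smul, ofSeqDesc_of, Y.ε_gr _ _ (hφ n x), add_zero]
    | hadd x y hx hy => simp only [map_add, hx, hy]
  · obtain ⟨y, hy⟩ := hone
    exact ⟨y, (ofSeqDesc_of φ 0 one).trans hy⟩
  · rw [ofSeqDesc_of]
    exact hφ n x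

end

end DG
end Sources

section Flat
namespace DG
open TensorProduct
variable {A : Type u} [CommRing A]

/-! #### Tensor products with complexes of flat modules -/

section

variable {P : ℕ → Type u} [∀ n, AddCommGroup (P n)] [∀ n, Module A (P n)]
  {dP : ∀ n, P (n + 1) →ₗ[A] P n} {hdP : ∀ n x, dP n (dP (n + 1) x) = 0} {one : P 0}

/-- The projection of a total module to a term of the complex. -/
def proj (n : ℕ) : (ofSeq P dP hdP one).X →ₗ[A] P n := DirectSum.component A ℕ P n

lemma proj_of_self (n : ℕ) (x : P n) :
    proj n (of n x : (ofSeq P dP hdP one).X) = x :=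
  DirectSum.component.lof_self A n x

lemma proj_of_ne {m n : ℕ} (h : m ≠ n) (x : P m) :
    proj n (of m x : (ofSeq P dP hdP one).X) = 0 :=
  DirectSum.of_eq_of_ne m n x h.symm

/-- The projection of a tensor product to the summand of a term of the complex. -/
def tproj (C : DG A) (n : ℕ) : (tensor (ofSeq P dP hdP one) C).X →ₗ[A] P n ⊗[A] C.X :=
  TensorProduct.map (proj n) LinearMap.id

/-- The inclusion of the summand of a tensor product belonging to a term of the complex. -/
def tincl (C : DG A) (n : ℕ) : P n ⊗[A] C.X →ₗ[A] (tensor (ofSeq P dP hdP one) C).X :=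
  TensorProduct.map (of n) LinearMap.id

lemma tproj_tm (C : DG A) (n : ℕ) (x : (ofSeq P dP hdP one).X) (y : C.X) :
    tproj C n (tm x y) = proj n x ⊗ₜ y := rfl

lemma tincl_tmul (C : DG A) (n : ℕ) (x : P n) (y : C.X) :
    tincl C n (x ⊗ₜ y) = tm (of n x : (ofSeq P dP hdP one).X) y := rfl

lemma tproj_d (C : DG A) (n : ℕ) (t : (tensor (ofSeq P dP hdP one) C).X) :
    tproj C n ((tensor _ C).d t) = (-1 : A) ^ n • LinearMap.lTensor (P n) C.d (tproj C n t) +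
      LinearMap.rTensor C.X (dP n) (tproj C (n + 1) t) := by
  induction t using tensor_induction with
  | h0 => simp only [map_zero, smul_zero, add_zero]
  | hmk x y =>
    rw [tensor_d_tm, map_add, tproj_tm, tproj_tm, tproj_tm, tproj_tm, LinearMap.lTensor_tmul,
      LinearMap.rTensor_tmul, add_comm]
    congr 1
    · rw [smul_tmul']
      congr 1
      induction x using ofSeq_induction with
      | h0 => simp only [map_zero, smul_zero]
      | hof m x =>
        rw [ofSeq_ε, map_smul]
        obtain rfl | h := eq_or_ne m n
        · rfl
        · rw [proj_of_ne h, smul_zero, smul_zero]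
      | hadd x y hx hy => simp only [map_add, hx, hy, smul_add]
    · congr 1
      induction x using ofSeq_induction with
      | h0 => simp only [map_zero]
      | hof m x =>
        obtain _ | m := m
        · rw [ofSeq_d_zero, proj_of_ne (by simp), map_zero, map_zero]
        · rw [ofSeq_d_succ]
          obtain rfl | h := eq_or_ne m n
          · rw [proj_of_self, proj_of_self]
          · rw [proj_of_ne h, proj_of_ne (by simpa using h), map_zero]
      | hadd x y hx hy => simp only [map_add, hx, hy]
  | hadd t t' h h' => simp only [map_add, h, h', smul_add]; abel

lemma tproj_tincl_self (C : DG A) (n : ℕ) (t : P n ⊗[A] C.X) :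
    tproj C n (tincl C n t : (tensor (ofSeq P dP hdP one) C).X) = t := by
  induction t with
  | zero => simp only [map_zero]
  | tmul x y => rw [tincl_tmul, tproj_tm, proj_of_self]
  | add t t' h h' => simp only [map_add, h, h']

lemma tproj_tincl_ne (C : DG A) {m n : ℕ} (hmn : m ≠ n) (t : P m ⊗[A] C.X) :
    tproj C n (tincl C m t : (tensor (ofSeq P dP hdP one) C).X) = 0 := by
  induction t with
  | zero => simp only [map_zero]
  | tmul x y => rw [tincl_tmul, tproj_tm, proj_of_ne hmn, zero_tmul]
  | add t t' h h' => simp only [map_add, h, h', add_zero]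

lemma exists_bound (C : DG A) (t : (tensor (ofSeq P dP hdP one) C).X) :
    ∃ N, (∀ n, N ≤ n → tproj C n t = 0) ∧ t = ∑ n ∈ Finset.range N, tincl C n (tproj C n t) := by
  have mono (t : (tensor (ofSeq P dP hdP one) C).X) (N N' : ℕ) (hN : N ≤ N')
      (h : (∀ n, N ≤ n → tproj C n t = 0) ∧
        t = ∑ n ∈ Finset.range N, tincl C n (tproj C n t)) :
      (∀ n, N' ≤ n → tproj C n t = 0) ∧ t = ∑ n ∈ Finset.range N', tincl C n (tproj C n t) := by
    refine ⟨fun n hn ↦ h.1 n (hN.trans hn), h.2.trans ?_⟩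
    refine Finset.sum_subset (Finset.range_mono hN) fun n _ hn ↦ ?_
    rw [h.1 n (by simpa using hn), map_zero]
  induction t using tensor_induction with
  | h0 => exact ⟨0, by simp⟩
  | hmk x y =>
    induction x using ofSeq_induction with
    | h0 => exact ⟨0, by simp⟩
    | hof n x =>
      refine ⟨n + 1, fun m hm ↦ by rw [tproj_tm, proj_of_ne (by omega), zero_tmul], ?_⟩
      rw [Finset.sum_eq_single n, tproj_tm, proj_of_self, tincl_tmul]
      · intro m _ hm
        rw [tproj_tm, proj_of_ne hm.symm, zero_tmul, map_zero]
      · simp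
    | hadd x x' h h' =>
      obtain ⟨N, hN⟩ := h
      obtain ⟨N', hN'⟩ := h'
      refine ⟨max N N', fun n hn ↦ ?_, ?_⟩
      · rw [map_add, LinearMap.add_apply, map_add, hN.1 _ (by omega), hN'.1 _ (by omega), add_zero]
      · simp only [map_add, LinearMap.add_apply, Finset.sum_add_distrib]
        rw [← (mono _ N _ (le_max_left _ _) hN).2, ← (mono _ N' _ (le_max_right _ _) hN').2]
  | hadd t t' h h' =>
    obtain ⟨N, hN⟩ := h
    obtain ⟨N', hN'⟩ := h'
    refine ⟨max N N', fun n hn ↦ ?_, ?_⟩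
    · rw [map_add, hN.1 _ (by omega), hN'.1 _ (by omega), add_zero]
    · simp only [map_add, Finset.sum_add_distrib]
      rw [← (mono _ N _ (le_max_left _ _) hN).2, ← (mono _ N' _ (le_max_right _ _) hN').2]

/-- The tensor product of an acyclic differential module with a bounded below complex of flat
modules is acyclic: the component of highest degree of a cycle can be removed by a boundary. -/
lemma acyclic_tensor [∀ n, Module.Flat A (P n)] (C : DG A)
    (hC : ∀ c, C.d c = 0 → ∃ c', C.d c' = c) (t : (tensor (ofSeq P dP hdP one) C).X)
    (ht : (tensor (ofSeq P dP hdP one) C).d t = 0) :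
    ∃ t', (tensor (ofSeq P dP hdP one) C).d t' = t := by
  have hex : Function.Exact C.d C.d := fun c ↦
    ⟨hC c, by rintro ⟨c', rfl⟩; exact C.d_d c'⟩
  obtain ⟨N, hN, -⟩ := exists_bound C t
  induction N generalizing t with
  | zero =>
    obtain ⟨N, -, h⟩ := exists_bound C t
    refine ⟨0, ?_⟩
    rw [map_zero, h]
    exact (Finset.sum_eq_zero fun n _ ↦ by rw [hN n (by simp), map_zero]).symm
  | succ N ih =>
    have h0 := tproj_d C N t
    rw [ht, map_zero, hN _ le_rfl, map_zero, add_zero] at h0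
    have h1 : LinearMap.lTensor (P N) C.d (tproj C N t) = 0 := by
      have := congrArg ((-1 : A) ^ N • ·) h0
      simpa [smul_smul, ← mul_pow] using this.symm
    -- By flatness the component of highest degree is the image of some `s` under `1 ⊗ d`.
    obtain ⟨s, hs⟩ := (Module.Flat.lTensor_exact (P N) hex _).1 h1
    obtain ⟨t', ht'⟩ := ih (t - (tensor (ofSeq P dP hdP one) C).d ((-1 : A) ^ N • tincl C N s))
      (by rw [map_sub, ht, DG.d_d, sub_zero]) (fun n hn ↦ by
        rw [map_sub, tproj_d, map_smul, map_smul]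
        obtain rfl | hn := eq_or_lt_of_le hn
        · rw [tproj_tincl_self, map_smul, hs, smul_smul, ← mul_pow, tproj_tincl_ne _ (by omega)]
          simp
        · rw [hN n hn, map_smul, tproj_tincl_ne _ (by omega), tproj_tincl_ne _ (by omega)]
          simp)
    exact ⟨t' + (-1 : A) ^ N • tincl C N s, by rw [map_add, ht', sub_add_cancel]⟩

/-- The mapping cone of a chain map; the degrees and the base point play no role here. -/
def mappingCone {Y Y' : DG A} (a : Y.X →ₗ[A] Y'.X) (h : IsMor a) : DG A where
  X := Y'.X × Y.X
  d := ((Y'.d ∘ₗ LinearMap.fst A Y'.X Y.X) + a ∘ₗ LinearMap.snd A Y'.X Y.X).prod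
    (-(Y.d ∘ₗ LinearMap.snd A Y'.X Y.X))
  ε := (Y'.ε ∘ₗ LinearMap.fst A Y'.X Y.X).prod (-(Y.ε ∘ₗ LinearMap.snd A Y'.X Y.X))
  gr _ := ⊥
  one := 0
  d_d t := by ext <;> simp [Y.d_d, Y'.d_d, h.d_comm]
  ε_ε t := by ext <;> simp [Y.ε_ε, Y'.ε_ε]
  d_ε t := by ext <;> simp [Y.d_ε, Y'.d_ε, h.ε_comm]; abel
  ε_one := by simp
  d_one := by simp
  one_mem := zero_mem _
  ε_gr n x hx := by
    obtain rfl : x = 0 := hx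
    simp

/-- The tensor product with a bounded below complex of flat modules preserves quasi-isomorphisms. -/
lemma QI.tensor_left [∀ n, Module.Flat A (P n)] {Y Y' : DG A} {a : Y.X →ₗ[A] Y'.X} (h : IsMor a)
    (H : QI a) : QI (X := tensor (ofSeq P dP hdP one) Y) (Y := tensor (ofSeq P dP hdP one) Y')
      (tmap LinearMap.id a) := by
  set X := ofSeq P dP hdP one
  let C := mappingCone a h
  -- the inclusions of and the projections to the two summands of the cone
  let i : Y'.X →ₗ[A] C.X := LinearMap.inl A Y'.X Y.X
  let j : Y.X →ₗ[A] C.X := LinearMap.inr A Y'.X Y.X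
  let p : C.X →ₗ[A] Y.X := LinearMap.snd A Y'.X Y.X
  let q : C.X →ₗ[A] Y'.X := LinearMap.fst A Y'.X Y.X
  have hi (y) : C.d (i y) = i (Y'.d y) := Prod.ext
    (show Y'.d y + a 0 = Y'.d y by rw [map_zero, add_zero])
    (show -Y.d 0 = 0 by rw [map_zero, neg_zero])
  have hj (y) : C.d (j y) = i (a y) - j (Y.d y) := Prod.ext
    (show Y'.d 0 + a y = a y - 0 by rw [map_zero, zero_add, sub_zero])
    (show -Y.d y = 0 - Y.d y by rw [zero_sub])
  have hp (c) : p (C.d c) = -Y.d (p c) := rfl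
  have hq (c) : q (C.d c) = Y'.d (q c) + a (p c) := rfl
  have hpi (y) : p (i y) = 0 := rfl
  have hpj (y) : p (j y) = y := rfl
  have hqi (y) : q (i y) = y := rfl
  have hC (c) (hc : C.d c = 0) : ∃ c', C.d c' = c := by
    obtain ⟨y', y⟩ := c
    have h1 : Y'.d y' + a y = 0 := congrArg Prod.fst hc
    have h2 : -Y.d y = 0 := congrArg Prod.snd hc
    rw [neg_eq_zero] at h2
    obtain ⟨x, rfl⟩ := H.inj y h2 (-y') (by rw [map_neg]; exact eq_neg_of_add_eq_zero_right h1)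
    obtain ⟨z, w, hz, hw⟩ := H.surj (y' + a x) (by rw [map_add, ← h.d_comm, h1])
    refine ⟨(w, z - x), Prod.ext ?_ ?_⟩
    · change Y'.d w + a (z - x) = y'
      rw [map_sub, eq_sub_of_add_eq hw]
      abel
    · change -Y.d (z - x) = Y.d x
      rw [map_sub, hz, zero_sub, neg_neg]
  have hD := acyclic_tensor (dP := dP) (hdP := hdP) (one := one) C hC
  let I : (tensor X Y').X →ₗ[A] (tensor X C).X := tmap LinearMap.id i
  let J : (tensor X Y).X →ₗ[A] (tensor X C).X := tmap X.ε j
  let p' : (tensor X C).X →ₗ[A] (tensor X Y).X := tmap X.ε p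
  let q' : (tensor X C).X →ₗ[A] (tensor X Y').X := tmap LinearMap.id q
  have hI (t) : (tensor X C).d (I t) = I ((tensor X Y').d t) := by
    induction t using tensor_induction with
    | h0 => simp only [map_zero]
    | hmk x y => simp only [I, tmap_tm, tensor_d_tm, map_add, LinearMap.id_apply, hi]
    | hadd t t' h h' => simp only [map_add, h, h']
  have hJ (t) : (tensor X C).d (J t) = I (tmap LinearMap.id a t) - J ((tensor X Y).d t) := by
    induction t using tensor_induction with
    | h0 => simp only [map_zero, sub_zero]
    | hmk x y =>
      simp only [I, J, tmap_tm, tensor_d_tm, map_add, LinearMap.id_apply, hj, X.d_ε, X.ε_ε,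
        map_neg, LinearMap.neg_apply, map_sub]
      abel
    | hadd t t' h h' => simp only [map_add, h, h']; abel
  have hp' (t) : p' ((tensor X C).d t) = -(tensor X Y).d (p' t) := by
    induction t using tensor_induction with
    | h0 => simp only [map_zero, neg_zero]
    | hmk x y =>
      simp only [p', tmap_tm, tensor_d_tm, map_add, hp, X.d_ε, X.ε_ε, map_neg,
        LinearMap.neg_apply, neg_add, neg_neg]
    | hadd t t' h h' => simp only [map_add, h, h', neg_add]
  have hq' (t) : q' ((tensor X C).d t) = (tensor X Y').d (q' t) + tmap LinearMap.id a (p' t) := by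
    induction t using tensor_induction with
    | h0 => simp only [map_zero, add_zero]
    | hmk x y =>
      simp only [p', q', tmap_tm, tensor_d_tm, map_add, LinearMap.id_apply, hq]
      abel
    | hadd t t' h h' => simp only [map_add, h, h']; abel
  have hpI (t) : p' (I t) = 0 := by
    induction t using tensor_induction with
    | h0 => simp only [map_zero]
    | hmk x y => simp only [p', I, tmap_tm, LinearMap.id_apply, hpi, map_zero]
    | hadd t t' h h' => simp only [map_add, h, h', add_zero]
  have hpJ (t) : p' (J t) = t := by
    induction t using tensor_induction with
    | h0 => simp only [map_zero]
    | hmk x y => simp only [p', J, tmap_tm, hpj, X.ε_ε]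
    | hadd t t' h h' => simp only [map_add, h, h']
  have hqI (t) : q' (I t) = t := by
    induction t using tensor_induction with
    | h0 => simp only [map_zero]
    | hmk x y => simp only [q', I, tmap_tm, LinearMap.id_apply, hqi]
    | hadd t t' h h' => simp only [map_add, h, h']
  refine ⟨fun t ht y hy ↦ ?_, fun y hy ↦ ?_⟩
  · obtain ⟨c, hc⟩ := hD (J t - I y) (by rw [map_sub, hJ, hI, ht, hy, map_zero, sub_zero, sub_self])
    refine ⟨-p' c, ?_⟩
    rw [map_neg, ← hp', hc, map_sub, hpI, hpJ, sub_zero]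
  · obtain ⟨c, hc⟩ := hD (I y) (by rw [hI, hy, map_zero])
    refine ⟨p' c, q' c, ?_, ?_⟩
    · rw [← neg_eq_zero, ← hp', hc, hpI]
    · rw [add_comm, ← hq', hc, hqI]

end

end DG
end Flat

section Operators

variable {A : Type u} [CommRing A] {ι : Type u}

/-! #### Differential modules with operators -/

/-- A differential module with a family of operators, each of them a homotopy from zero to the
multiplication by an element of the ring. -/
structure ODG (A : Type u) [CommRing A] (ι : Type u) extends DG A where
  w : ι → A
  op : ι → X →ₗ[A] X
  isHtpy : ∀ i, toDG.IsHtpy (w i) (op i)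

namespace ODG

open DG

/-- Differential modules with operators are related if there is a quasi-isomorphism from the first
to the second that intertwines the operators up to homotopy. -/
def Sim (X Y : ODG A ι) : Prop :=
  ∃ a : X.X →ₗ[A] Y.X, IsMor a ∧ QI a ∧ ∀ i, Intertwines a (X.op i) (Y.op i)

lemma Sim.refl (X : ODG A ι) : Sim X X :=
  ⟨LinearMap.id, ⟨fun _ ↦ rfl, fun _ ↦ rfl, 0, by simp⟩,
    ⟨fun _ _ y h ↦ ⟨y, h⟩, fun y h ↦ ⟨y, 0, h, by simp⟩⟩,
    fun _ ↦ ⟨0, fun _ ↦ by simp, fun _ ↦ by simp⟩⟩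

lemma Sim.trans {X Y Z : ODG A ι} (h : Sim X Y) (h' : Sim Y Z) : Sim X Z := by
  obtain ⟨a, ha, qa, ia⟩ := h
  obtain ⟨b, hb, qb, ib⟩ := h'
  refine ⟨b ∘ₗ a, ⟨fun x ↦ ?_, fun x ↦ ?_, ?_⟩, ⟨fun x hx z hz ↦ ?_, fun z hz ↦ ?_⟩, fun i ↦ ?_⟩
  · rw [LinearMap.comp_apply, ha.d_comm, hb.d_comm]; rfl
  · rw [LinearMap.comp_apply, ha.ε_comm, hb.ε_comm]; rfl
  · obtain ⟨y, hy⟩ := ha.one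
    obtain ⟨z, hz⟩ := hb.one
    exact ⟨z + b y, by rw [LinearMap.comp_apply, hy, map_add, hz, hb.d_comm, map_add, add_assoc]⟩
  · obtain ⟨y, hy⟩ := qb.inj (a x) (by rw [← ha.d_comm, hx, map_zero]) z hz
    exact qa.inj x hx y hy
  · obtain ⟨y, z', hy, rfl⟩ := qb.surj z hz
    obtain ⟨x, y', hx, rfl⟩ := qa.surj y hy
    exact ⟨x, b y' + z', hx, by rw [map_add, map_add, hb.d_comm, add_assoc]; rfl⟩
  · obtain ⟨s, hs, es⟩ := ia i
    obtain ⟨r, hr, er⟩ := ib i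
    refine ⟨b ∘ₗ s + r ∘ₗ a, fun x ↦ ?_, fun x ↦ ?_⟩
    · simp only [LinearMap.add_apply, LinearMap.comp_apply, hs, hb.ε_comm, ha.ε_comm, hr, map_add]
    · have e1 := congrArg b (es x)
      have e2 := er (a x)
      simp only [map_sub, sub_eq_iff_eq_add] at e1 e2
      simp only [LinearMap.add_apply, LinearMap.comp_apply, e1, e2, map_add, hb.d_comm, ha.d_comm]
      abel

/-- The tensor product; the operators act through both factors. -/
abbrev tensorO (X Y : ODG A ι) : ODG A ι where
  __ := DG.tensor X.toDG Y.toDG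
  w i := X.w i + Y.w i
  op i := tensorOp (X.op i) (Y.op i)
  isHtpy i := (X.isHtpy i).tensor (Y.isHtpy i)

/-- The action on a cone of an operator `h`, together with `c` times the operator of the cone. -/
def coneOp {f : A} {C : DG A} (c : A) (h : C.X →ₗ[A] C.X) : (cone f C).X →ₗ[A] (cone f C).X :=
  (h ∘ₗ LinearMap.fst A C.X C.X).prod
    (c • LinearMap.fst A C.X C.X - h ∘ₗ LinearMap.snd A C.X C.X)

lemma coneOp_pr {f : A} {C : DG A} (c : A) (h : C.X →ₗ[A] C.X) (u v : C.X) :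
    coneOp c h (pr u v : (cone f C).X) = pr (h u) (c • u - h v) := rfl

/-- The cone of multiplication by `f`; the operator of index `i` acts with the coefficient `c i`
on the new coordinate. -/
abbrev coneO (f : A) (c : ι → A) (C : ODG A ι) : ODG A ι where
  __ := cone f C.toDG
  w i := c i * f + C.w i
  op i := coneOp (c i) (C.op i)
  isHtpy i := by
    have H := C.isHtpy i
    refine ⟨fun t ↦ ?_, fun t ↦ ?_, fun n t ht ↦ ?_⟩
    · obtain ⟨u, v, rfl⟩ := exists_pr t
      rw [coneOp_pr, cone_d, cone_d, coneOp_pr, pr_add, smul_pr, pr_inj]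
      have e1 := H.d_add u
      have e2 := H.d_add v
      rw [← eq_sub_iff_add_eq] at e1 e2
      simp only [map_add, map_sub, map_smul, map_neg, e1, e2, smul_sub, smul_add, add_smul,
        smul_smul, mul_comm f (c i)]
      constructor <;> abel
    · obtain ⟨u, v, rfl⟩ := exists_pr t
      rw [coneOp_pr, cone_ε, cone_ε, coneOp_pr, H.ε_comm, map_sub, map_smul, H.ε_comm, neg_pr,
        pr_inj, map_neg, sub_neg_eq_add]
      exact ⟨rfl, by abel⟩
    · obtain ⟨u, v, rfl⟩ := exists_pr t
      rw [coneOp_pr, pr_mem_gr_succ]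
      obtain _ | n := n
      · obtain ⟨h, rfl⟩ := pr_mem_gr_zero.1 ht
        exact ⟨H.gr _ _ h, by
          rw [map_zero, sub_zero]
          exact Submodule.smul_mem _ _ h⟩
      · obtain ⟨h, h'⟩ := pr_mem_gr_succ.1 ht
        exact ⟨H.gr _ _ h, sub_mem (Submodule.smul_mem _ _ h) (H.gr _ _ h')⟩

/-- A module in degree zero, with zero operators. -/
abbrev deg0O {N : Type u} [AddCommGroup N] [Module A N] (n : N) : ODG A ι where
  __ := deg0 n
  w _ := 0
  op _ := 0
  isHtpy _ := ⟨fun _ ↦ by simp, fun _ ↦ by simp, fun _ _ _ ↦ zero_mem _⟩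

/-- A morphism of differential modules induces one of cones. -/
def coneMap {f : A} {C C' : DG A} (a : C.X →ₗ[A] C'.X) : (cone f C).X →ₗ[A] (cone f C').X :=
  a.prodMap a

lemma coneMap_pr {f : A} {C C' : DG A} (a : C.X →ₗ[A] C'.X) (u v : C.X) :
    coneMap a (pr u v : (cone f C).X) = pr (a u) (a v) := rfl

lemma Sim.cone {C C' : ODG A ι} (f : A) (c : ι → A) (h : Sim C C') :
    Sim (coneO f c C) (coneO f c C') := by
  obtain ⟨a, ha, qa, ia⟩ := h
  refine ⟨coneMap a, ⟨fun t ↦ ?_, fun t ↦ ?_, ?_⟩, ⟨fun t ht t' e ↦ ?_, fun t ht ↦ ?_⟩, fun i ↦ ?_⟩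
  · obtain ⟨u, v, rfl⟩ := exists_pr t
    change coneMap a ((DG.cone f C.toDG).d (pr u v)) = (DG.cone f C'.toDG).d (coneMap a (pr u v))
    rw [coneMap_pr, cone_d, cone_d, coneMap_pr, map_add, map_smul, map_neg, ha.d_comm, ha.d_comm]
  · obtain ⟨u, v, rfl⟩ := exists_pr t
    change coneMap a ((DG.cone f C.toDG).ε (pr u v)) = (DG.cone f C'.toDG).ε (coneMap a (pr u v))
    rw [coneMap_pr, cone_ε, cone_ε, coneMap_pr, map_neg, ha.ε_comm, ha.ε_comm]
  · obtain ⟨y, hy⟩ := ha.one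
    refine ⟨pr y 0, ?_⟩
    change coneMap a (pr C.one 0) = (pr C'.one 0 : (DG.cone f C'.toDG).X) + (DG.cone f C'.toDG).d _
    rw [coneMap_pr, cone_d, pr_add, hy, map_zero, smul_zero, map_zero, neg_zero, add_zero,
      add_zero]
  · obtain ⟨u, v, rfl⟩ := exists_pr t
    obtain ⟨y, w, rfl⟩ := exists_pr t'
    rw [cone_d, ← pr_zero] at ht
    rw [cone_d, coneMap_pr] at e
    rw [pr_inj, neg_eq_zero] at ht
    rw [pr_inj] at e
    obtain ⟨h1, h2⟩ := ht
    obtain ⟨e1, e2⟩ := e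
    obtain ⟨v', rfl⟩ := qa.inj v h2 (-w) (by rw [map_neg]; exact e2)
    have hw : C'.d (w + a v') = 0 := by
      rw [map_add, ← ha.d_comm, add_eq_zero_iff_neg_eq]
      exact e2.symm
    obtain ⟨x, s, hx, hs⟩ := qa.surj _ hw
    obtain ⟨p, hp⟩ := qa.inj (u + f • v' - f • x) (by
        rw [map_sub, map_add, map_smul, map_smul, hx, smul_zero, sub_zero, h1]) (y + f • s) (by
        have e1' : a u = C'.d y + f • w := e1
        rw [map_sub, map_add, map_smul, map_smul, e1', map_add, map_smul,
          ← sub_eq_iff_eq_add'.2 hs, smul_sub, smul_add]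
        abel)
    refine ⟨pr p (-(v' - x)), ?_⟩
    rw [cone_d, pr_inj, ← hp, map_neg, neg_neg, map_sub, hx, sub_zero, smul_neg, smul_sub]
    exact ⟨by abel, rfl⟩
  · obtain ⟨y, w, rfl⟩ := exists_pr t
    rw [cone_d, ← pr_zero] at ht
    rw [pr_inj, neg_eq_zero] at ht
    obtain ⟨h1, h2⟩ := ht
    obtain ⟨x, s, hx, rfl⟩ := qa.surj w h2
    obtain ⟨x', hx'⟩ := qa.inj (-(f • x)) (by rw [map_neg, map_smul, hx, smul_zero, neg_zero])
      (y + f • s) (by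
        rw [map_neg, map_smul, map_add, map_smul, neg_eq_iff_add_eq_zero, ← h1, smul_add]
        abel)
    obtain ⟨x'', s', hx'', e⟩ := qa.surj (y + f • s - a x') (by
      rw [map_sub, map_add, map_smul, ← ha.d_comm, ← hx', map_neg, map_smul, ← h1, smul_add]
      abel)
    refine ⟨pr (x' + x'') x, pr s' (-s), ?_, ?_⟩
    · rw [cone_d, ← pr_zero, pr_inj, map_add, ← hx', hx'', hx]
      constructor <;> simp
    · rw [cone_d, coneMap_pr, pr_add, pr_inj]
      refine ⟨?_, by rw [map_neg, neg_neg]⟩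
      rw [sub_eq_iff_eq_add, ← eq_sub_iff_add_eq] at e
      rw [e, map_add, smul_neg]
      abel
  · obtain ⟨s, hs, es⟩ := ia i
    refine ⟨coneMap s, fun t ↦ ?_, fun t ↦ ?_⟩
    · obtain ⟨u, v, rfl⟩ := exists_pr t
      rw [cone_ε, coneMap_pr, coneMap_pr, cone_ε, pr_inj, hs, map_neg, hs]
      exact ⟨rfl, rfl⟩
    · obtain ⟨u, v, rfl⟩ := exists_pr t
      rw [coneOp_pr, coneMap_pr, coneMap_pr, coneOp_pr, cone_d, coneMap_pr, coneMap_pr, cone_d]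
      have e1 := es u
      have e2 := es v
      rw [sub_eq_iff_eq_add] at e1 e2
      rw [pr_sub, pr_sub, pr_inj]
      simp only [map_sub, map_smul, map_add, map_neg, e1, e2]
      constructor <;> abel

/-- The iterated cone (the Koszul complex with coefficients in `C`) of the elements `f j`, where
`j` runs through a list. -/
def kos {J : Type u} (f : J → A) (c : ι → J → A) (L : List J) (C : ODG A ι) : ODG A ι :=
  L.foldr (fun j C ↦ coneO (f j) (fun i ↦ c i j) C) C

lemma kos_append {J : Type u} (f : J → A) (c : ι → J → A) (L L' : List J) (C : ODG A ι) :
    kos f c (L ++ L') C = kos f c L (kos f c L' C) := List.foldr_append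

lemma Sim.kos {J : Type u} (f : J → A) (c : ι → J → A) (L : List J) {C C' : ODG A ι}
    (h : Sim C C') : Sim (kos f c L C) (kos f c L C') := by
  induction L with
  | nil => exact h
  | cons j L ih => exact ih.cone _ _

/-- The canonical map from the tensor product with a cone to the cone of the tensor product. -/
def tensorConeMap (X C : DG A) (f : A) :
    (tensor X (cone f C)).X →ₗ[A] (cone f (tensor X C)).X :=
  (tmap (Y' := C) LinearMap.id (LinearMap.fst A C.X C.X : (cone f C).X →ₗ[A] C.X)).prod
    (tmap (Y' := C) X.ε (LinearMap.snd A C.X C.X : (cone f C).X →ₗ[A] C.X))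

lemma tensorConeMap_tm (X C : DG A) (f : A) (x : X.X) (u v : C.X) :
    tensorConeMap X C f (tm x (pr u v)) = pr (tm x u) (tm (X.ε x) v) := rfl

lemma tensor_cone_induction {X C : DG A} {f : A} {P : (tensor X (cone f C)).X → Prop}
    (t : (tensor X (cone f C)).X) (h0 : P 0) (hmk : ∀ (x : X.X) (u v : C.X), P (tm x (pr u v)))
    (hadd : ∀ t t', P t → P t' → P (t + t')) : P t :=
  tensor_induction t h0 (fun x y ↦ hmk x y.1 y.2) hadd

/-- The first inclusion into a cone. -/
def coneInl (C : DG A) (f : A) : C.X →ₗ[A] (cone f C).X := LinearMap.inl A C.X C.X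

/-- The second inclusion into a cone. -/
def coneInr (C : DG A) (f : A) : C.X →ₗ[A] (cone f C).X := LinearMap.inr A C.X C.X

lemma coneInl_apply (C : DG A) (f : A) (u : C.X) : coneInl C f u = pr u 0 := rfl

lemma coneInr_apply (C : DG A) (f : A) (v : C.X) : coneInr C f v = pr 0 v := rfl

/-- The inverse of the canonical map from the tensor product with a cone to the cone of the tensor
product. -/
def coneTensorMap (X C : DG A) (f : A) :
    (cone f (tensor X C)).X →ₗ[A] (tensor X (cone f C)).X :=
  LinearMap.coprod
    (tmap (X := X) (Y := C) (X' := X) (Y' := cone f C) LinearMap.id (coneInl C f))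
    (tmap (X := X) (Y := C) (X' := X) (Y' := cone f C) X.ε (coneInr C f))

lemma coneTensorMap_pr (X C : DG A) (f : A) (s t : (tensor X C).X) :
    coneTensorMap X C f (pr s t) =
      tmap LinearMap.id (coneInl C f) s +
      tmap X.ε (coneInr C f) t := rfl

lemma coneTensorMap_tensorConeMap (X C : DG A) (f : A) (t : (tensor X (cone f C)).X) :
    coneTensorMap X C f (tensorConeMap X C f t) = t := by
  induction t using tensor_cone_induction with
  | h0 => simp only [map_zero]
  | hmk x u v =>
    rw [tensorConeMap_tm, coneTensorMap_pr, tmap_tm, tmap_tm, X.ε_ε, LinearMap.id_apply, ← map_add,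
      coneInl_apply, coneInr_apply, pr_add, add_zero, zero_add]
  | hadd t t' h h' => simp only [map_add, h, h']

lemma tensorConeMap_coneTensorMap (X C : DG A) (f : A) (t : (cone f (tensor X C)).X) :
    tensorConeMap X C f (coneTensorMap X C f t) = t := by
  obtain ⟨s, t, rfl⟩ := exists_pr t
  have h1 : tensorConeMap X C f (tmap LinearMap.id (coneInl C f) s) = pr s 0 := by
    induction s using tensor_induction with
    | h0 => simp only [map_zero]; rfl
    | hmk x u =>
      rw [tmap_tm]
      rw [coneInl_apply, LinearMap.id_apply, tensorConeMap_tm, map_zero]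
    | hadd s s' h h' => simp only [map_add, h, h', pr_add, add_zero]
  have h2 : tensorConeMap X C f (tmap X.ε (coneInr C f) t) = pr 0 t := by
    induction t using tensor_induction with
    | h0 => simp only [map_zero]; rfl
    | hmk x u =>
      rw [tmap_tm]
      rw [coneInr_apply, tensorConeMap_tm, map_zero, X.ε_ε]
    | hadd s s' h h' => simp only [map_add, h, h', pr_add, add_zero]
  rw [coneTensorMap_pr, map_add, h1, h2, pr_add, add_zero, zero_add]

lemma tensorConeMap_d (X C : DG A) (f : A) (t : (tensor X (DG.cone f C)).X) :
    tensorConeMap X C f ((tensor X (DG.cone f C)).d t) =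
      (DG.cone f (tensor X C)).d (tensorConeMap X C f t) := by
  induction t using tensor_cone_induction with
  | h0 => simp only [map_zero]
  | hmk x u v =>
    simp only [tensor_d_tm, tensorConeMap_tm, cone_d, map_add, pr_add, pr_inj, X.d_ε, X.ε_ε,
      map_neg, map_smul, neg_add, LinearMap.neg_apply, neg_neg]
    exact ⟨by abel, trivial⟩
  | hadd t t' h h' => simp only [map_add, h, h']

lemma sim_tensor_cone (X C : ODG A ι) (f : A) (c : ι → A) :
    Sim (tensorO X (coneO f c C)) (coneO f c (tensorO X C)) := by
  have hd := tensorConeMap_d X.toDG C.toDG f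
  have hinv := coneTensorMap_tensorConeMap X.toDG C.toDG f
  have hinv' := tensorConeMap_coneTensorMap X.toDG C.toDG f
  refine ⟨tensorConeMap X.toDG C.toDG f, ⟨hd, fun t ↦ ?_, 0, ?_⟩,
    ⟨fun t ht y e ↦ ?_, fun y hy ↦ ?_⟩,
    fun i ↦ ⟨0, fun _ ↦ ?_, fun t ↦ ?_⟩⟩
  · change tensorConeMap X.toDG C.toDG f ((DG.tensor X.toDG (DG.cone f C.toDG)).ε t) =
      (DG.cone f (DG.tensor X.toDG C.toDG)).ε (tensorConeMap X.toDG C.toDG f t)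
    induction t using tensor_cone_induction with
    | h0 => simp only [map_zero]
    | hmk x u v => simp only [tensor_ε_tm, tensorConeMap_tm, cone_ε, map_neg]
    | hadd t t' h h' => simp only [map_add, h, h']
  · rw [map_zero, add_zero]
    change tensorConeMap X.toDG C.toDG f (tm X.one (pr C.one 0)) = pr (tm X.one C.one) 0
    rw [tensorConeMap_tm, map_zero]
  · refine ⟨coneTensorMap X.toDG C.toDG f y, ?_⟩
    change t = (DG.tensor X.toDG (DG.cone f C.toDG)).d _
    rw [← hinv ((DG.tensor X.toDG (DG.cone f C.toDG)).d _), hd, hinv', ← hinv t]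
    exact congrArg _ e
  · refine ⟨coneTensorMap X.toDG C.toDG f y, 0, ?_, ?_⟩
    · change (DG.tensor X.toDG (DG.cone f C.toDG)).d _ = 0
      rw [← hinv ((DG.tensor X.toDG (DG.cone f C.toDG)).d _), hd, hinv']
      change coneTensorMap _ _ _ ((coneO f c (tensorO X C)).d y) = 0
      rw [hy, map_zero]
    · rw [map_zero, add_zero]
      exact (hinv' y).symm
  · simp
  · rw [LinearMap.zero_apply, LinearMap.zero_apply, map_zero, sub_zero, sub_eq_zero]
    change tensorConeMap X.toDG C.toDG f (tensorOp (X.op i) (coneOp (c i) (C.op i)) t) =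
      coneOp (c i) (tensorOp (X.op i) (C.op i)) (tensorConeMap X.toDG C.toDG f t)
    induction t using tensor_cone_induction with
    | h0 => simp only [map_zero]
    | hmk x u v =>
      simp only [tensorOp_tm, coneOp_pr, tensorConeMap_tm, map_add, pr_add, pr_inj, X.ε_ε,
        (X.isHtpy i).ε_comm, map_neg, LinearMap.neg_apply, map_sub, map_smul]
      exact ⟨trivial, by abel⟩
    | hadd t t' h h' => simp only [map_add, h, h']

lemma sim_tensor_kos {J : Type u} (f : J → A) (c : ι → J → A) (L : List J) (X C : ODG A ι) :
    Sim (tensorO X (ODG.kos f c L C)) (ODG.kos f c L (tensorO X C)) := by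
  induction L with
  | nil => exact .refl _
  | cons j L ih => exact (sim_tensor_cone _ _ _ _).trans (ih.cone _ _)

/-- The canonical map from the tensor product with the base ring. -/
def unitMap (X : DG A) : (DG.tensor X (deg0 (1 : A))).X →ₗ[A] X.X :=
  (TensorProduct.rid A X.X).toLinearMap

/-- The inverse of the canonical map from the tensor product with the base ring. -/
def unitInv (X : DG A) : X.X →ₗ[A] (DG.tensor X (deg0 (1 : A))).X :=
  (TensorProduct.rid A X.X).symm.toLinearMap

lemma sim_tensor_unit (X : ODG A ι) : Sim (tensorO X (deg0O (1 : A))) X := by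
  let φ := unitMap X.toDG
  let ψ := unitInv X.toDG
  have hφ (x : X.X) (a : (deg0 (1 : A)).X) : φ (tm x a) = (show A from a) • x := rfl
  have hφψ (x) : φ (ψ x) = x := (TensorProduct.rid A X.X).apply_symm_apply x
  have hψφ (x) : ψ (φ x) = x := (TensorProduct.rid A X.X).symm_apply_apply x
  have hd (t) : φ ((DG.tensor X.toDG (deg0 (1 : A))).d t) = X.d (φ t) := by
    induction t using tensor_induction with
    | h0 => simp only [map_zero]
    | hmk x u =>
      rw [tensor_d_tm]
      change φ (tm (X.d x) u + tm (X.ε x) 0) = _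
      rw [map_zero, add_zero, hφ, hφ, map_smul]
    | hadd t t' h h' => simp only [map_add, h, h']
  refine ⟨φ, ⟨hd, fun t ↦ ?_, 0, ?_⟩, ⟨fun t ht y e ↦ ⟨ψ y, ?_⟩, fun y hy ↦ ⟨ψ y, 0, ?_, ?_⟩⟩,
    fun i ↦ ⟨0, fun _ ↦ ?_, fun t ↦ ?_⟩⟩
  · change φ ((DG.tensor X.toDG (deg0 (1 : A))).ε t) = X.ε (φ t)
    induction t using tensor_induction with
    | h0 => simp only [map_zero]
    | hmk x u =>
      rw [tensor_ε_tm]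
      change φ (tm (X.ε x) u) = _
      rw [hφ, hφ, map_smul]
    | hadd t t' h h' => simp only [map_add, h, h']
  · rw [map_zero, add_zero]
    exact (hφ X.one (deg0 (1 : A)).one).trans (one_smul A _)
  · change t = (DG.tensor X.toDG (deg0 (1 : A))).d _
    rw [← hψφ ((DG.tensor X.toDG (deg0 (1 : A))).d _), hd, hφψ, ← e, hψφ]
  · change (DG.tensor X.toDG (deg0 (1 : A))).d _ = 0
    rw [← hψφ ((DG.tensor X.toDG (deg0 (1 : A))).d _), hd, hφψ, hy, map_zero]
  · rw [hφψ, map_zero, add_zero]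
  · simp
  · rw [LinearMap.zero_apply, LinearMap.zero_apply, map_zero, sub_zero, sub_eq_zero]
    change φ (tensorOp (X.op i) 0 t) = X.op i (φ t)
    induction t using tensor_induction with
    | h0 => simp only [map_zero]
    | hmk x u =>
      rw [tensorOp_tm, LinearMap.zero_apply, map_zero, add_zero, hφ, hφ, map_smul]
    | hadd t t' h h' => simp only [map_add, h, h']

end ODG
end Operators

section Koszul

variable {A : Type u} [CommRing A] {ι : Type u}

/-! #### Koszul complexes of regular sequences -/

namespace DG

/-- The differential module `C` is a resolution of `A ⧸ I` by the base point: it is exact in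
positive degrees, its part of degree `0` is generated by the base point, and a multiple of the
base point is a boundary if and only if the factor lies in `I`. -/
structure Resolves (C : DG A) (I : Ideal A) : Prop where
  aug : ∃ p : C.X →ₗ[A] A, p C.one = 1 ∧ ∀ x, p (C.d x) ∈ I
  zero : ∀ x ∈ C.gr 0, ∃ b : A, x = b • C.one
  boundary : ∀ b ∈ I, ∃ y ∈ C.gr 1, C.d y = b • C.one
  cycle : ∀ x, C.d x = 0 → ∃ (b : A) (y : C.X), x = b • C.one + C.d y
  exactPos : C.ExactPos

lemma Resolves.mem {C : DG A} {I : Ideal A} (h : C.Resolves I) {b : A} {y : C.X}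
    (hy : C.d y = b • C.one) : b ∈ I := by
  obtain ⟨p, hp, hd⟩ := h.aug
  have := hd y
  rwa [hy, map_smul, hp, smul_eq_mul, mul_one] at this

lemma resolves_deg0 : (deg0 (A := A) (1 : A)).Resolves ⊥ where
  aug := ⟨(LinearMap.id : A →ₗ[A] A), rfl, fun x ↦ rfl⟩
  zero x _ := ⟨x, (mul_one (show A from x)).symm⟩
  boundary b hb := ⟨0, zero_mem _, by
    rw [Ideal.mem_bot.1 hb, map_zero, zero_smul]⟩
  cycle x _ := ⟨x, 0, by
    rw [map_zero, add_zero]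
    exact (mul_one (show A from x)).symm⟩
  exactPos n y hy _ := ⟨0, zero_mem _, by
    have : (show A from y) ∈ (⊥ : Submodule A A) := hy
    exact ((Submodule.mem_bot A).1 this).symm⟩

/-- The cone of a nonzerodivisor modulo `I` resolves the quotient by the larger ideal. -/
lemma Resolves.cone {C : DG A} {I : Ideal A} (h : C.Resolves I) (f : A)
    (hf : ∀ a, f * a ∈ I → a ∈ I) : (DG.cone f C).Resolves (Ideal.span {f} ⊔ I) where
  aug := by
    obtain ⟨p, hp, hd⟩ := h.aug
    refine ⟨p ∘ₗ LinearMap.fst A C.X C.X, hp, fun t ↦ ?_⟩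
    obtain ⟨u, v, rfl⟩ := exists_pr t
    change p (C.d u + f • v) ∈ _
    rw [map_add, map_smul, add_comm]
    exact Submodule.add_mem_sup (Ideal.mul_mem_right _ _ (Ideal.mem_span_singleton_self f)) (hd u)
  zero t ht := by
    obtain ⟨u, v, rfl⟩ := exists_pr t
    obtain ⟨hu, rfl⟩ := pr_mem_gr_zero.1 ht
    obtain ⟨b, rfl⟩ := h.zero u hu
    exact ⟨b, by rw [cone_one, smul_pr, smul_zero]⟩
  boundary b hb := by
    obtain ⟨x, hx, b, hb', rfl⟩ := Submodule.mem_sup.1 hb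
    obtain ⟨a, rfl⟩ := Ideal.mem_span_singleton'.1 hx
    obtain ⟨y, hy, e⟩ := h.boundary b hb'
    refine ⟨pr y (a • C.one), pr_mem_gr_succ.2 ⟨hy, Submodule.smul_mem _ _ C.one_mem⟩, ?_⟩
    rw [cone_d, cone_one, smul_pr, e, map_smul, C.d_one, smul_smul, ← add_smul,
      smul_zero, smul_zero,
      neg_zero, add_comm, mul_comm]
  cycle t ht := by
    obtain ⟨u, v, rfl⟩ := exists_pr t
    rw [cone_d, ← pr_zero, pr_inj, neg_eq_zero] at ht
    obtain ⟨h1, h2⟩ := ht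
    obtain ⟨b, w, rfl⟩ := h.cycle v h2
    have e1 : C.d (u + f • w) = -((f * b) • C.one) := by
      rw [smul_add, smul_smul, add_eq_zero_iff_eq_neg] at h1
      rw [map_add, map_smul, h1]
      abel
    have hb : b ∈ I := hf b (h.mem (y := -(u + f • w)) (by rw [map_neg, e1, neg_neg]))
    obtain ⟨y, -, hy⟩ := h.boundary b hb
    obtain ⟨b', w', e⟩ := h.cycle (u + f • w + f • y) (by
      rw [map_add, e1, map_smul, hy, smul_smul, neg_add_cancel])
    refine ⟨b', pr w' (-(y + w)), ?_⟩
    rw [cone_d, cone_one, smul_pr, pr_add, pr_inj, map_neg, neg_neg, map_add, hy, smul_zero,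
      zero_add, ← add_assoc, ← e, smul_neg, smul_add]
    exact ⟨by abel, rfl⟩
  exactPos n t ht e := by
    obtain ⟨u, v, rfl⟩ := exists_pr t
    rw [cone_d, ← pr_zero, pr_inj, neg_eq_zero] at e
    obtain ⟨h1, h2⟩ := e
    obtain ⟨hu, hv⟩ := pr_mem_gr_succ.1 ht
    have hw : ∃ w ∈ C.gr (n + 1), C.d w = v := by
      obtain _ | n := n
      · obtain ⟨b, rfl⟩ := h.zero v hv
        refine h.boundary b (hf b (h.mem (y := -u) ?_))
        rw [map_neg, ← smul_smul, neg_eq_iff_add_eq_zero, h1]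
      · exact h.exactPos n v hv h2
    obtain ⟨w, hw, rfl⟩ := hw
    obtain ⟨y, hy, e⟩ := h.exactPos n (u + f • w) (add_mem hu (Submodule.smul_mem _ _ hw)) (by
      rw [map_add, map_smul, h1])
    refine ⟨pr y (-w), pr_mem_gr_succ.2 ⟨hy, neg_mem hw⟩, ?_⟩
    rw [cone_d, e, map_neg, neg_neg, smul_neg, add_neg_cancel_right]

section Comparison

variable {P : ℕ → Type u} [∀ n, AddCommGroup (P n)] [∀ n, Module A (P n)]
  {dP : ∀ n, P (n + 1) →ₗ[A] P n} {hdP : ∀ n x, dP n (dP (n + 1) x) = 0} {one : P 0}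

lemma proj_d (n : ℕ) (x : (ofSeq P dP hdP one).X) :
    proj n ((ofSeq P dP hdP one).d x) = dP n (proj (n + 1) x) := by
  induction x using ofSeq_induction with
  | h0 => simp only [map_zero]
  | hof m x =>
    obtain _ | m := m
    · rw [ofSeq_d_zero, proj_of_ne (by omega), map_zero, map_zero]
    · rw [ofSeq_d_succ]
      obtain rfl | h := eq_or_ne m n
      · rw [proj_of_self, proj_of_self]
      · rw [proj_of_ne h, proj_of_ne (by omega), map_zero]
  | hadd x y hx hy => simp only [map_add, hx, hy]

lemma eq_sum_proj (x : (ofSeq P dP hdP one).X) :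
    ∃ N, x = of 0 (proj 0 x) + ∑ n ∈ Finset.range N, of (n + 1) (proj (n + 1) x) := by
  have key (x : (ofSeq P dP hdP one).X) : ∃ N, ∀ N' ≥ N,
      x = ∑ n ∈ Finset.range N', of n (proj n x) := by
    induction x using ofSeq_induction with
    | h0 => exact ⟨0, fun N' _ ↦ by simp⟩
    | hof m x =>
      refine ⟨m + 1, fun N' hN ↦ ?_⟩
      rw [Finset.sum_eq_single_of_mem m (Finset.mem_range.2 hN), proj_of_self]
      intro n _ hn
      rw [proj_of_ne hn.symm, map_zero]
    | hadd x y hx hy =>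
      obtain ⟨N, hN⟩ := hx
      obtain ⟨N', hN'⟩ := hy
      refine ⟨max N N', fun n hn ↦ ?_⟩
      simp only [map_add, Finset.sum_add_distrib]
      rw [← hN n (le_of_max_le_left hn), ← hN' n (le_of_max_le_right hn)]
  obtain ⟨N, hN⟩ := key x
  refine ⟨N, ?_⟩
  conv_lhs => rw [hN (N + 1) (by omega), Finset.sum_range_succ']
  rw [add_comm]

lemma cycle_ofSeq (hex : ∀ n x, dP n x = 0 → ∃ y, dP (n + 1) y = x)
    (x : (ofSeq P dP hdP one).X) (hx : (ofSeq P dP hdP one).d x = 0) :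
    ∃ p y, x = of 0 p + (ofSeq P dP hdP one).d y := by
  have h (n : ℕ) : ∃ y, dP (n + 1) y = proj (n + 1) x := hex n _ (by rw [← proj_d, hx, map_zero])
  choose y hy using h
  obtain ⟨N, hN⟩ := eq_sum_proj x
  refine ⟨proj 0 x, ∑ n ∈ Finset.range N, of (n + 2) (y n), ?_⟩
  rw [map_sum]
  simp only [ofSeq_d_succ, hy]
  exact hN

variable [∀ n, Module.Projective A (P n)]

/-- The comparison map from a projective resolution of `A ⧸ I` to another resolution of `A ⧸ I`
is a quasi-isomorphism. -/
lemma Resolves.exists_qi {C : DG A} {I : Ideal A} (hC : C.Resolves I)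
    (hex : ∀ n x, dP n x = 0 → ∃ y, dP (n + 1) y = x)
    (p : P 0 →ₗ[A] A ⧸ I) (hp : ∀ x, p x = 0 ↔ ∃ y, dP 0 y = x) (hone : p one = 1) :
    ∃ a : (ofSeq P dP hdP one).X →ₗ[A] C.X, IsMor a ∧ QI a ∧ ∀ n x, a (of n x) ∈ C.gr n := by
  obtain ⟨φ, hφ⟩ := Module.projective_lifting_property (Submodule.mkQ I) p
    (Submodule.mkQ_surjective I)
  have hφ' (x) : Ideal.Quotient.mk I (φ x) = p x := LinearMap.congr_fun hφ x
  have hφd (x) : φ (dP 0 x) ∈ I := by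
    rw [← Ideal.Quotient.eq_zero_iff_mem, hφ', hp]
    exact ⟨x, rfl⟩
  have hφ1 : φ one - 1 ∈ I := by
    rw [← Ideal.Quotient.eq, hφ', hone, map_one]
  obtain ⟨z, -, hz⟩ := hC.boundary _ hφ1
  obtain ⟨a, ha, hag, ha0⟩ := exists_comparison (hdP := hdP) (one := one) hC.exactPos
    (LinearMap.toSpanSingleton A C.X C.one ∘ₗ φ)
    (fun x ↦ Submodule.smul_mem _ _ C.one_mem) (fun x ↦ hC.boundary _ (hφd x))
    (fun x ↦ by
      change C.d (φ x • C.one) = 0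
      rw [map_smul, C.d_one, smul_zero])
    ⟨z, by
      change φ one • C.one = _
      rw [hz, sub_smul, one_smul, add_sub_cancel]⟩
  have ha0' (x) : a (of 0 x) = φ x • C.one := ha0 x
  refine ⟨a, ha, ⟨fun x hx y hy ↦ ?_, fun y hy ↦ ?_⟩, hag⟩
  · obtain ⟨q, x', rfl⟩ := cycle_ofSeq hex x hx
    have : φ q ∈ I := hC.mem (y := y - a x') (by
      rw [map_sub, ← hy, map_add, ha.d_comm, add_sub_cancel_right, ha0'])
    obtain ⟨y', rfl⟩ := (hp q).1 (by rw [← hφ', Ideal.Quotient.eq_zero_iff_mem]; exact this)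
    exact ⟨of 1 y' + x', by rw [map_add, ofSeq_d_succ]⟩
  · obtain ⟨b, y', rfl⟩ := hC.cycle y hy
    refine ⟨of 0 (b • one), y' - b • z, ofSeq_d_zero _, ?_⟩
    rw [ha0', map_sub, map_smul, map_smul, hz, smul_eq_mul, smul_smul, mul_sub, mul_one, sub_smul]
    abel

end Comparison

end DG

namespace ODG

open DG

variable {J : Type u} (f : J → A) (c : ι → J → A)

lemma kos_w (L : List J) (C : ODG A ι) (i : ι) :
    (kos f c L C).w i = (L.map fun j ↦ c i j * f j).sum + C.w i := by
  induction L with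
  | nil => simp [kos]
  | cons j L ih =>
    change c i j * f j + (kos f c L C).w i = _
    rw [ih, List.map_cons, List.sum_cons, add_assoc]

/-- The elements `f j`, for `j` in `D`, form a regular sequence in any order. -/
def RegularOn (f : J → A) (D : Set J) : Prop :=
  ∀ j ∈ D, ∀ T ⊆ D, j ∉ T → ∀ a, f j * a ∈ Ideal.span (f '' T) → a ∈ Ideal.span (f '' T)

lemma RegularOn.mono {f : J → A} {D D' : Set J} (h : RegularOn f D) (hD : D' ⊆ D) :
    RegularOn f D' := fun j hj T hT hjT a ha ↦ h j (hD hj) T (hT.trans hD) hjT a ha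

variable {f}

lemma span_image_cons (f : J → A) (j : J) (L : List J) :
    Ideal.span (f '' {i | i ∈ j :: L}) = Ideal.span {f j} ⊔ Ideal.span (f '' {i | i ∈ L}) := by
  rw [← Ideal.span_union, ← Set.image_singleton, ← Set.image_union]
  congr 2
  ext i
  simp

/-- The Koszul complex of a regular family resolves the quotient by the ideal generated. -/
lemma resolves_kos (L : List J) (hf : RegularOn f {j | j ∈ L}) (hL : L.Nodup) :
    (kos f c L (deg0O (1 : A))).Resolves (Ideal.span (f '' {j | j ∈ L})) := by
  induction L with
  | nil =>
    have : Ideal.span (f '' {j | j ∈ ([] : List J)}) = ⊥ := by simp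
    rw [this]
    exact resolves_deg0
  | cons j L ih =>
    rw [span_image_cons]
    rw [List.nodup_cons] at hL
    exact (ih (hf.mono fun i hi ↦ List.mem_cons_of_mem j hi) hL.2).cone _
      (hf j (by simp) {i | i ∈ L} (fun i hi ↦ List.mem_cons_of_mem j hi) hL.1)

/-- The total tensor product of finitely many differential modules with operators. -/
def tensorFamily : (l : ℕ) → (Fin l → ODG A ι) → ODG A ι
  | 0, _ => deg0O (1 : A)
  | l + 1, X => tensorO (X 0) (tensorFamily l fun k ↦ X k.succ)

lemma Sim.tensor_left {P : ℕ → Type u} [∀ n, AddCommGroup (P n)] [∀ n, Module A (P n)]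
    {dP : ∀ n, P (n + 1) →ₗ[A] P n} {hdP : ∀ n x, dP n (dP (n + 1) x) = 0} {one : P 0}
    [∀ n, Module.Flat A (P n)] (w : ι → A) (op) (H) {C C' : ODG A ι} (h : Sim C C') :
    Sim (tensorO ⟨ofSeq P dP hdP one, w, op, H⟩ C) (tensorO ⟨ofSeq P dP hdP one, w, op, H⟩ C') := by
  obtain ⟨a, ha, qa, ia⟩ := h
  have hid : IsMor (LinearMap.id : (ofSeq P dP hdP one).X →ₗ[A] _) :=
    ⟨fun _ ↦ rfl, fun _ ↦ rfl, 0, by simp⟩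
  exact ⟨tmap LinearMap.id a, hid.tensor ha, QI.tensor_left (hdP := hdP) ha qa,
    fun i ↦ Intertwines.tensor hid ha
    ⟨0, fun _ ↦ by simp, fun _ ↦ by simp⟩ (ia i)⟩

/-- The data of projective resolutions of quotient rings `A ⧸ I k`, with operators. -/
structure Res (A : Type u) [CommRing A] (ι : Type u) (I : Ideal A) where
  P : ℕ → Type u
  [grp : ∀ n, AddCommGroup (P n)]
  [mod : ∀ n, Module A (P n)]
  [proj : ∀ n, Module.Projective A (P n)]
  dP : ∀ n, P (n + 1) →ₗ[A] P n
  d_d : ∀ n x, dP n (dP (n + 1) x) = 0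
  exact : ∀ n x, dP n x = 0 → ∃ y, dP (n + 1) y = x
  one : P 0
  aug : P 0 →ₗ[A] A ⧸ I
  aug_eq_zero : ∀ x, aug x = 0 ↔ ∃ y, dP 0 y = x
  aug_one : aug one = 1
  w : ι → A
  op : ι → (ofSeq P dP d_d one).X →ₗ[A] (ofSeq P dP d_d one).X
  isHtpy : ∀ i, (ofSeq P dP d_d one).IsHtpy (w i) (op i)

attribute [instance] Res.grp Res.mod Res.proj

/-- The differential module with operators of a resolution. -/
abbrev Res.toODG {I : Ideal A} (R : Res A ι I) : ODG A ι where
  __ := ofSeq R.P R.dP R.d_d R.one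
  w := R.w
  op := R.op
  isHtpy := R.isHtpy

/-- The total tensor product of resolutions of the rings `A ⧸ (f j | j ∈ L k)` is equivalent to the
Koszul complex of the elements of all these lists. -/
lemma sim_tensorFamily_kos {l : ℕ} (L : Fin l → List J)
    (hf : ∀ k, RegularOn f {j | j ∈ L k})
    (hL : ∀ k, (L k).Nodup) (hdisj : ∀ k k', k ≠ k' → (L k).Disjoint (L k'))
    (R : ∀ k, Res A ι (Ideal.span (f '' {j | j ∈ L k})))
    (hw : ∀ k i, (R k).w i = ((L k).map fun j ↦ c i j * f j).sum) :
    ∃ L' : List J, L'.Nodup ∧ (∀ j, j ∈ L' ↔ ∃ k, j ∈ L k) ∧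
      Sim (tensorFamily l fun k ↦ (R k).toODG) (kos f c L' (deg0O (1 : A))) := by
  induction l with
  | zero => exact ⟨[], List.nodup_nil, by simp, .refl _⟩
  | succ l ih =>
    obtain ⟨L', hL', hm, h⟩ := ih (fun k ↦ L k.succ) (fun k ↦ hf _) (fun k ↦ hL _)
      (fun k k' hk ↦ hdisj _ _ (by simpa using hk)) (fun k ↦ R k.succ) (fun k ↦ hw _)
    refine ⟨L' ++ L 0, List.nodup_append'.2 ⟨hL', hL 0, ?_⟩, fun j ↦ ?_, ?_⟩
    · intro j hj hj'
      obtain ⟨k, hk⟩ := (hm j).1 hj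
      exact hdisj _ _ (Fin.succ_ne_zero k) hk hj'
    · rw [List.mem_append, hm, Fin.exists_fin_succ, or_comm]
    · rw [kos_append]
      -- Replace all resolutions but the first by Koszul complexes, pull these cones out of the
      -- tensor product, and replace the remaining first resolution, now the innermost term.
      have h0 : Sim (R 0).toODG (kos f c (L 0) (deg0O (1 : A))) := by
        obtain ⟨a, ha, qa, hag⟩ := (resolves_kos c (L 0) (hf 0) (hL 0)).exists_qi (hdP := (R 0).d_d)
          (R 0).exact (R 0).aug (R 0).aug_eq_zero (R 0).aug_one
        refine ⟨a, ha, qa, fun i ↦ ?_⟩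
        refine intertwines_of_exactPos (resolves_kos c (L 0) (hf 0) (hL 0)).exactPos a
          ha.d_comm hag ((R 0).isHtpy i) ?_
        have := (kos f c (L 0) (deg0O (1 : A))).isHtpy i
        rw [kos_w, ← hw, add_zero] at this
        exact this
      exact (h.tensor_left (R 0).w (R 0).op (R 0).isHtpy).trans ((sim_tensor_kos f c L' _ _).trans
        (((sim_tensor_unit _).trans h0).kos f c L'))

end ODG
end Koszul

section Elimination

variable {A : Type u} [CommRing A] {ι : Type u}

namespace ODG

open DG

/-! #### Elimination of regular elements from a Koszul complex -/

/-- A surjective morphism of differential modules with operators, the kernel of which is the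
injective image of multiplication by `f`. -/
structure Reduction (f : A) {C C' : ODG A ι} (a : C.X →ₗ[A] C'.X) : Prop where
  d_comm (x : C.X) : a (C.d x) = C'.d (a x)
  ε_comm (x : C.X) : a (C.ε x) = C'.ε (a x)
  one : a C.one = C'.one
  op_comm (i : ι) (x : C.X) : a (C.op i x) = C'.op i (a x)
  surj : Function.Surjective a
  inj (x : C.X) : f • x = 0 → x = 0
  ker (x : C.X) : a x = 0 → ∃ y, x = f • y
  ann (y : C'.X) : f • y = 0

lemma Reduction.cone {f : A} {C C' : ODG A ι} {a : C.X →ₗ[A] C'.X} (h : Reduction f a) (g : A)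
    (c : ι → A) : Reduction f (C := coneO g c C) (C' := coneO g c C') (coneMap a) where
  d_comm t := by
    obtain ⟨u, v, rfl⟩ := exists_pr t
    rw [cone_d, coneMap_pr, coneMap_pr, cone_d, pr_inj, map_add, h.d_comm, map_smul, map_neg,
      h.d_comm]
    exact ⟨rfl, rfl⟩
  ε_comm t := by
    obtain ⟨u, v, rfl⟩ := exists_pr t
    rw [cone_ε, coneMap_pr, coneMap_pr, cone_ε, pr_inj, h.ε_comm, map_neg, h.ε_comm]
    exact ⟨rfl, rfl⟩
  one := by
    rw [cone_one, coneMap_pr, cone_one, h.one, map_zero]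
  op_comm i t := by
    obtain ⟨u, v, rfl⟩ := exists_pr t
    rw [coneOp_pr, coneMap_pr, coneMap_pr, coneOp_pr, pr_inj, h.op_comm, map_sub, map_smul,
      h.op_comm]
    exact ⟨rfl, rfl⟩
  surj t := by
    obtain ⟨u, v, rfl⟩ := exists_pr t
    obtain ⟨u, rfl⟩ := h.surj u
    obtain ⟨v, rfl⟩ := h.surj v
    exact ⟨pr u v, rfl⟩
  inj t ht := by
    obtain ⟨u, v, rfl⟩ := exists_pr t
    rw [smul_pr, ← pr_zero, pr_inj] at ht
    rw [h.inj u ht.1, h.inj v ht.2, pr_zero]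
  ker t ht := by
    obtain ⟨u, v, rfl⟩ := exists_pr t
    rw [coneMap_pr, ← pr_zero, pr_inj] at ht
    obtain ⟨u', rfl⟩ := h.ker u ht.1
    obtain ⟨v', rfl⟩ := h.ker v ht.2
    exact ⟨pr u' v', rfl⟩
  ann t := by
    obtain ⟨u, v, rfl⟩ := exists_pr t
    rw [smul_pr, h.ann, h.ann, pr_zero]

/-- The cone of an injective multiplication is equivalent to its cokernel. -/
lemma Reduction.sim {f : A} {C C' : ODG A ι} {a : C.X →ₗ[A] C'.X} (h : Reduction f a)
    (c : ι → A) : Sim (coneO f c C) C' := by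
  let p : (DG.cone f C.toDG).X →ₗ[A] C'.X := a ∘ₗ LinearMap.fst A C.X C.X
  have hp (u v : C.X) : p (pr u v) = a u := rfl
  refine ⟨p, ⟨fun t ↦ ?_, fun t ↦ ?_, 0, ?_⟩, ⟨fun t ht y e ↦ ?_, fun y hy ↦ ?_⟩,
    fun i ↦ ⟨0, fun _ ↦ ?_, fun t ↦ ?_⟩⟩
  · obtain ⟨u, v, rfl⟩ := exists_pr t
    rw [cone_d, hp, hp, map_add, map_smul, h.ann, add_zero, h.d_comm]
  · obtain ⟨u, v, rfl⟩ := exists_pr t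
    rw [cone_ε, hp, hp, h.ε_comm]
  · rw [cone_one, hp, map_zero, add_zero, h.one]
  · obtain ⟨u, v, rfl⟩ := exists_pr t
    rw [cone_d, ← pr_zero, pr_inj, neg_eq_zero] at ht
    obtain ⟨h1, h2⟩ := ht
    obtain ⟨y, rfl⟩ := h.surj y
    rw [hp] at e
    obtain ⟨w, hw⟩ := h.ker (u - C.d y) (by rw [map_sub, h.d_comm, e, sub_self])
    rw [sub_eq_iff_eq_add'] at hw
    subst hw
    refine ⟨pr y w, ?_⟩
    rw [cone_d, pr_inj]
    refine ⟨rfl, eq_neg_of_add_eq_zero_right (h.inj _ ?_)⟩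
    rw [smul_add, ← h1, map_add, C.d_d, map_smul, zero_add]
  · obtain ⟨u, rfl⟩ := h.surj y
    obtain ⟨w, hw⟩ := h.ker (C.d u) (by rw [h.d_comm, hy])
    refine ⟨pr u (-w), 0, ?_, ?_⟩
    · rw [cone_d, ← pr_zero, pr_inj, hw, smul_neg, add_neg_cancel, map_neg, neg_neg]
      refine ⟨rfl, h.inj _ ?_⟩
      rw [← map_smul, ← hw, C.d_d]
    · rw [hp, map_zero, add_zero]
  · simp
  · obtain ⟨u, v, rfl⟩ := exists_pr t
    rw [coneOp_pr, hp, hp, h.op_comm, sub_self]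
    simp

variable {J : Type u} {f : J → A} (c : ι → J → A)

lemma Reduction.kos {g : A} {C C' : ODG A ι} {a : C.X →ₗ[A] C'.X} (h : Reduction g a)
    (L : List J) : ∃ a : (kos f c L C).X →ₗ[A] (ODG.kos f c L C').X, Reduction g a := by
  induction L with
  | nil => exact ⟨a, h⟩
  | cons j L ih =>
    obtain ⟨b, hb⟩ := ih
    exact ⟨_, hb.cone (f j) fun i ↦ c i j⟩

/-- The quotient map `A ⧸ I → A ⧸ I'`. -/
def factorMap {I I' : Ideal A} (h : I ≤ I') : A ⧸ I →ₗ[A] A ⧸ I' :=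
  (Ideal.Quotient.factorₐ A h).toLinearMap

/-- Multiplication by `g` on `A ⧸ I` has the cokernel `A ⧸ I'`, where `I'` is generated by `I` and
`g`, and it is injective if `g` is a nonzerodivisor modulo `I`. -/
lemma reduction_quotient {I : Ideal A} {g : A} (hg : ∀ a, g * a ∈ I → a ∈ I) {I' : Ideal A}
    (hI' : I' = Ideal.span {g} ⊔ I) :
    ∃ a : (deg0O (ι := ι) (A := A) (1 : A ⧸ I)).X →ₗ[A] (deg0O (ι := ι) (A := A) (1 : A ⧸ I')).X,
      Reduction g a := by
  have hle : I ≤ I' := hI' ▸ le_sup_right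
  have hgI : g ∈ I' := hI' ▸ Ideal.mem_sup_left (Ideal.mem_span_singleton_self g)
  refine ⟨factorMap hle, ⟨fun x ↦ ?_, fun _ ↦ rfl, rfl, fun i x ↦ ?_, ?_, ?_, ?_, ?_⟩⟩
  · exact map_zero (factorMap hle)
  · exact map_zero (factorMap hle)
  · intro (x : A ⧸ I')
    obtain ⟨x, rfl⟩ := Ideal.Quotient.mk_surjective x
    exact ⟨Ideal.Quotient.mk I x, rfl⟩
  · intro (x : A ⧸ I) (hx : g • x = 0)
    change x = 0
    obtain ⟨x, rfl⟩ := Ideal.Quotient.mk_surjective x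
    have : Ideal.Quotient.mk I (g * x) = 0 := hx
    rw [Ideal.Quotient.eq_zero_iff_mem] at this ⊢
    exact hg x this
  · intro (x : A ⧸ I) hx
    obtain ⟨x, rfl⟩ := Ideal.Quotient.mk_surjective x
    have hx' : Ideal.Quotient.mk I' x = 0 := hx
    rw [Ideal.Quotient.eq_zero_iff_mem, hI', Submodule.mem_sup] at hx'
    obtain ⟨_, h1, z, hz, rfl⟩ := hx'
    obtain ⟨y, rfl⟩ := Ideal.mem_span_singleton'.1 h1
    refine ⟨Ideal.Quotient.mk I y, ?_⟩
    change Ideal.Quotient.mk I (y * g + z) = Ideal.Quotient.mk I (g * y)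
    rw [Ideal.Quotient.eq]
    convert! hz using 1
    ring
  · intro (x : A ⧸ I')
    obtain ⟨x, rfl⟩ := Ideal.Quotient.mk_surjective x
    change Ideal.Quotient.mk I' (g * x) = 0
    rw [Ideal.Quotient.eq_zero_iff_mem]
    exact Ideal.mul_mem_right _ _ hgI

open Classical in
/-- The elements of the Koszul complex with index in `S` can be traded for the quotient by them. -/
lemma sim_kos_filter {S : Set J} (hf : RegularOn f S) (L : List J) (hL : L.Nodup) (T : Set J)
    (hTS : T ⊆ S) (hT : ∀ j ∈ L, j ∉ T) :
    Sim (kos f c L (deg0O (1 : A ⧸ Ideal.span (f '' T))))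
      (kos f c (L.filter (· ∉ S))
        (deg0O (1 : A ⧸ Ideal.span (f '' (T ∪ {j | j ∈ L ∧ j ∈ S}))))) := by
  induction L generalizing T with
  | nil =>
    have e : T ∪ {j | j ∈ ([] : List J) ∧ j ∈ S} = T := by simp
    rw [e]
    exact .refl _
  | cons j L ih =>
    rw [List.nodup_cons] at hL
    by_cases hj : j ∈ S
    -- An outermost cone with `j ∈ S` is the cone of an injective multiplication, since `f j` is a
    -- nonzerodivisor modulo the elements that have already been eliminated.
    · have e : T ∪ {i | i ∈ j :: L ∧ i ∈ S} = (T ∪ {j}) ∪ {i | i ∈ L ∧ i ∈ S} := by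
        ext i
        by_cases hi : i = j <;> simp [hi, hj]
      rw [e, List.filter_cons_of_neg (by simpa using hj)]
      obtain ⟨a, ha⟩ := reduction_quotient (ι := ι) (hf j hj T hTS (hT j (by simp)))
        (I' := Ideal.span (f '' (T ∪ {j}))) (by
          rw [Set.image_union, Ideal.span_union, Set.image_singleton, sup_comm])
      obtain ⟨b, hb⟩ := ha.kos (f := f) c L
      refine (hb.sim fun i ↦ c i j).trans (ih hL.2 _
        (Set.union_subset hTS (Set.singleton_subset_iff.2 hj)) fun i hi hiT ↦ ?_)
      obtain hiT | rfl := hiT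
      · exact hT i (by simp [hi]) hiT
      · exact hL.1 hi
    · have e : T ∪ {i | i ∈ j :: L ∧ i ∈ S} = T ∪ {i | i ∈ L ∧ i ∈ S} := by
        ext i
        by_cases hi : i = j <;> simp [hi, hj]
      rw [e, List.filter_cons_of_pos (by simpa using hj)]
      exact (ih hL.2 T hTS fun i hi ↦ hT i (by simp [hi])).cone _ _

lemma sim_deg0_quotient :
    Sim (A := A) (ι := ι) (deg0O (1 : A)) (deg0O (1 : A ⧸ (⊥ : Ideal A))) := by
  refine ⟨Submodule.mkQ (⊥ : Ideal A), ⟨fun x ↦ ?_, fun _ ↦ rfl, 0, ?_⟩,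
    ⟨?_, ?_⟩, fun i ↦ ⟨0, fun _ ↦ ?_, fun t ↦ ?_⟩⟩
  · exact map_zero _
  · exact (add_zero _).symm
  · intro (x : A) _ y (hx : Ideal.Quotient.mk ⊥ x = 0)
    rw [Ideal.Quotient.eq_zero_iff_mem] at hx
    exact ⟨(0 : A), hx⟩
  · intro (y : A ⧸ (⊥ : Ideal A)) _
    obtain ⟨y, rfl⟩ := Ideal.Quotient.mk_surjective y
    exact ⟨y, (0 : A ⧸ (⊥ : Ideal A)), rfl, (add_zero _).symm⟩
  · rfl
  · change Ideal.Quotient.mk (⊥ : Ideal A) 0 - 0 = 0 - 0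
    rw [map_zero]

open Classical in
lemma sim_kos_quotient {S : Set J} (hf : RegularOn f S) (L : List J) (hL : L.Nodup) {I : Ideal A}
    (hI : I = Ideal.span (f '' {j | j ∈ L ∧ j ∈ S})) :
    Sim (kos f c L (deg0O (1 : A))) (kos f c (L.filter (· ∉ S)) (deg0O (1 : A ⧸ I))) := by
  have h := sim_kos_filter c hf L hL ∅ (Set.empty_subset S) (by simp)
  rw [Set.empty_union, ← hI, Set.image_empty, Ideal.span_empty] at h
  exact (sim_deg0_quotient.kos f c L).trans h

end ODG

end Elimination

section Exterior

variable {A B : Type u} [CommRing A] [CommRing B] {ι : Type u}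

namespace ODG

open DG

/-! #### Koszul complexes with zero differential and exterior algebras -/

variable {σ : A →+* B} {V : Type u} [AddCommGroup V] [Module B V] {J : Type u} {f : J → A}
  (c : ι → J → A) (e : J → V) (δ : J → Module.Dual B V)

/-- The vector with coefficients `σ (c i j)`, for `j` in the list `L`. -/
def vec (σ : A →+* B) (L : List J) (i : ι) : V := (L.map fun j ↦ σ (c i j) • e j).sum

variable {c e} in
/-- A realization of a differential module with operators in the exterior algebra of a module with
a family of vectors `e j` and dual coordinates `δ j`, such that the operators become the
multiplications with vectors. -/
structure Realization (L : List J) (C : ODG A ι) (r : C.X →ₛₗ[σ] ExteriorAlgebra B V) : Prop where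
  d_zero (x : C.X) : C.d x = 0
  one : r C.one = 1
  inj (x : C.X) : r x = 0 → x = 0
  op (i : ι) (x : C.X) : r (C.op i x) = ExteriorAlgebra.ι B (vec c e σ L i) * r x
  contract (j : J) (h : ∀ j' ∈ L, δ j (e j') = 0) (x : C.X) :
    CliffordAlgebra.contractLeft (δ j) (r x) = 0
  mem (W : Submodule B (ExteriorAlgebra B V)) (h1 : 1 ∈ W)
    (h : ∀ j ∈ L, ∀ w ∈ W, ExteriorAlgebra.ι B (e j) * w ∈ W) (x : C.X) : r x ∈ W

/-- The extension of a realization to the cone of a multiplication by zero. -/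
def coneReal {C : DG A} {f : A} (v : V) (r : C.X →ₛₗ[σ] ExteriorAlgebra B V) :
    (DG.cone f C).X →ₛₗ[σ] ExteriorAlgebra B V where
  toFun t := r t.1 + ExteriorAlgebra.ι B v * r t.2
  map_add' t t' := by
    change r (t.1 + t'.1) + ExteriorAlgebra.ι B v * r (t.2 + t'.2) = _
    rw [map_add, map_add, mul_add]
    abel
  map_smul' a t := by
    change r (a • t.1) + ExteriorAlgebra.ι B v * r (a • t.2) = _
    rw [map_smulₛₗ, map_smulₛₗ, mul_smul_comm, smul_add]

lemma coneReal_pr {C : DG A} {f : A} (v : V) (r : C.X →ₛₗ[σ] ExteriorAlgebra B V) (x y : C.X) :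
    coneReal v r (pr x y : (DG.cone f C).X) = r x + ExteriorAlgebra.ι B v * r y := rfl

lemma Realization.cone {L : List J} {C : ODG A ι} {r : C.X →ₛₗ[σ] ExteriorAlgebra B V}
    (h : Realization (c := c) (e := e) δ L C r) (j : J) (hj : δ j (e j) = 1)
    (hL : ∀ j' ∈ L, δ j (e j') = 0) (g : A) (hg : σ g = 0) :
    Realization (c := c) (e := e) δ (j :: L) (coneO g (fun i ↦ c i j) C) (coneReal (e j) r) := by
  have hgx (x : C.X) : g • x = 0 := h.inj _ (by rw [map_smulₛₗ, hg, zero_smul])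
  have hδ (x y : C.X) : CliffordAlgebra.contractLeft (δ j)
      (r x + ExteriorAlgebra.ι B (e j) * r y) = r y := by
    rw [map_add, h.contract j hL x, zero_add]
    refine (CliffordAlgebra.contractLeft_ι_mul (Q := 0) (δ j) (e j) (r y)).trans ?_
    rw [h.contract j hL y, hj, one_smul, mul_zero, sub_zero]
  refine ⟨fun t ↦ ?_, ?_, fun t ht ↦ ?_, fun i t ↦ ?_, fun j' hj' t ↦ ?_, fun W h1 hW t ↦ ?_⟩
  · obtain ⟨x, y, rfl⟩ := exists_pr t
    rw [cone_d, h.d_zero, h.d_zero, hgx, add_zero, neg_zero, pr_zero]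
  · rw [cone_one, coneReal_pr, h.one, map_zero, mul_zero, add_zero]
  · obtain ⟨x, y, rfl⟩ := exists_pr t
    rw [coneReal_pr] at ht
    have hy := hδ x y
    rw [ht, map_zero] at hy
    obtain rfl := h.inj y hy.symm
    rw [map_zero, mul_zero, add_zero] at ht
    rw [h.inj x ht, pr_zero]
  · obtain ⟨x, y, rfl⟩ := exists_pr t
    have hv : vec c e σ (j :: L) i = σ (c i j) • e j + vec c e σ L i := rfl
    rw [coneOp_pr, coneReal_pr, coneReal_pr, map_sub, map_smulₛₗ, h.op, h.op, hv, map_add, map_smul,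
      mul_add, add_mul, add_mul, mul_sub, smul_mul_assoc, smul_mul_assoc, mul_smul_comm,
      ← mul_assoc, ← mul_assoc, ← mul_assoc, ExteriorAlgebra.ι_sq_zero, zero_mul,
      smul_zero, zero_add,
      eq_neg_of_add_eq_zero_left (ExteriorAlgebra.ι_add_mul_swap (e j) (vec c e σ L i)), neg_mul]
    abel
  · obtain ⟨x, y, rfl⟩ := exists_pr t
    have hj'' : ∀ i ∈ L, δ j' (e i) = 0 := fun i hi ↦ hj' i (by simp [hi])
    rw [coneReal_pr, map_add, h.contract j' hj'' x, zero_add]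
    refine (CliffordAlgebra.contractLeft_ι_mul (Q := 0) (δ j') (e j) (r y)).trans ?_
    rw [h.contract j' hj'' y, hj' j (by simp), zero_smul, mul_zero, sub_zero]
  · obtain ⟨x, y, rfl⟩ := exists_pr t
    have hm := h.mem W h1 fun i hi ↦ hW i (by simp [hi])
    rw [coneReal_pr]
    exact add_mem (hm x) (hW j (by simp) _ (hm y))

lemma realization_quotient (hσ : Function.Surjective σ) {I : Ideal A} (hI : RingHom.ker σ = I) :
    ∃ r : (deg0O (A := A) (ι := ι) (1 : A ⧸ I)).X →ₛₗ[σ] ExteriorAlgebra B V,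
      Realization (c := c) (e := e) δ [] (deg0O (A := A) (ι := ι) (1 : A ⧸ I)) r := by
  subst hI
  let g : A ⧸ RingHom.ker σ →+* ExteriorAlgebra B V :=
    (algebraMap B (ExteriorAlgebra B V)).comp (RingHom.kerLift σ)
  let r : (A ⧸ RingHom.ker σ) →ₛₗ[σ] ExteriorAlgebra B V :=
    { toFun := g
      map_add' := map_add g
      map_smul' := fun a x ↦ by
        obtain ⟨x, rfl⟩ := Ideal.Quotient.mk_surjective x
        change algebraMap B _ (σ (a * x)) = σ a • algebraMap B _ (σ x)
        rw [map_mul, map_mul, Algebra.smul_def] }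
  have hr (a : A) : r (Ideal.Quotient.mk _ a) = algebraMap B _ (σ a) := rfl
  refine ⟨r, ⟨fun _ ↦ rfl, ?_, ?_, ?_, ?_, ?_⟩⟩
  · exact map_one g
  · intro (x : A ⧸ RingHom.ker σ) hx
    obtain ⟨x, rfl⟩ := Ideal.Quotient.mk_surjective x
    have := (ExteriorAlgebra.algebraMap_leftInverse V).injective
      ((hr x).symm.trans (hx.trans (map_zero _).symm))
    exact Ideal.Quotient.eq_zero_iff_mem.2 this
  · intro i x
    have : vec c e σ [] i = 0 := rfl
    rw [this, map_zero, zero_mul]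
    exact map_zero r
  · intro j _ (x : A ⧸ RingHom.ker σ)
    obtain ⟨x, rfl⟩ := Ideal.Quotient.mk_surjective x
    exact CliffordAlgebra.contractLeft_algebraMap _ _ _
  · intro W h1 _ (x : A ⧸ RingHom.ker σ)
    obtain ⟨x, rfl⟩ := Ideal.Quotient.mk_surjective x
    have : r (Ideal.Quotient.mk _ x) = σ x • (1 : ExteriorAlgebra B V) := by
      rw [hr, Algebra.algebraMap_eq_smul_one]
    exact this ▸ Submodule.smul_mem _ _ h1

/-- The Koszul complex over `A ⧸ I` of elements of `I` has zero differential and embeds into the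
exterior algebra. -/
lemma realization_kos (hσ : Function.Surjective σ) {I : Ideal A} (hI : RingHom.ker σ = I)
    (L : List J) (hL : L.Nodup) (hf : ∀ j ∈ L, f j ∈ I) (hδ : ∀ j ∈ L, δ j (e j) = 1)
    (hδ' : ∀ j ∈ L, ∀ j' ∈ L, j ≠ j' → δ j (e j') = 0) :
    ∃ r : (kos f c L (deg0O (1 : A ⧸ I))).X →ₛₗ[σ] ExteriorAlgebra B V,
      Realization (c := c) (e := e) δ L (kos f c L (deg0O (1 : A ⧸ I))) r := by
  induction L with
  | nil => exact realization_quotient c e δ hσ hI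
  | cons j L ih =>
    rw [List.nodup_cons] at hL
    obtain ⟨r, hr⟩ := ih hL.2 (fun i hi ↦ hf i (by simp [hi])) (fun i hi ↦ hδ i (by simp [hi]))
      (fun i hi i' hi' ↦ hδ' i (by simp [hi]) i' (by simp [hi']))
    have hfj : σ (f j) = 0 := by
      have := hf j (by simp)
      rwa [← hI] at this
    exact ⟨_, hr.cone c e δ j (hδ j (by simp))
      (fun i hi ↦ hδ' j (by simp) i (by simp [hi]) (by rintro rfl; exact hL.1 hi)) _ hfj⟩

lemma Realization.word {L : List J} {C : ODG A ι} {r : C.X →ₛₗ[σ] ExteriorAlgebra B V}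
    (h : Realization (c := c) (e := e) δ L C r) (l : List ι) :
    r (C.word (l.map C.op)) = (l.map fun i ↦ ExteriorAlgebra.ι B (vec c e σ L i)).prod := by
  induction l with
  | nil => exact h.one
  | cons i l ih => exact (h.op i _).trans (congrArg _ ih)

/-- The combination of words in the operators given by a formal combination of lists. -/
def wordComb (C : ODG A ι) (x : List ι →₀ A) : C.X :=
  Finsupp.linearCombination A (fun l ↦ C.word (l.map C.op)) x

variable (σ) in
/-- The combination of products of vectors given by a formal combination of lists. -/
def prodComb (v : ι → V) (x : List ι →₀ A) : ExteriorAlgebra B V :=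
  x.sum fun l a ↦ σ a • (l.map fun i ↦ ExteriorAlgebra.ι B (v i)).prod

lemma Realization.wordComb {L : List J} {C : ODG A ι} {r : C.X →ₛₗ[σ] ExteriorAlgebra B V}
    (h : Realization (c := c) (e := e) δ L C r) (x : List ι →₀ A) :
    r (C.wordComb x) = prodComb σ (vec c e σ L) x := by
  rw [ODG.wordComb, Finsupp.linearCombination_apply, Finsupp.sum, map_sum, prodComb, Finsupp.sum]
  exact Finset.sum_congr rfl fun l _ ↦ by rw [map_smulₛₗ, h.word]

/-- If every vector `e j` is one of the vectors of the operators, then every element of the image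
of a realization is a combination of words. -/
lemma Realization.exists_wordComb (hσ : Function.Surjective σ) {L : List J} {C : ODG A ι}
    {r : C.X →ₛₗ[σ] ExteriorAlgebra B V} (h : Realization (c := c) (e := e) δ L C r)
    (hv : ∀ j ∈ L, ∃ i, vec c e σ L i = e j) (y : C.X) : ∃ x, y = C.wordComb x := by
  let g := Finsupp.linearCombination A fun l : List ι ↦ C.word (l.map C.op)
  have hg (x : List ι →₀ A) : C.wordComb x = g x := rfl
  -- The images of the combinations of words contain `1` and are stable under the multiplication by
  -- all `e j`, hence exhaust the image of the realization.
  let W : Submodule B (ExteriorAlgebra B V) :=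
    { carrier := {w | ∃ x, w = r (C.wordComb x)}
      add_mem' := by
        rintro _ _ ⟨x, rfl⟩ ⟨y, rfl⟩
        exact ⟨x + y, by rw [hg, hg, hg, map_add, map_add]⟩
      zero_mem' := ⟨0, by rw [hg, map_zero, map_zero]⟩
      smul_mem' := by
        rintro b _ ⟨x, rfl⟩
        obtain ⟨a, rfl⟩ := hσ b
        exact ⟨a • x, by rw [hg, hg, map_smul, map_smulₛₗ]⟩ }
  obtain ⟨x, hx⟩ := h.mem W ⟨Finsupp.single [] 1, by
      rw [ODG.wordComb, Finsupp.linearCombination_single, one_smul]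
      exact h.one.symm⟩ (by
      rintro j hj _ ⟨x, rfl⟩
      obtain ⟨i, hi⟩ := hv j hj
      refine ⟨x.mapDomain fun l ↦ i :: l, ?_⟩
      rw [← hi, ← h.op, ODG.wordComb, ODG.wordComb, Finsupp.linearCombination_mapDomain,
        Finsupp.linearCombination_apply, Finsupp.linearCombination_apply, Finsupp.sum, Finsupp.sum,
        map_sum]
      congr 1
      exact Finset.sum_congr rfl fun l _ ↦ map_smul _ _ _) y
  exact ⟨x, sub_eq_zero.1 (h.inj _ (by rw [map_sub, hx, sub_self]))⟩

open Classical in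
/-- The homology of a differential module with operators that is equivalent to the Koszul complex
of a regular family, a part `S` of which generates the same ideal: it is generated by the words in
the operators, and the relations between the words are those between the corresponding products of
vectors in an exterior algebra. -/
theorem wordComb_spec {S : Set J} (hf : RegularOn f S) (L : List J) (hL : L.Nodup) {T : ODG A ι}
    (hT : Sim T (kos f c L (deg0O (1 : A)))) (hTw : ∀ i, T.w i = 0)
    (hσ : Function.Surjective σ)
    (hI : RingHom.ker σ = Ideal.span (f '' {j | j ∈ L ∧ j ∈ S}))
    (hfI : ∀ j ∈ L, σ (f j) = 0)
    (hδ : ∀ j ∈ L, j ∉ S → δ j (e j) = 1)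
    (hδ' : ∀ j ∈ L, j ∉ S → ∀ j' ∈ L, j' ∉ S → j ≠ j' → δ j (e j') = 0) (v : ι → V)
    (hv : ∀ i, v i = vec c e σ (L.filter (· ∉ S)) i)
    (hve : ∀ j ∈ L, j ∉ S → ∃ i, v i = e j) :
    (∀ x : List ι →₀ A, (∃ y, T.wordComb x = T.d y) ↔ prodComb σ v x = 0) ∧
      ∀ t, T.d t = 0 → ∃ x y, t = T.wordComb x + T.d y := by
  obtain rfl : v = vec c e σ (L.filter (· ∉ S)) := funext hv
  -- All elements of the complex `K` on the superfluous elements act by zero on `A ⧸ I`, so that `K`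
  -- is its own homology, an exterior algebra.
  let K := kos f c (L.filter (· ∉ S)) (deg0O (1 : A ⧸ Ideal.span (f '' {j | j ∈ L ∧ j ∈ S})))
  obtain ⟨a, ha, qa, ia⟩ : Sim T K := hT.trans (sim_kos_quotient c hf L hL rfl)
  have hm (j : J) : j ∈ L.filter (· ∉ S) ↔ j ∈ L ∧ j ∉ S := by simp
  obtain ⟨r, hr⟩ : ∃ r : K.X →ₛₗ[σ] ExteriorAlgebra B V,
      Realization (c := c) (e := e) δ (L.filter (· ∉ S)) K r :=
    realization_kos (f := f) c e δ hσ hI (L.filter (· ∉ S)) (hL.filter _)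
    (fun j hj ↦ by rw [← hI]; exact hfI j ((hm j).1 hj).1)
    (fun j hj ↦ hδ j ((hm j).1 hj).1 ((hm j).1 hj).2)
    (fun j hj j' hj' ↦ hδ' j ((hm j).1 hj).1 ((hm j).1 hj).2 j' ((hm j').1 hj').1 ((hm j').1 hj').2)
  have hTi (i : ι) : T.IsHtpy 0 (T.op i) := by rw [← hTw i]; exact T.isHtpy i
  have hKi (i : ι) : K.IsHtpy 0 (K.op i) := by
    refine ⟨fun x ↦ ?_, (K.isHtpy i).ε_comm, (K.isHtpy i).gr⟩
    rw [hr.d_zero, hr.d_zero, map_zero, zero_smul, add_zero]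
  have haw (l : List ι) : a (T.word (l.map T.op)) = K.word (l.map K.op) := by
    obtain ⟨y, hy⟩ := ha.word T.op K.op l (fun i _ ↦ hTi i) (fun i _ ↦ hKi i) (fun i _ ↦ ia i)
    rw [hy, hr.d_zero, add_zero]
  have haw' (x : List ι →₀ A) : a (T.wordComb x) = K.wordComb x := by
    rw [wordComb, wordComb, Finsupp.linearCombination_apply, Finsupp.linearCombination_apply,
      Finsupp.sum, Finsupp.sum, map_sum]
    exact Finset.sum_congr rfl fun l _ ↦ by rw [map_smul, haw]
  have hc (x : List ι →₀ A) : T.d (T.wordComb x) = 0 := by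
    rw [wordComb, Finsupp.linearCombination_apply, Finsupp.sum, map_sum]
    refine Finset.sum_eq_zero fun l _ ↦ ?_
    rw [map_smul, T.d_word, smul_zero]
    intro g hg
    obtain ⟨i, -, rfl⟩ := List.mem_map.1 hg
    exact hTi i
  refine ⟨fun x ↦ ⟨?_, fun h ↦ ?_⟩, fun t ht ↦ ?_⟩
  · rintro ⟨y, hy⟩
    rw [← hr.wordComb c e δ, ← haw', hy, ha.d_comm, hr.d_zero, map_zero]
  · refine qa.inj _ (hc x) 0 ?_
    rw [haw', map_zero]
    exact hr.inj _ (by rw [hr.wordComb c e δ, h])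
  · obtain ⟨x, hx⟩ := hr.exists_wordComb c e δ hσ
      (fun j hj ↦ hve j ((hm j).1 hj).1 ((hm j).1 hj).2) (a t)
    obtain ⟨y, hy⟩ := qa.inj (t - T.wordComb x) (by rw [map_sub, ht, hc, sub_zero]) 0 (by
      rw [map_sub, haw', hx, sub_self, map_zero])
    exact ⟨x, y, by rw [← hy, add_sub_cancel]⟩

end ODG

end Exterior

section Evaluation

open TensorProduct

variable {C : Type u} [SmallCategory C] {R : Cᵒᵖ ⥤ CommRingCat.{u}}

/-! ### Evaluation of the multitor complex -/

/-- The sections of a presheaf of modules over an object, as a module over the commutative ring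
of sections of `R`. -/
def Sec (F : PMod R) (U : Cᵒᵖ) : Type u := F.obj U

instance (F : PMod R) (U : Cᵒᵖ) : AddCommGroup (Sec F U) := inferInstanceAs (AddCommGroup (F.obj U))

instance (F : PMod R) (U : Cᵒᵖ) : Module (R.obj U) (Sec F U) :=
  inferInstanceAs (Module (R.obj U) (F.obj U))

/-- The action of a morphism on sections. -/
def secMap {F G : PMod R} (φ : F ⟶ G) (U : Cᵒᵖ) : Sec F U →ₗ[R.obj U] Sec G U := (φ.app U).hom

/-- The restriction of sections. -/
def secRes (F : PMod R) {U V : Cᵒᵖ} (f : U ⟶ V) : Sec F U →ₛₗ[(R.map f).hom] Sec F V where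
  toFun m := F.map f m
  map_add' := map_add (F.map f).hom
  map_smul' r m := F.map_smul f r m

/-- The sections of a tensor product. -/
def secTensor (F G : PMod R) (U : Cᵒᵖ) :
    Sec F U ⊗[R.obj U] Sec G U ≃ₗ[R.obj U] Sec (F ⊗ G) U := LinearEquiv.refl _ _

section

variable {F G H : PMod R} (U : Cᵒᵖ)

lemma secMap_comp (φ : F ⟶ G) (ψ : G ⟶ H) (x : Sec F U) :
    secMap (φ ≫ ψ) U x = secMap ψ U (secMap φ U x) := rfl

lemma secMap_id (x : Sec F U) : secMap (𝟙 F) U x = x := rfl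

lemma secMap_zero (x : Sec F U) : secMap (0 : F ⟶ G) U x = 0 := rfl

lemma secMap_add (φ ψ : F ⟶ G) (x : Sec F U) : secMap (φ + ψ) U x = secMap φ U x + secMap ψ U x :=
  rfl

lemma secMap_neg (φ : F ⟶ G) (x : Sec F U) : secMap (-φ) U x = -secMap φ U x := rfl

lemma secMap_neg_one_pow_smul (n : ℕ) (φ : F ⟶ G) (x : Sec F U) :
    secMap ((-1 : ℤˣ) ^ n • φ) U x = (-1 : R.obj U) ^ n • secMap φ U x := by
  obtain h | h := n.even_or_odd
  · rw [h.neg_one_pow, h.neg_one_pow, one_smul, one_smul]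
  · rw [h.neg_one_pow, h.neg_one_pow, Units.neg_smul, neg_smul, one_smul, one_smul, secMap_neg]

/-- Evaluation of morphisms at a section is additive. -/
def secEval (F G : PMod R) {U : Cᵒᵖ} (x : Sec F U) : (F ⟶ G) →+ Sec G U :=
  AddMonoidHom.mk' (fun φ ↦ secMap φ U x) fun φ ψ ↦ secMap_add U φ ψ x

lemma secMap_sum {α : Type*} (s : Finset α) (φ : α → (F ⟶ G)) (x : Sec F U) :
    secMap (∑ i ∈ s, φ i) U x = ∑ i ∈ s, secMap (φ i) U x := map_sum (secEval F G x) φ s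

lemma secMap_whiskerRight (φ : F ⟶ G) (x : Sec F U) (y : Sec H U) :
    secMap (φ ▷ H) U (secTensor F H U (x ⊗ₜ y)) = secTensor G H U (secMap φ U x ⊗ₜ y) := rfl

lemma secMap_whiskerLeft (φ : F ⟶ G) (x : Sec H U) (y : Sec F U) :
    secMap (H ◁ φ) U (secTensor H F U (x ⊗ₜ y)) = secTensor H G U (x ⊗ₜ secMap φ U y) := rfl

variable {U}

lemma secRes_secMap {V : Cᵒᵖ} (f : U ⟶ V) (φ : F ⟶ G) (x : Sec F U) :
    secRes G f (secMap φ U x) = secMap φ V (secRes F f x) :=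
  (PresheafOfModules.naturality_apply φ f x).symm

lemma secRes_secTensor {V : Cᵒᵖ} (f : U ⟶ V) (x : Sec F U) (y : Sec G U) :
    secRes (F ⊗ G) f (secTensor F G U (x ⊗ₜ y)) =
      secTensor F G V (secRes F f x ⊗ₜ secRes G f y) := rfl

end

/-! #### Total modules of complexes of presheaves -/

open DG

lemma secMap_d_d (K : ChainComplex (PMod R) ℕ) (U : Cᵒᵖ) (n : ℕ) (x : Sec (K.X (n + 2)) U) :
    secMap (K.d (n + 1) n) U (secMap (K.d (n + 2) (n + 1)) U x) = 0 := by
  rw [← secMap_comp, K.d_comp_d, secMap_zero]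

/-- The total module of the sections of a complex of presheaves of modules. -/
def totDG (K : ChainComplex (PMod R) ℕ) (U : Cᵒᵖ) (one : Sec (K.X 0) U) : DG (R.obj U) :=
  ofSeq (fun n ↦ Sec (K.X n) U) (fun n ↦ secMap (K.d (n + 1) n) U) (secMap_d_d K U) one

/-- The inclusion of the sections of a term of a complex in the total module. -/
def tof (K : ChainComplex (PMod R) ℕ) {U : Cᵒᵖ} (one : Sec (K.X 0) U) (n : ℕ) :
    Sec (K.X n) U →ₗ[R.obj U] (totDG K U one).X :=
  of (P := fun n ↦ Sec (K.X n) U) (dP := fun n ↦ secMap (K.d (n + 1) n) U) (hdP := secMap_d_d K U) n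

/-- The map out of a total module given by its restrictions to the terms. -/
def totDesc (K : ChainComplex (PMod R) ℕ) {U : Cᵒᵖ} (one : Sec (K.X 0) U) {A' : Type u}
    [CommRing A'] {σ : R.obj U →+* A'} {Y : Type u} [AddCommGroup Y] [Module A' Y]
    (φ : ∀ n, Sec (K.X n) U →ₛₗ[σ] Y) : (totDG K U one).X →ₛₗ[σ] Y :=
  ofSeqDesc (P := fun n ↦ Sec (K.X n) U) (dP := fun n ↦ secMap (K.d (n + 1) n) U)
    (hdP := secMap_d_d K U) φ

section

variable {K : ChainComplex (PMod R) ℕ} {U : Cᵒᵖ} {one : Sec (K.X 0) U}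

lemma totDesc_tof {A' : Type u} [CommRing A'] {σ : R.obj U →+* A'} {Y : Type u} [AddCommGroup Y]
    [Module A' Y] (φ : ∀ n, Sec (K.X n) U →ₛₗ[σ] Y) (n : ℕ) (x : Sec (K.X n) U) :
    totDesc K one φ (tof K one n x) = φ n x :=
  ofSeqDesc_of (P := fun n ↦ Sec (K.X n) U) (dP := fun n ↦ secMap (K.d (n + 1) n) U)
    (hdP := secMap_d_d K U) φ n x

lemma tot_d_zero (x : Sec (K.X 0) U) : (totDG K U one).d (tof K one 0 x) = 0 :=
  ofSeq_d_zero (P := fun n ↦ Sec (K.X n) U) (dP := fun n ↦ secMap (K.d (n + 1) n) U)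
    (hdP := secMap_d_d K U) x

lemma tot_d_succ (n : ℕ) (x : Sec (K.X (n + 1)) U) :
    (totDG K U one).d (tof K one (n + 1) x) = tof K one n (secMap (K.d (n + 1) n) U x) :=
  ofSeq_d_succ (P := fun n ↦ Sec (K.X n) U) (dP := fun n ↦ secMap (K.d (n + 1) n) U)
    (hdP := secMap_d_d K U) n x

lemma tot_ε (n : ℕ) (x : Sec (K.X n) U) :
    (totDG K U one).ε (tof K one n x) = (-1 : R.obj U) ^ n • tof K one n x :=
  ofSeq_ε (P := fun n ↦ Sec (K.X n) U) (dP := fun n ↦ secMap (K.d (n + 1) n) U)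
    (hdP := secMap_d_d K U) n x

lemma tof_mem (n : ℕ) (x : Sec (K.X n) U) : tof K one n x ∈ (totDG K U one).gr n := ⟨x, rfl⟩

lemma exists_tof (n : ℕ) (t : (totDG K U one).X) (ht : t ∈ (totDG K U one).gr n) :
    ∃ x, t = tof K one n x := by
  obtain ⟨x, rfl⟩ := ht
  exact ⟨x, rfl⟩

lemma tof_injective (n : ℕ) : Function.Injective (tof K one n) :=
  of_injective (P := fun n ↦ Sec (K.X n) U) (dP := fun n ↦ secMap (K.d (n + 1) n) U)
    (hdP := secMap_d_d K U) n

lemma tot_one : (totDG K U one).one = tof K one 0 one := rfl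

lemma tot_induction {p : (totDG K U one).X → Prop} (x : (totDG K U one).X)
    (h0 : p 0) (hof : ∀ n x, p (tof K one n x)) (hadd : ∀ x y, p x → p y → p (x + y)) : p x :=
  ofSeq_induction (P := fun n ↦ Sec (K.X n) U) (dP := fun n ↦ secMap (K.d (n + 1) n) U)
    (hdP := secMap_d_d K U) x h0 hof hadd

end

/-- The restriction map of total modules. -/
def totRes (K : ChainComplex (PMod R) ℕ) {U V : Cᵒᵖ} (f : U ⟶ V) (one : Sec (K.X 0) U)
    (one' : Sec (K.X 0) V) : (totDG K U one).X →ₛₗ[(R.map f).hom] (totDG K V one').X :=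
  totDesc K one fun n ↦ (tof K one' n).comp (secRes (K.X n) f)

lemma totRes_tof (K : ChainComplex (PMod R) ℕ) {U V : Cᵒᵖ} (f : U ⟶ V) (one : Sec (K.X 0) U)
    (one' : Sec (K.X 0) V) (n : ℕ) (x : Sec (K.X n) U) :
    totRes K f one one' (tof K one n x) = tof K one' n (secRes (K.X n) f x) :=
  totDesc_tof _ n x

section Tensor

variable (K L : ChainComplex (PMod R) ℕ) (U : Cᵒᵖ) (one : Sec (K.X 0) U)

/-- The tensor product of two complexes. -/
def tensorCx : ChainComplex (PMod R) ℕ := HomologicalComplex.tensorObj K L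

/-- The inclusion of a summand of a tensor product of complexes. -/
def tensorι (p q n : ℕ) (h : p + q = n) :
    K.X p ⊗ L.X q ⟶ (tensorCx K L).X n :=
  HomologicalComplex.ιTensorObj K L p q n h

/-- The projection to a summand of a tensor product of complexes. -/
def tensorπ (p q n : ℕ) : (tensorCx K L).X n ⟶ K.X p ⊗ L.X q :=
  HomologicalComplex.mapBifunctorDesc fun p' q' _ ↦
    if h : p' = p ∧ q' = q then eqToHom (by rw [h.1, h.2]; rfl) else 0

lemma tensorι_tensorπ_self (p q n : ℕ) (h : p + q = n) :
    tensorι K L p q n h ≫ tensorπ K L p q n = 𝟙 _ := by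
  rw [tensorπ]
  refine (HomologicalComplex.ι_mapBifunctorDesc _ _ _ _).trans ?_
  rw [dif_pos ⟨rfl, rfl⟩]
  rfl

lemma tensorι_tensorπ_ne (p q n : ℕ) (h : p + q = n) (p' q' : ℕ) (hne : ¬(p = p' ∧ q = q')) :
    tensorι K L p q n h ≫ tensorπ K L p' q' n = 0 := by
  rw [tensorπ]
  refine (HomologicalComplex.ι_mapBifunctorDesc _ _ _ _).trans ?_
  rw [dif_neg hne]

lemma tensor_hom_ext {n : ℕ} {F : PMod R} {f g : (tensorCx K L).X n ⟶ F}
    (h : ∀ p q h, tensorι K L p q n h ≫ f = tensorι K L p q n h ≫ g) : f = g :=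
  HomologicalComplex.mapBifunctor.hom_ext h

lemma sum_tensorπ_tensorι (n : ℕ) :
    ∑ x ∈ (Finset.HasAntidiagonal.antidiagonal n).attach, tensorπ K L x.1.1 x.1.2 n ≫
      tensorι K L x.1.1 x.1.2 n (Finset.HasAntidiagonal.mem_antidiagonal.1 x.2) = 𝟙 _ := by
  refine tensor_hom_ext K L fun p q h ↦ ?_
  rw [Preadditive.comp_sum, Category.comp_id]
  have hm : (p, q) ∈ Finset.HasAntidiagonal.antidiagonal n :=
    Finset.HasAntidiagonal.mem_antidiagonal.2 h
  rw [Finset.sum_eq_single_of_mem ⟨(p, q), hm⟩ (Finset.mem_attach _ _)]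
  · rw [← Category.assoc, tensorι_tensorπ_self, Category.id_comp]
  · rintro ⟨⟨p', q'⟩, h'⟩ - hne
    rw [← Category.assoc, tensorι_tensorπ_ne K L p q n h p' q'
      (by rintro ⟨rfl, rfl⟩; exact hne rfl),
      zero_comp]

lemma tensorι_d_succ_succ (p q n : ℕ) (h : p + 1 + (q + 1) = n + 1) :
    tensorι K L (p + 1) (q + 1) (n + 1) h ≫ (tensorCx K L).d (n + 1) n =
      (K.d (p + 1) p ▷ L.X (q + 1)) ≫ tensorι K L p (q + 1) n (by omega) +
        (-1 : ℤˣ) ^ (p + 1) •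
          ((K.X (p + 1) ◁ L.d (q + 1) q) ≫ tensorι K L (p + 1) q n (by omega)) := by
  have key : HomologicalComplex.ιTensorObj K L (p + 1) (q + 1) (n + 1) h ≫
      (HomologicalComplex.tensorObj K L).d (n + 1) n =
        (K.d (p + 1) p ▷ L.X (q + 1)) ≫ HomologicalComplex.ιTensorObj K L p (q + 1) n (by omega) +
          (-1 : ℤˣ) ^ (p + 1) • ((K.X (p + 1) ◁ L.d (q + 1) q) ≫
            HomologicalComplex.ιTensorObj K L (p + 1) q n (by omega)) := by
    rw [HomologicalComplex.mapBifunctor.d_eq, Preadditive.comp_add,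
      HomologicalComplex.mapBifunctor.ι_D₁, HomologicalComplex.mapBifunctor.ι_D₂,
      HomologicalComplex.mapBifunctor.d₁_eq _ _ _ _
        (show (ComplexShape.down ℕ).Rel (p + 1) p from rfl)
        _ _ (show p + (q + 1) = n by omega),
      HomologicalComplex.mapBifunctor.d₂_eq _ _ _ _ _
        (show (ComplexShape.down ℕ).Rel (q + 1) q from rfl) _ (show p + 1 + q = n by omega)]
    congr 1
    exact one_smul _ _
  exact key

lemma tensorι_d_succ_zero (p n : ℕ) (h : p + 1 + 0 = n + 1) :
    tensorι K L (p + 1) 0 (n + 1) h ≫ (tensorCx K L).d (n + 1) n =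
      (K.d (p + 1) p ▷ L.X 0) ≫ tensorι K L p 0 n (by omega) := by
  have key : HomologicalComplex.ιTensorObj K L (p + 1) 0 (n + 1) h ≫
      (HomologicalComplex.tensorObj K L).d (n + 1) n =
        (K.d (p + 1) p ▷ L.X 0) ≫ HomologicalComplex.ιTensorObj K L p 0 n (by omega) := by
    rw [HomologicalComplex.mapBifunctor.d_eq, Preadditive.comp_add,
      HomologicalComplex.mapBifunctor.ι_D₁, HomologicalComplex.mapBifunctor.ι_D₂,
      HomologicalComplex.mapBifunctor.d₁_eq _ _ _ _
        (show (ComplexShape.down ℕ).Rel (p + 1) p from rfl)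
        _ _ (show p + 0 = n by omega),
      HomologicalComplex.mapBifunctor.d₂_eq_zero _ _ _ _ _ _ _ (by simp), add_zero]
    exact one_smul _ _
  exact key

lemma tensorι_d_zero_succ (q n : ℕ) (h : 0 + (q + 1) = n + 1) :
    tensorι K L 0 (q + 1) (n + 1) h ≫ (tensorCx K L).d (n + 1) n =
      (K.X 0 ◁ L.d (q + 1) q) ≫ tensorι K L 0 q n (by omega) := by
  have key : HomologicalComplex.ιTensorObj K L 0 (q + 1) (n + 1) h ≫
      (HomologicalComplex.tensorObj K L).d (n + 1) n =
        (K.X 0 ◁ L.d (q + 1) q) ≫ HomologicalComplex.ιTensorObj K L 0 q n (by omega) := by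
    rw [HomologicalComplex.mapBifunctor.d_eq, Preadditive.comp_add,
      HomologicalComplex.mapBifunctor.ι_D₁, HomologicalComplex.mapBifunctor.ι_D₂,
      HomologicalComplex.mapBifunctor.d₁_eq_zero _ _ _ _ _ _ _ (by simp),
      HomologicalComplex.mapBifunctor.d₂_eq _ _ _ _ _
        (show (ComplexShape.down ℕ).Rel (q + 1) q from rfl) _ (show 0 + q = n by omega), zero_add]
    exact one_smul _ _
  exact key

/-- The product of a section of a term of `K` and a section of a term of `L`, in the total module
of the tensor product. -/
def secProd (p q : ℕ) : Sec (K.X p) U →ₗ[R.obj U] Sec (L.X q) U →ₗ[R.obj U]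
    (totDG (tensorCx K L) U 0).X :=
  (TensorProduct.mk (R.obj U) (Sec (K.X p) U) (Sec (L.X q) U)).compr₂
    (tof (tensorCx K L) 0 (p + q) ∘ₗ secMap (tensorι K L p q (p + q) rfl) U ∘ₗ
      (secTensor (K.X p) (L.X q) U).toLinearMap)

lemma secProd_apply (p q n : ℕ) (h : p + q = n) (x : Sec (K.X p) U) (y : Sec (L.X q) U) :
    secProd K L U p q x y =
      tof (tensorCx K L) 0 n
        (secMap (tensorι K L p q n h) U (secTensor (K.X p) (L.X q) U (x ⊗ₜ y))) := by
  subst h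
  rfl

/-- The comparison map from the tensor product of total modules to the total module of the tensor
product. -/
def tensorTot : (tensor (totDG K U one) (totDG L U 0)).X →ₗ[R.obj U]
    (totDG (tensorCx K L) U 0).X :=
  TensorProduct.lift (totDesc K one fun p ↦ LinearMap.flip (totDesc L 0 fun q ↦
    LinearMap.flip (secProd K L U p q)))

lemma tensorTot_tm (p q : ℕ) (x : Sec (K.X p) U) (y : Sec (L.X q) U) :
    tensorTot K L U one (tm (tof K one p x) (tof L 0 q y)) =
      secProd K L U p q x y := by
  change totDesc K one (fun p ↦ LinearMap.flip (totDesc L 0 fun q ↦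
    LinearMap.flip (secProd K L U p q)))
    (tof K one p x) (tof L 0 q y) = _
  rw [totDesc_tof, LinearMap.flip_apply, totDesc_tof, LinearMap.flip_apply]

variable {K L U one} in
lemma tot_tensor_induction {P : (tensor (totDG K U one) (totDG L U 0)).X → Prop}
    (t : (tensor (totDG K U one) (totDG L U 0)).X) (h0 : P 0)
    (hmk : ∀ p q (x : Sec (K.X p) U) (y : Sec (L.X q) U),
      P (tm (tof K one p x) (tof L 0 q y)))
    (hadd : ∀ t t', P t → P t' → P (t + t')) : P t := by
  induction t using tensor_induction with
  | h0 => exact h0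
  | hmk x y =>
    induction x using tot_induction with
    | h0 => rw [map_zero]; exact h0
    | hof p x =>
      induction y using tot_induction with
      | h0 => rw [map_zero]; exact h0
      | hof q y => exact hmk p q x y
      | hadd y y' hy hy' => rw [map_add]; exact hadd _ _ hy hy'
    | hadd x x' hx hx' => rw [map_add]; exact hadd _ _ hx hx'
  | hadd t t' h h' => exact hadd _ _ h h'

lemma tensorTot_d (t : (tensor (totDG K U one) (totDG L U 0)).X) :
    tensorTot K L U one ((tensor (totDG K U one) (totDG L U 0)).d t) =
      (totDG (tensorCx K L) U 0).d (tensorTot K L U one t) := by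
  induction t using tot_tensor_induction with
  | h0 => simp only [map_zero]
  | hmk p q x y =>
    rw [tensor_d_tm, map_add, tensorTot_tm, tot_ε, map_smul, LinearMap.smul_apply, map_smul]
    obtain _ | p := p <;> obtain _ | q := q
    · rw [tot_d_zero, tot_d_zero, map_zero, map_zero, LinearMap.zero_apply, map_zero,
        smul_zero, add_zero, secProd_apply K L U 0 0 0 rfl, tot_d_zero]
    · rw [tot_d_zero, map_zero, LinearMap.zero_apply, map_zero, zero_add, tot_d_succ,
        tensorTot_tm, secProd_apply K L U 0 (q + 1) (q + 1) (by omega), tot_d_succ, ← secMap_comp,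
        tensorι_d_zero_succ, secMap_comp, secMap_whiskerLeft, pow_zero, one_smul,
        secProd_apply K L U 0 q q (by omega)]
    · rw [tot_d_zero, map_zero, map_zero, smul_zero, add_zero, tot_d_succ,
        tensorTot_tm, secProd_apply K L U (p + 1) 0 (p + 1) (by omega), tot_d_succ, ← secMap_comp,
        tensorι_d_succ_zero, secMap_comp, secMap_whiskerRight, secProd_apply K L U p 0 p (by omega)]
    · rw [tot_d_succ, tot_d_succ, tensorTot_tm, tensorTot_tm,
        secProd_apply K L U (p + 1) (q + 1) (p + q + 1 + 1) (by omega), tot_d_succ, ← secMap_comp,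
        tensorι_d_succ_succ, secMap_add, secMap_comp, secMap_whiskerRight, map_add,
        secProd_apply K L U p (q + 1) (p + q + 1) (by omega)]
      congr 1
      rw [secProd_apply K L U (p + 1) q (p + q + 1) (by omega)]
      rw [secMap_neg_one_pow_smul, secMap_comp, secMap_whiskerLeft, map_smul]
  | hadd t t' h h' => simp only [map_add, h, h']

/-- The inverse of the comparison map. -/
def totTensor : (totDG (tensorCx K L) U 0).X →ₗ[R.obj U]
    (tensor (totDG K U one) (totDG L U 0)).X :=
  totDesc (tensorCx K L) 0 fun n ↦ ∑ x ∈ Finset.HasAntidiagonal.antidiagonal n,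
    (TensorProduct.map (tof K one x.1)
      (tof L 0 x.2)) ∘ₗ
      (secTensor (K.X x.1) (L.X x.2) U).symm.toLinearMap ∘ₗ secMap (tensorπ K L x.1 x.2 n) U

lemma totTensor_of (n : ℕ) (z : Sec ((tensorCx K L).X n) U) :
    totTensor K L U one (tof (tensorCx K L) 0 n z) = ∑ x ∈ Finset.HasAntidiagonal.antidiagonal n,
      TensorProduct.map (tof K one x.1)
        (tof L 0 x.2)
        ((secTensor (K.X x.1) (L.X x.2) U).symm (secMap (tensorπ K L x.1 x.2 n) U z)) := by
  refine (totDesc_tof _ _ _).trans ?_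
  exact LinearMap.sum_apply _ _ _

lemma totTensor_tensorTot (t : (tensor (totDG K U one) (totDG L U 0)).X) :
    totTensor K L U one (tensorTot K L U one t) = t := by
  induction t using tot_tensor_induction with
  | h0 => simp only [map_zero]
  | hmk p q x y =>
    rw [tensorTot_tm, secProd_apply K L U p q _ rfl, totTensor_of,
      Finset.sum_eq_single_of_mem (p, q) (Finset.HasAntidiagonal.mem_antidiagonal.2 rfl)]
    · rw [← secMap_comp, tensorι_tensorπ_self, secMap_id, LinearEquiv.symm_apply_apply]
      rfl
    · rintro ⟨p', q'⟩ - hne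
      rw [← secMap_comp, tensorι_tensorπ_ne K L p q _ rfl p' q'
        (by rintro ⟨rfl, rfl⟩; exact hne rfl), secMap_zero, map_zero, map_zero]
  | hadd t t' h h' => simp only [map_add, h, h']

lemma tensorTot_map (p q n : ℕ) (h : p + q = n) (t : Sec (K.X p) U ⊗[R.obj U] Sec (L.X q) U) :
    tensorTot K L U one (TensorProduct.map (tof K one p)
        (tof L 0 q) t) =
      tof (tensorCx K L) 0 n (secMap (tensorι K L p q n h) U (secTensor (K.X p) (L.X q) U t)) := by
  induction t with
  | zero =>
    rw [map_zero]
    exact (map_zero (tensorTot K L U one)).trans (by simp only [map_zero])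
  | tmul x y =>
    rw [← secProd_apply]
    exact tensorTot_tm K L U one p q x y
  | add t t' ht ht' =>
    rw [map_add]
    exact (map_add (tensorTot K L U one) _ _).trans (by simp only [map_add, ht, ht'])

lemma tensorTot_totTensor (z : (totDG (tensorCx K L) U 0).X) :
    tensorTot K L U one (totTensor K L U one z) = z := by
  induction z using tot_induction with
  | h0 => simp only [map_zero]
  | hof n z =>
    rw [totTensor_of, ← Finset.sum_attach]
    refine (map_sum (tensorTot K L U one) _ _).trans ?_
    rw [Finset.sum_congr rfl fun x _ ↦ tensorTot_map K L U one x.1.1 x.1.2 n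
      (Finset.HasAntidiagonal.mem_antidiagonal.1 x.2) _]
    simp only [LinearEquiv.apply_symm_apply, ← secMap_comp]
    rw [← map_sum, ← secMap_sum, sum_tensorπ_tensorι, secMap_id]
  | hadd t t' h h' => simp only [map_add, h, h']

lemma tensorTot_gr (n : ℕ) (t) (ht : t ∈ (tensor (totDG K U one) (totDG L U 0)).gr n) :
    tensorTot K L U one t ∈ (totDG (tensorCx K L) U 0).gr n := by
  refine tensor_gr_induction (P := fun t ↦ tensorTot K L U one t ∈ DG.gr _ n) t ht ?_ ?_ ?_ ?_
  · rw [map_zero]; exact zero_mem _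
  · rintro p q h _ ⟨x, rfl⟩ _ ⟨y, rfl⟩
    change tensorTot K L U one (tm (tof K one p x) (tof L 0 q y)) ∈ _
    rw [tensorTot_tm, secProd_apply K L U p q n h]
    exact tof_mem _ _
  · intro t t' h h'; rw [map_add]; exact add_mem h h'
  · intro a t h; rw [map_smul]; exact Submodule.smul_mem _ _ h

lemma totRes_tensorTot {U V : Cᵒᵖ} (f : U ⟶ V) (one : Sec (K.X 0) U) (one' : Sec (K.X 0) V)
    (t : (tensor (totDG K U one) (totDG L U 0)).X) :
    totRes (tensorCx K L) f 0 0 (tensorTot K L U one t) =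
      tensorTot K L V one' (tmap (totRes K f one one') (totRes L f 0 0) t) := by
  induction t using tot_tensor_induction with
  | h0 => simp only [map_zero]
  | hmk p q x y =>
    rw [tmap_tm, totRes_tof, totRes_tof, tensorTot_tm, tensorTot_tm, secProd_apply K L U p q _ rfl,
      secProd_apply K L V p q _ rfl, totRes_tof, secRes_secMap, secRes_secTensor]
  | hadd t t' h h' => simp only [map_add, h, h']

end Tensor

end Evaluation

namespace ODG

open DG

/-! #### Morphisms of families -/

section Family

variable {A A' : Type u} [CommRing A] [CommRing A'] {σ : A →+* A'} {ι ι' : Type u}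

lemma isMor_deg0 : IsMor (X := deg0 (1 : A)) (Y := deg0 (1 : A'))
    (show A →ₛₗ[σ] A' from ⟨⟨σ, map_add σ⟩, fun a x ↦ map_mul σ a x⟩) where
  d_comm _ := map_zero σ
  ε_comm _ := rfl
  one := ⟨(0 : A'), (map_one σ).trans (add_zero (1 : A')).symm⟩

lemma tmap_id_d {X Y Y' : DG A} {b : Y.X →ₗ[A] Y'.X} (hb : ∀ y, b (Y.d y) = Y'.d (b y))
    (t : (DG.tensor X Y).X) :
    tmap LinearMap.id b ((DG.tensor X Y).d t) = (DG.tensor X Y').d (tmap LinearMap.id b t) := by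
  induction t using tensor_induction with
  | h0 => simp only [map_zero]
  | hmk x y =>
    rw [tensor_d_tm, map_add, tmap_tm, tmap_tm, tmap_tm, tensor_d_tm, hb]
    rfl
  | hadd t t' h h' => simp only [map_add, h, h']

lemma tmap_id_gr {X Y Y' : DG A} {b : Y.X →ₗ[A] Y'.X} (hb : ∀ n, ∀ y ∈ Y.gr n, b y ∈ Y'.gr n)
    (n : ℕ) (t) (ht : t ∈ (DG.tensor X Y).gr n) :
    tmap LinearMap.id b t ∈ (DG.tensor X Y').gr n := by
  refine tensor_gr_induction (P := fun t ↦ tmap LinearMap.id b t ∈ DG.gr _ n) t ht ?_ ?_ ?_ ?_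
  · rw [map_zero]; exact zero_mem _
  · intro p q h x hx y hy
    rw [tmap_tm]
    exact tm_mem h hx (hb _ _ hy)
  · intro t t' h h'; rw [map_add]; exact add_mem h h'
  · intro a t h; rw [map_smul]; exact Submodule.smul_mem _ _ h

lemma tmap_tmap_id {X Y Z : DG A} {X' Y' Z' : DG A'} {a : X.X →ₛₗ[σ] X'.X} {b : Y.X →ₗ[A] Z.X}
    {b' : Y'.X →ₗ[A'] Z'.X} {r : Z.X →ₛₗ[σ] Z'.X} {s : Y.X →ₛₗ[σ] Y'.X}
    (h : ∀ y, r (b y) = b' (s y)) (t : (DG.tensor X Y).X) :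
    tmap a r (tmap LinearMap.id b t) = tmap LinearMap.id b' (tmap a s t) := by
  induction t using tensor_induction with
  | h0 => simp only [map_zero]
  | hmk x y =>
    rw [tmap_tm, tmap_tm, tmap_tm, tmap_tm, h]
    rfl
  | hadd t t' h h' => simp only [map_add, h, h']

/-- The semilinear map of total tensor products induced by a family of semilinear maps. -/
def famMap : (l : ℕ) → {X : Fin l → ODG A ι} → {X' : Fin l → ODG A' ι'} →
    (∀ k, (X k).X →ₛₗ[σ] (X' k).X) → (tensorFamily l X).X →ₛₗ[σ] (tensorFamily l X').X
  | 0, _, _, _ => show A →ₛₗ[σ] A' from ⟨⟨σ, map_add σ⟩, fun a x ↦ map_mul σ a x⟩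
  | l + 1, _, _, a => tmap (a 0) (famMap l fun k ↦ a k.succ)

lemma isMor_famMap {l : ℕ} {X : Fin l → ODG A ι} {X' : Fin l → ODG A' ι'}
    {a : ∀ k, (X k).X →ₛₗ[σ] (X' k).X} (ha : ∀ k, IsMor (a k)) : IsMor (famMap l a) := by
  induction l with
  | zero => exact isMor_deg0
  | succ l ih => exact (ha 0).tensor (ih fun k ↦ ha k.succ)

lemma intertwines_famMap {l : ℕ} {X : Fin l → ODG A ι} {X' : Fin l → ODG A' ι'}
    {a : ∀ k, (X k).X →ₛₗ[σ] (X' k).X} (ha : ∀ k, IsMor (a k)) (i : ι) (i' : ι')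
    (h : ∀ k, Intertwines (a k) ((X k).op i) ((X' k).op i')) :
    Intertwines (famMap l a) ((tensorFamily l X).op i) ((tensorFamily l X').op i') := by
  induction l with
  | zero =>
    refine ⟨0, fun _ ↦ rfl, fun x ↦ ?_⟩
    exact (congrArg (· - (0 : A')) (map_zero σ)).trans rfl
  | succ l ih =>
    exact Intertwines.tensor (ha 0) (isMor_famMap fun k ↦ ha k.succ) (h 0)
      (ih (fun k ↦ ha k.succ) fun k ↦ h k.succ)

lemma tensorFamily_w {l : ℕ} (X : Fin l → ODG A ι) (i : ι) :
    (tensorFamily l X).w i = ∑ k, (X k).w i := by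
  induction l with
  | zero => rfl
  | succ l ih =>
    rw [Fin.sum_univ_succ, ← ih]
    rfl

end Family

end ODG

section Evaluation

open DG ODG

variable {C : Type u} [SmallCategory C] {R : Cᵒᵖ ⥤ CommRingCat.{u}}

/-! #### The total module of the multitor complex -/

/-- A base point and operators on the total module of the sections of a complex over an object. -/
structure SecOps (K : ChainComplex (PMod R) ℕ) (U : Cᵒᵖ) (ι : Type u) where
  one : Sec (K.X 0) U
  w : ι → R.obj U
  op : ι → (totDG K U one).X →ₗ[R.obj U] (totDG K U one).X
  isHtpy : ∀ i, (totDG K U one).IsHtpy (w i) (op i)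

/-- The differential module with operators of a complex. -/
abbrev SecOps.toODG {K : ChainComplex (PMod R) ℕ} {U : Cᵒᵖ} {ι : Type u} (X : SecOps K U ι) :
    ODG (R.obj U) ι where
  __ := totDG K U X.one
  w := X.w
  op := X.op
  isHtpy := X.isHtpy

/-- The complex with a single term in degree zero, the unit. -/
abbrev unitCx (R : Cᵒᵖ ⥤ CommRingCat.{u}) : ChainComplex (PMod R) ℕ :=
  HomologicalComplex.tensorUnit (PMod R) (ComplexShape.down ℕ)

/-- The map from the ring of sections to the total module of the unit complex. -/
def unitTot (U : Cᵒᵖ) : Sec (𝟙_ (PMod R)) U →ₗ[R.obj U] (totDG (unitCx R) U 0).X :=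
  tof (unitCx R) 0 0 ∘ₗ
    secMap (HomologicalComplex.singleObjXSelf (ComplexShape.down ℕ) 0 _).inv U

lemma unitTot_apply (U : Cᵒᵖ) (r : Sec (𝟙_ (PMod R)) U) :
    unitTot U r = tof (unitCx R) 0 0
      (secMap (HomologicalComplex.singleObjXSelf (ComplexShape.down ℕ) 0 _).inv
        U r) := rfl

lemma unitTot_bijective (U : Cᵒᵖ) : Function.Bijective (unitTot (R := R) U) := by
  constructor
  · intro r r' h
    rw [unitTot_apply, unitTot_apply] at h
    have h' := tof_injective 0 h
    have := congrArg (secMap (HomologicalComplex.singleObjXSelf (ComplexShape.down ℕ) 0 _).hom U) h'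
    rwa [← secMap_comp, ← secMap_comp, Iso.inv_hom_id, secMap_id, secMap_id] at this
  · intro t
    induction t using tot_induction with
    | h0 => exact ⟨0, map_zero _⟩
    | hof n x =>
      obtain _ | n := n
      · refine ⟨secMap (HomologicalComplex.singleObjXSelf (ComplexShape.down ℕ) 0 _).hom U x, ?_⟩
        rw [unitTot_apply]
        refine congrArg _ ?_
        rw [← secMap_comp, Iso.hom_inv_id, secMap_id]
      · refine ⟨0, ?_⟩
        have hz : IsZero ((unitCx R).X (n + 1)) :=
          HomologicalComplex.isZero_single_obj_X _ _ _ _ (by simp)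
        have : x = 0 := by
          rw [← secMap_id U x, hz.eq_of_src (𝟙 _) 0, secMap_zero]
        rw [this, map_zero, map_zero]
    | hadd t t' h h' =>
      obtain ⟨x, rfl⟩ := h
      obtain ⟨y, rfl⟩ := h'
      exact ⟨x + y, map_add _ _ _⟩

lemma totRes_unitTot {U V : Cᵒᵖ} (f : U ⟶ V) (r : Sec (𝟙_ (PMod R)) U) :
    totRes (unitCx R) f 0 0 (unitTot U r) = unitTot V (secRes (𝟙_ (PMod R)) f r) := by
  rw [unitTot_apply, unitTot_apply, totRes_tof, secRes_secMap]

variable {ι ι' : Type u} {U : Cᵒᵖ}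

/-- The comparison of the tensor product of total modules of complexes with the total module of the
tensor product of the complexes. -/
def totMap : (l : ℕ) → {K : Fin l → ChainComplex (PMod R) ℕ} → (X : ∀ k, SecOps (K k) U ι) →
    (tensorFamily l fun k ↦ (X k).toODG).X →ₗ[R.obj U] (totDG (tensorComplex l K) U 0).X
  | 0, _, _ => unitTot U
  | l + 1, K, X => tensorTot (K 0) (tensorComplex l fun k ↦ K k.succ) U (X 0).one ∘ₗ
      tmap (Y' := totDG (tensorComplex l fun k ↦ K k.succ) U 0) LinearMap.id
        (totMap l fun k ↦ X k.succ)

lemma totMap_bijective {l : ℕ} {K : Fin l → ChainComplex (PMod R) ℕ}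
    (X : ∀ k, SecOps (K k) U ι) : Function.Bijective (totMap l X) := by
  induction l with
  | zero => exact unitTot_bijective U
  | succ l ih =>
    have h1 : Function.Bijective
        (tensorTot (K 0) (tensorComplex l fun k ↦ K k.succ) U (X 0).one) :=
      Function.bijective_iff_has_inverse.2 ⟨_, totTensor_tensorTot _ _ _ _,
        tensorTot_totTensor _ _ _ _⟩
    have h2 : Function.Bijective (TensorProduct.map
        (LinearMap.id : (totDG (K 0) U (X 0).one).X →ₗ[R.obj U] _)
        (totMap l fun k ↦ X k.succ)) :=
      (TensorProduct.congr (.refl _ _) (LinearEquiv.ofBijective _ (ih fun k ↦ X k.succ))).bijective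
    exact h1.comp h2

lemma totMap_d {l : ℕ} {K : Fin l → ChainComplex (PMod R) ℕ} (X : ∀ k, SecOps (K k) U ι) (t) :
    totMap l X ((tensorFamily l fun k ↦ (X k).toODG).d t) =
      (totDG (tensorComplex l K) U 0).d (totMap l X t) := by
  induction l with
  | zero =>
    refine (map_zero (unitTot U)).trans ?_
    exact (tot_d_zero _).symm
  | succ l ih =>
    refine Eq.trans ?_ (tensorTot_d (K 0) (tensorComplex l fun k ↦ K k.succ) U (X 0).one _)
    exact congrArg (tensorTot (K 0) (tensorComplex l fun k ↦ K k.succ) U (X 0).one)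
      (tmap_id_d (ih fun k ↦ X k.succ) t)

lemma totMap_gr {l : ℕ} {K : Fin l → ChainComplex (PMod R) ℕ} (X : ∀ k, SecOps (K k) U ι) (n : ℕ)
    (t) (ht : t ∈ (tensorFamily l fun k ↦ (X k).toODG).gr n) :
    totMap l X t ∈ (totDG (tensorComplex l K) U 0).gr n := by
  induction l generalizing n with
  | zero =>
    obtain _ | n := n
    · exact tof_mem _ _
    · have : (show R.obj U from t) ∈ (⊥ : Submodule (R.obj U) (R.obj U)) := ht
      rw [Submodule.mem_bot] at this
      have e : totMap 0 X t = 0 := (congrArg (unitTot U) this).trans (map_zero _)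
      rw [e]
      exact zero_mem _
  | succ l ih =>
    refine tensorTot_gr (K 0) (tensorComplex l fun k ↦ K k.succ) U (X 0).one n _ ?_
    exact tmap_id_gr (fun n t ht ↦ ih (fun k ↦ X k.succ) n t ht) n t ht

lemma totRes_totMap {l : ℕ} {K : Fin l → ChainComplex (PMod R) ℕ} {V : Cᵒᵖ} (f : U ⟶ V)
    (X : ∀ k, SecOps (K k) U ι) (X' : ∀ k, SecOps (K k) V ι') (t) :
    totRes (tensorComplex l K) f 0 0 (totMap l X t) =
      totMap l X' (famMap l (X := fun k ↦ (X k).toODG) (X' := fun k ↦ (X' k).toODG)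
        (fun k ↦ totRes (K k) f (X k).one (X' k).one) t) := by
  induction l with
  | zero =>
    exact totRes_unitTot f t
  | succ l ih =>
    refine (totRes_tensorTot (K 0) (tensorComplex l fun k ↦ K k.succ) f (X 0).one
      (X' 0).one _).trans
      ?_
    exact congrArg (tensorTot (K 0) (tensorComplex l fun k ↦ K k.succ) V (X' 0).one)
      (tmap_tmap_id (ih (fun k ↦ X k.succ) fun k ↦ X' k.succ) t)

lemma isMor_totRes (K : ChainComplex (PMod R) ℕ) {V : Cᵒᵖ} (f : U ⟶ V) (one : Sec (K.X 0) U)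
    (one' : Sec (K.X 0) V) (h : secRes _ f one = one') : IsMor (totRes K f one one') where
  d_comm x := by
    induction x using tot_induction with
    | h0 => simp only [map_zero]
    | hof n x =>
      obtain _ | n := n
      · rw [tot_d_zero, map_zero, totRes_tof, tot_d_zero]
      · rw [tot_d_succ, totRes_tof, totRes_tof, tot_d_succ, secRes_secMap]
    | hadd x y hx hy => simp only [map_add, hx, hy]
  ε_comm x := by
    induction x using tot_induction with
    | h0 => simp only [map_zero]
    | hof n x => rw [tot_ε, map_smulₛₗ, totRes_tof, tot_ε, map_pow, map_neg, map_one]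
    | hadd x y hx hy => simp only [map_add, hx, hy]
  one := ⟨0, by rw [map_zero, add_zero, tot_one, totRes_tof, h, tot_one]⟩

end Evaluation

section Evaluation

open DG ODG

variable {C : Type u} [SmallCategory C] {R : Cᵒᵖ ⥤ CommRingCat.{u}}

/-! #### Exactness and sections -/

lemma sec_exact {S : ShortComplex (PMod R)} (hS : S.Exact) (U : Cᵒᵖ) (x : Sec S.X₂ U)
    (hx : secMap S.g U x = 0) : ∃ y, secMap S.f U y = x := by
  have h := hS.map (PresheafOfModules.evaluation (R ⋙ forget₂ CommRingCat RingCat) U)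
  rw [ShortComplex.moduleCat_exact_iff] at h
  exact h x hx

lemma secMap_surjective {F G : PMod R} (φ : F ⟶ G) [Epi φ] (U : Cᵒᵖ) :
    Function.Surjective (secMap φ U) := PresheafOfModules.surjective_of_epi φ U

lemma secMap_injective {F G : PMod R} (φ : F ⟶ G) [Mono φ] (U : Cᵒᵖ) :
    Function.Injective (secMap φ U) := PresheafOfModules.injective_of_mono φ U

lemma exists_kernel {F G : PMod R} (φ : F ⟶ G) {U : Cᵒᵖ} (x : Sec F U) (hx : secMap φ U x = 0) :
    ∃ y : Sec (kernel φ) U, secMap (kernel.ι φ) U y = x :=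
  sec_exact (ShortComplex.exact_of_f_is_kernel (.mk _ _ (kernel.condition φ)) (kernelIsKernel φ)) U
    x hx

section Homology

variable (K : ChainComplex (PMod R) ℕ) (q : ℕ) {U : Cᵒᵖ}

/-- The element `t` of degree `q` of a total module is a cycle with homology class `c`. -/
def IsClass (t : (totDG K U 0).X) (c : Sec (K.homology q) U) : Prop :=
  ∃ z : Sec (K.cycles q) U, t = tof K 0 q (secMap (K.iCycles q) U z) ∧
    c = secMap (K.homologyπ q) U z

variable {K q}

lemma IsClass.add {t t' : (totDG K U 0).X} {c c' : Sec (K.homology q) U} (h : IsClass K q t c)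
    (h' : IsClass K q t' c') : IsClass K q (t + t') (c + c') := by
  obtain ⟨z, rfl, rfl⟩ := h
  obtain ⟨z', rfl, rfl⟩ := h'
  exact ⟨z + z', by simp only [map_add], by simp only [map_add]⟩

lemma IsClass.smul {t : (totDG K U 0).X} {c : Sec (K.homology q) U} (h : IsClass K q t c)
    (a : R.obj U) : IsClass K q (a • t) (a • c) := by
  obtain ⟨z, rfl, rfl⟩ := h
  exact ⟨a • z, by simp only [map_smul], by simp only [map_smul]⟩

lemma IsClass.zero : IsClass (U := U) K q 0 0 :=
  ⟨0, by simp only [map_zero], by simp only [map_zero]⟩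

lemma IsClass.res {V : Cᵒᵖ} (f : U ⟶ V) {t : (totDG K U 0).X} {c : Sec (K.homology q) U}
    (h : IsClass K q t c) : IsClass K q (totRes K f 0 0 t) (secRes _ f c) := by
  obtain ⟨z, rfl, rfl⟩ := h
  exact ⟨secRes _ f z, by rw [totRes_tof, secRes_secMap], by rw [secRes_secMap]⟩

lemma exists_isClass (t : (totDG K U 0).X) (ht : t ∈ (totDG K U 0).gr q)
    (hd : (totDG K U 0).d t = 0) : ∃ c, IsClass K q t c := by
  obtain ⟨x, rfl⟩ := exists_tof _ t ht
  have hx : secMap (K.d q ((ComplexShape.down ℕ).next q)) U x = 0 := by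
    obtain _ | n := q
    · have : K.d 0 ((ComplexShape.down ℕ).next 0) = 0 := K.shape _ _ (by simp)
      rw [this, secMap_zero]
    · rw [tot_d_succ] at hd
      have := tof_injective n (hd.trans (map_zero _).symm)
      rw [ChainComplex.next_nat_succ]
      exact this
  obtain ⟨z, rfl⟩ := sec_exact (ShortComplex.exact_of_f_is_kernel
    (.mk (K.iCycles q) (K.d q _) (K.iCycles_d _ _)) (K.cyclesIsKernel q _ rfl)) U x hx
  exact ⟨_, z, rfl, rfl⟩

lemma exists_isClass_of_homology (c : Sec (K.homology q) U) :
    ∃ t ∈ (totDG K U 0).gr q, (totDG K U 0).d t = 0 ∧ IsClass K q t c := by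
  obtain ⟨z, rfl⟩ := secMap_surjective (K.homologyπ q) U c
  refine ⟨tof K 0 q (secMap (K.iCycles q) U z), tof_mem _ _, ?_, z, rfl, rfl⟩
  obtain _ | n := q
  · exact tot_d_zero _
  · rw [tot_d_succ, ← secMap_comp, K.iCycles_d, secMap_zero, map_zero]

/-- The projection of a total module to its part of degree `n`. -/
def totProj (K : ChainComplex (PMod R) ℕ) (U : Cᵒᵖ) (n : ℕ) :
    (totDG K U 0).X →ₗ[R.obj U] (totDG K U 0).X :=
  totDesc K 0 fun m ↦ if m = n then tof K 0 m else 0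

lemma totProj_tof (n m : ℕ) (x : Sec (K.X m) U) :
    totProj K U n (tof K 0 m x) = if m = n then tof K 0 m x else 0 := by
  refine (totDesc_tof _ _ _).trans ?_
  split_ifs
  · rfl
  · rfl

lemma totProj_of_mem {n m : ℕ} {t : (totDG K U 0).X} (ht : t ∈ (totDG K U 0).gr m) :
    totProj K U n t = if m = n then t else 0 := by
  obtain ⟨x, rfl⟩ := exists_tof _ t ht
  exact totProj_tof _ _ _

lemma totProj_d (n : ℕ) (t : (totDG K U 0).X) :
    totProj K U n ((totDG K U 0).d t) = (totDG K U 0).d (totProj K U (n + 1) t) := by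
  induction t using tot_induction with
  | h0 => simp only [map_zero]
  | hof m x =>
    obtain _ | m := m
    · rw [tot_d_zero, map_zero, totProj_tof, if_neg (by omega), map_zero]
    · rw [tot_d_succ, totProj_tof, totProj_tof]
      by_cases h : m = n
      · rw [if_pos h, if_pos (by omega), tot_d_succ]
      · rw [if_neg h, if_neg (by omega), map_zero]
  | hadd t t' h h' => simp only [map_add, h, h']

lemma totProj_mem (n : ℕ) (t : (totDG K U 0).X) :
    totProj K U n t ∈ (totDG K U 0).gr n := by
  induction t using tot_induction with
  | h0 => rw [map_zero]; exact zero_mem _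
  | hof m x =>
    rw [totProj_tof]
    split_ifs with h
    · subst h; exact tof_mem _ _
    · exact zero_mem _
  | hadd t t' h h' => rw [map_add]; exact add_mem h h'

lemma IsClass.eq_zero_iff {t : (totDG K U 0).X} {c : Sec (K.homology q) U} (h : IsClass K q t c) :
    c = 0 ↔ ∃ y, t = (totDG K U 0).d y := by
  obtain ⟨z, rfl, rfl⟩ := h
  have hprev : (ComplexShape.down ℕ).prev q = q + 1 := by simp
  constructor
  · intro h
    obtain ⟨y, rfl⟩ := sec_exact (ShortComplex.exact_of_g_is_cokernel
      (.mk (K.toCycles (q + 1) q) (K.homologyπ q) (K.toCycles_comp_homologyπ _ _))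
      (K.homologyIsCokernel (q + 1) q hprev)) U z h
    refine ⟨tof K 0 (q + 1) y, ?_⟩
    change tof K 0 q (secMap _ U (secMap (K.toCycles (q + 1) q) U y)) = _
    rw [tot_d_succ, ← secMap_comp, K.toCycles_i]
  · rintro ⟨y, hy⟩
    have h1 : totProj K U q ((totDG K U 0).d y) = (totDG K U 0).d y := by
      rw [← hy, totProj_tof, if_pos rfl]
    rw [totProj_d] at h1
    obtain ⟨y', hy'⟩ := exists_tof _ _ (totProj_mem (q + 1) y)
    rw [← h1, hy', tot_d_succ] at hy
    have h2 := tof_injective q hy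
    rw [← K.toCycles_i, secMap_comp] at h2
    rw [secMap_injective _ _ h2, ← secMap_comp, K.toCycles_comp_homologyπ, secMap_zero]

lemma IsClass.eq {t t' : (totDG K U 0).X} {c c' : Sec (K.homology q) U} (h : IsClass K q t c)
    (h' : IsClass K q t' c') (y) (hy : t = t' + (totDG K U 0).d y) : c = c' := by
  have := h.add (h'.smul (-1))
  rw [neg_one_smul, neg_one_smul] at this
  rw [← sub_eq_zero, sub_eq_add_neg, this.eq_zero_iff]
  exact ⟨y, by rw [hy]; abel⟩

end Homology

/-! #### Free resolutions -/

section FreeResolution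

variable (F : PMod R)

lemma projective_freeCover (G : PMod R) (U : Cᵒᵖ) :
    Module.Projective (R.obj U) (Sec ((freeCover R).F.obj G) U) :=
  inferInstanceAs (Module.Projective (R.obj U) (Sec G U →₀ R.obj U))

/-- Isomorphisms induce linear equivalences on sections. -/
def secEquiv {F G : PMod R} (e : F ≅ G) (U : Cᵒᵖ) : Sec F U ≃ₗ[R.obj U] Sec G U :=
  LinearEquiv.ofLinear (secMap e.hom U) (secMap e.inv U)
    (LinearMap.ext fun x ↦ by
      rw [LinearMap.comp_apply, ← secMap_comp, e.inv_hom_id, secMap_id, LinearMap.id_apply])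
    (LinearMap.ext fun x ↦ by
      rw [LinearMap.comp_apply, ← secMap_comp, e.hom_inv_id, secMap_id, LinearMap.id_apply])

instance projective_freeResolution (n : ℕ) (U : Cᵒᵖ) :
    Module.Projective (R.obj U) (Sec ((freeResolution F).X n) U) := by
  have key (n : ℕ) : ∃ G, Nonempty ((freeResolution F).X n ≅ (freeCover R).F.obj G) := by
    obtain _ | _ | n := n
    · exact ⟨_, ⟨(freeCover R).chainComplexXZeroIso F⟩⟩
    · exact ⟨_, ⟨(freeCover R).chainComplexXOneIso F⟩⟩
    · exact ⟨_, ⟨(freeCover R).chainComplexXIso F n⟩⟩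
  obtain ⟨G, ⟨e⟩⟩ := key n
  have := projective_freeCover G U
  exact Module.Projective.of_equiv (secEquiv e U).symm

lemma freeResolution_exact (U : Cᵒᵖ) (n : ℕ) (x : Sec ((freeResolution F).X (n + 1)) U)
    (hx : secMap ((freeResolution F).d (n + 1) n) U x = 0) :
    ∃ y, secMap ((freeResolution F).d (n + 2) (n + 1)) U y = x := by
  have h := (freeCover R).exactAt_map_chainComplex_succ F n
  rw [HomologicalComplex.exactAt_iff' _ (n + 2) (n + 1) n (by simp) (by simp)] at h
  exact sec_exact h U x hx

/-- The term of degree zero of the free resolution. -/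
def zeroIso : (freeResolution F).X 0 ≅ (freeCover R).F.obj F := (freeCover R).chainComplexXZeroIso F

/-- The canonical epimorphism onto `F` from a presheaf of free modules. -/
def coverπ : (freeCover R).F.obj F ⟶ F := (freeCover R).π.app F

instance : Epi (coverπ F) := (freeCover R).epi_π_app F

/-- The term of degree one of the free resolution. -/
def oneIso : (freeResolution F).X 1 ≅ (freeCover R).F.obj (kernel (coverπ F)) :=
  (freeCover R).chainComplexXOneIso F

lemma freeResolution_d_one_zero : (freeResolution F).d 1 0 = (oneIso F).hom ≫
    coverπ (kernel (coverπ F)) ≫ kernel.ι (coverπ F) ≫ (zeroIso F).inv :=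
  (freeCover R).map_chainComplex_d_1_0 F

variable {F} in
/-- The basis element given by a section. -/
def coverMk {U : Cᵒᵖ} (a : Sec F U) : Sec ((freeCover R).F.obj F) U :=
  ModuleCat.freeMk (R := (R ⋙ forget₂ CommRingCat RingCat).obj U) a

lemma coverπ_coverMk {U : Cᵒᵖ} (a : Sec F U) : secMap (coverπ F) U (coverMk a) = a :=
  ModuleCat.freeDesc_apply (R := (R ⋙ forget₂ CommRingCat RingCat).obj U) _ a

lemma secRes_coverMk {U V : Cᵒᵖ} (f : U ⟶ V) (a : Sec F U) :
    secRes _ f (coverMk a) = coverMk (secRes F f a) :=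
  ModuleCat.freeDesc_apply (R := (R ⋙ forget₂ CommRingCat RingCat).obj U)
    (M := (ModuleCat.restrictScalars ((R ⋙ forget₂ CommRingCat RingCat).map f).hom).obj
      (((freeCover R).F.obj F).obj V)) _ a

/-- The augmentation of the free resolution. -/
def freeResolutionAug : (freeResolution F).X 0 ⟶ F := (zeroIso F).hom ≫ coverπ F

/-- The basis element of the free resolution given by a section. -/
def freeResolutionMk {U : Cᵒᵖ} (a : Sec F U) : Sec ((freeResolution F).X 0) U :=
  secMap (zeroIso F).inv U (coverMk a)

lemma aug_freeResolutionMk {U : Cᵒᵖ} (a : Sec F U) :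
    secMap (freeResolutionAug F) U (freeResolutionMk F a) = a := by
  rw [freeResolutionAug, freeResolutionMk, ← secMap_comp, Iso.inv_hom_id_assoc, coverπ_coverMk]

lemma secRes_freeResolutionMk {U V : Cᵒᵖ} (f : U ⟶ V) (a : Sec F U) :
    secRes _ f (freeResolutionMk F a) = freeResolutionMk F (secRes F f a) := by
  rw [freeResolutionMk, secRes_secMap, secRes_coverMk, freeResolutionMk]

lemma aug_eq_zero_iff {U : Cᵒᵖ} (x : Sec ((freeResolution F).X 0) U) :
    secMap (freeResolutionAug F) U x = 0 ↔ ∃ y, secMap ((freeResolution F).d 1 0) U y = x := by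
  constructor
  · intro h
    rw [freeResolutionAug, secMap_comp] at h
    obtain ⟨y, hy⟩ := exists_kernel _ _ h
    obtain ⟨y, rfl⟩ := secMap_surjective (coverπ (kernel (coverπ F))) U y
    refine ⟨secMap (oneIso F).inv U y, ?_⟩
    rw [freeResolution_d_one_zero, ← secMap_comp, Iso.inv_hom_id_assoc, ← Category.assoc,
      secMap_comp, secMap_comp, hy, ← secMap_comp, Iso.hom_inv_id, secMap_id]
  · rintro ⟨y, rfl⟩
    rw [← secMap_comp, freeResolution_d_one_zero, freeResolutionAug, Category.assoc,
      Category.assoc, Category.assoc, Iso.inv_hom_id_assoc, kernel.condition, comp_zero, comp_zero,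
      secMap_zero]

/-- A choice of null-homotopies of the multiplications by elements annihilating the sections of
`F` over `U`, on the free resolution of `F`. -/
def freeOps {U : Cᵒᵖ} (a : Sec F U) {ι : Type u} (w : ι → R.obj U)
    (hw : ∀ i (x : Sec F U), w i • x = 0) : SecOps (freeResolution F) U ι :=
  have h (i : ι) : ∃ h, (totDG (freeResolution F) U (freeResolutionMk F a)).IsHtpy (w i) h :=
    exists_isHtpy (P := fun n ↦ Sec ((freeResolution F).X n) U) (freeResolution_exact F U) (w i)
      fun x ↦ (aug_eq_zero_iff F _).1 (by rw [map_smul, hw])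
  { one := freeResolutionMk F a
    w := w
    op := fun i ↦ (h i).choose
    isHtpy := fun i ↦ (h i).choose_spec }

/-- The operators on a free resolution of a cyclic module `A ⧸ I`, as data on a resolution of
`A ⧸ I`. -/
def freeRes {U : Cᵒᵖ} (a : Sec F U) {ι : Type u} (w : ι → R.obj U)
    (hw : ∀ i (x : Sec F U), w i • x = 0) {I : Ideal (R.obj U)}
    (e : Sec F U ≃ₗ[R.obj U] R.obj U ⧸ I)
    (he : e a = 1) : Res (R.obj U) ι I where
  P n := Sec ((freeResolution F).X n) U
  dP n := secMap ((freeResolution F).d (n + 1) n) U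
  d_d := secMap_d_d (freeResolution F) U
  exact := freeResolution_exact F U
  one := freeResolutionMk F a
  aug := e.toLinearMap ∘ₗ secMap (freeResolutionAug F) U
  aug_eq_zero x := by
    rw [← aug_eq_zero_iff]
    exact e.map_eq_zero_iff
  aug_one := by
    refine (congrArg e (aug_freeResolutionMk F a)).trans he
  w := w
  op := (freeOps F a w hw).op
  isHtpy := (freeOps F a w hw).isHtpy

end FreeResolution

end Evaluation

section Evaluation

open DG ODG

variable {C : Type u} [SmallCategory C] {R : Cᵒᵖ ⥤ CommRingCat.{u}}

/-! #### Words in the operators as classes in the multitor -/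

section Free

variable (R) in
/-- The presheaf of free modules on a presheaf of sets. -/
abbrev freeP (S : Cᵒᵖ ⥤ Type u) : PMod R := PresheafOfModules.freeObj S

/-- The sections of a presheaf of free modules are formal combinations. -/
def freeEl {S : Cᵒᵖ ⥤ Type u} {U : Cᵒᵖ} : (S.obj U →₀ R.obj U) ≃ₗ[R.obj U] Sec (freeP R S) U :=
  LinearEquiv.refl _ _

lemma secRes_freeEl_single {S : Cᵒᵖ ⥤ Type u} {U V : Cᵒᵖ} (f : U ⟶ V) (s : S.obj U) :
    secRes (freeP R S) f (freeEl (Finsupp.single s 1)) = freeEl (Finsupp.single (S.map f s) 1) :=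
  ModuleCat.freeDesc_apply (R := (R ⋙ forget₂ CommRingCat RingCat).obj U)
    (M := (ModuleCat.restrictScalars ((R ⋙ forget₂ CommRingCat RingCat).map f).hom).obj
      ((freeP R S).obj V)) _ s

/-- The morphism out of a presheaf of free modules given by a natural family of maps. -/
def freeDescSec {S : Cᵒᵖ ⥤ Type u} {G : PMod R} (φ : ∀ U, S.obj U → Sec G U)
    (h : ∀ {U V : Cᵒᵖ} (f : U ⟶ V) (s : S.obj U), secRes G f (φ U s) = φ V (S.map f s)) :
    freeP R S ⟶ G :=
  PresheafOfModules.freeObjDesc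
    { app := fun U ↦ ↾(φ U)
      naturality := fun U V f ↦ by
        ext s
        exact (h f s).symm }

lemma freeDescSec_single {S : Cᵒᵖ ⥤ Type u} {G : PMod R} (φ : ∀ U, S.obj U → Sec G U)
    (h : ∀ {U V : Cᵒᵖ} (f : U ⟶ V) (s : S.obj U), secRes G f (φ U s) = φ V (S.map f s)) (U : Cᵒᵖ)
    (s : S.obj U) : secMap (freeDescSec φ h) U (freeEl (Finsupp.single s 1)) = φ U s :=
  ModuleCat.freeDesc_apply (R := (R ⋙ forget₂ CommRingCat RingCat).obj U) _ s

lemma freeDescSec_freeEl {S : Cᵒᵖ ⥤ Type u} {G : PMod R} (φ : ∀ U, S.obj U → Sec G U)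
    (h : ∀ {U V : Cᵒᵖ} (f : U ⟶ V) (s : S.obj U), secRes G f (φ U s) = φ V (S.map f s)) (U : Cᵒᵖ)
    (x : S.obj U →₀ R.obj U) :
    secMap (freeDescSec φ h) U (freeEl x) = x.sum fun s a ↦ a • φ U s := by
  induction x using Finsupp.induction_linear with
  | zero => simp only [map_zero, Finsupp.sum_zero_index]
  | add x y hx hy =>
    rw [map_add, map_add, hx, hy, Finsupp.sum_add_index' (by simp) (by simp [add_smul])]
  | single s a =>
    rw [Finsupp.sum_single_index (h := fun (s : S.obj U) (a : R.obj U) ↦ a • φ U s) (zero_smul _ _),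
      ← freeDescSec_single φ h U s, ← map_smul,
      ← map_smul, Finsupp.smul_single, smul_eq_mul, mul_one]

end Free

/-- A compatible family of base points for the sections of a presheaf of modules, such that the
annihilators of the base points annihilate all sections. -/
structure Pointed (F : PMod R) where
  pt : ∀ U, Sec F U
  res : ∀ {U V : Cᵒᵖ} (f : U ⟶ V), secRes F f (pt U) = pt V
  ann : ∀ U (a : R.obj U), a • pt U = 0 → ∀ x : Sec F U, a • x = 0

variable {l : ℕ} {F : Fin l → PMod R} (P : ∀ k, Pointed (F k))

/-- Families of sections `z k` of the annihilators of the `F k`, with sum zero. -/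
def Cyc (U : Cᵒᵖ) : Type u :=
  {z : Fin l → R.obj U // (∀ k, z k • (P k).pt U = 0) ∧ ∑ k, z k = 0}

/-- The restriction of families of sections of the annihilators. -/
def Cyc.res {U V : Cᵒᵖ} (f : U ⟶ V) (z : Cyc P U) : Cyc P V :=
  ⟨fun k ↦ R.map f (z.1 k), fun k ↦ by
    have := congrArg (secRes (F k) f) (z.2.1 k)
    rw [map_smulₛₗ, (P k).res, map_zero] at this
    exact this, by
    have := congrArg (R.map f) z.2.2
    rw [map_zero, map_sum] at this
    exact this⟩

/-- The presheaf of `q`-tuples of families of sections of the annihilators, with sum zero. -/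
def tuples (q : ℕ) : Cᵒᵖ ⥤ Type u where
  obj U := Fin q → Cyc P U
  map f := ↾fun s i ↦ (s i).res P f
  map_id U := by
    ext s i
    refine Subtype.ext (funext fun k ↦ ?_)
    change R.map (𝟙 U) _ = _
    rw [R.map_id]
    rfl
  map_comp f g := by
    ext s i
    refine Subtype.ext (funext fun k ↦ ?_)
    change R.map (f ≫ g) _ = _
    rw [R.map_comp]
    rfl

/-- The operators on the free resolutions. -/
def resOps (U : Cᵒᵖ) (k : Fin l) : SecOps (freeResolution (F k)) U (Cyc P U) :=
  freeOps (F k) ((P k).pt U) (fun z ↦ z.1 k) fun z ↦ (P k).ann U _ (z.2.1 k)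

/-- The tensor product of the free resolutions, with operators. -/
def fam (U : Cᵒᵖ) : ODG (R.obj U) (Cyc P U) := tensorFamily l fun k ↦ (resOps P U k).toODG

lemma fam_w (U : Cᵒᵖ) (z : Cyc P U) : (fam P U).w z = 0 :=
  (tensorFamily_w _ z).trans z.2.2

lemma fam_isHtpy (U : Cᵒᵖ) (z : Cyc P U) : (fam P U).IsHtpy 0 ((fam P U).op z) := by
  rw [← fam_w P U z]
  exact (fam P U).isHtpy z

/-- The total module of the multitor complex. -/
abbrev torTot (F : Fin l → PMod R) (U : Cᵒᵖ) : DG (R.obj U) :=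
  totDG (tensorComplex l fun k ↦ freeResolution (F k)) U 0

/-- The comparison with the total module of the multitor complex. -/
def famTot (U : Cᵒᵖ) : (fam P U).X →ₗ[R.obj U] (torTot F U).X := totMap l (resOps P U)

lemma famTot_bijective (U : Cᵒᵖ) : Function.Bijective (famTot P U) := totMap_bijective _

lemma famTot_d (U : Cᵒᵖ) (t : (fam P U).X) :
    famTot P U ((fam P U).d t) = (torTot F U).d (famTot P U t) := totMap_d _ _

/-- The word in the operators given by a list. -/
def wordTot (U : Cᵒᵖ) (L : List (Cyc P U)) : (torTot F U).X :=
  famTot P U ((fam P U).word (L.map (fam P U).op))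

lemma wordTot_mem (U : Cᵒᵖ) (L : List (Cyc P U)) : wordTot P U L ∈ (torTot F U).gr L.length := by
  refine totMap_gr (resOps P U) _ _ ?_
  have := (fam P U).word_mem (L.map (fam P U).op) (by
    intro h hh
    obtain ⟨z, -, rfl⟩ := List.mem_map.1 hh
    exact fam_isHtpy P U z)
  rwa [List.length_map] at this

lemma d_wordTot (U : Cᵒᵖ) (L : List (Cyc P U)) : (torTot F U).d (wordTot P U L) = 0 := by
  rw [wordTot, ← famTot_d, (fam P U).d_word, map_zero]
  intro h hh
  obtain ⟨z, -, rfl⟩ := List.mem_map.1 hh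
  exact fam_isHtpy P U z

lemma totRes_wordTot {U V : Cᵒᵖ} (f : U ⟶ V) (L : List (Cyc P U)) :
    ∃ y, totRes (tensorComplex l fun k ↦ freeResolution (F k)) f 0 0 (wordTot P U L) =
      wordTot P V (L.map (Cyc.res P f)) + (torTot F V).d y := by
  have hmor (k) : IsMor
      (totRes (freeResolution (F k)) f (resOps P U k).one (resOps P V k).one) := by
    refine isMor_totRes _ f _ _ ?_
    refine (secRes_freeResolutionMk (F k) f _).trans ?_
    rw [(P k).res]
    rfl
  have hint (k) (z : Cyc P U) :
      Intertwines (totRes (freeResolution (F k)) f (resOps P U k).one (resOps P V k).one)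
        ((resOps P U k).op z) ((resOps P V k).op (z.res P f)) :=
    intertwines_of_exactPos (P := fun n ↦ Sec ((freeResolution (F k)).X n) U)
      (dP := fun n ↦ secMap ((freeResolution (F k)).d (n + 1) n) U)
      (hdP := secMap_d_d (freeResolution (F k)) U)
      (exactPos_ofSeq (P := fun n ↦ Sec ((freeResolution (F k)).X n) V)
        (freeResolution_exact (F k) V)) _ (hmor k).d_comm
      (fun n x ↦ by
        refine Eq.subst (motive := fun t ↦ t ∈ (totDG (freeResolution (F k)) V
          (resOps P V k).one).gr n) (totRes_tof (freeResolution (F k)) f _ _ n x).symm ?_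
        exact tof_mem _ _)
      ((resOps P U k).isHtpy z) ((resOps P V k).isHtpy (z.res P f))
  obtain ⟨y, hy⟩ := (isMor_famMap (X := fun k ↦ (resOps P U k).toODG)
    (X' := fun k ↦ (resOps P V k).toODG) hmor).word (fam P U).op
    (fun z ↦ (fam P V).op (z.res P f)) L (fun z _ ↦ fam_isHtpy P U z) (fun z _ ↦ fam_isHtpy P V _)
    (fun z _ ↦ intertwines_famMap (X := fun k ↦ (resOps P U k).toODG)
      (X' := fun k ↦ (resOps P V k).toODG) hmor z (z.res P f) fun k ↦ hint k z)
  refine ⟨famTot P V y, (totRes_totMap f (resOps P U) (resOps P V) _).trans ?_⟩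
  refine (congrArg (famTot P V) hy).trans ((map_add (famTot P V) _ _).trans ?_)
  refine congrArg₂ (· + ·) ?_ (famTot_d P V y)
  rw [wordTot, List.map_map]
  rfl

/-- The list of the entries of a tuple. -/
def tupleList {q : ℕ} {U : Cᵒᵖ} (s : (tuples P q).obj U) : List (Cyc P U) := List.ofFn s

lemma tupleList_map {q : ℕ} {U V : Cᵒᵖ} (f : U ⟶ V) (s : (tuples P q).obj U) :
    tupleList P ((tuples P q).map f s) = (tupleList P s).map (Cyc.res P f) :=
  (List.map_ofFn (f := show Fin q → Cyc P U from s) (g := Cyc.res P f)).symm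

lemma length_tupleList {q : ℕ} {U : Cᵒᵖ} (s : (tuples P q).obj U) : (tupleList P s).length = q :=
  List.length_ofFn

lemma exists_tupleList {U : Cᵒᵖ} (L : List (Cyc P U)) :
    ∃ s : (tuples P L.length).obj U, tupleList P s = L := ⟨L.get, List.ofFn_get L⟩

/-- The element `t` of degree `q` is a cycle with class `c` in the multitor. -/
def IsTor {q : ℕ} {U : Cᵒᵖ} (t : (torTot F U).X) (c : Sec (presheafTor q F) U) : Prop :=
  IsClass (tensorComplex l fun k ↦ freeResolution (F k)) q t c

section IsTor

variable {q : ℕ} {U : Cᵒᵖ} {t t' : (torTot F U).X} {c c' : Sec (presheafTor q F) U}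

lemma IsTor.add (h : IsTor t c) (h' : IsTor t' c') : IsTor (t + t') (c + c') := IsClass.add h h'

lemma IsTor.smul (h : IsTor t c) (a : R.obj U) : IsTor (a • t) (a • c) := IsClass.smul h a

variable (F q U) in
lemma IsTor.zero : IsTor (0 : (torTot F U).X) (0 : Sec (presheafTor q F) U) := IsClass.zero

lemma IsTor.eq (h : IsTor t c) (h' : IsTor t' c') (y : (torTot F U).X)
    (hy : t = t' + (torTot F U).d y) : c = c' := IsClass.eq h h' y hy

lemma IsTor.eq_zero_iff (h : IsTor t c) : c = 0 ↔ ∃ y, t = (torTot F U).d y :=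
  IsClass.eq_zero_iff h

lemma IsTor.res {V : Cᵒᵖ} (f : U ⟶ V) (h : IsTor t c) :
    IsTor (totRes (tensorComplex l fun k ↦ freeResolution (F k)) f 0 0 t)
      (secRes (presheafTor q F) f c) := IsClass.res f h

lemma exists_isTor (ht : t ∈ (torTot F U).gr q) (hd : (torTot F U).d t = 0) :
    ∃ c : Sec (presheafTor q F) U, IsTor t c := exists_isClass t ht hd

lemma exists_isTor_of_sec (c : Sec (presheafTor q F) U) :
    ∃ t ∈ (torTot F U).gr q, (torTot F U).d t = 0 ∧ IsTor t c := exists_isClass_of_homology c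

end IsTor

/-- The homology class of a word of length `q`. -/
lemma exists_wordClass (q : ℕ) (U : Cᵒᵖ) (s : (tuples P q).obj U) :
    ∃ c : Sec (presheafTor q F) U, IsTor (wordTot P U (tupleList P s)) c :=
  exists_isTor (by have := wordTot_mem P U (tupleList P s); rwa [length_tupleList] at this)
    (d_wordTot P U _)

/-- The homology class of a word of length `q`. -/
def wordClass (q : ℕ) (U : Cᵒᵖ) (s : (tuples P q).obj U) : Sec (presheafTor q F) U :=
  (exists_wordClass P q U s).choose

lemma isTor_wordClass (q : ℕ) (U : Cᵒᵖ) (s : (tuples P q).obj U) :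
    IsTor (wordTot P U (tupleList P s)) (wordClass P q U s) :=
  (exists_wordClass P q U s).choose_spec

lemma secRes_wordClass (q : ℕ) {U V : Cᵒᵖ} (f : U ⟶ V) (s : (tuples P q).obj U) :
    secRes (presheafTor q F) f (wordClass P q U s) = wordClass P q V ((tuples P q).map f s) := by
  obtain ⟨y, hy⟩ := totRes_wordTot P f (tupleList P s)
  refine ((isTor_wordClass P q U s).res f).eq (isTor_wordClass P q V _) y ?_
  rw [hy, tupleList_map]

/-- The morphism that sends a tuple to the class of the corresponding word. -/
def wordHom (q : ℕ) : freeP R (tuples P q) ⟶ presheafTor q F :=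
  freeDescSec (wordClass P q) (secRes_wordClass P q)

lemma isTor_wordHom (q : ℕ) (U : Cᵒᵖ) (x : (tuples P q).obj U →₀ R.obj U) :
    IsTor (famTot P U ((fam P U).wordComb (x.mapDomain (tupleList P))))
      (secMap (wordHom P q) U (freeEl x)) := by
  induction x using Finsupp.induction_linear with
  | zero =>
    simp only [map_zero, Finsupp.mapDomain_zero, ODG.wordComb]
    exact .zero F q U
  | add x y hx hy =>
    simp only [map_add, Finsupp.mapDomain_add, ODG.wordComb] at hx hy ⊢
    exact hx.add hy
  | single s a =>
    rw [Finsupp.mapDomain_single, ODG.wordComb, Finsupp.linearCombination_single, map_smul,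
      wordHom, freeDescSec_freeEl (wordClass P q) (secRes_wordClass P q), Finsupp.sum_single_index
        (h := fun (s : (tuples P q).obj U) (a : R.obj U) ↦ a • wordClass P q U s) (zero_smul _ _)]
    exact (isTor_wordClass P q U s).smul a

lemma exists_totProj_wordComb (q : ℕ) (U : Cᵒᵖ) (x : List (Cyc P U) →₀ R.obj U) :
    ∃ x' : (tuples P q).obj U →₀ R.obj U, totProj _ U q (famTot P U ((fam P U).wordComb x)) =
      famTot P U ((fam P U).wordComb (x'.mapDomain (tupleList P))) := by
  induction x using Finsupp.induction_linear with
  | zero => exact ⟨0, by simp only [Finsupp.mapDomain_zero, ODG.wordComb, map_zero]⟩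
  | add x y hx hy =>
    obtain ⟨x', hx'⟩ := hx
    obtain ⟨y', hy'⟩ := hy
    refine ⟨x' + y', ?_⟩
    simp only [map_add, Finsupp.mapDomain_add, ODG.wordComb] at hx' hy' ⊢
    rw [hx', hy']
  | single L a =>
    rw [ODG.wordComb, Finsupp.linearCombination_single, map_smul, map_smul]
    have := totProj_of_mem (n := q) (wordTot_mem P U L)
    rw [wordTot] at this
    rw [this]
    split_ifs with h
    · subst h
      obtain ⟨s, hs⟩ := exists_tupleList P L
      refine ⟨Finsupp.single s a, ?_⟩
      rw [Finsupp.mapDomain_single, ODG.wordComb, Finsupp.linearCombination_single, map_smul, hs]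
    · exact ⟨0, by simp only [Finsupp.mapDomain_zero, ODG.wordComb, map_zero, smul_zero]⟩

/-- If the homology of the tensor product of the resolutions over `U` is described by products of
vectors, then the map from formal combinations of tuples to the multitor is surjective over `U`,
with kernel the relations between the products of vectors. -/
lemma wordHom_spec {B : Type u} [CommRing B] {V : Type u} [AddCommGroup V] [Module B V]
    (q : ℕ) (U : Cᵒᵖ) (σ : R.obj U →+* B) (v : Cyc P U → V)
    (h : (∀ x, (∃ y, (fam P U).wordComb x = (fam P U).d y) ↔ prodComb σ v x = 0) ∧
      ∀ t, (fam P U).d t = 0 → ∃ x y, t = (fam P U).wordComb x + (fam P U).d y) :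
    Function.Surjective (secMap (wordHom P q) U) ∧ ∀ x : (tuples P q).obj U →₀ R.obj U,
      secMap (wordHom P q) U (freeEl x) = 0 ↔ prodComb σ v (x.mapDomain (tupleList P)) = 0 := by
  constructor
  · intro c
    obtain ⟨t, ht, hd, hc⟩ := exists_isTor_of_sec c
    obtain ⟨t', rfl⟩ := (famTot_bijective P U).2 t
    have hd' : (fam P U).d t' = 0 := (famTot_bijective P U).1 (by
      rw [famTot_d, map_zero]
      exact hd)
    -- The cycle is homologous to a combination of words of all lengths; its part of degree `q` is a
    -- combination of words of length `q`.
    obtain ⟨x, y, rfl⟩ := h.2 t' hd'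
    obtain ⟨x', hx'⟩ := exists_totProj_wordComb P q U x
    have ht' := totProj_of_mem (n := q) ht
    rw [if_pos rfl, map_add, map_add, hx', famTot_d, totProj_d] at ht'
    refine ⟨freeEl x', ((isTor_wordHom P q U x').eq hc
      (- totProj _ U (q + 1) (famTot P U y)) ?_)⟩
    rw [map_add, famTot_d, ← ht', map_neg]
    abel
  · intro x
    rw [(isTor_wordHom P q U x).eq_zero_iff, ← h.1]
    constructor
    · rintro ⟨y, hy⟩
      obtain ⟨y, rfl⟩ := (famTot_bijective P U).2 y
      exact ⟨y, (famTot_bijective P U).1 (by rw [hy, famTot_d])⟩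
    · rintro ⟨y, hy⟩
      exact ⟨famTot P U y, by rw [hy, famTot_d]⟩

end Evaluation

section Smooth

open TensorProduct ODG

/-! ### Regular families in smooth algebras -/

lemma ODG.RegularOn.map_flat {A B J : Type u} [CommRing A] [CommRing B] [Algebra A B]
    [Module.Flat A B]
    {f : J → A} {D : Set J} (h : RegularOn f D) : RegularOn (fun j ↦ algebraMap A B (f j)) D := by
  intro j hj T hT hjT b hb
  have hmem (b : B) : b ∈ Ideal.span ((fun j ↦ algebraMap A B (f j)) '' T) ↔
      b ⊗ₜ[A] (Ideal.Quotient.mk (Ideal.span (f '' T)) 1) = 0 := by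
    rw [← (tensorQuotEquivQuotSMul B (Ideal.span (f '' T))).map_eq_zero_iff,
      tensorQuotEquivQuotSMul_tmul_mk, one_smul, Submodule.Quotient.mk_eq_zero,
      Ideal.smul_top_eq_map,
      Ideal.map_span, ← Set.image_comp]
    rfl
  rw [hmem] at hb ⊢
  let g : (A ⧸ Ideal.span (f '' T)) →ₗ[A] A ⧸ Ideal.span (f '' T) := f j • LinearMap.id
  have hg : Function.Injective g := by
    rw [injective_iff_map_eq_zero]
    intro x hx
    obtain ⟨x, rfl⟩ := Ideal.Quotient.mk_surjective x
    have hx' : Ideal.Quotient.mk (Ideal.span (f '' T)) (f j * x) = 0 := hx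
    rw [Ideal.Quotient.eq_zero_iff_mem] at hx' ⊢
    exact h j hj T hT hjT x hx'
  apply Module.Flat.lTensor_preserves_injective_linearMap (M := B) g hg
  rw [map_zero, LinearMap.lTensor_tmul, LinearMap.smul_apply, TensorProduct.tmul_smul,
    TensorProduct.smul_tmul', Algebra.smul_def]
  exact hb

/-- The variables of a polynomial ring are regular in any order. -/
lemma regularOn_X (k J : Type u) [CommRing k] :
    RegularOn (MvPolynomial.X : J → MvPolynomial J k) Set.univ := by
  classical
  intro j _ T _ hjT a ha
  rw [MvPolynomial.mem_ideal_span_X_image] at ha ⊢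
  intro m hm
  obtain ⟨i, hi, him⟩ := ha (Finsupp.single j 1 + m) (by
    rw [MvPolynomial.mem_support_iff, MvPolynomial.coeff_X_mul]
    exact MvPolynomial.mem_support_iff.1 hm)
  refine ⟨i, hi, ?_⟩
  rwa [Finsupp.add_apply, Finsupp.single_apply, if_neg (by rintro rfl; exact hjT hi),
    zero_add] at him

variable {k A : Type u} [Field k] [CommRing A] [Algebra k A]

/-- If `A ⧸ I` is smooth, then `d f ↦ f` extends to a map from the differentials of `A` to the
fiber of `I` at a point of the vanishing locus of `I`. -/
lemma exists_fiber_retraction [Algebra.FormallySmooth k A] (I : Ideal A)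
    [Algebra.FormallySmooth k (A ⧸ I)] (K : Type u) [Field K] [Algebra A K]
    (hK : ∀ x ∈ I, algebraMap A K x = 0) :
    ∃ Φ : Ω[A⁄k] →ₗ[A] K ⊗[A] I, ∀ x : I, Φ (KaehlerDifferential.D k A x) = 1 ⊗ₜ x := by
  obtain ⟨r, hr⟩ := (Algebra.FormallySmooth.iff_split_injection (R := k) (P := A) (A := A ⧸ I)
    Ideal.Quotient.mk_surjective).1 inferInstance
  have hker : RingHom.ker (algebraMap A (A ⧸ I)) = I := Ideal.mk_ker
  -- The splitting of `I/I² → A ⧸ I ⊗ Ω` given by smoothness, followed by the map from `I/I²` to the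
  -- fiber of `I`.
  let c : RingHom.ker (algebraMap A (A ⧸ I)) →ₗ[A] K ⊗[A] I :=
    TensorProduct.mk A K I 1 ∘ₗ (LinearEquiv.ofEq _ _ hker).toLinearMap
  have hc (x y) : c (x * y) = 0 := by
    have hx : x.1 ∈ I := hker.le x.2
    have : (x * y : RingHom.ker (algebraMap A (A ⧸ I))) = x.1 • y := rfl
    rw [this, map_smul]
    change x.1 • (1 ⊗ₜ[A] _) = _
    rw [TensorProduct.smul_tmul', Algebra.smul_def, hK _ hx, zero_mul, TensorProduct.zero_tmul]
  refine ⟨Ideal.Cotangent.lift c hc ∘ₗ r ∘ₗ TensorProduct.mk A (A ⧸ I) _ 1, fun x ↦ ?_⟩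
  have hx : x.1 ∈ RingHom.ker (algebraMap A (A ⧸ I)) := hker.ge x.2
  have h1 := LinearMap.congr_fun hr ((RingHom.ker (algebraMap A (A ⧸ I))).toCotangent ⟨x.1, hx⟩)
  rw [LinearMap.comp_apply, KaehlerDifferential.kerCotangentToTensor_toCotangent,
    LinearMap.id_apply] at h1
  refine (congrArg (Ideal.Cotangent.lift c hc) h1).trans ?_
  exact Ideal.Cotangent.lift_toCotangent _ _ _

/-- An algebra is formally smooth over an intermediate algebra if the differentials of the latter
are a direct summand. -/
lemma formallySmooth_of_retraction (k X L : Type u) [CommRing k] [CommRing X] [CommRing L]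
    [Algebra k X] [Algebra X L] [Algebra k L] [IsScalarTower k X L] [Algebra.FormallySmooth k L]
    (s : Ω[L⁄k] →ₗ[L] L ⊗[X] Ω[X⁄k]) (hs : s ∘ₗ KaehlerDifferential.mapBaseChange k X L = .id) :
    Algebra.FormallySmooth X L := by
  have hinj : Function.Injective (KaehlerDifferential.mapBaseChange k X L) :=
    Function.LeftInverse.injective (LinearMap.congr_fun hs)
  rw [Algebra.formallySmooth_iff]
  constructor
  · have e := Function.Exact.split_tfae' (KaehlerDifferential.exact_mapBaseChange_map k X L)
    obtain ⟨t, ht⟩ := ((e.out 0 1 rfl rfl).2 ⟨KaehlerDifferential.map_surjective k X L, s, hs⟩).2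
    exact Module.Projective.of_split t _ ht
  · refine subsingleton_of_forall_eq 0 fun x ↦ ?_
    have h0 : Algebra.H1Cotangent.δ k X L x = 0 := hinj (by
      rw [map_zero]
      exact (Algebra.H1Cotangent.exact_δ_mapBaseChange k X L).apply_apply_eq_zero x)
    obtain ⟨y, rfl⟩ := (Algebra.H1Cotangent.exact_map_δ k X L x).1 h0
    rw [Subsingleton.elim y 0, map_zero]

/-- Elements of `I` with linearly independent images in the fiber of `I` at `p` define a map to an
affine space that is smooth at `p`: by the retraction of the differentials onto the fiber of `I`,
their differentials are linearly independent at `p`. -/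
lemma isSmoothAt_of_linearIndependent [Algebra.Smooth k A] (I : Ideal A)
    [Algebra.FormallySmooth k (A ⧸ I)] (p : Ideal A) [p.IsPrime] (hp : I ≤ p)
    {S : Type u} [Finite S]
    (f : S → I) (hf : LinearIndependent p.ResidueField fun j ↦ (1 : p.ResidueField) ⊗ₜ[A] f j) :
    letI := (MvPolynomial.aeval fun j ↦ (f j : A) : MvPolynomial S k →ₐ[k] A).toAlgebra
    Algebra.IsSmoothAt (MvPolynomial S k) p := by
  letI := (MvPolynomial.aeval fun j ↦ (f j : A) : MvPolynomial S k →ₐ[k] A).toAlgebra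
  have : IsScalarTower k (MvPolynomial S k) A := .of_algHom _
  let L := Localization.AtPrime p
  let K := p.ResidueField
  have : IsScalarTower k (MvPolynomial S k) L := .to₁₂₄ _ _ A _
  have : Algebra.FormallySmooth A L := .of_isLocalization p.primeCompl
  have : Algebra.FormallySmooth k L := .comp k A L
  have : Algebra.EssFiniteType A L := .of_isLocalization _ p.primeCompl
  have : Algebra.EssFiniteType k L := .comp k A L
  have : Module.Free L Ω[L⁄k] := Module.free_of_flat_of_isLocalRing
  obtain ⟨Φ, hΦ⟩ := exists_fiber_retraction (k := k) I K fun x hx ↦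
    Ideal.algebraMap_residueField_eq_zero.2 (hp hx)
  have hunit (x : p.primeCompl) : IsUnit (algebraMap A (Module.End A (K ⊗[A] I)) x) := by
    have h1 : IsUnit (algebraMap A K x) := by
      rw [isUnit_iff_ne_zero, Ne, Ideal.algebraMap_residueField_eq_zero]
      exact x.2
    rw [Module.End.isUnit_iff]
    have h2 : (algebraMap A (Module.End A (K ⊗[A] I)) x : K ⊗[A] I → K ⊗[A] I) =
        fun t ↦ h1.unit • t := by
      funext t
      rw [Module.algebraMap_end_apply, Units.smul_def, IsUnit.unit_spec, algebraMap_smul]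
    rw [h2]
    exact MulAction.bijective _
  -- Pass to the local ring at `p`; the elements outside `p` act invertibly on the fiber.
  let Φ₁ : Ω[L⁄k] →ₗ[A] K ⊗[A] I := IsLocalizedModule.lift p.primeCompl
    (KaehlerDifferential.map k k A L) Φ hunit
  let Φ₂ : Ω[L⁄k] →ₗ[L] K ⊗[A] I := LinearMap.extendScalarsOfIsLocalization p.primeCompl L Φ₁
  have hΦ₂ (x : I) : Φ₂ (KaehlerDifferential.D k L (algebraMap A L x)) = 1 ⊗ₜ x := by
    rw [← hΦ, ← KaehlerDifferential.map_D k k A L]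
    exact IsLocalizedModule.lift_apply p.primeCompl _ Φ hunit _
  have hli : LinearIndependent K fun j ↦
      (1 : K) ⊗ₜ[L] KaehlerDifferential.D k L (algebraMap A L (f j)) := by
    refine LinearIndependent.of_comp (Φ₂.liftBaseChange K) ?_
    convert! hf using 1
    funext j
    exact (LinearMap.liftBaseChange_tmul _ _ _ _).trans ((one_smul _ _).trans (hΦ₂ _))
  let b₀ := (KaehlerDifferential.mvPolynomialBasis k S).baseChange L
  have hb₀ (j) : KaehlerDifferential.mapBaseChange k (MvPolynomial S k) L (b₀ j) =
      KaehlerDifferential.D k L (algebraMap A L (f j)) := by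
    rw [Module.Basis.baseChange_apply, KaehlerDifferential.mvPolynomialBasis_apply,
      KaehlerDifferential.mapBaseChange_tmul, one_smul, KaehlerDifferential.map_D,
      IsScalarTower.algebraMap_apply (MvPolynomial S k) A L]
    congr 2
    exact MvPolynomial.aeval_X _ _
  have : Module.Finite L (L ⊗[MvPolynomial S k] Ω[MvPolynomial S k⁄k]) := .of_basis b₀
  -- A map from a finite module to a free one over a local ring splits if it is injective on the
  -- fiber.
  obtain ⟨s, hs⟩ := (IsLocalRing.split_injective_iff_lTensor_residueField_injective
    (KaehlerDifferential.mapBaseChange k (MvPolynomial S k) L)).2 (by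
      have e : ((KaehlerDifferential.mapBaseChange k (MvPolynomial S k) L).lTensor K :
          K ⊗[L] (L ⊗[MvPolynomial S k] Ω[MvPolynomial S k⁄k]) → K ⊗[L] Ω[L⁄k]) =
          (b₀.baseChange K).constr K fun j ↦
            (1 : K) ⊗ₜ[L] KaehlerDifferential.D k L (algebraMap A L (f j)) := by
        have : (KaehlerDifferential.mapBaseChange k (MvPolynomial S k) L).baseChange K =
          (b₀.baseChange K).constr K fun j ↦
            (1 : K) ⊗ₜ[L] KaehlerDifferential.D k L (algebraMap A L (f j)) := by
          refine (b₀.baseChange K).ext fun j ↦ ?_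
          rw [Module.Basis.constr_basis, Module.Basis.baseChange_apply, LinearMap.baseChange_tmul,
            hb₀]
        rw [← this]
        rfl
      refine e ▸ ?_
      exact Module.Basis.injective_constr_of_linearIndependent _ hli)
  exact formallySmooth_of_retraction k (MvPolynomial S k) L s hs

end Smooth

section Smooth

open TensorProduct ODG

variable {A : Type u} [CommRing A] (p : Ideal A) [p.IsPrime]

/-- A family of elements of a finitely generated ideal that spans the fiber at `p` generates the
ideal near `p`. -/
lemma exists_generates_of_span_fiber {I : Ideal A} (hI : I.FG) {J : Type u} (f : J → I)
    (hf : Submodule.span p.ResidueField (Set.range fun j ↦ (1 : p.ResidueField) ⊗ₜ[A] f j) = ⊤) :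
    ∃ g ∉ p, ∀ x ∈ I, g * x ∈ Ideal.span (Set.range fun j ↦ (f j : A)) := by
  classical
  -- The quotient of `I` by the given elements vanishes near `p`, by Nakayama's lemma.
  let N := I ⧸ Submodule.span A (Set.range f)
  have : Module.Finite A I := Module.Finite.iff_fg.2 hI
  have hN : (⟨p, inferInstance⟩ : PrimeSpectrum A) ∉ Module.support A N := by
    rw [Module.mem_support_iff_nontrivial_residueField_tensorProduct,
      not_nontrivial_iff_subsingleton]
    let φ := (Submodule.mkQ (Submodule.span A (Set.range f))).baseChange p.ResidueField
    have hφ : Function.Surjective φ :=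
      LinearMap.lTensor_surjective _ (Submodule.mkQ_surjective _)
    have h0 : φ = 0 := by
      refine LinearMap.ext_on_range hf fun j ↦ ?_
      rw [LinearMap.baseChange_tmul, Submodule.mkQ_apply,
        (Submodule.Quotient.mk_eq_zero (Submodule.span A (Set.range f))).2
          (Submodule.subset_span (Set.mem_range_self j)), tmul_zero]
      rfl
    refine ⟨fun x y ↦ ?_⟩
    obtain ⟨x, rfl⟩ := hφ x
    obtain ⟨y, rfl⟩ := hφ y
    rw [h0]
    rfl
  rw [Module.notMem_support_iff'] at hN
  obtain ⟨T, hT⟩ := (Module.finite_def (R := A) (M := I)).1 this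
  choose r hr hrx using fun x : I ↦ hN (Submodule.Quotient.mk x)
  have hmem (y : I) (hy : y ∈ Submodule.span A (Set.range f)) :
      (y : A) ∈ Ideal.span (Set.range fun j ↦ (f j : A)) := by
    have := Submodule.mem_map_of_mem (f := I.subtype) hy
    rw [Submodule.map_span, ← Set.range_comp] at this
    exact this
  refine ⟨∏ x ∈ T, r x, fun h ↦ ?_, fun x hx ↦ ?_⟩
  · obtain ⟨x, -, hx⟩ := (Ideal.IsPrime.prod_mem_iff).1 h
    exact hr x hx
  · have hx' : (⟨x, hx⟩ : I) ∈ Submodule.span A (T : Set I) := hT ▸ Submodule.mem_top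
    refine hmem ((∏ x ∈ T, r x) • ⟨x, hx⟩) ?_
    generalize (⟨x, hx⟩ : I) = x at hx'
    induction hx' using Submodule.span_induction with
    | mem y hy =>
      have h1 := hrx y
      rw [← Submodule.Quotient.mk_smul, Submodule.Quotient.mk_eq_zero] at h1
      rw [← Finset.prod_erase_mul T r hy, mul_smul]
      exact Submodule.smul_mem _ _ h1
    | zero => rw [smul_zero]; exact zero_mem _
    | add y z _ _ hy hz => rw [smul_add]; exact add_mem hy hz
    | smul a y _ hy => rw [smul_comm]; exact Submodule.smul_mem _ _ hy

lemma span_fiber_of_generates {I : Ideal A} {J : Type u} (f : J → I) (g : A) (hg : g ∉ p)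
    (hf : ∀ x ∈ I, g * x ∈ Ideal.span (Set.range fun j ↦ (f j : A))) :
    Submodule.span p.ResidueField (Set.range fun j ↦ (1 : p.ResidueField) ⊗ₜ[A] f j) = ⊤ := by
  rw [eq_top_iff]
  rintro t -
  induction t with
  | zero => exact zero_mem _
  | add x y hx hy => exact add_mem hx hy
  | tmul a x =>
    have hg' : algebraMap A p.ResidueField g ≠ 0 := by
      rwa [Ne, Ideal.algebraMap_residueField_eq_zero]
    have hx : g • x ∈ Submodule.span A (Set.range f) := by
      have h1 : I.subtype (g • x) ∈ (Submodule.span A (Set.range f)).map I.subtype := by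
        rw [Submodule.map_span, ← Set.range_comp]
        exact hf x x.2
      obtain ⟨y, hy, hyx⟩ := h1
      exact (show y = g • x from Subtype.ext hyx) ▸ hy
    have key (y : I) (hy : y ∈ Submodule.span A (Set.range f)) :
        (1 : p.ResidueField) ⊗ₜ[A] y ∈
          Submodule.span p.ResidueField (Set.range fun j ↦ (1 : p.ResidueField) ⊗ₜ[A] f j) := by
      induction hy using Submodule.span_induction with
      | mem y hy => obtain ⟨j, rfl⟩ := hy; exact Submodule.subset_span ⟨j, rfl⟩
      | zero => rw [tmul_zero]; exact zero_mem _
      | add y z _ _ hy hz => rw [tmul_add]; exact add_mem hy hz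
      | smul b y _ hy =>
        rw [tmul_smul, ← algebraMap_smul p.ResidueField]
        exact Submodule.smul_mem _ _ hy
    have h2 := Submodule.smul_mem _ (a * (algebraMap A p.ResidueField g)⁻¹) (key _ hx)
    rw [tmul_smul, ← algebraMap_smul p.ResidueField g ((1 : p.ResidueField) ⊗ₜ[A] x), smul_smul,
      inv_mul_cancel_right₀ hg', smul_tmul', smul_eq_mul, mul_one] at h2
    exact h2

/-- Near a point of the vanishing locus of an ideal with smooth quotient, every family of generators
of the ideal contains a family of generators that is regular in any order. A subfamily that is a
basis of the fiber defines a smooth, hence flat, map to an affine space near the point, and flat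
maps preserve the regularity of the coordinates. -/
lemma exists_regularOn {k : Type u} [Field k] [Algebra k A] [Algebra.Smooth k A] {I : Ideal A}
    (hI : I.FG) [Algebra.FormallySmooth k (A ⧸ I)] (hp : I ≤ p) {J : Type u} (f : J → A)
    (hfI : ∀ j, f j ∈ I) (g₀ : A) (hg₀ : g₀ ∉ p)
    (hf : ∀ x ∈ I, g₀ * x ∈ Ideal.span (Set.range f)) :
    ∃ (S : Set J) (g : A), S.Finite ∧ g ∉ p ∧ (∀ x ∈ I, g * x ∈ Ideal.span (f '' S)) ∧
      ∀ (B : Type u) [CommRing B] [Algebra A B] [Module.Flat A B], IsUnit (algebraMap A B g) →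
        RegularOn (fun j ↦ algebraMap A B (f j)) S := by
  let F (j : J) : p.ResidueField ⊗[A] I := 1 ⊗ₜ[A] ⟨f j, hfI j⟩
  have hspan : Submodule.span p.ResidueField (Set.range F) = ⊤ :=
    span_fiber_of_generates p (fun j ↦ ⟨f j, hfI j⟩) g₀ hg₀ hf
  have : Module.Finite A I := Module.Finite.iff_fg.2 hI
  obtain ⟨κ, a, ha, hS, hli⟩ := exists_linearIndependent' p.ResidueField F
  have : Finite κ := hli.finite_of_isNoetherian
  obtain ⟨g₁, hg₁, h₁⟩ := exists_generates_of_span_fiber p hI (fun i ↦ ⟨f (a i), hfI (a i)⟩)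
    (hS.trans hspan)
  have hsm := isSmoothAt_of_linearIndependent (k := k) I p hp (fun i ↦ ⟨f (a i), hfI (a i)⟩) hli
  let φ : MvPolynomial κ k →ₐ[k] A := MvPolynomial.aeval fun i ↦ f (a i)
  letI := φ.toAlgebra
  have : IsScalarTower k (MvPolynomial κ k) A := .of_algHom _
  have : Algebra.FinitePresentation (MvPolynomial κ k) A :=
    .of_restrict_scalars_finitePresentation k _ _
  have : Algebra.IsSmoothAt (MvPolynomial κ k) p := hsm
  obtain ⟨g₂, hg₂, h₂⟩ := Algebra.IsSmoothAt.exists_notMem_smooth (MvPolynomial κ k) p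
  refine ⟨Set.range a, g₁ * g₂, Set.finite_range a, fun h ↦ ?_, fun x hx ↦ ?_, fun B _ _ _ hB ↦ ?_⟩
  · exact (Ideal.IsPrime.mem_or_mem ‹_› h).elim hg₁ hg₂
  · rw [mul_comm g₁, mul_assoc, ← Set.range_comp]
    exact Ideal.mul_mem_left _ _ (h₁ x hx)
  · rw [map_mul] at hB
    have hB₂ : IsUnit (algebraMap A B g₂) := isUnit_of_mul_isUnit_right hB
    letI : Algebra (Localization.Away g₂) B := (IsLocalization.Away.lift g₂ hB₂).toAlgebra
    have : IsScalarTower A (Localization.Away g₂) B :=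
      .of_algebraMap_eq fun x ↦ (IsLocalization.Away.lift_eq g₂ hB₂ x).symm
    have : Module.Flat (Localization.Away g₂) B :=
      (Module.flat_iff_of_isLocalization (Localization.Away g₂) (.powers g₂) B).2 inferInstance
    letI : Algebra (MvPolynomial κ k) B := ((algebraMap A B).comp φ.toRingHom).toAlgebra
    have : IsScalarTower (MvPolynomial κ k) A B := .of_algebraMap_eq fun x ↦ rfl
    have : IsScalarTower (MvPolynomial κ k) (Localization.Away g₂) B :=
      .of_algebraMap_eq fun x ↦ by
        rw [IsScalarTower.algebraMap_apply (MvPolynomial κ k) A (Localization.Away g₂),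
          ← IsScalarTower.algebraMap_apply A (Localization.Away g₂) B]
        rfl
    -- The algebra `B` is flat over the polynomial ring, since it is flat over a localization of `A`
    -- that is smooth over it.
    have : Module.Flat (MvPolynomial κ k) B := .trans _ (Localization.Away g₂) _
    have hreg := (regularOn_X k κ).map_flat (B := B)
    have hX (i : κ) : algebraMap (MvPolynomial κ k) B (MvPolynomial.X i) =
        algebraMap A B (f (a i)) := congrArg (algebraMap A B) (MvPolynomial.aeval_X _ _)
    simp only [hX] at hreg
    rintro _ ⟨i, rfl⟩ T hT hiT b hb
    have hT' : (fun j ↦ algebraMap A B (f j)) '' T =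
        (fun i ↦ algebraMap A B (f (a i))) '' (a ⁻¹' T) := by
      rw [← Set.image_preimage_eq_of_subset hT, ← Set.image_comp, Set.preimage_image_eq _ ha]
      rfl
    rw [hT'] at hb ⊢
    exact hreg i trivial (a ⁻¹' T) (Set.subset_univ _) hiT b hb

end Smooth

/-! #### Charts of regular generators -/

open ODG in
/-- Finite families of generators of ideals `I k`, indexed by the fibers of `κ`, that are regular in
any order, together with a subset `S` of all the generators that generates the sum of the ideals and
is regular in any order, too. -/
structure IsChart {A : Type u} [CommRing A] {l : ℕ} (I : Fin l → Ideal A) {J : Type u}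
    (κ : J → Fin l) (f : J → A) (S : Set J) : Prop where
  regularOn (k : Fin l) : RegularOn f (κ ⁻¹' {k})
  span (k : Fin l) : Ideal.span (f '' (κ ⁻¹' {k})) = I k
  regularOn_inter : RegularOn f S
  span_inter : Ideal.span (f '' S) = ⨆ k, I k

section Smooth

variable {A : Type u} [CommRing A] (p : Ideal A) [p.IsPrime]

lemma map_eq_span_of_generates {B : Type u} [CommRing B] [Algebra A B] {I : Ideal A} {J : Type u}
    {f : J → A} {D : Set J} {g : A} (hg : IsUnit (algebraMap A B g)) (hf : ∀ j ∈ D, f j ∈ I)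
    (h : ∀ x ∈ I, g * x ∈ Ideal.span (f '' D)) :
    Ideal.span ((fun j ↦ algebraMap A B (f j)) '' D) = I.map (algebraMap A B) := by
  have h1 : Ideal.span ((fun j ↦ algebraMap A B (f j)) '' D) =
      (Ideal.span (f '' D)).map (algebraMap A B) := by
    rw [Ideal.map_span, ← Set.image_comp]
    rfl
  rw [h1]
  refine le_antisymm (Ideal.map_mono (Ideal.span_le.2 ?_)) (Ideal.map_le_iff_le_comap.2 ?_)
  · rintro _ ⟨j, hj, rfl⟩
    exact hf j hj
  · intro x hx
    have := Ideal.mem_map_of_mem (algebraMap A B) (h x hx)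
    rw [map_mul] at this
    exact (Ideal.unit_mul_mem_iff_mem _ hg).1 this

/-- Near a common point of the vanishing loci of ideals with smooth quotients such that the quotient
by the sum of the ideals is smooth, too, there are regular families of generators, compatible with
flat extensions. -/
lemma exists_isChart {k : Type u} [Field k] [Algebra k A] [Algebra.Smooth k A] {l : ℕ}
    (I : Fin l → Ideal A) (hI : ∀ i, (I i).FG) (hs : ∀ i, Algebra.FormallySmooth k (A ⧸ I i))
    (hs' : Algebra.FormallySmooth k (A ⧸ ⨆ i, I i)) (hp : ⨆ i, I i ≤ p) :
    ∃ (J : Type u) (_ : Finite J) (κ : J → Fin l) (f : J → A) (S : Set J) (g : A), g ∉ p ∧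
      ∀ (B : Type u) [CommRing B] [Algebra A B] [Module.Flat A B], IsUnit (algebraMap A B g) →
        IsChart (fun i ↦ (I i).map (algebraMap A B)) κ (fun j ↦ algebraMap A B (f j)) S := by
  have h1 (i : Fin l) := exists_regularOn p (k := k) (hI i) ((le_iSup I i).trans hp)
    (fun x : I i ↦ (x : A)) (fun x ↦ x.2) 1
    (fun h ↦ (‹p.IsPrime›).ne_top ((Ideal.eq_top_iff_one _).2 h))
    (fun x hx ↦ by rw [one_mul]; exact Ideal.subset_span ⟨⟨x, hx⟩, rfl⟩)
  choose D g hD hg hgen hreg using h1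
  let J := Σ i, D i
  let κ : J → Fin l := fun j ↦ j.1
  let f : J → A := fun j ↦ (j.2 : I j.1)
  have (i : Fin l) : Finite (D i) := hD i
  have hfI (j : J) : f j ∈ ⨆ i, I i := Ideal.mem_iSup_of_mem j.1 j.2.1.2
  have himg (i : Fin l) : f '' (κ ⁻¹' {i}) = (fun x : I i ↦ (x : A)) '' D i := by
    ext x
    constructor
    · rintro ⟨⟨i', j⟩, rfl : i' = i, rfl⟩
      exact ⟨j, j.2, rfl⟩
    · rintro ⟨j, hj, rfl⟩
      exact ⟨⟨i, j, hj⟩, rfl, rfl⟩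
  -- The union of the families generates the sum of the ideals near `p`.
  obtain ⟨S, g', -, hg', hgen', hreg'⟩ := exists_regularOn p (k := k) (I := ⨆ i, I i)
    (Submodule.fg_iSup _ hI) hp f hfI (∏ i, g i) (fun h ↦ by
      obtain ⟨i, -, hi⟩ := (Ideal.IsPrime.prod_mem_iff).1 h
      exact hg i hi) (fun x hx ↦ by
      induction hx using Submodule.iSup_induction' with
      | mem i x hx =>
        rw [← Finset.prod_erase_mul Finset.univ g (Finset.mem_univ i), mul_assoc]
        refine Ideal.mul_mem_left _ _ (Ideal.span_mono ?_ (hgen i x hx))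
        rw [← himg]
        exact Set.image_subset_range _ _
      | zero => rw [mul_zero]; exact zero_mem _
      | add x y _ _ hx hy => rw [mul_add]; exact add_mem hx hy)
  refine ⟨J, inferInstance, κ, f, S, (∏ i, g i) * g', fun h ↦ ?_, fun B _ _ _ hB ↦ ?_⟩
  · obtain h | h := Ideal.IsPrime.mem_or_mem ‹_› h
    · obtain ⟨i, -, hi⟩ := (Ideal.IsPrime.prod_mem_iff).1 h
      exact hg i hi
    · exact hg' h
  · rw [map_mul, map_prod] at hB
    have hB' := isUnit_of_mul_isUnit_right hB
    have hBi (i : Fin l) : IsUnit (algebraMap A B (g i)) :=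
      isUnit_of_dvd_unit (Finset.dvd_prod_of_mem (fun i ↦ algebraMap A B (g i)) (Finset.mem_univ i))
        (isUnit_of_mul_isUnit_left hB)
    refine ⟨fun i ↦ ?_, fun i ↦ ?_, hreg' B hB', ?_⟩
    · rintro ⟨i', j⟩ (rfl : i' = i) T hT hj a ha
      have hT' : (fun j ↦ algebraMap A B (f j)) '' T =
          (fun x : I i' ↦ algebraMap A B x) '' {x | ∃ h : x ∈ D i', ⟨i', x, h⟩ ∈ T} := by
        ext y
        constructor
        · rintro ⟨⟨i'', x⟩, hx, rfl⟩
          obtain rfl : i'' = i' := hT hx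
          exact ⟨x, ⟨x.2, hx⟩, rfl⟩
        · rintro ⟨x, ⟨hx, hx'⟩, rfl⟩
          exact ⟨_, hx', rfl⟩
      rw [hT'] at ha ⊢
      exact hreg i' B (hBi i') j j.2 _ (fun x hx ↦ hx.1) (fun h ↦ hj h.2) a ha
    · refine map_eq_span_of_generates (hBi i) (fun j hj ↦ ?_) fun x hx ↦ ?_
      · obtain rfl : j.1 = i := hj
        exact j.2.1.2
      · rw [himg]
        exact hgen i x hx
    · rw [← Ideal.map_iSup]
      exact map_eq_span_of_generates hB' (fun j _ ↦ hfI j) hgen'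

end Smooth

/-! #### The multitor over a chart -/

section Evaluation

open ODG

variable {C : Type u} [SmallCategory C] {R : Cᵒᵖ ⥤ CommRingCat.{u}} {l : ℕ} {F : Fin l → PMod R}

/-- The multitor vanishes where the unit ideal is the sum of ideals that annihilate the factors: the
identity of the tensor product of the resolutions is then null-homotopic. -/
lemma presheafTor_subsingleton (q : ℕ) (U : Cᵒᵖ) (w : Fin l → R.obj U)
    (hw : ∀ k (x : Sec (F k) U), w k • x = 0) (h1 : ∑ k, w k = 1) :
    Subsingleton (Sec (presheafTor q F) U) := by
  let X (k : Fin l) : SecOps (freeResolution (F k)) U PUnit.{u + 1} :=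
    freeOps (F k) 0 (fun _ ↦ w k) fun _ ↦ hw k
  have hX : (tensorFamily l fun k ↦ (X k).toODG).w PUnit.unit = 1 :=
    (tensorFamily_w _ _).trans h1
  refine subsingleton_of_forall_eq 0 fun c ↦ ?_
  obtain ⟨t, -, hd, hc⟩ := exists_isTor_of_sec c
  obtain ⟨t, rfl⟩ := (totMap_bijective X).2 t
  have hd' : (tensorFamily l fun k ↦ (X k).toODG).d t = 0 := (totMap_bijective X).1 (by
    rw [totMap_d, map_zero]
    exact hd)
  refine hc.eq_zero_iff.2 ⟨totMap l X ((tensorFamily l fun k ↦ (X k).toODG).op PUnit.unit t), ?_⟩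
  have := ((tensorFamily l fun k ↦ (X k).toODG).isHtpy PUnit.unit).d_add t
  rw [hd', map_zero, add_zero, hX, one_smul] at this
  exact (congrArg (totMap l X) this.symm).trans (totMap_d X _)

/-- Over an object with regular families of generators of the annihilators, the map from formal
combinations of tuples to the multitor is surjective, with kernel the relations between the products
of the vectors that have as coordinates the coefficients in front of the superfluous generators. -/
lemma wordHom_chart (P : ∀ k, Pointed (F k)) (q : ℕ) (U : Cᵒᵖ)
    (hP : ∀ k (x : Sec (F k) U), ∃ a : R.obj U, x = a • (P k).pt U)
    {I : Fin l → Ideal (R.obj U)} (hI : ∀ k a, a ∈ I k ↔ a • (P k).pt U = 0)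
    {J : Type u} [Fintype J] [DecidableEq J] {κ : J → Fin l} {f : J → R.obj U} {S : Set J}
    [DecidablePred (· ∈ S)] (hf : IsChart I κ f S)
    {B : Type u} [CommRing B] {V : Type u} [AddCommGroup V] [Module B V] (σ : R.obj U →+* B)
    (hσ : Function.Surjective σ) (hker : RingHom.ker σ = ⨆ k, I k)
    (c : Cyc P U → J → R.obj U) (hc : ∀ z k, z.1 k = ∑ j with κ j = k, c z j * f j)
    (e : J → V) (δ : J → Module.Dual B V) (hδ : ∀ j ∉ S, δ j (e j) = 1)
    (hδ' : ∀ j ∉ S, ∀ j' ∉ S, j ≠ j' → δ j (e j') = 0) (v : Cyc P U → V)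
    (hv : ∀ z, v z = ∑ j with j ∉ S, σ (c z j) • e j) (hve : ∀ j ∉ S, ∃ z, v z = e j) :
    Function.Surjective (secMap (wordHom P q) U) ∧ ∀ x : (tuples P q).obj U →₀ R.obj U,
      secMap (wordHom P q) U (freeEl x) = 0 ↔
        ODG.prodComb σ v (x.mapDomain (tupleList P)) = 0 := by
  -- The words are computed in the Koszul complex of all generators, where the family with index `S`
  -- is eliminated.
  let L (k : Fin l) : List J := (Finset.univ.filter fun j ↦ κ j = k).toList
  have hL (k : Fin l) : {j | j ∈ L k} = κ ⁻¹' {k} := by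
    ext j
    simp [L]
  have hspan (k : Fin l) : Ideal.span (f '' {j | j ∈ L k}) = I k := by rw [hL, hf.span]
  have hquot (k : Fin l) : ∃ e : Sec (F k) U ≃ₗ[R.obj U] R.obj U ⧸ Ideal.span (f '' {j | j ∈ L k}),
      e ((P k).pt U) = 1 := by
    let φ : R.obj U →ₗ[R.obj U] Sec (F k) U := LinearMap.toSpanSingleton _ _ ((P k).pt U)
    have hφ : Function.Surjective φ := fun x ↦ (hP k x).imp fun a h ↦ h.symm
    have hk : LinearMap.ker φ = Ideal.span (f '' {j | j ∈ L k}) := by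
      ext a
      rw [hspan, hI, LinearMap.mem_ker]
      rfl
    refine ⟨(φ.quotKerEquivOfSurjective hφ).symm.trans (Submodule.quotEquivOfEq _ _ hk), ?_⟩
    have : (φ.quotKerEquivOfSurjective hφ).symm ((P k).pt U) = Submodule.Quotient.mk 1 := by
      rw [LinearEquiv.symm_apply_eq]
      exact (one_smul (R.obj U) _).symm
    rw [LinearEquiv.trans_apply, this]
    rfl
  choose eq heq using hquot
  have hex := sim_tensorFamily_kos (c := c) L (fun k ↦ by
      rw [hL]
      exact hf.regularOn k) (fun k ↦ Finset.nodup_toList _)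
    (fun k k' hk j hj hj' ↦ hk (by
      rw [← (show κ j = k by simpa [L] using hj), (show κ j = k' by simpa [L] using hj')]))
    (fun k ↦ freeRes (F k) ((P k).pt U) (fun z : Cyc P U ↦ z.1 k)
      (fun z ↦ (P k).ann U _ (z.2.1 k)) (eq k) (heq k))
    (fun k z ↦ (hc z k).trans (Finset.sum_map_toList _ _).symm)
  obtain ⟨L', hL', hm, hsim⟩ := hex
  have hm' (j : J) : j ∈ L' := (hm j).2 ⟨κ j, by simp [L]⟩
  have hfilter (g : J → V) : ((L'.filter (· ∉ S)).map g).sum = ∑ j with j ∉ S, g j := by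
    have : (L'.filter (· ∉ S)).toFinset = Finset.univ.filter (· ∉ S) := by
      ext j
      simp [hm']
    rw [← this, List.sum_toFinset _ (hL'.filter _)]
  have hSI : Ideal.span (f '' {j | j ∈ L' ∧ j ∈ S}) = ⨆ k, I k := by
    rw [← hf.span_inter]
    congr 2
    ext j
    simp [hm']
  refine wordHom_spec P q U σ v (wordComb_spec c e δ hf.regularOn_inter L' hL' hsim
    (fam_w P U) hσ (hker.trans hSI.symm) (fun j _ ↦ ?_) (fun j _ hj ↦ hδ j hj)
    (fun j _ hj j' _ hj' ↦ hδ' j hj j' hj') v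
    (fun z ↦ (hv z).trans ((hfilter fun j ↦ σ (c z j) • e j).symm.trans
      (by unfold vec; congr!)))
    fun j _ hj ↦ hve j hj)
  have : f j ∈ RingHom.ker σ := by
    rw [hker, ← iSup_congr hspan]
    exact Ideal.mem_iSup_of_mem (κ j) (Ideal.subset_span ⟨j, by simp [L], rfl⟩)
  exact this

end Evaluation

/-! ### Charts on a smooth scheme -/

section Geometry

lemma exists_sum_of_mem_iSup {A : Type u} [CommRing A] {l : ℕ} (I : Fin l → Ideal A) {x : A}
    (hx : x ∈ ⨆ i, I i) : ∃ w : Fin l → A, (∀ i, w i ∈ I i) ∧ ∑ i, w i = x := by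
  induction hx using Submodule.iSup_induction' with
  | mem i x hx =>
    refine ⟨Pi.single i x, fun j ↦ ?_, by simp⟩
    obtain rfl | h := eq_or_ne j i
    · simpa using hx
    · simp [h]
  | zero => exact ⟨0, fun i ↦ zero_mem _, by simp⟩
  | add x y _ _ hx hy =>
    obtain ⟨w, hw, rfl⟩ := hx
    obtain ⟨w', hw', rfl⟩ := hy
    exact ⟨w + w', fun i ↦ add_mem (hw i) (hw' i), by simp [Finset.sum_add_distrib]⟩

/-- The restriction of functions. -/
abbrev rr {X : Scheme.{u}} {U V : X.Opens} (h : V ≤ U) : Γ(X, U) →+* Γ(X, V) :=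
  (X.presheaf.map (homOfLE h).op).hom

variable {M : Scheme.{u}} {l : ℕ} (Y : Fin l → M.IdealSheafData)

lemma ideal_iSup_apply (U : M.affineOpens) : (⨆ i, Y i).ideal U = ⨆ i, (Y i).ideal U := by
  rw [Scheme.IdealSheafData.ideal_iSup, iSup_apply]

/-- Away from the intersection, the unit ideal is locally the sum of the ideals. -/
lemma exists_sum_eq_one {p : M} (hp : p ∉ (⨆ i, Y i).support) {W : M.Opens} (hpW : p ∈ W) :
    ∃ U : M.affineOpens, U.1 ≤ W ∧ p ∈ U.1 ∧ ∃ w : Fin l → Γ(M, U.1),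
      (∀ i, w i ∈ (Y i).ideal U) ∧ ∑ i, w i = 1 := by
  obtain ⟨_, ⟨U₀, hU₀, rfl⟩, hpU₀, hUW⟩ := M.isBasis_affineOpens.exists_subset_of_mem_open hpW W.2
  rw [Scheme.IdealSheafData.mem_support_iff_of_mem (U := ⟨U₀, hU₀⟩) hpU₀,
    Scheme.mem_zeroLocus_iff] at hp
  push Not at hp
  obtain ⟨g, hg, hpg⟩ := hp
  rw [SetLike.mem_coe, ideal_iSup_apply] at hg
  obtain ⟨w, hw, rfl⟩ := exists_sum_of_mem_iSup _ hg
  let g := ∑ i, w i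
  let U : M.affineOpens := ⟨M.basicOpen g, hU₀.basicOpen g⟩
  have hle : U.1 ≤ U₀ := M.basicOpen_le g
  have hu : IsUnit (rr hle g) := RingedSpace.isUnit_res_basicOpen _ g
  obtain ⟨u, hu⟩ := hu
  refine ⟨U, hle.trans hUW, hpg, fun i ↦ ↑u⁻¹ * rr hle (w i), fun i ↦ ?_, ?_⟩
  · refine Ideal.mul_mem_left _ _ ?_
    exact (Y i).ideal_le_comap_ideal (U := U) (V := ⟨U₀, hU₀⟩) hle (hw i)
  · rw [← Finset.mul_sum, ← map_sum, ← hu]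
    exact u.inv_mul

variable {k : Type u} [Field k] (f : M ⟶ Spec (CommRingCat.of k))

/-- The action of the base field on the functions on an open subset. -/
def scalars (U : M.Opens) : k →+* Γ(M, U) :=
  (f.appLE ⊤ U le_top).hom.comp (Scheme.ΓSpecIso (CommRingCat.of k)).inv.hom

lemma smooth_scalars [Smooth f] {U : M.Opens} (hU : IsAffineOpen U) :
    (scalars f U).Smooth :=
  RingHom.Smooth.respectsIso.2 _
    (Scheme.ΓSpecIso (CommRingCat.of k)).symm.commRingCatIsoToRingEquiv
    (f.smooth_appLE (isAffineOpen_top _) hU le_top)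

lemma flat_rr {U V : M.Opens} (hU : IsAffineOpen U) (hV : IsAffineOpen V) (h : V ≤ U) :
    (rr h).Flat := by
  have := Flat.flat_appLE (𝟙 M) hU hV h
  simp only [Scheme.Hom.appLE, Scheme.Hom.id_app] at this
  exact (congrArg (fun φ ↦ RingHom.Flat (CommRingCat.Hom.hom φ)) (Category.id_comp _)).mp this

lemma formallySmooth_quotient (I : M.IdealSheafData) (hI : Smooth (I.subschemeι ≫ f))
    (U : M.affineOpens) :
    letI := (scalars f U.1).toAlgebra
    Algebra.FormallySmooth k (Γ(M, U.1) ⧸ I.ideal U) := by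
  letI := (scalars f U.1).toAlgebra
  let W := I.subschemeι ⁻¹ᵁ U.1
  letI := (scalars (I.subschemeι ≫ f) W).toAlgebra
  have hs : (scalars (I.subschemeι ≫ f) W).Smooth := smooth_scalars _ (U.2.preimage _)
  have : Algebra.Smooth k Γ(I.subscheme, W) := hs
  let φ : Γ(M, U.1) →ₐ[k] Γ(I.subscheme, W) :=
    { toRingHom := (I.subschemeι.app U.1).hom
      commutes' := fun a ↦ by
        have h : f.appLE ⊤ U.1 le_top ≫ I.subschemeι.app U.1 =
            (I.subschemeι ≫ f).appLE ⊤ W le_top := by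
          refine (congrArg (f.appLE ⊤ U.1 le_top ≫ ·) I.subschemeι.app_eq_appLE).trans ?_
          exact Scheme.Hom.appLE_comp_appLE _ _ _ _ _ _ _
        exact ConcreteCategory.congr_hom h _ }
  have hker : I.ideal U = RingHom.ker φ := (I.ker_subschemeι_app U).symm
  let e := Ideal.quotientKerAlgEquivOfSurjective (f := φ) (I.subschemeι_app_surjective U)
  exact .of_equiv ((Ideal.quotientEquivAlgOfEq k hker).trans e).symm

/-- Near every point of the intersection there are regular families of generators. -/
lemma exists_isChart_affine [Smooth f] (hY : ∀ i, Smooth ((Y i).subschemeι ≫ f))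
    (hZ : Smooth ((⨆ i, Y i).subschemeι ≫ f)) {p : M} (hp : p ∈ (⨆ i, Y i).support) {W : M.Opens}
    (hpW : p ∈ W) :
    ∃ U : M.affineOpens, U.1 ≤ W ∧ p ∈ U.1 ∧ ∃ (J : Type u) (_ : Finite J) (κ : J → Fin l)
      (g : J → Γ(M, U.1)) (S : Set J), ∀ (V : M.affineOpens) (h : V.1 ≤ U.1),
        IsChart (fun i ↦ (Y i).ideal V) κ (fun j ↦ rr h (g j)) S := by
  obtain ⟨_, ⟨U₀, hU₀, rfl⟩, hpU₀, hUW⟩ := M.isBasis_affineOpens.exists_subset_of_mem_open hpW W.2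
  let U₁ : M.affineOpens := ⟨U₀, hU₀⟩
  rw [Scheme.IdealSheafData.mem_support_iff_of_mem (U := U₁) hpU₀,
    Scheme.mem_zeroLocus_iff] at hp
  letI := (scalars f U₀).toAlgebra
  have : Algebra.Smooth k Γ(M, U₀) := smooth_scalars f hU₀
  have : IsNoetherianRing Γ(M, U₀) := Algebra.FiniteType.isNoetherianRing k _
  -- The prime ideal of the point `p`.
  let P : Ideal Γ(M, U₀) :=
    (IsLocalRing.maximalIdeal (M.presheaf.stalk p)).comap (M.presheaf.germ U₀ p hpU₀).hom
  have hP (g : Γ(M, U₀)) : g ∉ P ↔ p ∈ M.basicOpen g := by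
    rw [Scheme.mem_basicOpen _ _ _ hpU₀, Ideal.mem_comap, IsLocalRing.mem_maximalIdeal,
      mem_nonunits_iff, not_not]
  obtain ⟨J, hJ, κ, g, S, s, hs, h⟩ := exists_isChart P (k := k) (fun i ↦ (Y i).ideal U₁)
    (fun i ↦ IsNoetherian.noetherian _) (fun i ↦ formallySmooth_quotient f _ (hY i) U₁)
    (by
      have := formallySmooth_quotient f _ hZ U₁
      rwa [ideal_iSup_apply] at this) (by
      rw [← ideal_iSup_apply]
      intro x hx
      by_contra hx'
      exact hp x hx ((hP x).1 hx'))
  have hle : M.basicOpen s ≤ U₀ := M.basicOpen_le s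
  refine ⟨⟨M.basicOpen s, hU₀.basicOpen s⟩, hle.trans hUW, (hP s).1 hs, J, hJ, κ,
    fun j ↦ rr hle (g j), S, fun V hV ↦ ?_⟩
  letI := (rr (hV.trans hle)).toAlgebra
  have : Module.Flat Γ(M, U₀) Γ(M, V.1) := flat_rr hU₀ V.2 (hV.trans hle)
  have h' := h Γ(M, V.1) (by
    have hu : IsUnit (rr hle s) := RingedSpace.isUnit_res_basicOpen _ s
    have := hu.map (rr hV)
    rwa [← ring_res_res hle hV] at this)
  convert h' using 1
  · funext i
    exact ((Y i).map_ideal (U := V) (V := U₁) (hV.trans hle)).symm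
  · funext j
    exact (ring_res_res hle hV (g j)).symm

end Geometry

/-! ### Sections of sheaves of modules on a scheme -/

section Sheaves

open Opposite TopologicalSpace

/-- The morphism of presheaves of modules given by linear maps between sections. -/
def secHom {C : Type u} [SmallCategory C] {R : Cᵒᵖ ⥤ CommRingCat.{u}} {F G : PMod R}
    (φ : ∀ U, Sec F U →ₗ[R.obj U] Sec G U)
    (hφ : ∀ {U V : Cᵒᵖ} (f : U ⟶ V) (x : Sec F U), φ V (secRes F f x) = secRes G f (φ U x)) :
    F ⟶ G where
  app U := ModuleCat.ofHom (φ U)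
  naturality f := by
    ext x
    exact hφ f x

variable {X : Scheme.{u}}

/-- Two sections of a sheaf that agree locally are equal. -/
lemma eq_of_local (F : X.Modules) {U : X.Opens} {s t : Γ(F, U)}
    (h : ∀ p ∈ U, ∃ (V : X.Opens) (hV : V ≤ U), p ∈ V ∧ res F hV s = res F hV t) : s = t := by
  choose V hV hp hst using h
  refine TopCat.Sheaf.eq_of_locally_eq' ⟨F.presheaf, F.isSheaf⟩ (fun p : U ↦ V p p.2) U
    (fun p ↦ homOfLE (hV p p.2)) (fun p hpU ↦ ?_) s t fun p ↦ hst p p.2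
  exact Opens.mem_iSup.2 ⟨⟨p, hpU⟩, hp p hpU⟩

/-- Sections of a sheaf that agree on the intersections can be glued. -/
lemma exists_glue (F : X.Modules) {U : X.Opens} {ι : Type*} (V : ι → X.Opens) (hV : ∀ i, V i ≤ U)
    (hU : U ≤ iSup V) (s : ∀ i, Γ(F, V i))
    (hs : ∀ i j, res F (inf_le_left : V i ⊓ V j ≤ V i) (s i) = res F inf_le_right (s j)) :
    ∃ t : Γ(F, U), ∀ i, res F (hV i) t = s i :=
  (TopCat.Sheaf.existsUnique_gluing' ⟨F.presheaf, F.isSheaf⟩ V U (fun i ↦ homOfLE (hV i)) hU s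
    (by intro i j; exact hs i j)).exists

/-! #### Sections of sheafifications -/

/-- The section of the associated sheaf given by a section of a presheaf of modules. -/
def toSh (P : PMod X.presheaf) (U : X.Opens) : Sec P (op U) →ₗ[Γ(X, U)] Γ(sheafify P, U) where
  toFun x := (((PresheafOfModules.sheafificationAdjunction
    (𝟙 X.ringCatSheaf.obj)).unit.app P).app (op U)).hom x
  map_add' := map_add _
  map_smul' r x := (((PresheafOfModules.sheafificationAdjunction
    (𝟙 X.ringCatSheaf.obj)).unit.app P).app (op U)).hom.map_smul r x

/-- The underlying morphism of presheaves of abelian groups. -/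
abbrev abSh (P : PMod X.presheaf) : P.presheaf ⟶ (sheafify P).presheaf :=
  CategoryTheory.toSheafify (Opens.grothendieckTopology X) P.presheaf

instance (P : PMod X.presheaf) :
    Presheaf.IsLocallyInjective (Opens.grothendieckTopology X) (abSh P) :=
  inferInstanceAs (Presheaf.IsLocallyInjective _ (CategoryTheory.toSheafify _ _))

instance (P : PMod X.presheaf) :
    Presheaf.IsLocallySurjective (Opens.grothendieckTopology X) (abSh P) :=
  inferInstanceAs (Presheaf.IsLocallySurjective _ (CategoryTheory.toSheafify _ _))

lemma toSh_res (P : PMod X.presheaf) {U V : X.Opens} (h : V ≤ U) (x : Sec P (op U)) :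
    toSh P V (secRes P (homOfLE h).op x) = res (sheafify P) h (toSh P U x) :=
  ConcreteCategory.congr_hom ((abSh P).naturality (homOfLE h).op) x

lemma toSh_locally_surjective (P : PMod X.presheaf) {U : X.Opens} (t : Γ(sheafify P, U)) {p : X}
    (hp : p ∈ U) : ∃ (V : X.Opens) (hV : V ≤ U) (x : Sec P (op V)), p ∈ V ∧
      toSh P V x = res (sheafify P) hV t := by
  obtain ⟨V, i, ⟨x, hx⟩, hpV⟩ := Presheaf.imageSieve_mem (Opens.grothendieckTopology X)
    (abSh P) t p hp
  exact ⟨V, i.le, x, hpV, hx⟩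

lemma toSh_locally_injective (P : PMod X.presheaf) {U : X.Opens} (x : Sec P (op U))
    (hx : toSh P U x = 0) {p : X} (hp : p ∈ U) :
    ∃ (V : X.Opens) (hV : V ≤ U), p ∈ V ∧ secRes P (homOfLE hV).op x = 0 := by
  obtain ⟨V, i, h, hpV⟩ := Presheaf.equalizerSieve_mem (Opens.grothendieckTopology X)
    (abSh P) x 0
    (hx.trans (map_zero (toSh P U)).symm) p hp
  exact ⟨V, i.le, hpV, h.trans (map_zero (secRes P i.op))⟩

/-- A morphism from a presheaf to a sheaf of modules, on sections. -/
def secTo {P : PMod X.presheaf} {G : X.Modules} (φ : P ⟶ G.val) (U : X.Opens) :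
    Sec P (op U) →ₗ[Γ(X, U)] Γ(G, U) :=
  (φ.app (op U)).hom

lemma secTo_res {P : PMod X.presheaf} {G : X.Modules} (φ : P ⟶ G.val) {U V : X.Opens}
    (h : V ≤ U) (x : Sec P (op U)) :
    secTo φ V (secRes P (homOfLE h).op x) = res G h (secTo φ U x) :=
  ConcreteCategory.congr_hom (((PresheafOfModules.toPresheaf _).map φ).naturality (homOfLE h).op) x

/-- The morphism from the associated sheaf given by a morphism from a presheaf to a sheaf. -/
def shDesc {P : PMod X.presheaf} {G : X.Modules} (φ : P ⟶ G.val) : sheafify P ⟶ G :=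
  ((PresheafOfModules.sheafificationAdjunction (𝟙 X.ringCatSheaf.obj)).homEquiv P G).symm
    (PresheafOfModules.homMk ((PresheafOfModules.toPresheaf _).map φ)
      fun U r m ↦ (φ.app U).hom.map_smul r m)

lemma shDesc_toSh {P : PMod X.presheaf} {G : X.Modules} (φ : P ⟶ G.val) {U : X.Opens}
    (x : Sec P (op U)) : (shDesc φ).app U (toSh P U x) = secTo φ U x := by
  have := ((PresheafOfModules.sheafificationAdjunction
    (𝟙 X.ringCatSheaf.obj)).homEquiv P G).apply_symm_apply
    (PresheafOfModules.homMk (M₂ := (PresheafOfModules.restrictScalars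
      (𝟙 X.ringCatSheaf.obj)).obj G.val) ((PresheafOfModules.toPresheaf _).map φ)
      fun U r m ↦ (φ.app U).hom.map_smul r m)
  exact congrArg (fun g ↦ (PresheafOfModules.Hom.app g (op U)).hom x)
    ((Adjunction.homEquiv_unit _ _ _ _).symm.trans this)

lemma sh_hom_ext {P : PMod X.presheaf} {G : X.Modules} {f g : sheafify P ⟶ G}
    (h : ∀ U x, f.app U (toSh P U x) = g.app U (toSh P U x)) : f = g := by
  refine Scheme.Modules.hom_ext _ _ fun U ↦ ?_
  ext t
  refine eq_of_local G fun p hp ↦ ?_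
  obtain ⟨V, hV, x, hpV, hx⟩ := toSh_locally_surjective P t hp
  exact ⟨V, hV, hpV, by rw [← app_res, ← app_res, ← hx, h]⟩

lemma sheafifyMap_toSh {P P' : PMod X.presheaf} (φ : P ⟶ P') {U : X.Opens} (x : Sec P (op U)) :
    (sheafifyMap φ).app U (toSh P U x) = toSh P' U (secMap φ (op U) x) :=
  (congrArg (fun g ↦ (PresheafOfModules.Hom.app g (op U)).hom x)
    ((PresheafOfModules.sheafificationAdjunction (𝟙 X.ringCatSheaf.obj)).unit.naturality φ)).symm

/-- A morphism from a presheaf to a sheaf that is locally injective and locally surjective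
exhibits the sheaf as the associated sheaf. -/
lemma isIso_shDesc {P : PMod X.presheaf} {G : X.Modules} (φ : P ⟶ G.val)
    (hi : ∀ (U : X.Opens) (x : Sec P (op U)), secTo φ U x = 0 → ∀ p ∈ U,
      ∃ (V : X.Opens) (hV : V ≤ U), p ∈ V ∧ secRes P (homOfLE hV).op x = 0)
    (hs : ∀ (U : X.Opens) (t : Γ(G, U)), ∀ p ∈ U, ∃ (V : X.Opens) (hV : V ≤ U)
      (x : Sec P (op V)), p ∈ V ∧ secTo φ V x = res G hV t) : IsIso (shDesc φ) := by
  rw [Scheme.Modules.Hom.isIso_iff_isIso_app]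
  intro U
  rw [ConcreteCategory.isIso_iff_bijective]
  have hinj (U : X.Opens) : Function.Injective ((shDesc φ).app U) := by
    refine (injective_iff_map_eq_zero ((shDesc φ).app U).hom).2 fun t ht ↦ ?_
    refine eq_of_local _ fun p hp ↦ ?_
    obtain ⟨V, hV, x, hpV, hx⟩ := toSh_locally_surjective P t hp
    have h0 : secTo φ V x = 0 := by
      rw [← shDesc_toSh, hx, app_res]
      exact (congrArg (res G hV) ht).trans (map_zero _)
    obtain ⟨V', hV', hpV', h'⟩ := hi V x h0 p hpV
    refine ⟨V', hV'.trans hV, hpV', ?_⟩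
    rw [res_res _ hV hV', ← hx, ← toSh_res, h', map_zero, map_zero]
  refine ⟨hinj U, fun t ↦ ?_⟩
  choose V hV x hp hx using hs U t
  obtain ⟨s, hs⟩ := exists_glue (sheafify P) (U := U) (fun p : U ↦ V p p.2) (fun p ↦ hV p p.2)
    (fun p hpU ↦ Opens.mem_iSup.2 ⟨⟨p, hpU⟩, hp p hpU⟩) (fun p ↦ toSh P _ (x p p.2))
    (fun p p' ↦ hinj _ (by
      rw [app_res, app_res, shDesc_toSh, shDesc_toSh, hx, hx, ← res_res, ← res_res]))
  refine ⟨s, eq_of_local G fun p hpU ↦ ⟨V p hpU, hV p hpU, hp p hpU, ?_⟩⟩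
  rw [← app_res, hs ⟨p, hpU⟩, shDesc_toSh, hx]

/-! #### Sheaves of homomorphisms -/

/-- The presheaf of homomorphisms between sheaves of modules is a sheaf. -/
lemma presheafHom_glue (F G : X.Modules) {U : X.Opens} {ι : Type*} (V : ι → X.Opens)
    (hV : ∀ i, V i ≤ U) (hU : U ≤ iSup V) (φ : ∀ i, localHom F G (V i))
    (hφ : ∀ i j, localHomRes F G (inf_le_left : V i ⊓ V j ≤ V i) (φ i) =
      localHomRes F G inf_le_right (φ j)) :
    ∃ ψ : localHom F G U, ∀ i, localHomRes F G (hV i) ψ = φ i := by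
  have hcov {W : X.Opens} (hW : W ≤ U) : W ≤ ⨆ i, W ⊓ V i := by
    rw [← inf_iSup_eq]
    exact le_inf le_rfl (hW.trans hU)
  have hφ' (i j) (W : X.Opens) (hi : W ≤ V i) (hj : W ≤ V j) (s : Γ(F, W)) :
      (φ i).1 ⟨W, hi⟩ s = (φ j).1 ⟨W, hj⟩ s :=
    congrArg (fun χ : localHom F G (V i ⊓ V j) ↦ χ.1 ⟨W, le_inf hi hj⟩ s) (hφ i j)
  have hex (W : {W : X.Opens // W ≤ U}) (s : Γ(F, W.1)) : ∃ t : Γ(G, W.1), ∀ i,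
      res G inf_le_left t = (φ i).1 ⟨W.1 ⊓ V i, inf_le_right⟩ (res F inf_le_left s) := by
    refine exists_glue G (fun i ↦ W.1 ⊓ V i) (fun i ↦ inf_le_left) (hcov W.2) _ fun i j ↦ ?_
    rw [← (φ i).2 ⟨W.1 ⊓ V i, inf_le_right⟩ ⟨_, inf_le_left.trans inf_le_right⟩ inf_le_left,
      ← (φ j).2 ⟨W.1 ⊓ V j, inf_le_right⟩ ⟨_, inf_le_right.trans inf_le_right⟩ inf_le_right,
      ← res_res, ← res_res]
    exact hφ' i j _ _ _ _
  have huniq (W : {W : X.Opens // W ≤ U}) {t t' : Γ(G, W.1)}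
      (h : ∀ i, res G (inf_le_left : W.1 ⊓ V i ≤ W.1) t = res G inf_le_left t') : t = t' := by
    refine eq_of_local G fun p hp ↦ ?_
    obtain ⟨i, hi⟩ := Opens.mem_iSup.1 (hcov W.2 hp)
    exact ⟨_, inf_le_left, hi, h i⟩
  choose t ht using hex
  refine ⟨⟨fun W ↦ ⟨⟨t W, fun s s' ↦ huniq W fun i ↦ ?_⟩, fun r s ↦ huniq W fun i ↦ ?_⟩,
    fun W W' h s ↦ huniq W' fun i ↦ ?_⟩, fun i ↦ localHom_ext fun W s ↦ ?_⟩
  · rw [map_add, ht, ht, ht, map_add, map_add]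
  · refine (ht W (r • s) i).trans ?_
    rw [map_smulₛₗ, map_smul, ← ht]
    exact ((res G _).map_smulₛₗ r (t W s)).symm
  · change res G inf_le_left (t W' (res F h s)) = res G inf_le_left (res G h (t W s))
    rw [ht, ← res_res F h inf_le_left, ← res_res G h inf_le_left,
      res_res F (inf_le_left : W.1 ⊓ V i ≤ W.1) (inf_le_inf_right _ h),
      res_res G (inf_le_left : W.1 ⊓ V i ≤ W.1) (inf_le_inf_right _ h), ht]
    exact (φ i).2 ⟨W.1 ⊓ V i, inf_le_right⟩ ⟨W'.1 ⊓ V i, inf_le_right⟩ _ _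
  · refine huniq ⟨W.1, W.2.trans (hV i)⟩ fun j ↦ ?_
    refine (ht ⟨W.1, W.2.trans (hV i)⟩ s j).trans ?_
    rw [← (φ i).2 W ⟨W.1 ⊓ V j, inf_le_left.trans W.2⟩ inf_le_left s]
    exact (hφ' i j _ _ _ _).symm

/-- A section of the sheaf of homomorphisms is a homomorphism. -/
lemma toSh_presheafHom_bijective (F G : X.Modules) (U : X.Opens) :
    Function.Bijective (toSh (presheafHom F G) U) := by
  have hsep {U : X.Opens} (φ : localHom F G U) (h : ∀ p ∈ U, ∃ (V : X.Opens) (hV : V ≤ U), p ∈ V ∧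
      localHomRes F G hV φ = 0) : φ = 0 := by
    refine localHom_ext fun W s ↦ eq_of_local G fun p hp ↦ ?_
    obtain ⟨V, hV, hpV, h0⟩ := h p (W.2 hp)
    refine ⟨W.1 ⊓ V, inf_le_left, ⟨hp, hpV⟩, ?_⟩
    rw [← φ.2 W ⟨W.1 ⊓ V, inf_le_left.trans W.2⟩ inf_le_left s]
    refine (congrArg (fun χ : localHom F G V ↦ χ.1 ⟨W.1 ⊓ V, inf_le_right⟩
      (res F inf_le_left s)) h0).trans ?_
    exact (map_zero (res G _)).symm
  have hinj (U : X.Opens) : Function.Injective (toSh (presheafHom F G) U) := by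
    refine (injective_iff_map_eq_zero _).2 fun φ hφ ↦ hsep φ fun p hp ↦ ?_
    exact toSh_locally_injective _ φ hφ hp
  refine ⟨hinj U, fun t ↦ ?_⟩
  choose V hV x hp hx using fun p (hp : p ∈ U) ↦ toSh_locally_surjective (presheafHom F G) t hp
  obtain ⟨ψ, hψ⟩ := presheafHom_glue F G (U := U) (fun p : U ↦ V p p.2) (fun p ↦ hV p p.2)
    (fun p hpU ↦ Opens.mem_iSup.2 ⟨⟨p, hpU⟩, hp p hpU⟩) (fun p ↦ x p p.2)
    (fun p p' ↦ hinj _ (by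
      refine (toSh_res (presheafHom F G) inf_le_left (x p p.2)).trans
        (Eq.trans ?_ (toSh_res (presheafHom F G) inf_le_right (x p' p'.2)).symm)
      rw [hx, hx, ← res_res, ← res_res]))
  refine ⟨ψ, eq_of_local _ fun p hpU ↦ ⟨V p hpU, hV p hpU, hp p hpU, ?_⟩⟩
  rw [← hx, ← hψ ⟨p, hpU⟩]
  exact (toSh_res (presheafHom F G) _ ψ).symm

end Sheaves

/-! ### Ideal sheaves and coefficient homomorphisms -/

section Ideals

open Opposite TopologicalSpace

variable {M Y : Scheme.{u}} (i : Y ⟶ M)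

/-- A morphism of sheaves of modules, on sections. -/
def appL {X : Scheme.{u}} {F G : X.Modules} (φ : F ⟶ G) (U : X.Opens) :
    Γ(F, U) →ₗ[Γ(X, U)] Γ(G, U) := (φ.val.app (op U)).hom

lemma appL_res {X : Scheme.{u}} {F G : X.Modules} (φ : F ⟶ G) {U V : X.Opens} (h : V ≤ U)
    (s : Γ(F, U)) : appL φ V (res F h s) = res G h (appL φ U s) := app_res φ h s

/-- The sheaf `i_* 𝒪_Y`. -/
abbrev pushO : M.Modules := (Scheme.Modules.pushforward i).obj (structureSheaf Y)

/-- The restriction of functions `𝒪_M → i_* 𝒪_Y`, on sections. -/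
def fnRes (U : M.Opens) : Γ(M, U) →ₗ[Γ(M, U)] Γ(pushO i, U) := appL (toPushforward i) U

lemma fnRes_rr {U V : M.Opens} (h : V ≤ U) (a : Γ(M, U)) :
    fnRes i V (rr h a) = res (pushO i) h (fnRes i U a) := appL_res (toPushforward i) h a

/-- The inclusion of the ideal sheaf, on sections. -/
def idealIncl (U : M.Opens) : Γ(idealSheaf i, U) →ₗ[Γ(M, U)] Γ(M, U) :=
  appL (kernel.ι (toPushforward i)) U

lemma idealIncl_res {U V : M.Opens} (h : V ≤ U) (s : Γ(idealSheaf i, U)) :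
    idealIncl i V (res _ h s) = rr h (idealIncl i U s) := appL_res (kernel.ι (toPushforward i)) h s

lemma fnRes_idealIncl (U : M.Opens) (s : Γ(idealSheaf i, U)) :
    fnRes i U (idealIncl i U s) = 0 :=
  congrArg (fun φ : idealSheaf i ⟶ pushO i ↦ appL φ U s) (kernel.condition (toPushforward i))

/-- The sections of a sheaf of modules over an open subset, as a functor. -/
abbrev sectionFunctor {X : Scheme.{u}} (U : X.Opens) : X.Modules ⥤ Ab.{u} :=
  Scheme.Modules.toPresheaf X ⋙ (evaluation _ _).obj (op U)

instance {X : Scheme.{u}} (U : X.Opens) : (sectionFunctor U).Additive where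

instance {X : Scheme.{u}} (U : X.Opens) : PreservesLimits (sectionFunctor U) :=
  have : PreservesLimits ((evaluation X.Opensᵒᵖ Ab.{u}).obj (op U)) := evaluationPreservesLimits _
  comp_preservesLimits (Scheme.Modules.toPresheaf X) ((evaluation _ _).obj (op U))

lemma idealIncl_injective (U : M.Opens) : Function.Injective (idealIncl i U) := by
  have : Mono ((sectionFunctor U).map (kernel.ι (toPushforward i))) := inferInstance
  exact (AddCommGrpCat.mono_iff_injective _).1 this

lemma exists_idealIncl {U : M.Opens} (a : Γ(M, U)) (ha : fnRes i U a = 0) :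
    ∃ s, idealIncl i U s = a := by
  have h := (ShortComplex.exact_of_f_is_kernel (.mk _ _ (kernel.condition (toPushforward i)))
    (kernelIsKernel _)).map_of_mono_of_preservesKernel (sectionFunctor U)
      (inferInstanceAs (Mono (kernel.ι (toPushforward i)))) inferInstance
  rw [ShortComplex.ab_exact_iff] at h
  exact h a ha

lemma exists_affine_le {U : M.Opens} {p : M} (hp : p ∈ U) :
    ∃ V : M.affineOpens, V.1 ≤ U ∧ p ∈ V.1 := by
  obtain ⟨_, ⟨V, hV, rfl⟩, hpV, hVU⟩ := M.isBasis_affineOpens.exists_subset_of_mem_open hp U.2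
  exact ⟨⟨V, hV⟩, hVU, hpV⟩

/-- Two sections that agree on all affine open subsets are equal. -/
lemma eq_of_affine (F : M.Modules) {U : M.Opens} {s t : Γ(F, U)}
    (h : ∀ (V : M.affineOpens) (hV : V.1 ≤ U), res F hV s = res F hV t) : s = t := by
  refine eq_of_local F fun p hp ↦ ?_
  obtain ⟨V, hV, hpV⟩ := exists_affine_le hp
  exact ⟨V, hV, hpV, h V hV⟩

/-- Functions on `U` that generate the ideal of `Y` on all affine open subsets of `U`, such that the
coefficients of a relation between them vanish on `Y`. -/
structure IsRegGen {U : M.Opens} {J : Type u} [Fintype J] (f : J → Γ(M, U)) : Prop where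
  mem (j : J) : fnRes i U (f j) = 0
  span (V : M.affineOpens) (h : V.1 ≤ U) (x : Γ(M, V.1)) (hx : fnRes i V.1 x = 0) :
    ∃ a : J → Γ(M, V.1), x = ∑ j, a j * rr h (f j)
  rel (V : M.affineOpens) (h : V.1 ≤ U) (a : J → Γ(M, V.1)) (ha : ∑ j, a j * rr h (f j) = 0)
    (j : J) : fnRes i V.1 (a j) = 0

variable {i} in
/-- The coefficients in front of functions that generate the ideal of `Y` and that are regular in
any order define homomorphisms from the ideal sheaf to `i_* 𝒪_Y`. -/
lemma IsRegGen.exists_dual {U : M.Opens} {J : Type u} [Fintype J] {f : J → Γ(M, U)}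
    (hf : IsRegGen i f) (j : J) : ∃ e : localHom (idealSheaf i) (pushO i) U,
      ∀ (V : M.Opens) (h : V ≤ U) (s : Γ(idealSheaf i, V)) (a : J → Γ(M, V)),
        idealIncl i V s = ∑ j, a j * rr h (f j) → e.1 ⟨V, h⟩ s = fnRes i V (a j) := by
  -- `P V s t` says that `t` is the coefficient of `f j` in `s` on all affine open subsets. Such a
  -- `t` is unique, and it exists by gluing.
  let P (V : {V : M.Opens // V ≤ U}) (s : Γ(idealSheaf i, V.1)) (t : Γ(pushO i, V.1)) : Prop :=
    ∀ (W : M.affineOpens) (h : W.1 ≤ V.1), ∃ a : J → Γ(M, W.1),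
      rr h (idealIncl i V.1 s) = ∑ j, a j * rr (h.trans V.2) (f j) ∧
        res (pushO i) h t = fnRes i W.1 (a j)
  have hcoef (W : M.affineOpens) (h : W.1 ≤ U) (a b : J → Γ(M, W.1))
      (hab : ∑ j, a j * rr h (f j) = ∑ j, b j * rr h (f j)) :
      fnRes i W.1 (a j) = fnRes i W.1 (b j) := by
    rw [← sub_eq_zero, ← map_sub]
    refine hf.rel W h (a - b) ?_ j
    simp only [Pi.sub_apply, sub_mul, Finset.sum_sub_distrib, hab, sub_self]
  have huniq {V s t t'} (h : P V s t) (h' : P V s t') : t = t' := by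
    refine eq_of_affine _ fun W hW ↦ ?_
    obtain ⟨a, ha, hat⟩ := h W hW
    obtain ⟨a', ha', hat'⟩ := h' W hW
    rw [hat, hat']
    exact hcoef W _ a a' (ha.symm.trans ha')
  have hres {V V' : {V : M.Opens // V ≤ U}} (hV : V'.1 ≤ V.1) {s t} (h : P V s t) :
      P V' (res _ hV s) (res _ hV t) := by
    intro W hW
    obtain ⟨a, ha, hat⟩ := h W (hW.trans hV)
    refine ⟨a, ?_, ?_⟩
    · rw [← ha, idealIncl_res]
      exact (ring_res_res hV hW _).symm
    · rw [← hat, ← res_res]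
  have hsum {V : {V : M.Opens // V ≤ U}} {V' : M.Opens} (hV : V' ≤ V.1) (a : J → Γ(M, V.1)) :
      rr hV (∑ j, a j * rr V.2 (f j)) = ∑ j, rr hV (a j) * rr (hV.trans V.2) (f j) := by
    rw [map_sum]
    refine Finset.sum_congr rfl fun j _ ↦ ?_
    rw [map_mul]
    exact congrArg _ (ring_res_res V.2 hV (f j)).symm
  have hP (V : {V : M.Opens // V ≤ U}) (s) (a : J → Γ(M, V.1))
      (ha : idealIncl i V.1 s = ∑ j, a j * rr V.2 (f j)) : P V s (fnRes i V.1 (a j)) := by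
    refine fun W hW ↦ ⟨fun j ↦ rr hW (a j), ?_, (fnRes_rr i hW _).symm⟩
    rw [ha, hsum]
  have hex (V : {V : M.Opens // V ≤ U}) (s : Γ(idealSheaf i, V.1)) : ∃ t, P V s t := by
    have h1 (W : {W : M.affineOpens // W.1 ≤ V.1}) : ∃ a : J → Γ(M, W.1.1),
        idealIncl i W.1.1 (res _ W.2 s) = ∑ j, a j * rr (W.2.trans V.2) (f j) :=
      hf.span W.1 (W.2.trans V.2) _ (fnRes_idealIncl i _ _)
    choose a ha using h1
    obtain ⟨t, ht⟩ := exists_glue (pushO i) (U := V.1)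
      (fun W : {W : M.affineOpens // W.1 ≤ V.1} ↦ W.1.1) (fun W ↦ W.2) (fun p hp ↦ by
        obtain ⟨W, hW, hpW⟩ := exists_affine_le hp
        exact Opens.mem_iSup.2 ⟨⟨W, hW⟩, hpW⟩) (fun W ↦ fnRes i W.1.1 (a W j)) (fun W W' ↦ by
        have hle : W.1.1 ⊓ W'.1.1 ≤ U := inf_le_left.trans (W.2.trans V.2)
        have e1 := hres (V := ⟨W.1.1, W.2.trans V.2⟩) (V' := ⟨_, hle⟩) inf_le_left
          (hP ⟨W.1.1, W.2.trans V.2⟩ _ (a W) (ha W))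
        have e2 := hres (V := ⟨W'.1.1, W'.2.trans V.2⟩) (V' := ⟨_, hle⟩) inf_le_right
          (hP ⟨W'.1.1, W'.2.trans V.2⟩ _ (a W') (ha W'))
        rw [← res_res] at e1 e2
        exact huniq e1 e2)
    refine ⟨t, fun W hW ↦ ⟨a ⟨W, hW⟩, ?_, ht ⟨W, hW⟩⟩⟩
    rw [← ha, idealIncl_res]
  choose t ht using hex
  refine ⟨⟨fun V ↦ ⟨⟨t V, fun s s' ↦ huniq (ht V _) fun W hW ↦ ?_⟩, fun r s ↦
    huniq (ht V _) fun W hW ↦ ?_⟩, fun V V' h s ↦ huniq (ht V' _) (hres h (ht V s))⟩,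
    fun V h s a ha ↦ huniq (ht ⟨V, h⟩ s) (hP ⟨V, h⟩ s a ha)⟩
  · obtain ⟨a, ha, hat⟩ := ht V s W hW
    obtain ⟨a', ha', hat'⟩ := ht V s' W hW
    refine ⟨a + a', ?_, ?_⟩
    · rw [map_add, map_add, ha, ha', ← Finset.sum_add_distrib]
      exact Finset.sum_congr rfl fun j _ ↦ (add_mul _ _ _).symm
    · rw [map_add, hat, hat']
      exact (map_add _ _ _).symm
  · obtain ⟨a, ha, hat⟩ := ht V s W hW
    refine ⟨fun j ↦ rr hW r * a j, ?_, ?_⟩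
    · rw [map_smul, smul_eq_mul, map_mul, ha, Finset.mul_sum]
      exact Finset.sum_congr rfl fun j _ ↦ (mul_assoc _ _ _).symm
    · refine (map_smulₛₗ (res (pushO i) hW) r (t V s)).trans ?_
      rw [hat]
      exact (map_smul (fnRes i W.1) (rr hW r) (a j)).symm

variable {i} in
/-- Homomorphisms from the ideal sheaf are determined by their values on generators. -/
lemma IsRegGen.localHom_ext {U : M.Opens} {J : Type u} [Fintype J] {f : J → Γ(M, U)}
    (hf : IsRegGen i f) (s : J → Γ(idealSheaf i, U)) (hs : ∀ j, idealIncl i U (s j) = f j)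
    {G : M.Modules} {φ ψ : localHom (idealSheaf i) G U}
    (h : ∀ j, φ.1 ⟨U, le_rfl⟩ (s j) = ψ.1 ⟨U, le_rfl⟩ (s j)) : φ = ψ := by
  refine MultiTor.localHom_ext fun V x ↦ eq_of_affine G fun W hW ↦ ?_
  rw [← φ.2 V ⟨W, hW.trans V.2⟩ hW, ← ψ.2 V ⟨W, hW.trans V.2⟩ hW]
  generalize res _ hW x = x
  obtain ⟨a, ha⟩ := hf.span W (hW.trans V.2) (idealIncl i W.1 x) (fnRes_idealIncl i _ _)
  have hx : x = ∑ j, a j • res _ (hW.trans V.2) (s j) := by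
    refine idealIncl_injective i _ ?_
    rw [ha, map_sum]
    exact Finset.sum_congr rfl fun j _ ↦ by rw [map_smul, idealIncl_res, hs, smul_eq_mul]
  rw [hx, map_sum, map_sum]
  refine Finset.sum_congr rfl fun j _ ↦ ?_
  rw [map_smul, map_smul, φ.2 ⟨U, le_rfl⟩ ⟨W, hW.trans V.2⟩, ψ.2 ⟨U, le_rfl⟩ ⟨W, hW.trans V.2⟩, h]

end Ideals

/-! #### Homomorphisms over an open subset as morphisms of sheaves -/

section Cut

open Opposite TopologicalSpace

variable {X : Scheme.{u}}

/-- The intersection of `V` with `W`, as the image of the preimage in `W`. -/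
abbrev star (W V : X.Opens) : X.Opens := W.ι ''ᵁ W.ι ⁻¹ᵁ V

lemma star_eq (W V : X.Opens) : star W V = W ⊓ V := by
  rw [star, Scheme.Hom.image_preimage_eq_opensRange_inf, Scheme.Opens.opensRange_ι]

lemma star_le_left (W V : X.Opens) : star W V ≤ W := (star_eq W V).le.trans inf_le_left

lemma star_le_right (W V : X.Opens) : star W V ≤ V := (star_eq W V).le.trans inf_le_right

lemma le_star {W V V' : X.Opens} (h : V' ≤ W) (h' : V' ≤ V) : V' ≤ star W V :=
  (le_inf h h').trans (star_eq W V).ge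

lemma star_mono (W : X.Opens) {V V' : X.Opens} (h : V' ≤ V) : star W V' ≤ star W V :=
  le_star (star_le_left W V') ((star_le_right W V').trans h)

/-- The direct image of the restriction of `G` to `W`, with sections `V ↦ G(W ∩ V)`. -/
def cut (G : X.Modules) (W : X.Opens) : X.Modules :=
  (Scheme.Modules.pushforward W.ι).obj ((Scheme.Modules.restrictFunctor W.ι).obj G)

/-- The sections of `cut G W`. -/
def cutEquiv (G : X.Modules) (W V : X.Opens) : Γ(cut G W, V) ≃+ Γ(G, star W V) := .refl _

lemma cutEquiv_smul (G : X.Modules) (W V : X.Opens) (r : Γ(X, V)) (s : Γ(cut G W, V)) :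
    cutEquiv G W V (r • s) = rr (star_le_right W V) r • cutEquiv G W V s := by
  change (W.ι.appIso _).inv (W.ι.app V r) • cutEquiv G W V s = _
  rw [← ConcreteCategory.comp_apply, Scheme.Hom.app_appIso_inv]
  rfl

lemma cutEquiv_res (G : X.Modules) (W : X.Opens) {V V' : X.Opens} (h : V' ≤ V)
    (s : Γ(cut G W, V)) :
    cutEquiv G W V' (res _ h s) = res G (star_mono W h) (cutEquiv G W V s) := rfl

/-- The morphism of sheaves of modules given by linear maps between sections. -/
def modHom {F G : X.Modules} (φ : ∀ U : X.Opens, Γ(F, U) →ₗ[Γ(X, U)] Γ(G, U))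
    (hφ : ∀ {U V : X.Opens} (h : V ≤ U) (s : Γ(F, U)), φ V (res F h s) = res G h (φ U s)) :
    F ⟶ G :=
  ⟨{ app := fun U ↦ ModuleCat.ofHom (X := F.val.obj U) (Y := G.val.obj U)
      { toFun := fun s ↦ φ U.unop s
        map_add' := fun s t ↦ (φ U.unop).map_add s t
        map_smul' := fun r s ↦ (φ U.unop).map_smul r s }
     naturality := fun {U V} f ↦ by
      ext s
      exact hφ f.unop.le s }⟩

/-- The morphism to `cut G W` given by a homomorphism over `W`. -/
def toCut {F G : X.Modules} {W : X.Opens} (φ : localHom F G W) : F ⟶ cut G W :=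
  modHom
    (fun V ↦
      { toFun := fun s ↦ (cutEquiv G W V).symm
          (φ.1 ⟨star W V, star_le_left _ _⟩ (res F (star_le_right W V) s))
        map_add' := fun s t ↦ by rw [map_add, map_add, map_add]
        map_smul' := fun r s ↦ (cutEquiv G W V).injective (by
          rw [map_smulₛₗ, map_smul, RingHom.id_apply, cutEquiv_smul, AddEquiv.apply_symm_apply,
            AddEquiv.apply_symm_apply]) })
    (fun {V V'} h s ↦ (cutEquiv G W V').injective (by
      rw [cutEquiv_res]
      change φ.1 ⟨star W V', star_le_left _ _⟩ (res F _ (res F h s)) =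
        res G (star_mono W h) (φ.1 ⟨star W V, star_le_left _ _⟩ (res F _ s))
      rw [← φ.2 ⟨star W V, star_le_left _ _⟩ ⟨star W V', star_le_left _ _⟩, ← res_res,
        ← res_res]))

lemma toCut_app {F G : X.Modules} {W : X.Opens} (φ : localHom F G W) (V : X.Opens) (s : Γ(F, V)) :
    cutEquiv G W V ((toCut φ).app V s) =
      φ.1 ⟨star W V, star_le_left _ _⟩ (res F (star_le_right W V) s) := rfl

/-- The homomorphism over `W` given by a morphism to `cut G W`. -/
def ofCut {F G : X.Modules} {W : X.Opens} (θ : F ⟶ cut G W) : localHom F G W :=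
  ⟨fun V ↦
    { toFun := fun s ↦ res G (le_star V.2 le_rfl) (cutEquiv G W V.1 (θ.app V.1 s))
      map_add' := fun s t ↦ by rw [map_add, map_add, map_add]
      map_smul' := fun r s ↦ by
        rw [Scheme.Modules.Hom.app_smul, cutEquiv_smul, map_smulₛₗ]
        congr 1
        rw [← ring_res_res, ring_res_self]
        rfl },
    fun V V' h s ↦ by
      change res G _ (cutEquiv G W V'.1 (θ.app V'.1 (res F h s))) =
        res G h (res G _ (cutEquiv G W V.1 (θ.app V.1 s)))
      rw [app_res, cutEquiv_res, ← res_res, ← res_res]⟩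

lemma ofCut_apply {F G : X.Modules} {W : X.Opens} (θ : F ⟶ cut G W)
    (V : {V : X.Opens // V ≤ W}) (s : Γ(F, V.1)) :
    (ofCut θ).1 V s = res G (le_star V.2 le_rfl) (cutEquiv G W V.1 (θ.app V.1 s)) := rfl

lemma localHom_eq_zero_of_toCut {F G : X.Modules} {W : X.Opens} {φ : localHom F G W}
    (h : toCut φ = 0) : φ = 0 := by
  refine localHom_ext fun V s ↦ ?_
  have h1 := toCut_app φ V.1 s
  rw [h] at h1
  have h2 := congrArg (res G (le_star V.2 le_rfl)) h1
  rw [← φ.2 ⟨star W V.1, star_le_left _ _⟩ V (le_star V.2 le_rfl), ← res_res, res_self] at h2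
  refine h2.symm.trans ?_
  exact (congrArg _ (map_zero (cutEquiv G W V.1))).trans (map_zero _)

end Cut

/-! #### Sections of inverse images -/

section Pullback

open Opposite TopologicalSpace

variable {M Y Z : Scheme.{u}}

/-- The inverse image of a section. -/
def pullSec (f : Y ⟶ M) (F : M.Modules) (U : M.Opens) :
    Γ(F, U) →ₗ[Γ(M, U)]
      Γ((Scheme.Modules.pushforward f).obj ((Scheme.Modules.pullback f).obj F), U) :=
  appL ((Scheme.Modules.pullbackPushforwardAdjunction f).unit.app F) U

/-- The morphism from an inverse image given by a morphism to a direct image. -/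
def pullDesc (f : Y ⟶ M) {F : M.Modules} {G : Y.Modules}
    (ψ : F ⟶ (Scheme.Modules.pushforward f).obj G) : (Scheme.Modules.pullback f).obj F ⟶ G :=
  ((Scheme.Modules.pullbackPushforwardAdjunction f).homEquiv F G).symm ψ

lemma pullDesc_pullSec (f : Y ⟶ M) {F : M.Modules} {G : Y.Modules}
    (ψ : F ⟶ (Scheme.Modules.pushforward f).obj G) (U : M.Opens) (s : Γ(F, U)) :
    (pullDesc f ψ).app (f ⁻¹ᵁ U) (pullSec f F U s) = ψ.app U s := by
  have := ((Scheme.Modules.pullbackPushforwardAdjunction f).homEquiv F G).apply_symm_apply ψ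
  exact congrArg (fun g : F ⟶ (Scheme.Modules.pushforward f).obj G ↦ g.app U s)
    ((Adjunction.homEquiv_unit _ _ _ _).symm.trans this)

lemma pullMap_pullSec (f : Y ⟶ M) {F G : M.Modules} (φ : F ⟶ G) (U : M.Opens) (s : Γ(F, U)) :
    ((Scheme.Modules.pullback f).map φ).app (f ⁻¹ᵁ U) (pullSec f F U s) =
      pullSec f G U (φ.app U s) :=
  (congrArg (fun g : F ⟶ _ ↦ g.app U s)
    ((Scheme.Modules.pullbackPushforwardAdjunction f).unit.naturality φ)).symm

lemma pullSec_comp (j : Z ⟶ Y) (i : Y ⟶ M) (F : M.Modules) (U : M.Opens) (s : Γ(F, U)) :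
    ((Scheme.Modules.pullbackComp j i).hom.app F).app (j ⁻¹ᵁ i ⁻¹ᵁ U)
      (pullSec j _ (i ⁻¹ᵁ U) (pullSec i F U s)) = pullSec (j ≫ i) F U s := by
  have h1 := unit_conjugateEquiv
    ((Scheme.Modules.pullbackPushforwardAdjunction i).comp
      (Scheme.Modules.pullbackPushforwardAdjunction j))
    (Scheme.Modules.pullbackPushforwardAdjunction (j ≫ i))
    (Scheme.Modules.pullbackComp j i).inv F
  rw [Scheme.Modules.conjugateEquiv_pullbackComp_inv] at h1
  have h2 : pullSec j _ (i ⁻¹ᵁ U) (pullSec i F U s) =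
      ((Scheme.Modules.pullbackComp j i).inv.app F).app (j ⁻¹ᵁ i ⁻¹ᵁ U)
        (pullSec (j ≫ i) F U s) := by
    refine Eq.trans ?_ (congrArg (fun g : F ⟶ _ ↦ g.app U s) h1)
    rw [Adjunction.comp_unit_app]
    rfl
  rw [h2]
  exact congrArg (fun g : (Scheme.Modules.pullback (j ≫ i)).obj F ⟶ _ ↦
    g.app (j ⁻¹ᵁ i ⁻¹ᵁ U) (pullSec (j ≫ i) F U s))
    ((Scheme.Modules.pullbackComp j i).inv_hom_id_app F)

end Pullback

/-! ### Normal sheaves and their sections -/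

section Normal

open Opposite TopologicalSpace

variable {M Y Z : Scheme.{u}}

/-- The section of the sheaf of homomorphisms given by a homomorphism. -/
def homSec (F G : M.Modules) (V : M.Opens) : localHom F G V →ₗ[Γ(M, V)] Γ(sheafHom F G, V) :=
  toSh (presheafHom F G) V

lemma homSec_res {F G : M.Modules} {U V : M.Opens} (h : V ≤ U) (φ : localHom F G U) :
    homSec F G V (localHomRes F G h φ) = res _ h (homSec F G U φ) :=
  toSh_res (presheafHom F G) h φ

/-- The composition of a homomorphism with a morphism of sheaves. -/
def post (F : M.Modules) {G G' : M.Modules} (g : G ⟶ G') {V : M.Opens} (φ : localHom F G V) :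
    localHom F G' V := secMap (presheafHomPostcomp F g) (op V) φ

lemma post_apply {F G G' : M.Modules} (g : G ⟶ G') {V : M.Opens} (φ : localHom F G V) (W) (s) :
    (post F g φ).1 W s = g.app W.1 (φ.1 W s) := rfl

/-- The composition of a morphism of sheaves with a homomorphism. -/
def pre {F F' : M.Modules} (f : F' ⟶ F) (G : M.Modules) {V : M.Opens} (φ : localHom F G V) :
    localHom F' G V := secMap (presheafHomPrecomp f G) (op V) φ

lemma pre_apply {F F' G : M.Modules} (f : F' ⟶ F) {V : M.Opens} (φ : localHom F G V) (W) (s) :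
    (pre f G φ).1 W s = φ.1 W (f.app W.1 s) := rfl

lemma sheafHomPostcomp_homSec {F G G' : M.Modules} (g : G ⟶ G') {V : M.Opens}
    (φ : localHom F G V) :
    (sheafHomPostcomp F g).app V (homSec F G V φ) = homSec F G' V (post F g φ) :=
  sheafifyMap_toSh _ _

lemma sheafHomPrecomp_homSec {F F' G : M.Modules} (f : F' ⟶ F) {V : M.Opens}
    (φ : localHom F G V) :
    (sheafHomPrecomp f G).app V (homSec F G V φ) = homSec F' G V (pre f G φ) :=
  sheafifyMap_toSh _ _

lemma pull_hom_ext_unit (f : Y ⟶ M) {F : M.Modules} {G : Y.Modules}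
    {a b : (Scheme.Modules.pullback f).obj F ⟶ G}
    (h : (Scheme.Modules.pullbackPushforwardAdjunction f).unit.app F ≫
        (Scheme.Modules.pushforward f).map a =
      (Scheme.Modules.pullbackPushforwardAdjunction f).unit.app F ≫
        (Scheme.Modules.pushforward f).map b) : a = b := by
  apply ((Scheme.Modules.pullbackPushforwardAdjunction f).homEquiv F G).injective
  rwa [Adjunction.homEquiv_unit, Adjunction.homEquiv_unit]

/-- Morphisms from the inverse image of a sheaf of homomorphisms are determined by their values on
inverse images of homomorphisms. -/
lemma pullHom_hom_ext (f : Y ⟶ M) {F F' : M.Modules} {G : Y.Modules}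
    {a b : (Scheme.Modules.pullback f).obj (sheafHom F F') ⟶ G}
    (h : ∀ U φ, a.app (f ⁻¹ᵁ U) (pullSec f _ U (homSec F F' U φ)) =
      b.app (f ⁻¹ᵁ U) (pullSec f _ U (homSec F F' U φ))) : a = b :=
  pull_hom_ext_unit f (sh_hom_ext fun U φ ↦ h U φ)

variable (j : Z ⟶ Y) (i : Y ⟶ M) (k : Z ⟶ M) (h : j ≫ i = k)

/-- The section of `ℋom(ℐ_Y, 𝒪_Z)` on `Z` given by a homomorphism. -/
def intoSec (V : M.Opens) : localHom (idealSheaf i) (pushO k) V →ₗ[Γ(M, V)]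
    Γ((Scheme.Modules.pushforward k).obj (normalSheafInto i k), V) :=
  pullSec k _ V ∘ₗ homSec _ _ V

/-- The unit of the adjunction for `j`, pushed forward to `M`. -/
def restrictUnit (N : Y.Modules) : (Scheme.Modules.pushforward i).obj N ⟶
    (Scheme.Modules.pushforward k).obj ((Scheme.Modules.pullback j).obj N) :=
  (Scheme.Modules.pushforward i).map
      ((Scheme.Modules.pullbackPushforwardAdjunction j).unit.app N) ≫
    (Scheme.Modules.pushforwardComp j i).hom.app _ ≫
    (Scheme.Modules.pushforwardCongr h).hom.app _

/-- The section of the restriction of the normal sheaf given by a homomorphism. -/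
def normSec (V : M.Opens) : localHom (idealSheaf i) (pushO i) V →ₗ[Γ(M, V)]
    Γ((Scheme.Modules.pushforward k).obj ((Scheme.Modules.pullback j).obj (normalSheaf i)), V) :=
  appL (restrictUnit j i k h (normalSheaf i)) V ∘ₗ pullSec i _ V ∘ₗ homSec _ _ V

lemma normSec_res {U V : M.Opens} (hV : V ≤ U) (ν : localHom (idealSheaf i) (pushO i) U) :
    normSec j i k h V (localHomRes _ _ hV ν) = res _ hV (normSec j i k h U ν) := by
  refine (congrArg (fun t ↦ appL (restrictUnit j i k h (normalSheaf i)) V (pullSec i _ V t))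
    (homSec_res hV ν)).trans ?_
  refine (congrArg (appL (restrictUnit j i k h (normalSheaf i)) V) (appL_res _ hV _)).trans ?_
  exact appL_res (restrictUnit j i k h (normalSheaf i)) hV _

lemma normSec_rfl (V : M.Opens) (ν : localHom (idealSheaf i) (pushO i) V) :
    normSec j i (j ≫ i) rfl V ν =
      pullSec j (normalSheaf i) (i ⁻¹ᵁ V) (pullSec i _ V (homSec _ _ V ν)) := by
  change ((Scheme.Modules.pullback j).obj (normalSheaf i)).presheaf.map (eqToHom rfl).op _ = _
  rw [eqToHom_refl, op_id, CategoryTheory.Functor.map_id]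
  rfl

lemma normalSheafRestrict_normSec (V : M.Opens) (ν : localHom (idealSheaf i) (pushO i) V) :
    (normalSheafRestrict j i k h).app (k ⁻¹ᵁ V) (normSec j i k h V ν) =
      intoSec i k V (post _ (pushforwardRes j i k h) ν) := by
  subst h
  rw [normSec_rfl]
  have h1 := pullSec_comp j i (sheafHom (idealSheaf i) (pushO i)) V (homSec _ _ V ν)
  have h2 := pullMap_pullSec (j ≫ i)
    (sheafHomPostcomp (idealSheaf i) (pushforwardRes j i (j ≫ i) rfl)) V (homSec _ _ V ν)
  rw [sheafHomPostcomp_homSec] at h2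
  refine Eq.trans ?_ h2
  rw [← h1]
  rfl

lemma normalSheafMap_pullSec (V : M.Opens) (μ : localHom (idealSheaf k) (pushO k) V) :
    (normalSheafMap j i k h).app (k ⁻¹ᵁ V) (pullSec k _ V (homSec _ _ V μ)) =
      intoSec i k V (pre (idealSheafMap j i k h) _ μ) :=
  (pullMap_pullSec k _ V _).trans (congrArg (pullSec k _ V) (sheafHomPrecomp_homSec _ μ))

/-- Morphisms from the restriction of the normal sheaf are determined by their values on
homomorphisms. -/
lemma normSec_hom_ext {G : Z.Modules} {a b : (Scheme.Modules.pullback j).obj (normalSheaf i) ⟶ G}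
    (hab : ∀ V ν, a.app (k ⁻¹ᵁ V) (normSec j i k h V ν) = b.app (k ⁻¹ᵁ V) (normSec j i k h V ν)) :
    a = b := by
  subst h
  refine pull_hom_ext_unit j (pullHom_hom_ext i fun V ν ↦ ?_)
  have := hab V ν
  rw [normSec_rfl] at this
  exact this

end Normal

/-! #### Quotients of direct sums by fiber products -/

section Abstract

open Opposite TopologicalSpace

variable {X : Scheme.{u}}

lemma sum_app {F G : X.Modules} {ι : Type*} (T : Finset ι) (f : ι → (F ⟶ G)) (W : X.Opens)
    (x : Γ(F, W)) : (∑ a ∈ T, f a).app W x = ∑ a ∈ T, (f a).app W x := by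
  classical
  induction T using Finset.induction_on with
  | empty => rfl
  | insert a T ha ih =>
    rw [Finset.sum_insert ha, Finset.sum_insert ha, ← ih]
    rfl

/-- Sections of two sheaves with the same image are the components of a section of the fiber
product. -/
lemma exists_pullback_section {F G H : X.Modules} (f : F ⟶ H) (g : G ⟶ H) {W : X.Opens}
    (x : Γ(F, W)) (y : Γ(G, W)) (h : f.app W x = g.app W y) :
    ∃ z : Γ(pullback f g, W), (pullback.fst f g).app W z = x := by
  let z := Concrete.pullbackMk ((sectionFunctor W).map f) ((sectionFunctor W).map g) x y h
  refine ⟨(PreservesPullback.iso (sectionFunctor W) f g).inv z, ?_⟩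
  have h1 := PreservesPullback.iso_inv_fst (sectionFunctor W) f g
  refine (ConcreteCategory.congr_hom h1 z).trans ?_
  exact Concrete.pullbackMk_fst _ _ _ _ _

variable {l : ℕ} {N N' : Fin l → X.Modules} {T : X.Modules} (r : ∀ a, N a ⟶ N' a)
  (m : ∀ a, T ⟶ N' a)

/-- The quotient of `⨁ N a` by the fiber product with `T` over `⨁ N' a`. -/
def fiberQuot : X.Modules := cokernel (pullback.fst (biproduct.map r) (biproduct.lift m))

/-- The projection from a summand. -/
def fiberQuotProj (a : Fin l) : N a ⟶ fiberQuot r m := biproduct.ι N a ≫ cokernel.π _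

variable {r m}

lemma fiberQuot_hom_ext {G : X.Modules} {f g : fiberQuot r m ⟶ G}
    (h : ∀ a, fiberQuotProj r m a ≫ f = fiberQuotProj r m a ≫ g) : f = g := by
  refine (cancel_epi (cokernel.π (pullback.fst (biproduct.map r) (biproduct.lift m)))).1 ?_
  refine biproduct.hom_ext' _ _ fun a ↦ ?_
  exact (Category.assoc _ _ _).symm.trans ((h a).trans (Category.assoc _ _ _))

lemma sum_fiberQuotProj {W : X.Opens} (n : ∀ a, Γ(N a, W)) (y : Γ(T, W))
    (h : ∀ a, (r a).app W (n a) = (m a).app W y) :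
    ∑ a, (fiberQuotProj r m a).app W (n a) = 0 := by
  have hx : (biproduct.map r).app W (∑ a, (biproduct.ι N a).app W (n a)) =
      (biproduct.lift m).app W y := by
    rw [biproduct.lift_eq, sum_app, map_sum]
    refine Finset.sum_congr rfl fun a _ ↦ ?_
    have h2 := congrArg (fun f ↦ f.app W (n a)) (biproduct.ι_map r a)
    refine h2.trans ?_
    exact congrArg ((biproduct.ι N' a).app W) (h a)
  obtain ⟨z, hz⟩ := exists_pullback_section _ _ _ _ hx
  have h3 := congrArg (fun f : pullback (biproduct.map r) (biproduct.lift m) ⟶ _ ↦ f.app W z)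
    (cokernel.condition (pullback.fst (biproduct.map r) (biproduct.lift m)))
  have h4 : (cokernel.π (pullback.fst (biproduct.map r) (biproduct.lift m))).app W
      (∑ a, (biproduct.ι N a).app W (n a)) = 0 := by
    rw [← hz]
    exact h3
  rw [map_sum] at h4
  exact h4

lemma exists_fiberQuot_desc {G : X.Modules} (ψ : ∀ a, N' a ⟶ G) (h : ∑ a, m a ≫ ψ a = 0) :
    ∃ θ : fiberQuot r m ⟶ G, ∀ a, fiberQuotProj r m a ≫ θ = r a ≫ ψ a := by
  refine ⟨cokernel.desc _ (biproduct.map r ≫ biproduct.desc ψ) ?_, fun a ↦ ?_⟩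
  · rw [pullback.condition_assoc, biproduct.lift_desc, h, comp_zero]
  · refine (Category.assoc _ _ _).trans
      ((congrArg (biproduct.ι N a ≫ ·) (cokernel.π_desc _ _ _)).trans ?_)
    rw [biproduct.ι_map_assoc, biproduct.ι_desc]

end Abstract

/-! #### The quotient of the normal sheaves -/

section NormalSection

open Opposite TopologicalSpace

variable {M Y Z : Scheme.{u}} (j : Z ⟶ Y) (i : Y ⟶ M) (k : Z ⟶ M) (h : j ≫ i = k)

/-- The section of the restriction of the normal sheaf given by a homomorphism, as a semilinear map
to the sections over the preimage. -/
def normSecₛₗ (V : M.Opens) : localHom (idealSheaf i) (pushO i) V →ₛₗ[(k.app V).hom]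
    Γ((Scheme.Modules.pullback j).obj (normalSheaf i), k ⁻¹ᵁ V) where
  toFun ν := normSec j i k h V ν
  map_add' := (normSec j i k h V).map_add
  map_smul' := (normSec j i k h V).map_smul

lemma normSecₛₗ_res {U V : M.Opens} (hV : V ≤ U) (ν : localHom (idealSheaf i) (pushO i) U) :
    normSecₛₗ j i k h V (localHomRes _ _ hV ν) =
      res ((Scheme.Modules.pullback j).obj (normalSheaf i))
        ((Opens.map k.base).map (homOfLE hV)).le (normSecₛₗ j i k h U ν) :=
  normSec_res j i k h hV ν

lemma normalSheafRestrict_normSecₛₗ (V : M.Opens) (ν : localHom (idealSheaf i) (pushO i) V) :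
    (normalSheafRestrict j i k h).app (k ⁻¹ᵁ V) (normSecₛₗ j i k h V ν) =
      intoSec i k V (post _ (pushforwardRes j i k h) ν) :=
  normalSheafRestrict_normSec j i k h V ν

end NormalSection

section Quotient

open Opposite TopologicalSpace

variable {M : Scheme.{u}} {l : ℕ} (Y : Fin l → M.IdealSheafData)

lemma inter_preimage_mono {U V : M.Opens} (h : V ≤ U) :
    (inter Y).subschemeι ⁻¹ᵁ V ≤ (inter Y).subschemeι ⁻¹ᵁ U :=
  ((Opens.map (inter Y).subschemeι.base).map (homOfLE h)).le

/-- Homomorphisms from the ideal sheaf of `Y a` to `𝒪_{Y a}`. -/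
abbrev normalHom (a : Fin l) (V : M.Opens) :=
  localHom (idealSheaf (Y a).subschemeι) (pushO (Y a).subschemeι) V

/-- The restriction of the normal sheaf of `Y a`, as a sheaf of homomorphisms. -/
def restrictFam (a : Fin l) :
    (Scheme.Modules.pullback (interInclusion Y a)).obj (normalSheaf (Y a).subschemeι) ⟶
      normalSheafInto (Y a).subschemeι (inter Y).subschemeι :=
  normalSheafRestrict _ _ _ (interInclusion_comp Y a)

/-- The map from the normal sheaf of the intersection. -/
def mapFam (a : Fin l) : normalSheaf (inter Y).subschemeι ⟶
    normalSheafInto (Y a).subschemeι (inter Y).subschemeι :=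
  normalSheafMap _ _ _ (interInclusion_comp Y a)

/-- The quotient of the normal sheaves. -/
def quot : (inter Y).subscheme.Modules := fiberQuot (restrictFam Y) (mapFam Y)

/-- The projection from the restriction of the normal sheaf of `Y a` to the quotient. -/
def quotProj (a : Fin l) :
    (Scheme.Modules.pullback (interInclusion Y a)).obj (normalSheaf (Y a).subschemeι) ⟶ quot Y :=
  fiberQuotProj (restrictFam Y) (mapFam Y) a

lemma quot_hom_ext {G : (inter Y).subscheme.Modules} {f g : quot Y ⟶ G}
    (h : ∀ a, quotProj Y a ≫ f = quotProj Y a ≫ g) : f = g :=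
  fiberQuot_hom_ext (r := restrictFam Y) (m := mapFam Y) h

lemma exists_quot_desc {G : (inter Y).subscheme.Modules}
    (ψ : ∀ a, normalSheafInto (Y a).subschemeι (inter Y).subschemeι ⟶ G)
    (h : ∑ a, mapFam Y a ≫ ψ a = 0) :
    ∃ θ : quot Y ⟶ G, ∀ a, quotProj Y a ≫ θ = restrictFam Y a ≫ ψ a :=
  exists_fiberQuot_desc (r := restrictFam Y) (m := mapFam Y) ψ h

lemma sum_quotProj {W : (inter Y).subscheme.Opens}
    (n : ∀ a, Γ((Scheme.Modules.pullback (interInclusion Y a)).obj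
      (normalSheaf (Y a).subschemeι), W)) (y : Γ(normalSheaf (inter Y).subschemeι, W))
    (h : ∀ a, (restrictFam Y a).app W (n a) = (mapFam Y a).app W y) :
    ∑ a, (quotProj Y a).app W (n a) = 0 :=
  sum_fiberQuotProj (r := restrictFam Y) (m := mapFam Y) n y h

/-- The section of the restriction of the normal sheaf of `Y a` given by a homomorphism. -/
def famSec (a : Fin l) (V : M.Opens) : normalHom Y a V →ₛₗ[((inter Y).subschemeι.app V).hom]
    Γ((Scheme.Modules.pullback (interInclusion Y a)).obj (normalSheaf (Y a).subschemeι),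
      (inter Y).subschemeι ⁻¹ᵁ V) :=
  normSecₛₗ (interInclusion Y a) (Y a).subschemeι (inter Y).subschemeι (interInclusion_comp Y a) V

lemma famSec_res (a : Fin l) {U V : M.Opens} (hV : V ≤ U) (ν : normalHom Y a U) :
    famSec Y a V (localHomRes _ _ hV ν) = res _ (inter_preimage_mono Y hV) (famSec Y a U ν) :=
  normSecₛₗ_res (interInclusion Y a) (Y a).subschemeι (inter Y).subschemeι
    (interInclusion_comp Y a) hV ν

/-- The class in the quotient of the normal sheaves of a homomorphism from the ideal sheaf. -/
def quotSec (a : Fin l) (V : M.Opens) : normalHom Y a V →ₛₗ[((inter Y).subschemeι.app V).hom]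
    Γ(quot Y, (inter Y).subschemeι ⁻¹ᵁ V) :=
  (appL (quotProj Y a) ((inter Y).subschemeι ⁻¹ᵁ V)).comp (famSec Y a V)

lemma quotSec_apply (a : Fin l) (V : M.Opens) (ν : normalHom Y a V) :
    quotSec Y a V ν = (quotProj Y a).app ((inter Y).subschemeι ⁻¹ᵁ V) (famSec Y a V ν) := rfl

lemma quotSec_res (a : Fin l) {U V : M.Opens} (hV : V ≤ U) (ν : normalHom Y a U) :
    quotSec Y a V (localHomRes _ _ hV ν) =
      res (quot Y) (inter_preimage_mono Y hV) (quotSec Y a U ν) := by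
  rw [quotSec_apply, famSec_res, app_res, quotSec_apply]

/-- A homomorphism from the quotient vanishes if it vanishes on the classes of homomorphisms from
the ideal sheaves. -/
lemma eq_zero_of_quotSec {G : (inter Y).subscheme.Modules} {U : M.Opens}
    {φ : localHom (quot Y) G ((inter Y).subschemeι ⁻¹ᵁ U)}
    (h : ∀ a (V : M.Opens) (hV : V ≤ U) (ν : normalHom Y a V),
      φ.1 ⟨(inter Y).subschemeι ⁻¹ᵁ V, inter_preimage_mono Y hV⟩ (quotSec Y a V ν) = 0) :
    φ = 0 := by
  refine localHom_eq_zero_of_toCut (quot_hom_ext Y fun a ↦ ?_)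
  refine normSec_hom_ext _ _ _ (interInclusion_comp Y a) fun V ν ↦ ?_
  refine (cutEquiv G _ _).injective ?_
  rw [comp_zero]
  refine (toCut_app φ ((inter Y).subschemeι ⁻¹ᵁ V) (quotSec Y a V ν)).trans ?_
  refine Eq.trans ?_ (map_zero (cutEquiv G _ _)).symm
  have hle : star ((inter Y).subschemeι ⁻¹ᵁ U) ((inter Y).subschemeι ⁻¹ᵁ V) ≤
      (inter Y).subschemeι ⁻¹ᵁ (V ⊓ U) :=
    (star_eq _ _).le.trans (le_inf inf_le_right inf_le_left)
  have h1 : res (quot Y)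
      (star_le_right ((inter Y).subschemeι ⁻¹ᵁ U) ((inter Y).subschemeι ⁻¹ᵁ V)) (quotSec Y a V ν) =
      res (quot Y) hle (quotSec Y a (V ⊓ U) (localHomRes _ _ inf_le_left ν)) := by
    rw [quotSec_res, ← res_res]
  rw [h1, φ.2 ⟨(inter Y).subschemeι ⁻¹ᵁ (V ⊓ U), inter_preimage_mono Y inf_le_right⟩
    ⟨_, star_le_left _ _⟩ hle]
  exact (congrArg _ (h a (V ⊓ U) inf_le_right _)).trans (map_zero _)

/-- The restriction of functions from `Y a` to the intersection. -/
def interRes (a : Fin l) : pushO (Y a).subschemeι ⟶ pushO (inter Y).subschemeι :=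
  pushforwardRes (interInclusion Y a) (Y a).subschemeι (inter Y).subschemeι
    (interInclusion_comp Y a)

/-- The inclusion of the ideal sheaf of `Y a` into that of the intersection. -/
def interIdeal (a : Fin l) : idealSheaf (Y a).subschemeι ⟶ idealSheaf (inter Y).subschemeι :=
  idealSheafMap (interInclusion Y a) (Y a).subschemeι (inter Y).subschemeι (interInclusion_comp Y a)

lemma famSec_apply (a : Fin l) (V : M.Opens) (ν : normalHom Y a V) : famSec Y a V ν =
    normSecₛₗ (interInclusion Y a) (Y a).subschemeι (inter Y).subschemeι (interInclusion_comp Y a)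
      V ν := rfl

lemma restrictFam_eq (a : Fin l) : restrictFam Y a = normalSheafRestrict (interInclusion Y a)
    (Y a).subschemeι (inter Y).subschemeι (interInclusion_comp Y a) := rfl

lemma interRes_eq (a : Fin l) : interRes Y a = pushforwardRes (interInclusion Y a)
    (Y a).subschemeι (inter Y).subschemeι (interInclusion_comp Y a) := rfl

lemma restrictFam_famSec (a : Fin l) (V : M.Opens) (ν : normalHom Y a V) :
    (restrictFam Y a).app ((inter Y).subschemeι ⁻¹ᵁ V) (famSec Y a V ν) =
      intoSec (Y a).subschemeι (inter Y).subschemeι V (post _ (interRes Y a) ν) := by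
  rw [famSec_apply, restrictFam_eq, interRes_eq]
  exact normalSheafRestrict_normSecₛₗ (interInclusion Y a) (Y a).subschemeι (inter Y).subschemeι
    (interInclusion_comp Y a) V ν

/-- The section of the normal sheaf of the intersection given by a homomorphism. -/
def interSec (V : M.Opens)
    (μ : localHom (idealSheaf (inter Y).subschemeι) (pushO (inter Y).subschemeι) V) :
    Γ(normalSheaf (inter Y).subschemeι, (inter Y).subschemeι ⁻¹ᵁ V) :=
  pullSec (inter Y).subschemeι _ V (homSec _ _ V μ)

lemma mapFam_interSec (a : Fin l) (V : M.Opens)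
    (μ : localHom (idealSheaf (inter Y).subschemeι) (pushO (inter Y).subschemeι) V) :
    (mapFam Y a).app ((inter Y).subschemeι ⁻¹ᵁ V) (interSec Y V μ) =
      intoSec (Y a).subschemeι (inter Y).subschemeι V (pre (interIdeal Y a) _ μ) :=
  normalSheafMap_pullSec (interInclusion Y a) (Y a).subschemeι (inter Y).subschemeι
    (interInclusion_comp Y a) V μ

/-- A family of homomorphisms from the ideal sheaves of the `Y a` that comes from a homomorphism
from the ideal sheaf of the intersection has class zero in the quotient. -/
lemma sum_quotSec_eq_zero {V : M.Opens} (ν : ∀ a, normalHom Y a V)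
    (μ : localHom (idealSheaf (inter Y).subschemeι) (pushO (inter Y).subschemeι) V)
    (h : ∀ a, post _ (interRes Y a) (ν a) = pre (interIdeal Y a) _ μ) :
    ∑ a, quotSec Y a V (ν a) = 0 := by
  obtain ⟨n, hn⟩ : ∃ n : ∀ a, Γ((Scheme.Modules.pullback (interInclusion Y a)).obj
      (normalSheaf (Y a).subschemeι), (inter Y).subschemeι ⁻¹ᵁ V), ∀ a, n a = famSec Y a V (ν a) :=
    ⟨_, fun _ ↦ rfl⟩
  have e (a : Fin l) : (restrictFam Y a).app ((inter Y).subschemeι ⁻¹ᵁ V) (n a) =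
      (mapFam Y a).app ((inter Y).subschemeι ⁻¹ᵁ V) (interSec Y V μ) := by
    rw [hn, restrictFam_famSec, mapFam_interSec, h]
  rw [← sum_quotProj Y n (interSec Y V μ) e]
  refine Finset.sum_congr rfl fun a _ ↦ ?_
  rw [quotSec_apply, hn]

end Quotient

/-! #### Evaluation at sections of the ideal sheaves -/

section Eval

open Opposite TopologicalSpace

variable {M Y Z : Scheme.{u}} (i : Y ⟶ M) (k : Z ⟶ M)

lemma preimage_mono {U V : M.Opens} (h : V ≤ U) : k ⁻¹ᵁ V ≤ k ⁻¹ᵁ U :=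
  ((Opens.map k.base).map (homOfLE h)).le

lemma star_preimage_le (U V : M.Opens) : star (k ⁻¹ᵁ U) (k ⁻¹ᵁ V) ≤ k ⁻¹ᵁ (V ⊓ U) :=
  (star_eq _ _).le.trans (le_inf inf_le_right inf_le_left)

/-- Sections of `i_* 𝒪_Y` are functions on the preimage. -/
def pushEquiv (U : M.Opens) : Γ(pushO k, U) ≃+ Γ(structureSheaf Z, k ⁻¹ᵁ U) := .refl _

lemma pushEquiv_smul {U : M.Opens} (r : Γ(M, U)) (t : Γ(pushO k, U)) :
    pushEquiv k U (r • t) = k.app U r • pushEquiv k U t := rfl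

lemma pushEquiv_res {U V : M.Opens} (h : V ≤ U) (t : Γ(pushO k, U)) :
    pushEquiv k V (res _ h t) = res _ (preimage_mono k h) (pushEquiv k U t) := rfl

lemma app_rr {U V : M.Opens} (h : V ≤ U) (r : Γ(M, U)) :
    k.app V (rr h r) = rr (preimage_mono k h) (k.app U r) :=
  ConcreteCategory.congr_hom (k.naturality (homOfLE h).op) r

variable {U : M.Opens} (s : Γ(idealSheaf i, U))

/-- The value on `s` of a homomorphism over `V`, as a function on the preimage of `U ⊓ V`. -/
def evalSec (V : M.Opens) (μ : localHom (idealSheaf i) (pushO k) V) :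
    Γ(structureSheaf Z, star (k ⁻¹ᵁ U) (k ⁻¹ᵁ V)) :=
  res _ (star_preimage_le k U V)
    (pushEquiv k (V ⊓ U) (μ.1 ⟨V ⊓ U, inf_le_left⟩ (res _ inf_le_right s)))

lemma evalSec_add (V : M.Opens) (μ μ' : localHom (idealSheaf i) (pushO k) V) :
    evalSec i k s V (μ + μ') = evalSec i k s V μ + evalSec i k s V μ' := by
  rw [evalSec, localHom_add_apply, map_add, map_add]
  rfl

lemma evalSec_smul (V : M.Opens) (r : Γ(M, V)) (μ : localHom (idealSheaf i) (pushO k) V) :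
    evalSec i k s V (r • μ) =
      rr (star_le_right (k ⁻¹ᵁ U) (k ⁻¹ᵁ V)) (k.app V r) • evalSec i k s V μ := by
  rw [evalSec, localHom_smul_apply]
  refine (congrArg _ (pushEquiv_smul k _ _)).trans ?_
  rw [map_smulₛₗ]
  congr 1
  refine (congrArg _ (app_rr k (inf_le_left : V ⊓ U ≤ V) r)).trans ?_
  exact (ring_res_res _ _ _).symm

lemma evalSec_res {V V' : M.Opens} (h : V' ≤ V) (μ : localHom (idealSheaf i) (pushO k) V) :
    evalSec i k s V' (localHomRes _ _ h μ) =
      res _ (star_mono _ (preimage_mono k h)) (evalSec i k s V μ) := by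
  have h1 : V' ⊓ U ≤ V ⊓ U := inf_le_inf_right U h
  have h2 := μ.2 ⟨V ⊓ U, inf_le_left⟩ ⟨V' ⊓ U, h1.trans inf_le_left⟩ h1 (res _ inf_le_right s)
  rw [← res_res] at h2
  rw [evalSec, evalSec, ← res_res]
  refine (congrArg (fun t ↦ res (structureSheaf Z) (star_preimage_le k U V') (pushEquiv k _ t))
    h2).trans ?_
  rw [pushEquiv_res, ← res_res]

/-- Evaluation at `s`, as a morphism of presheaves. -/
def evalPre : presheafHom (idealSheaf i) (pushO k) ⟶
    ((Scheme.Modules.pushforward k).obj (cut (structureSheaf Z) (k ⁻¹ᵁ U))).val :=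
  PresheafOfModules.homMk
    { app := fun V ↦ AddCommGrpCat.ofHom <| AddMonoidHom.mk'
        (fun μ : localHom (idealSheaf i) (pushO k) V.unop ↦
          (cutEquiv (structureSheaf Z) (k ⁻¹ᵁ U) (k ⁻¹ᵁ V.unop)).symm (evalSec i k s V.unop μ))
        (fun μ μ' ↦ (congrArg _ (evalSec_add i k s V.unop μ μ')).trans (map_add _ _ _))
      naturality := fun V V' f ↦ by
        ext μ
        exact evalSec_res i k s f.unop.le μ }
    (fun V r μ ↦ (evalSec_smul i k s V.unop r μ).trans
      (cutEquiv_smul (structureSheaf Z) (k ⁻¹ᵁ U) (k ⁻¹ᵁ V.unop) (k.app V.unop r)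
        ((cutEquiv (structureSheaf Z) (k ⁻¹ᵁ U) (k ⁻¹ᵁ V.unop)).symm
          (evalSec i k s V.unop μ))).symm)

/-- Evaluation at `s`. -/
def evalHom : normalSheafInto i k ⟶ cut (structureSheaf Z) (k ⁻¹ᵁ U) :=
  pullDesc k (shDesc (evalPre i k s))

lemma evalHom_intoSec (V : M.Opens) (μ : localHom (idealSheaf i) (pushO k) V) :
    cutEquiv _ _ _ ((evalHom i k s).app (k ⁻¹ᵁ V) (intoSec i k V μ)) = evalSec i k s V μ := by
  have h := pullDesc_pullSec k (shDesc (evalPre i k s)) V (homSec _ _ V μ)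
  have h2 := shDesc_toSh (evalPre i k s) (U := V) μ
  exact congrArg (cutEquiv _ _ _) (h.trans h2)

lemma idealIncl_idealSheafMap (j : Z ⟶ Y) (h : j ≫ i = k) (U : M.Opens)
    (s : Γ(idealSheaf i, U)) :
    idealIncl k U ((idealSheafMap j i k h).app U s) = idealIncl i U s :=
  congrArg (fun φ : idealSheaf i ⟶ structureSheaf M ↦ φ.app U s) (kernel.lift_ι _ _ _)

end Eval

section EvalSum

open Opposite TopologicalSpace

variable {M Z : Scheme.{u}} {l : ℕ} {Y : Fin l → Scheme.{u}} (j : ∀ a, Z ⟶ Y a)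
  (i : ∀ a, Y a ⟶ M) (k : Z ⟶ M) (h : ∀ a, j a ≫ i a = k)

/-- The section of the normal sheaf given by a homomorphism. -/
def ownSec (V : M.Opens) (μ : localHom (idealSheaf k) (pushO k) V) : Γ(normalSheaf k, k ⁻¹ᵁ V) :=
  pullSec k _ V (homSec _ _ V μ)

lemma normalSheaf_hom_ext {G : Z.Modules} {a b : normalSheaf k ⟶ G}
    (h : ∀ V μ, a.app (k ⁻¹ᵁ V) (ownSec k V μ) = b.app (k ⁻¹ᵁ V) (ownSec k V μ)) : a = b :=
  pullHom_hom_ext k h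

/-- Evaluation at sections of the ideal sheaves with sum zero kills the homomorphisms from the ideal
sheaf of `Z`. -/
lemma sum_normalSheafMap_evalHom {U : M.Opens} (s : ∀ a, Γ(idealSheaf (i a), U))
    (hs : ∑ a, idealIncl (i a) U (s a) = 0) :
    ∑ a, normalSheafMap (j a) (i a) k (h a) ≫ evalHom (i a) k (s a) = 0 := by
  refine normalSheaf_hom_ext k fun V μ ↦ (cutEquiv _ _ _).injective ?_
  rw [sum_app, map_sum]
  -- On the values of one homomorphism `μ` from the ideal sheaf of `Z` the sum is `μ` of the sum.
  have h0 : ∑ a, (idealSheafMap (j a) (i a) k (h a)).app (V ⊓ U)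
      (res _ inf_le_right (s a)) = 0 := by
    refine idealIncl_injective k _ ?_
    rw [map_sum, map_zero, ← map_zero (rr (inf_le_right : V ⊓ U ≤ U)), ← hs, map_sum]
    refine Finset.sum_congr rfl fun a _ ↦ ?_
    rw [idealIncl_idealSheafMap, idealIncl_res]
  have h1 (a : Fin l) : cutEquiv _ _ _ ((normalSheafMap (j a) (i a) k (h a) ≫
      evalHom (i a) k (s a)).app (k ⁻¹ᵁ V) (ownSec k V μ)) =
      evalSec (i a) k (s a) V (pre (idealSheafMap (j a) (i a) k (h a)) _ μ) :=
    (congrArg (fun t ↦ cutEquiv _ _ _ ((evalHom (i a) k (s a)).app (k ⁻¹ᵁ V) t))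
      (normalSheafMap_pullSec (j a) (i a) k (h a) V μ)).trans (evalHom_intoSec _ _ _ _ _)
  rw [Finset.sum_congr rfl fun a _ ↦ h1 a]
  refine Eq.trans ?_ (map_zero (cutEquiv (structureSheaf Z) (k ⁻¹ᵁ U) (k ⁻¹ᵁ V))).symm
  have h2 := congrArg (fun t ↦ res (structureSheaf Z) (star_preimage_le k U V)
    (pushEquiv k (V ⊓ U) (μ.1 ⟨V ⊓ U, inf_le_left⟩ t))) h0
  simp only [map_sum, map_zero] at h2
  exact h2

end EvalSum

section QuotientHom

open Opposite TopologicalSpace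

variable {M : Scheme.{u}} {l : ℕ} (Y : Fin l → M.IdealSheafData)

lemma sum_mapFam_evalHom {U : M.Opens} (s : ∀ a, Γ(idealSheaf (Y a).subschemeι, U))
    (hs : ∑ a, idealIncl (Y a).subschemeι U (s a) = 0) :
    ∑ a, mapFam Y a ≫ evalHom (Y a).subschemeι (inter Y).subschemeι (s a) = 0 :=
  sum_normalSheafMap_evalHom (fun a ↦ interInclusion Y a) (fun a ↦ (Y a).subschemeι)
    (inter Y).subschemeι (interInclusion_comp Y) s hs

/-- Sections of the ideal sheaves of the `Y a` with sum zero define a homomorphism from the quotient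
of the normal sheaves to the structure sheaf, by evaluation. -/
lemma exists_quotHom {U : M.Opens} (s : ∀ a, Γ(idealSheaf (Y a).subschemeι, U))
    (hs : ∑ a, idealIncl (Y a).subschemeι U (s a) = 0) :
    ∃ φ : localHom (quot Y) (structureSheaf (inter Y).subscheme) ((inter Y).subschemeι ⁻¹ᵁ U),
      ∀ a (V : M.Opens) (hV : V ≤ U) (ν : normalHom Y a V),
        φ.1 ⟨(inter Y).subschemeι ⁻¹ᵁ V, preimage_mono _ hV⟩ (quotSec Y a V ν) =
          pushEquiv (inter Y).subschemeι V
            ((interRes Y a).app V (ν.1 ⟨V, le_rfl⟩ (res _ hV (s a)))) := by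
  obtain ⟨θ, hθ⟩ := exists_quot_desc Y
    (fun a ↦ evalHom (Y a).subschemeι (inter Y).subschemeι (s a)) (sum_mapFam_evalHom Y s hs)
  refine ⟨ofCut θ, fun a V hV ν ↦ ?_⟩
  rw [ofCut_apply, quotSec_apply]
  have h1 : θ.app ((inter Y).subschemeι ⁻¹ᵁ V) ((quotProj Y a).app _ (famSec Y a V ν)) =
      (evalHom (Y a).subschemeι (inter Y).subschemeι (s a)).app _
        ((restrictFam Y a).app _ (famSec Y a V ν)) :=
    congrArg (fun f ↦ f.app ((inter Y).subschemeι ⁻¹ᵁ V) (famSec Y a V ν)) (hθ a)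
  rw [h1, restrictFam_famSec, evalHom_intoSec, evalSec, ← res_res]
  have h2 := (post _ (interRes Y a) ν).2 ⟨V, le_rfl⟩ ⟨V ⊓ U, inf_le_left⟩ inf_le_left
    (res _ hV (s a))
  rw [← res_res] at h2
  refine (congrArg (fun t ↦ res (structureSheaf (inter Y).subscheme) _
    (pushEquiv (inter Y).subschemeι (V ⊓ U) t)) h2).trans ?_
  rw [pushEquiv_res, ← res_res, res_self]
  rfl

end QuotientHom

/-! ### Sheaves covered by the same presheaf -/

section Descent

open Opposite TopologicalSpace

variable {X : Scheme.{u}}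

/-- The presheaf of modules underlying a sheaf of modules on a scheme. -/
abbrev toPre (G : X.Modules) : PMod X.presheaf := G.val

/-- The morphism from a presheaf to the associated sheaf. -/
def toShHom (P : PMod X.presheaf) : P ⟶ (sheafify P).val :=
  PresheafOfModules.homMk (abSh P) fun U r m ↦ (toSh P U.unop).map_smul r m

lemma secTo_toShHom (P : PMod X.presheaf) (U : X.Opens) (x : Sec P (op U)) :
    secTo (toShHom P) U x = toSh P U x := rfl

lemma secTo_comp {P P' : PMod X.presheaf} {G : X.Modules} (φ : P ⟶ P') (ψ : P' ⟶ G.val)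
    (U : X.Opens) (x : Sec P (op U)) : secTo (φ ≫ ψ) U x = secTo ψ U (secMap φ (op U) x) := rfl

/-- If the monomorphism from `S` to the presheaf `A` is locally surjective and the morphism from `S`
to the sheaf `G` is locally bijective, then `G` is the sheaf associated with `A`. The conditions are
stated in terms of a presheaf `P` that covers `S`. -/
lemma nonempty_sheafify_iso_of_factor {P S A : PMod X.presheaf} {G : X.Modules} (π : P ⟶ S) [Epi π]
    (δ : S ⟶ A) [Mono δ] (γ : S ⟶ G.val)
    (hδ : ∀ (U : X.Opens) (y : Sec A (op U)), ∀ p ∈ U, ∃ (V : X.Opens) (hV : V ≤ U)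
      (x : Sec P (op V)), p ∈ V ∧ secMap (π ≫ δ) (op V) x = secRes A (homOfLE hV).op y)
    (hγ : ∀ (U : X.Opens) (t : Γ(G, U)), ∀ p ∈ U, ∃ (V : X.Opens) (hV : V ≤ U)
      (x : Sec P (op V)), p ∈ V ∧ secTo (π ≫ γ) V x = res G hV t)
    (h : ∀ (U : X.Opens) (x : Sec P (op U)), secTo (π ≫ γ) U x = 0 → ∀ p ∈ U,
      ∃ (V : X.Opens) (hV : V ≤ U), p ∈ V ∧
        secMap (π ≫ δ) (op V) (secRes P (homOfLE hV).op x) = 0) :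
    Nonempty (sheafify A ≅ G) := by
  have hinj (U : X.Opens) : Function.Injective (secMap δ (op U)) := secMap_injective δ (op U)
  have i1 : IsIso (shDesc γ) := by
    refine isIso_shDesc γ (fun U y hy p hp ↦ ?_) fun U t p hp ↦ ?_
    · obtain ⟨x, rfl⟩ := secMap_surjective π (op U) y
      obtain ⟨V, hV, hpV, h0⟩ := h U x hy p hp
      refine ⟨V, hV, hpV, hinj V ?_⟩
      rw [map_zero, ← h0, secRes_secMap, secMap_comp]
    · obtain ⟨V, hV, x, hpV, hx⟩ := hγ U t p hp
      exact ⟨V, hV, secMap π (op V) x, hpV, hx⟩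
  have i2 : IsIso (shDesc (δ ≫ toShHom A)) := by
    refine isIso_shDesc _ (fun U y hy p hp ↦ ?_) fun U t p hp ↦ ?_
    · rw [secTo_comp, secTo_toShHom] at hy
      obtain ⟨V, hV, hpV, h0⟩ := toSh_locally_injective A _ hy hp
      refine ⟨V, hV, hpV, hinj V ?_⟩
      rw [map_zero, ← h0, secRes_secMap]
    · obtain ⟨V, hV, y, hpV, hy⟩ := toSh_locally_surjective A t hp
      obtain ⟨W, hW, x, hpW, hx⟩ := hδ V y p hpV
      refine ⟨W, hW.trans hV, secMap π (op W) x, hpW, ?_⟩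
      rw [secTo_comp, secTo_toShHom, ← secMap_comp, hx, toSh_res, hy, ← res_res]
  exact ⟨(asIso (shDesc (δ ≫ toShHom A))).symm ≪≫ asIso (shDesc γ)⟩

/-- A presheaf of modules and a sheaf of modules that are covered by the same presheaf, with locally
the same kernel: the sheaf is isomorphic to the sheaf associated with the presheaf. -/
lemma nonempty_sheafify_iso {P A : PMod X.presheaf} {G : X.Modules} (α : P ⟶ A) (β : P ⟶ G.val)
    (hα : ∀ (U : X.Opens) (y : Sec A (op U)), ∀ p ∈ U, ∃ (V : X.Opens) (hV : V ≤ U)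
      (x : Sec P (op V)), p ∈ V ∧ secMap α (op V) x = secRes A (homOfLE hV).op y)
    (hβ : ∀ (U : X.Opens) (t : Γ(G, U)), ∀ p ∈ U, ∃ (V : X.Opens) (hV : V ≤ U)
      (x : Sec P (op V)), p ∈ V ∧ secTo β V x = res G hV t)
    (h : ∀ (U : X.Opens) (x : Sec P (op U)), secMap α (op U) x = 0 → secTo β U x = 0)
    (h' : ∀ (U : X.Opens) (x : Sec P (op U)), secTo β U x = 0 → ∀ p ∈ U,
      ∃ (V : X.Opens) (hV : V ≤ U), p ∈ V ∧ secMap α (op V) (secRes P (homOfLE hV).op x) = 0) :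
    Nonempty (sheafify A ≅ G) := by
  let b : P ⟶ toPre G := β
  -- Both morphisms factor through the coimage of `α`.
  have hker : kernel.ι α ≫ b = 0 := by
    ext U x
    exact h U.unop (secMap (kernel.ι α) U x)
      (congrArg (fun φ : kernel α ⟶ A ↦ secMap φ U x) (kernel.condition α))
  have h1 : cokernel.π (kernel.ι α) ≫ cokernel.desc (kernel.ι α) b hker = b :=
    cokernel.π_desc (kernel.ι α) b hker
  have h2 : cokernel.π (kernel.ι α) ≫ Abelian.factorThruCoimage α = α := Abelian.coimage.fac α
  refine nonempty_sheafify_iso_of_factor (G := G) (cokernel.π (kernel.ι α))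
    (Abelian.factorThruCoimage α) (cokernel.desc (kernel.ι α) b hker) ?_ ?_ ?_
  · rw [h2]
    exact hα
  · intro U t p hp
    obtain ⟨V, hV, x, hpV, hx⟩ := hβ U t p hp
    exact ⟨V, hV, x, hpV, (congrArg (fun φ : P ⟶ toPre G ↦ secTo (G := G) φ V x) h1).trans hx⟩
  · intro U x hx
    rw [h2]
    exact h' U x ((congrArg (fun φ : P ⟶ toPre G ↦ secTo (G := G) φ U x) h1).symm.trans hx)

end Descent

/-! #### Structure sheaves of closed subschemes as cyclic modules -/

section Pt

open Opposite TopologicalSpace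

variable {M Y : Scheme.{u}} (i : Y ⟶ M)

/-- The structure sheaf of `Y`, generated by the function `1`. -/
def pushPointed : Pointed (toPre (pushO i)) where
  pt U := fnRes i U.unop 1
  res {U V} f := by
    have := fnRes_rr i f.unop.le 1
    rw [map_one] at this
    exact this.symm
  ann U a h x := by
    have h1 : i.app U.unop a = 0 := by
      have h2 := (fnRes i U.unop).map_smul a 1
      rw [smul_eq_mul, mul_one] at h2
      exact h2.trans h
    have h3 : pushEquiv i U.unop (a • x) = i.app U.unop a • pushEquiv i U.unop x :=
      pushEquiv_smul i a x
    rw [h1, zero_smul] at h3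
    exact h3

lemma smul_pushPointed (U : M.Opens) (a : Γ(M, U)) :
    a • (pushPointed i).pt (op U) = fnRes i U a := by
  have h2 := (fnRes i U).map_smul a 1
  rw [smul_eq_mul, mul_one] at h2
  exact h2.symm

end Pt

/-! ### Homomorphisms from the quotient given by families of functions -/

section Data

open Opposite TopologicalSpace

variable {M Z : Scheme.{u}} {l : ℕ} {Y : Fin l → Scheme.{u}}

/-- The properties of the quotient `Q` of the normal sheaves of a family of closed subschemes
`Y a` with intersection `Z`, in terms of the classes `q a V ν` in `Q` of the homomorphisms `ν` from
the ideal sheaf of `Y a` to `𝒪_{Y a}`. -/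
structure QuotData (i : ∀ a, Y a ⟶ M) (ι : Z ⟶ M) where
  /-- the quotient -/
  Q : Z.Modules
  /-- the restriction of functions -/
  rho (a : Fin l) : pushO (i a) ⟶ pushO ι
  rho_fnRes (a : Fin l) (U : M.Opens) (x : Γ(M, U)) :
    (rho a).app U (fnRes (i a) U x) = fnRes ι U x
  /-- the inclusion of ideal sheaves -/
  incl (a : Fin l) : idealSheaf (i a) ⟶ idealSheaf ι
  idealIncl_incl (a : Fin l) (U : M.Opens) (s : Γ(idealSheaf (i a), U)) :
    idealIncl ι U ((incl a).app U s) = idealIncl (i a) U s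
  /-- the class of a homomorphism -/
  q (a : Fin l) (V : M.Opens) :
    localHom (idealSheaf (i a)) (pushO (i a)) V →ₛₗ[(ι.app V).hom] Γ(Q, ι ⁻¹ᵁ V)
  q_res (a : Fin l) {U V : M.Opens} (h : V ≤ U) (ν : localHom (idealSheaf (i a)) (pushO (i a)) U) :
    q a V (localHomRes _ _ h ν) = res Q (preimage_mono ι h) (q a U ν)
  eq_zero {U : M.Opens} (φ : localHom Q (structureSheaf Z) (ι ⁻¹ᵁ U))
    (h : ∀ (a : Fin l) (V : M.Opens) (hV : V ≤ U) (ν),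
      φ.1 ⟨ι ⁻¹ᵁ V, preimage_mono ι hV⟩ (q a V ν) = 0) : φ = 0
  sum_q {V : M.Opens} (ν : ∀ a, localHom (idealSheaf (i a)) (pushO (i a)) V)
    (μ : localHom (idealSheaf ι) (pushO ι) V)
    (h : ∀ a, post _ (rho a) (ν a) = pre (incl a) _ μ) : ∑ a, q a V (ν a) = 0
  exists_hom {U : M.Opens} (s : ∀ a, Γ(idealSheaf (i a), U))
    (hs : ∑ a, idealIncl (i a) U (s a) = 0) :
    ∃ φ : localHom Q (structureSheaf Z) (ι ⁻¹ᵁ U), ∀ (a : Fin l) (V : M.Opens) (hV : V ≤ U) (ν),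
      φ.1 ⟨ι ⁻¹ᵁ V, preimage_mono ι hV⟩ (q a V ν) =
        pushEquiv ι V ((rho a).app V (ν.1 ⟨V, le_rfl⟩ (res _ hV (s a))))

/-- The families of functions that vanish on the `Y a`, with sum zero. -/
abbrev PushCyc (i : ∀ a, Y a ⟶ M) (U : M.Opens) : Type u :=
  Cyc (F := fun a ↦ toPre (pushO (i a))) (fun a ↦ pushPointed (i a)) (op U)

/-- The restriction of families of functions. -/
abbrev PushCyc.res {i : ∀ a, Y a ⟶ M} {U V : M.Opens} (h : V ≤ U) (z : PushCyc i U) : PushCyc i V :=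
  Cyc.res _ (homOfLE h).op z

namespace QuotData

variable {i : ∀ a, Y a ⟶ M} {ι : Z ⟶ M} (D : QuotData i ι)

section Eval

variable {U V : M.Opens} (hV : V ≤ U) (a : Fin l)
  (ν : localHom (idealSheaf (i a)) (pushO (i a)) V)

/-- The value of `ν` on the restriction of a section of the ideal sheaf, restricted to `Z`. -/
def evalAt : Γ(idealSheaf (i a), U) →+ Γ(structureSheaf Z, ι ⁻¹ᵁ V) :=
  AddMonoidHom.mk'
    (fun s ↦ pushEquiv ι V ((D.rho a).app V (ν.1 ⟨V, le_rfl⟩ (MultiTor.res _ hV s)))) fun s t ↦ by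
      rw [map_add, map_add, map_add, map_add]

lemma evalAt_smul (r : Γ(M, U)) (s : Γ(idealSheaf (i a), U)) :
    D.evalAt hV a ν (r • s) = ι.app V (rr hV r) • D.evalAt hV a ν s := by
  change pushEquiv ι V ((D.rho a).app V (ν.1 ⟨V, le_rfl⟩ (MultiTor.res _ hV (r • s)))) = _
  rw [map_smulₛₗ, map_smul, Scheme.Modules.Hom.app_smul, pushEquiv_smul]
  rfl

lemma evalAt_eq (s : Γ(idealSheaf (i a), U)) (t : Γ(M, V))
    (h : ν.1 ⟨V, le_rfl⟩ (MultiTor.res _ hV s) = fnRes (i a) V t) :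
    D.evalAt hV a ν s = ι.app V t := by
  change pushEquiv ι V ((D.rho a).app V (ν.1 ⟨V, le_rfl⟩ (MultiTor.res _ hV s))) = _
  rw [h, rho_fnRes]
  rfl

end Eval

section Hom

variable {U : M.Opens}

lemma exists_cycSec (z : PushCyc i U) (a : Fin l) :
    ∃ s : Γ(idealSheaf (i a), U), idealIncl (i a) U s = z.1 a :=
  exists_idealIncl (i a) _ ((smul_pushPointed (i a) U _).symm.trans (z.2.1 a))

/-- The members of a family of functions, as sections of the ideal sheaves. -/
def cycSec (z : PushCyc i U) (a : Fin l) : Γ(idealSheaf (i a), U) := (exists_cycSec z a).choose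

lemma idealIncl_cycSec (z : PushCyc i U) (a : Fin l) : idealIncl (i a) U (cycSec z a) = z.1 a :=
  (exists_cycSec z a).choose_spec

lemma cycSec_res {V : M.Opens} (hV : V ≤ U) (z : PushCyc i U) (a : Fin l) :
    cycSec (z.res hV) a = MultiTor.res _ hV (cycSec z a) := by
  refine idealIncl_injective (i a) V ?_
  rw [idealIncl_res, idealIncl_cycSec, idealIncl_cycSec]
  rfl

lemma exists_cycHom (z : PushCyc i U) :
    ∃ φ : localHom D.Q (structureSheaf Z) (ι ⁻¹ᵁ U), ∀ (a : Fin l) (V : M.Opens) (hV : V ≤ U) (ν),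
      φ.1 ⟨ι ⁻¹ᵁ V, preimage_mono ι hV⟩ (D.q a V ν) = D.evalAt hV a ν (cycSec z a) :=
  D.exists_hom (cycSec z) (by
    rw [← z.2.2]
    exact Finset.sum_congr rfl fun a _ ↦ idealIncl_cycSec z a)

/-- The homomorphism from the quotient to the structure sheaf given by evaluation at a family of
functions. -/
def cycHom (z : PushCyc i U) : localHom D.Q (structureSheaf Z) (ι ⁻¹ᵁ U) :=
  (D.exists_cycHom z).choose

lemma cycHom_q (z : PushCyc i U) (a : Fin l) {V : M.Opens} (hV : V ≤ U) (ν) :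
    (D.cycHom z).1 ⟨ι ⁻¹ᵁ V, preimage_mono ι hV⟩ (D.q a V ν) = D.evalAt hV a ν (cycSec z a) :=
  (D.exists_cycHom z).choose_spec a V hV ν

variable {D} in
lemma hom_ext {φ ψ : localHom D.Q (structureSheaf Z) (ι ⁻¹ᵁ U)}
    (h : ∀ (a : Fin l) (V : M.Opens) (hV : V ≤ U) (ν),
      φ.1 ⟨ι ⁻¹ᵁ V, preimage_mono ι hV⟩ (D.q a V ν) =
        ψ.1 ⟨ι ⁻¹ᵁ V, preimage_mono ι hV⟩ (D.q a V ν)) : φ = ψ := by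
  refine sub_eq_zero.1 (D.eq_zero _ fun a V hV ν ↦ ?_)
  exact sub_eq_zero.2 (h a V hV ν)

lemma cycHom_res {V : M.Opens} (hV : V ≤ U) (z : PushCyc i U) :
    D.cycHom (z.res hV) = localHomRes _ _ (preimage_mono ι hV) (D.cycHom z) := by
  refine hom_ext fun a W hW ν ↦ ?_
  rw [cycHom_q, cycSec_res]
  refine Eq.trans ?_ (D.cycHom_q z a (hW.trans hV) ν).symm
  change pushEquiv ι W ((D.rho a).app W (ν.1 ⟨W, le_rfl⟩ (MultiTor.res _ hW _))) =
    pushEquiv ι W ((D.rho a).app W (ν.1 ⟨W, le_rfl⟩ (MultiTor.res _ _ _)))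
  rw [← res_res]

lemma localHom_sum_apply {X : Scheme.{u}} {F G : X.Modules} {W : X.Opens} {K : Type*}
    (T : Finset K) (φ : K → localHom F G W) (V) (s) :
    (∑ j ∈ T, φ j).1 V s = ∑ j ∈ T, (φ j).1 V s := by
  classical
  induction T using Finset.induction_on with
  | empty => rfl
  | insert a T ha ih => rw [Finset.sum_insert ha, Finset.sum_insert ha, ← ih, localHom_add_apply]

/-- The homomorphism given by a family of functions depends only on the classes of the functions
modulo the products of the ideals of the `Y a` with the ideal of `Z`, linearly. -/
lemma cycHom_eq_sum {J K : Type*} (T : Finset J) (T' : Finset K) (z : PushCyc i U)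
    (c : J → Γ(M, U)) (w : J → PushCyc i U) (d : K → Γ(M, U)) (g : Fin l → K → Γ(M, U))
    (hd : ∀ k ∈ T', ι.app U (d k) = 0) (hg : ∀ a, ∀ k ∈ T', fnRes (i a) U (g a k) = 0)
    (h : ∀ a, z.1 a = ∑ j ∈ T, c j * (w j).1 a + ∑ k ∈ T', d k * g a k) :
    D.cycHom z = ∑ j ∈ T, ι.app U (c j) • D.cycHom (w j) := by
  refine hom_ext fun a V hV ν ↦ ?_
  have hg' (k : T') : ∃ s, idealIncl (i a) U s = g a k := exists_idealIncl (i a) _ (hg a k k.2)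
  choose t ht using hg'
  have hs : cycSec z a = ∑ j ∈ T, c j • cycSec (w j) a + ∑ k : T', d k • t k := by
    refine idealIncl_injective (i a) U ?_
    rw [idealIncl_cycSec, map_add, map_sum, map_sum]
    refine (h a).trans (congrArg₂ (· + ·) (Finset.sum_congr rfl fun j _ ↦ ?_) ?_)
    · rw [map_smul, idealIncl_cycSec]
      rfl
    · rw [← Finset.sum_coe_sort]
      refine Finset.sum_congr rfl fun k _ ↦ ?_
      rw [map_smul, ht]
      rfl
  rw [cycHom_q, localHom_sum_apply, hs, map_add, map_sum, map_sum]
  have h0 (k : T') : D.evalAt hV a ν (d k • t k) = 0 := by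
    rw [evalAt_smul, app_rr, hd k k.2, map_zero, zero_smul]
  rw [Finset.sum_eq_zero fun k _ ↦ h0 k, add_zero]
  refine Finset.sum_congr rfl fun j _ ↦ ?_
  rw [evalAt_smul, localHom_smul_apply, D.cycHom_q (w j) a hV ν, app_rr]

end Hom

end QuotData

end Data

/-! #### Frames of the quotient -/

section Frame

open Opposite TopologicalSpace

variable {M Z : Scheme.{u}} {l : ℕ} {Y : Fin l → Scheme.{u}}

lemma rr_self {U : M.Opens} (h : U ≤ U) (a : Γ(M, U)) : rr h a = a := ring_res_self h a

/-- Functions `f j` on `U` such that those with `κ j = a` generate the ideal of `Y a` regularly,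
and those with `j ∈ S` generate the ideal of `Z` regularly, where `m` is a matrix that expresses all
of them in terms of the latter. -/
structure IsFrame (i : ∀ a, Y a ⟶ M) (ι : Z ⟶ M) {U : M.Opens} {J : Type u} [Fintype J]
    [DecidableEq J] (κ : J → Fin l) (f : J → Γ(M, U)) (S : Set J) [DecidablePred (· ∈ S)]
    (m : J → J → Γ(M, U)) : Prop where
  reg (a : Fin l) : IsRegGen (i a) fun j : {j // κ j = a} ↦ f j
  regInter : IsRegGen ι fun j : {j // j ∈ S} ↦ f j
  surjective (a : Fin l) (V : M.affineOpens) (h : V.1 ≤ U) : Function.Surjective (fnRes (i a) V.1)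
  eq_sum (j : J) : f j = ∑ x, m j x * f x
  eq_zero (j x : J) (hx : x ∉ S) : m j x = 0
  eq_one (s : J) (hs : s ∈ S) (x : J) : m s x = if x = s then 1 else 0

lemma IsRegGen.restrict {Y : Scheme.{u}} {i : Y ⟶ M} {U : M.Opens} {J : Type u} [Fintype J]
    {f : J → Γ(M, U)} (hf : IsRegGen i f) {V : M.Opens} (h : V ≤ U) :
    IsRegGen i fun j ↦ rr h (f j) where
  mem j := by rw [fnRes_rr, hf.mem, map_zero]
  span W hW x hx := by
    obtain ⟨a, ha⟩ := hf.span W (hW.trans h) x hx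
    refine ⟨a, ha.trans (Finset.sum_congr rfl fun j _ ↦ ?_)⟩
    exact congrArg (a j * ·) (ring_res_res h hW (f j))
  rel W hW a ha j := by
    refine hf.rel W (hW.trans h) a (Eq.trans (Finset.sum_congr rfl fun j _ ↦ ?_) ha) j
    exact congrArg (a j * ·) (ring_res_res h hW (f j))

lemma IsRegGen.exists_idealIncl {Y : Scheme.{u}} {i : Y ⟶ M} {U : M.Opens} {J : Type u} [Fintype J]
    {f : J → Γ(M, U)} (hf : IsRegGen i f) :
    ∃ s : J → Γ(idealSheaf i, U), ∀ j, idealIncl i U (s j) = f j := by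
  choose s hs using fun j ↦ MultiTor.exists_idealIncl i (f j) (hf.mem j)
  exact ⟨s, hs⟩

/-- The homomorphism that takes the coefficient of a generator. -/
def IsRegGen.dual {Y : Scheme.{u}} {i : Y ⟶ M} {U : M.Opens} {J : Type u} [Fintype J]
    {f : J → Γ(M, U)} (hf : IsRegGen i f) (j : J) : localHom (idealSheaf i) (pushO i) U :=
  (hf.exists_dual j).choose

lemma IsRegGen.dual_apply {Y : Scheme.{u}} {i : Y ⟶ M} {U : M.Opens} {J : Type u} [Fintype J]
    {f : J → Γ(M, U)} (hf : IsRegGen i f) (j : J) (s : Γ(idealSheaf i, U)) (a : J → Γ(M, U))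
    (h : idealIncl i U s = ∑ j, a j * f j) : (hf.dual j).1 ⟨U, le_rfl⟩ s = fnRes i U (a j) :=
  (hf.exists_dual j).choose_spec U le_rfl s a (by
    rw [h]
    exact Finset.sum_congr rfl fun j _ ↦ by rw [rr_self])

lemma IsRegGen.dual_gen {Y : Scheme.{u}} {i : Y ⟶ M} {U : M.Opens} {J : Type u}
    [Fintype J] [DecidableEq J] {f : J → Γ(M, U)} (hf : IsRegGen i f) (j : J)
    (s : Γ(idealSheaf i, U)) (x : J) (h : idealIncl i U s = f x) :
    (hf.dual j).1 ⟨U, le_rfl⟩ s = fnRes i U (if j = x then 1 else 0) :=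
  hf.dual_apply j s (fun j ↦ if j = x then 1 else 0) (by simp [h])

/-- Over an affine open subset, homomorphisms from the ideal sheaf are combinations of the
coefficient homomorphisms. -/
lemma IsRegGen.exists_eq_sum {Y : Scheme.{u}} {i : Y ⟶ M} {U : M.Opens} {J : Type u}
    [Fintype J] {f : J → Γ(M, U)} (hf : IsRegGen i f) {V : M.Opens} (hV : V ≤ U)
    (hi : Function.Surjective (fnRes i V)) (ν : localHom (idealSheaf i) (pushO i) V) :
    ∃ n : J → Γ(M, V), ν = ∑ j, n j • localHomRes _ _ hV (hf.dual j) := by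
  classical
  obtain ⟨s, hs⟩ := hf.exists_idealIncl
  choose n hn using fun j ↦ hi (ν.1 ⟨V, le_rfl⟩ (MultiTor.res _ hV (s j)))
  refine ⟨n, (hf.restrict hV).localHom_ext (fun j ↦ MultiTor.res _ hV (s j))
    (fun j ↦ by rw [idealIncl_res, hs]) fun x ↦ ?_⟩
  rw [QuotData.localHom_sum_apply, ← hn]
  have h1 (j : J) : (n j • localHomRes _ _ hV (hf.dual j)).1 ⟨V, le_rfl⟩ (MultiTor.res _ hV (s x)) =
      if j = x then fnRes i V (n j) else 0 := by
    rw [localHom_smul_apply]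
    have h2 : (localHomRes _ _ hV (hf.dual j)).1 ⟨V, le_rfl⟩ (MultiTor.res _ hV (s x)) =
        fnRes i V (if j = x then 1 else 0) := by
      refine (((hf.dual j).2 ⟨U, le_rfl⟩ ⟨V, hV⟩ hV (s x)).trans
        (congrArg (MultiTor.res (pushO i) hV) (hf.dual_gen j (s x) x (hs x)))).trans ?_
      rw [← fnRes_rr]
      split_ifs
      · rw [map_one]
      · rw [map_zero]
    rw [h2]
    change rr le_rfl (n j) • _ = _
    rw [rr_self]
    split_ifs
    · rw [← map_smul, smul_eq_mul, mul_one]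
    · rw [map_zero, smul_zero]
  rw [Finset.sum_congr rfl fun j _ ↦ h1 j, Finset.sum_ite_eq' Finset.univ x,
    if_pos (Finset.mem_univ x)]

end Frame

section FrameHom

open Opposite TopologicalSpace

variable {M Z : Scheme.{u}} {l : ℕ} {Y : Fin l → Scheme.{u}} {i : ∀ a, Y a ⟶ M} {ι : Z ⟶ M}
  (D : QuotData i ι) {U : M.Opens} {J : Type u} [Fintype J] [DecidableEq J] {κ : J → Fin l}
  {f : J → Γ(M, U)} {S : Set J} [DecidablePred (· ∈ S)] {m : J → J → Γ(M, U)}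
  (h : IsFrame i ι κ f S m)

lemma sum_eq_sum_subtype {A : Type*} [AddCommMonoid A] (p : J → Prop) [DecidablePred p]
    {F : J → A} (hF : ∀ x, ¬p x → F x = 0) : ∑ x, F x = ∑ x : {x // p x}, F x := by
  rw [← Finset.sum_subtype (Finset.univ.filter p) (by simp) F, Finset.sum_filter_of_ne]
  exact fun x _ hx ↦ not_imp_comm.1 (hF x) hx

namespace QuotData

/-- The class in the quotient of the coefficient homomorphism of a generator. -/
def dualClass (j : J) : Γ(D.Q, ι ⁻¹ᵁ U) := D.q (κ j) U ((h.reg (κ j)).dual ⟨j, rfl⟩)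

lemma q_dual (a : Fin l) (x : {j // κ j = a}) :
    D.q a U ((h.reg a).dual x) = D.dualClass h x.1 := by
  obtain ⟨j, rfl⟩ := x
  rfl

/-- The classes of the coefficient homomorphisms satisfy the relations given by the homomorphisms
from the ideal sheaf of the intersection. -/
lemma sum_smul_dualClass {s : J} (hs : s ∈ S) :
    ∑ j, ι.app U (m j s) • D.dualClass h j = 0 := by
  have h1 := D.sum_q (V := U) (fun a ↦ ∑ x : {j // κ j = a}, m x s • (h.reg a).dual x)
    (h.regInter.dual ⟨s, hs⟩) fun a ↦ by
      obtain ⟨t, ht⟩ := (h.reg a).exists_idealIncl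
      refine (h.reg a).localHom_ext t ht fun x ↦ ?_
      rw [post_apply, pre_apply, localHom_sum_apply]
      have h2 (y : {j // κ j = a}) : (m y s • (h.reg a).dual y).1 ⟨U, le_rfl⟩ (t x) =
          if y = x then fnRes (i a) U (m y s) else 0 := by
        rw [localHom_smul_apply, (h.reg a).dual_gen y (t x) x (ht x)]
        change rr le_rfl (m y s) • _ = _
        rw [rr_self]
        split_ifs
        · rw [← map_smul, smul_eq_mul, mul_one]
        · rw [map_zero, smul_zero]
      rw [Finset.sum_congr rfl fun y _ ↦ h2 y, Finset.sum_ite_eq' Finset.univ x,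
        if_pos (Finset.mem_univ x), D.rho_fnRes]
      refine (h.regInter.dual_apply ⟨s, hs⟩ _ (fun y ↦ m x y) ?_).symm
      rw [D.idealIncl_incl, ht, h.eq_sum, sum_eq_sum_subtype (· ∈ S)]
      exact fun y hy ↦ by rw [h.eq_zero _ y hy, zero_mul]
  rw [← h1, ← Fintype.sum_fiberwise κ]
  refine Finset.sum_congr rfl fun a _ ↦ ?_
  rw [map_sum]
  exact Finset.sum_congr rfl fun x _ ↦ by rw [map_smulₛₗ, D.q_dual h]

/-- A homomorphism from the quotient that vanishes on the classes of the coefficient homomorphisms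
of the superfluous generators is zero. -/
lemma eq_zero_of_dualClass {ψ : localHom D.Q (structureSheaf Z) (ι ⁻¹ᵁ U)}
    (hψ : ∀ j ∉ S, ψ.1 ⟨ι ⁻¹ᵁ U, le_rfl⟩ (D.dualClass h j) = 0) : ψ = 0 := by
  -- The relation with index `j ∈ S` expresses the class of `j` in terms of the superfluous classes.
  have hall (j : J) : ψ.1 ⟨ι ⁻¹ᵁ U, le_rfl⟩ (D.dualClass h j) = 0 := by
    by_cases hj : j ∈ S
    · have h1 := congrArg (ψ.1 ⟨ι ⁻¹ᵁ U, le_rfl⟩) (D.sum_smul_dualClass h hj)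
      rw [map_sum, map_zero] at h1
      have h2 (x : J) : ψ.1 ⟨ι ⁻¹ᵁ U, le_rfl⟩ (ι.app U (m x j) • D.dualClass h x) =
          if x = j then ψ.1 ⟨ι ⁻¹ᵁ U, le_rfl⟩ (D.dualClass h x) else 0 := by
        rw [map_smul]
        by_cases hx : x ∈ S
        · rw [h.eq_one x hx j]
          by_cases hxj : x = j
          · rw [if_pos hxj.symm, if_pos hxj, map_one, one_smul]
          · rw [if_neg (Ne.symm hxj), if_neg hxj, map_zero, zero_smul]
        · rw [hψ x hx, smul_zero, ite_self]
      rw [Finset.sum_congr rfl fun x _ ↦ h2 x, Finset.sum_ite_eq' Finset.univ j,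
        if_pos (Finset.mem_univ j)] at h1
      exact h1
    · exact hψ j hj
  refine D.eq_zero ψ fun a V hV ν ↦ (pushEquiv ι V).symm.injective ?_
  rw [map_zero]
  refine eq_of_affine (pushO ι) fun W hW ↦ ?_
  rw [map_zero]
  have hq : D.q a W.1 (localHomRes _ _ hW ν) = res D.Q (preimage_mono ι hW) (D.q a V ν) :=
    D.q_res a hW ν
  have h1 : res (structureSheaf Z) (preimage_mono ι hW)
      (ψ.1 ⟨ι ⁻¹ᵁ V, preimage_mono ι hV⟩ (D.q a V ν)) =
      ψ.1 ⟨ι ⁻¹ᵁ W.1, preimage_mono ι (hW.trans hV)⟩ (D.q a W.1 (localHomRes _ _ hW ν)) := by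
    rw [hq]
    exact (ψ.2 ⟨ι ⁻¹ᵁ V, preimage_mono ι hV⟩ ⟨ι ⁻¹ᵁ W.1, preimage_mono ι (hW.trans hV)⟩
      (preimage_mono ι hW) _).symm
  refine Eq.trans (b := ψ.1 ⟨ι ⁻¹ᵁ W.1, preimage_mono ι (hW.trans hV)⟩
    (D.q a W.1 (localHomRes _ _ hW ν))) h1 ?_
  obtain ⟨n, hn⟩ := (h.reg a).exists_eq_sum (hW.trans hV) (h.surjective a W (hW.trans hV))
    (localHomRes _ _ hW ν)
  rw [hn, map_sum, map_sum]
  refine Finset.sum_eq_zero fun x _ ↦ ?_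
  rw [map_smulₛₗ, map_smul, D.q_res, D.q_dual h]
  have h2 := ψ.2 ⟨ι ⁻¹ᵁ U, le_rfl⟩ ⟨ι ⁻¹ᵁ W.1, preimage_mono ι (hW.trans hV)⟩
    (preimage_mono ι (hW.trans hV)) (D.dualClass h x.1)
  rw [hall, map_zero] at h2
  rw [h2, smul_zero]

/-- The homomorphism given by a family of functions takes the class of a coefficient homomorphism to
the corresponding coefficient of the family. -/
lemma cycHom_dualClass (z : PushCyc i U) (j : J) (c : J → Γ(M, U))
    (hc : z.1 (κ j) = ∑ x : {x // κ x = κ j}, c x * f x) :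
    (D.cycHom z).1 ⟨ι ⁻¹ᵁ U, le_rfl⟩ (D.dualClass h j) = ι.app U (c j) := by
  refine (D.cycHom_q z (κ j) le_rfl _).trans (D.evalAt_eq le_rfl (κ j) _ _ _ ?_)
  refine (h.reg (κ j)).dual_apply ⟨j, rfl⟩ _ (fun x ↦ c x) ?_
  rw [res_self, idealIncl_cycSec]
  exact hc

variable (m) in
/-- The coefficients of the relation that expresses the generator `f j` in terms of the generators
of the ideal of the intersection. -/
def relCoef (j x : J) : Γ(M, U) := (if x = j then 1 else 0) - m j x

lemma sum_relCoef (hm : ∀ j, f j = ∑ x, m j x * f x) (j : J) : ∑ x, relCoef m j x * f x = 0 := by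
  simp only [relCoef, sub_mul, Finset.sum_sub_distrib, ite_mul, one_mul, zero_mul,
    Finset.sum_ite_eq', Finset.mem_univ, if_true]
  rw [← hm, sub_self]

/-- The family of functions given by the relation for the generator `f j`. -/
def frameCyc (j : J) : PushCyc i U :=
  ⟨fun a ↦ ∑ x : {x // κ x = a}, relCoef m j x * f x, fun a ↦ by
    refine (smul_pushPointed (i a) U _).trans ?_
    rw [map_sum]
    refine Finset.sum_eq_zero fun x _ ↦ ?_
    rw [← smul_eq_mul, map_smul, (h.reg a).mem x, smul_zero]
    rfl,
   (Fintype.sum_fiberwise κ _).trans (sum_relCoef h.eq_sum j)⟩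

lemma cycHom_frameCyc_dualClass {j : J} (hj : j ∉ S) (j' : J) :
    (D.cycHom (frameCyc h j')).1 ⟨ι ⁻¹ᵁ U, le_rfl⟩ (D.dualClass h j) =
      ι.app U (if j = j' then 1 else 0) := by
  rw [D.cycHom_dualClass h (frameCyc h j') j (relCoef m j') rfl, relCoef, h.eq_zero j' j hj,
    sub_zero]

/-- Over an affine open subset, the homomorphism given by a family of functions is the combination
of the homomorphisms given by the superfluous generators, with the coefficients of the family. -/
lemma cycHom_eq_sum_frameCyc (hU : IsAffineOpen U) (z : PushCyc i U) (c : J → Γ(M, U))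
    (hc : ∀ a, z.1 a = ∑ x : {x // κ x = a}, c x * f x) :
    D.cycHom z = ∑ j with j ∉ S, ι.app U (c j) • D.cycHom (frameCyc h j) := by
  -- Subtracting the relations of the superfluous generators leaves a family `d` supported in `S`;
  -- as the generators with index in `S` are regular, the coefficients `d` vanish on `Z`, and the
  -- products `d x * f x` lie in the products of ideals that act by zero.
  let d (x : J) : Γ(M, U) := c x - ∑ j with j ∉ S, c j * relCoef m j x
  have hd0 (x : J) (hx : x ∉ S) : d x = 0 := by
    have h1 (j : J) : c j * relCoef m j x = if x = j then c j else 0 := by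
      rw [relCoef, h.eq_zero j x hx, sub_zero, mul_ite, mul_one, mul_zero]
    simp only [d, h1]
    rw [Finset.sum_ite_eq, if_pos (by simpa using hx), sub_self]
  have hsum : ∑ x, d x * f x = 0 := by
    have h1 : ∑ x, c x * f x = 0 := by
      rw [← Fintype.sum_fiberwise κ]
      exact (Finset.sum_congr rfl fun a _ ↦ (hc a).symm).trans z.2.2
    simp only [d, sub_mul, Finset.sum_sub_distrib, h1, Finset.sum_mul]
    rw [Finset.sum_comm, zero_sub, neg_eq_zero]
    refine Finset.sum_eq_zero fun j _ ↦ ?_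
    simp only [mul_assoc]
    rw [← Finset.mul_sum, sum_relCoef h.eq_sum, mul_zero]
  have hd (x : J) (hx : x ∈ S) : ι.app U (d x) = 0 := by
    refine h.regInter.rel ⟨U, hU⟩ le_rfl (fun x ↦ d x) ?_ ⟨x, hx⟩
    rw [← hsum, sum_eq_sum_subtype (· ∈ S) fun x hx ↦ by rw [hd0 x hx, zero_mul]]
    exact Finset.sum_congr rfl fun x _ ↦ by rw [rr_self]
  refine D.cycHom_eq_sum (Finset.univ.filter (· ∉ S)) (Finset.univ.filter (· ∈ S)) z c (frameCyc h)
    d (fun a x ↦ if κ x = a then f x else 0) (fun x hx ↦ hd x (Finset.mem_filter.1 hx).2)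
    (fun a x _ ↦ ?_) fun a ↦ ?_
  · split_ifs with hx
    · exact (h.reg a).mem ⟨x, hx⟩
    · exact map_zero _
  · have h1 : ∑ x with x ∈ S, d x * (if κ x = a then f x else 0) =
        ∑ x : {x // κ x = a}, d x * f x := by
      rw [Finset.sum_filter_of_ne fun x _ hx ↦ by
        by_contra h0
        exact hx (by rw [hd0 x h0, zero_mul])]
      rw [sum_eq_sum_subtype (κ · = a) fun x hx ↦ by rw [if_neg hx, mul_zero]]
      exact Finset.sum_congr rfl fun x _ ↦ by rw [if_pos x.2]
    have h2 : ∑ j with j ∉ S, c j * (frameCyc h j).1 a =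
        ∑ x : {x // κ x = a}, (∑ j with j ∉ S, c j * relCoef m j x) * f x := by
      simp only [Finset.sum_mul]
      rw [Finset.sum_comm]
      refine Finset.sum_congr rfl fun j _ ↦ ?_
      refine (Finset.mul_sum _ _ _).trans (Finset.sum_congr rfl fun x _ ↦ ?_)
      exact (mul_assoc _ _ _).symm
    refine (hc a).trans ?_
    rw [h1]
    refine Eq.trans ?_ (congrArg (· + _) h2.symm)
    rw [← Finset.sum_add_distrib]
    refine Finset.sum_congr rfl fun x _ ↦ ?_
    simp only [d]
    ring

end QuotData

end FrameHom

/-! #### Exterior powers and frames of charts -/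

section Algebra

/-- Combinations of products of vectors in an exterior power, as elements of the exterior algebra.
-/
lemma coe_sum_ιMulti {A B V K T : Type u} [CommRing A] [CommRing B] [AddCommGroup V] [Module B V]
    (σ : A →+* B) (v : K → V) (q : ℕ) (t : T → Fin q → K) (x : T →₀ A) :
    ((x.sum fun s a ↦ σ a • exteriorPower.ιMulti B q fun k ↦ v (t s k) : ⋀[B]^q V) :
      ExteriorAlgebra B V) = ODG.prodComb σ v (x.mapDomain fun s ↦ List.ofFn (t s)) := by
  rw [ODG.prodComb, Finsupp.sum_mapDomain_index (fun _ ↦ by rw [map_zero, zero_smul])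
    fun _ _ _ ↦ by rw [map_add, add_smul], Finsupp.sum, Finsupp.sum,
    AddSubmonoidClass.coe_finsetSum]
  refine Finset.sum_congr rfl fun s _ ↦ ?_
  rw [Submodule.coe_smul, exteriorPower.ιMulti_apply_coe, ExteriorAlgebra.ιMulti_apply,
    List.map_ofFn]
  rfl

/-- Combinations of the products of vectors that span, with coefficients in a ring that surjects to
the ring of scalars, exhaust the exterior power. -/
lemma exists_sum_ιMulti {A B V K : Type u} [CommRing A] [CommRing B] [AddCommGroup V] [Module B V]
    {σ : A →+* B} (hσ : Function.Surjective σ) {v : K → V}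
    (hv : Submodule.span B (Set.range v) = ⊤) (q : ℕ) (y : ⋀[B]^q V) :
    ∃ x : (Fin q → K) →₀ A,
      (x.sum fun s a ↦ σ a • exteriorPower.ιMulti B q fun k ↦ v (s k)) = y := by
  have hy : y ∈ Submodule.span B
      (exteriorPower.ιMulti B q '' {a | Set.range a ⊆ Set.range v}) := by
    rw [exteriorPower.ιMulti_span_of_span B q V hv]
    trivial
  induction hy using Submodule.span_induction with
  | mem y hy =>
    obtain ⟨a, ha, rfl⟩ := hy
    choose s hs using fun k ↦ ha ⟨k, rfl⟩
    refine ⟨Finsupp.single s 1, ?_⟩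
    rw [Finsupp.sum_single_index (by rw [map_zero, zero_smul]), map_one, one_smul]
    exact congrArg _ (funext hs)
  | zero => exact ⟨0, Finsupp.sum_zero_index⟩
  | add y y' _ _ hy hy' =>
    obtain ⟨x, rfl⟩ := hy
    obtain ⟨x', rfl⟩ := hy'
    exact ⟨x + x', Finsupp.sum_add_index' (fun _ ↦ by rw [map_zero, zero_smul])
      fun _ _ _ ↦ by rw [map_add, add_smul]⟩
  | smul b y _ hy =>
    obtain ⟨x, rfl⟩ := hy
    obtain ⟨a, rfl⟩ := hσ b
    refine ⟨a • x, ?_⟩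
    rw [Finsupp.sum_smul_index fun _ ↦ by rw [map_zero, zero_smul], Finsupp.smul_sum]
    exact Finset.sum_congr rfl fun s _ ↦ by
      beta_reduce
      rw [map_mul, mul_smul]

end Algebra

section FrameOfChart

open Opposite TopologicalSpace

variable {M Z : Scheme.{u}} {l : ℕ}

lemma fnRes_eq_zero_iff (I : M.IdealSheafData) (V : M.affineOpens) (x : Γ(M, V.1)) :
    fnRes I.subschemeι V.1 x = 0 ↔ x ∈ I.ideal V := by
  rw [← I.ker_subschemeι_app V]
  rfl

/-- Functions that generate the ideal of a closed subscheme on all smaller affine open subsets and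
that are regular in any order generate it regularly. -/
lemma isRegGen_of_regularOn (I : M.IdealSheafData) (U : M.affineOpens) {J : Type u} [Fintype J]
    (p : J → Prop) [DecidablePred p] (f : J → Γ(M, U.1))
    (hs : ∀ (V : M.affineOpens) (h : V.1 ≤ U.1),
      Ideal.span ((fun j ↦ rr h (f j)) '' {j | p j}) = I.ideal V)
    (hr : ∀ (V : M.affineOpens) (h : V.1 ≤ U.1), ODG.RegularOn (fun j ↦ rr h (f j)) {j | p j}) :
    IsRegGen I.subschemeι fun j : {j // p j} ↦ f j where
  mem j := by
    rw [fnRes_eq_zero_iff, ← hs U le_rfl]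
    refine Ideal.subset_span ⟨j, j.2, rr_self le_rfl _⟩
  span V h x hx := by
    rw [fnRes_eq_zero_iff, ← hs V h, Set.image_eq_range] at hx
    obtain ⟨a, ha⟩ := Submodule.mem_span_range_iff_exists_fun _ |>.1 hx
    exact ⟨a, ha.symm⟩
  rel V h a ha j := by
    classical
    rw [fnRes_eq_zero_iff, ← hs V h]
    refine Ideal.span_mono (Set.image_mono Set.sdiff_subset)
      (hr V h j.1 j.2 ({x | p x} \ {j.1}) Set.sdiff_subset (by simp) (a j) ?_)
    rw [← Finset.add_sum_erase _ _ (Finset.mem_univ j), add_eq_zero_iff_eq_neg] at ha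
    rw [mul_comm]
    refine ha ▸ neg_mem (sum_mem fun x hx ↦ Ideal.mul_mem_left _ _ (Ideal.subset_span ?_))
    exact ⟨x, ⟨x.2, fun h ↦ (Finset.mem_erase.1 hx).1 (Subtype.ext h)⟩, rfl⟩

/-- Regular generators of the ideals of the `Y a` and of `Z` form a frame: the former lie in the
ideal of `Z`. -/
lemma QuotData.exists_isFrame {Y : Fin l → Scheme.{u}} {i : ∀ a, Y a ⟶ M} {ι : Z ⟶ M}
    (D : QuotData i ι) (U : M.affineOpens) {J : Type u} [Fintype J]
    [DecidableEq J] (κ : J → Fin l) (f : J → Γ(M, U.1)) (S : Set J) [DecidablePred (· ∈ S)]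
    (reg : ∀ a, IsRegGen (i a) fun j : {j // κ j = a} ↦ f j)
    (regInter : IsRegGen ι fun j : {j // j ∈ S} ↦ f j)
    (hi : ∀ (a : Fin l) (V : M.affineOpens), V.1 ≤ U.1 → Function.Surjective (fnRes (i a) V.1)) :
    ∃ m, IsFrame i ι κ f S m := by
  have hf (j : J) : fnRes ι U.1 (f j) = 0 := by
    rw [← D.rho_fnRes (κ j), (reg (κ j)).mem ⟨j, rfl⟩, map_zero]
  choose b hb using fun j ↦ regInter.span U le_rfl (f j) (hf j)
  -- The rows of the matrix with index in `S` are chosen to be trivial, the other rows by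
  -- generation.
  refine ⟨fun j x ↦ if hx : x ∈ S then (if j ∈ S then if x = j then 1 else 0 else b j ⟨x, hx⟩)
    else 0, reg, regInter, hi, fun j ↦ ?_, fun j x hx ↦ dif_neg hx, fun s hs x ↦ ?_⟩
  · rw [sum_eq_sum_subtype (· ∈ S) fun x hx ↦ by rw [dif_neg hx, zero_mul]]
    by_cases hj : j ∈ S
    · rw [Finset.sum_eq_single ⟨j, hj⟩ (fun x _ hx ↦ ?_) (by simp)]
      · rw [dif_pos hj, if_pos hj, if_pos rfl, one_mul]
      · rw [dif_pos x.2, if_pos hj, if_neg fun h ↦ hx (Subtype.ext h), zero_mul]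
    · refine (hb j).trans (Finset.sum_congr rfl fun x _ ↦ ?_)
      rw [dif_pos x.2, if_neg hj, rr_self]
  · by_cases hx : x ∈ S
    · rw [dif_pos hx, if_pos hs]
    · rw [dif_neg hx, if_neg (by rintro rfl; exact hx hs)]

end FrameOfChart

/-! ### Wedge products of families of functions -/

section Exterior

open Opposite TopologicalSpace

variable {X : Scheme.{u}} (q : ℕ) (F : X.Modules)

/-- The section of the exterior power given by an element of the exterior power of the sections. -/
def extEl (W : X.Opens) : ⋀[Γ(X, W)]^q Γ(F, W) →ₗ[Γ(X, W)] Γ(extPower q F, W) :=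
  toSh (presheafExt q F) W

lemma extEl_res {W V : X.Opens} (h : V ≤ W) (y : ⋀[Γ(X, W)]^q Γ(F, W)) :
    extEl q F V (extMap q (res F h) y) = res _ h (extEl q F W y) :=
  toSh_res (presheafExt q F) h y

lemma extEl_locally_surjective {W : X.Opens} (t : Γ(extPower q F, W)) {p : X} (hp : p ∈ W) :
    ∃ (V : X.Opens) (hV : V ≤ W) (y : ⋀[Γ(X, V)]^q Γ(F, V)), p ∈ V ∧ extEl q F V y = res _ hV t :=
  toSh_locally_surjective (presheafExt q F) t hp

lemma extEl_locally_injective {W : X.Opens} (y : ⋀[Γ(X, W)]^q Γ(F, W)) (hy : extEl q F W y = 0)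
    {p : X} (hp : p ∈ W) : ∃ (V : X.Opens) (hV : V ≤ W), p ∈ V ∧ extMap q (res F hV) y = 0 :=
  toSh_locally_injective (presheafExt q F) y hy hp

end Exterior

section Wedge

open Opposite TopologicalSpace

variable {M Z : Scheme.{u}} {l : ℕ} {Y : Fin l → Scheme.{u}} {i : ∀ a, Y a ⟶ M} {ι : Z ⟶ M}

/-- The presheaf of tuples of families of functions that vanish on the `Y a`, with sum zero. -/
abbrev pushTuples (i : ∀ a, Y a ⟶ M) (q : ℕ) : M.Opensᵒᵖ ⥤ Type u :=
  tuples (F := fun a ↦ toPre (pushO (i a))) (fun a ↦ pushPointed (i a)) q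

/-- The formal combinations of tuples. -/
abbrev TupleComb (i : ∀ a, Y a ⟶ M) (q : ℕ) (U : M.Opens) : Type u :=
  Sec (freeP M.presheaf (pushTuples i q)) (op U)

variable (D : QuotData i ι) (q : ℕ)

namespace QuotData

/-- The section of the dual of the quotient given by a family of functions. -/
def dualSec {U : M.Opens} (z : PushCyc i U) : Γ(MultiTor.dual D.Q, ι ⁻¹ᵁ U) :=
  homSec D.Q (structureSheaf Z) (ι ⁻¹ᵁ U) (D.cycHom z)

lemma dualSec_res {U V : M.Opens} (h : V ≤ U) (z : PushCyc i U) :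
    D.dualSec (z.res h) = MultiTor.res (MultiTor.dual D.Q) (preimage_mono ι h) (D.dualSec z) := by
  rw [dualSec, cycHom_res]
  exact homSec_res (preimage_mono ι h) (D.cycHom z)

/-- The exterior power of the dual of the quotient, over the preimage of an open subset. -/
abbrev ExtSec (U : M.Opens) : Type u := ⋀[Γ(Z, ι ⁻¹ᵁ U)]^q Γ(MultiTor.dual D.Q, ι ⁻¹ᵁ U)

/-- The wedge product of the sections given by a tuple of families of functions. -/
def wedge {U : M.Opens} (s : (pushTuples i q).obj (op U)) : D.ExtSec q U :=
  exteriorPower.ιMulti Γ(Z, ι ⁻¹ᵁ U) q fun k ↦ D.dualSec ((show Fin q → PushCyc i U from s) k)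

/-- The combination of wedge products given by a combination of tuples. -/
def wedgeSum (U : M.Opens) : TupleComb i q U →ₛₗ[(ι.app U).hom] D.ExtSec q U where
  toFun x := (freeEl.symm x).sum fun s a ↦ ι.app U a • D.wedge q s
  map_add' x y := by
    rw [map_add]
    exact Finsupp.sum_add_index' (fun _ ↦ by rw [map_zero, zero_smul])
      fun _ _ _ ↦ by rw [map_add, add_smul]
  map_smul' r x := by
    rw [map_smul, Finsupp.sum_smul_index fun _ ↦ by rw [map_zero, zero_smul], Finsupp.smul_sum]
    exact Finset.sum_congr rfl fun s _ ↦ by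
      beta_reduce
      rw [map_mul, mul_smul]

lemma wedgeSum_freeEl (U : M.Opens) (x : (pushTuples i q).obj (op U) →₀ Γ(M, U)) :
    D.wedgeSum q U (freeEl (R := M.presheaf) x) = x.sum fun s a ↦ ι.app U a • D.wedge q s := rfl

lemma wedgeSum_single {U : M.Opens} (s : (pushTuples i q).obj (op U)) :
    D.wedgeSum q U (freeEl (R := M.presheaf) (S := pushTuples i q) (Finsupp.single s 1)) =
      D.wedge q s := by
  rw [wedgeSum_freeEl, Finsupp.sum_single_index (by rw [map_zero, zero_smul]), map_one, one_smul]

lemma wedge_res {U V : M.Opens} (h : V ≤ U) (s : (pushTuples i q).obj (op U)) :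
    D.wedge q ((pushTuples i q).map (homOfLE h).op s) =
      extMap q (MultiTor.res (MultiTor.dual D.Q) (preimage_mono ι h)) (D.wedge q s) := by
  rw [wedge, wedge, extMap_ιMulti]
  exact congrArg _ (funext fun k ↦ D.dualSec_res h ((show Fin q → PushCyc i U from s) k))

lemma tupleComb_induction {U : M.Opens} {p : TupleComb i q U → Prop} (x : TupleComb i q U)
    (h0 : p 0) (hadd : ∀ x y, p x → p y → p (x + y))
    (hs : ∀ (s : (pushTuples i q).obj (op U)) (a : Γ(M, U)),
      p (a • freeEl (R := M.presheaf) (S := pushTuples i q) (Finsupp.single s 1))) : p x := by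
  obtain ⟨x, rfl⟩ := (freeEl (R := M.presheaf) (S := pushTuples i q)).surjective x
  induction x using Finsupp.induction_linear with
  | zero => rwa [map_zero]
  | add x y hx hy =>
    rw [map_add]
    exact hadd _ _ hx hy
  | single s a =>
    have := hs s a
    rwa [← map_smul, Finsupp.smul_single, smul_eq_mul, mul_one] at this

lemma wedgeSum_res {U V : M.Opens} (h : V ≤ U) (x : TupleComb i q U) :
    D.wedgeSum q V (secRes _ (homOfLE h).op x) =
      extMap q (MultiTor.res (MultiTor.dual D.Q) (preimage_mono ι h)) (D.wedgeSum q U x) := by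
  refine tupleComb_induction q (p := fun x ↦ D.wedgeSum q V (secRes _ (homOfLE h).op x) =
    extMap q (MultiTor.res (MultiTor.dual D.Q) (preimage_mono ι h)) (D.wedgeSum q U x)) x
    ?_ (fun x y hx hy ↦ ?_) fun s a ↦ ?_
  · simp only [map_zero]
  · simp only [map_add, hx, hy]
  · rw [map_smulₛₗ, map_smulₛₗ, map_smulₛₗ, map_smulₛₗ, wedgeSum_single, ← D.wedge_res q h]
    refine congrArg₂ (· • ·) (app_rr ι h a) ?_
    refine (congrArg (D.wedgeSum q V)
      (secRes_freeEl_single (S := pushTuples i q) (homOfLE h).op s)).trans ?_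
    exact D.wedgeSum_single q _

/-- The direct image of the exterior power of the dual of the quotient. -/
abbrev target : M.Modules :=
  (Scheme.Modules.pushforward ι).obj (extPower q (MultiTor.dual D.Q))

/-- The section of the exterior power sheaf given by an element of the exterior power. -/
def toTarget (U : M.Opens) : D.ExtSec q U →+ Γ(D.target q, U) :=
  (extEl q (MultiTor.dual D.Q) (ι ⁻¹ᵁ U)).toAddMonoidHom

lemma toTarget_smul (U : M.Opens) (r : Γ(M, U)) (y : D.ExtSec q U) :
    D.toTarget q U (ι.app U r • y) = r • D.toTarget q U y :=
  (extEl q (MultiTor.dual D.Q) (ι ⁻¹ᵁ U)).map_smul (ι.app U r) y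

lemma toTarget_res {U V : M.Opens} (h : V ≤ U) (y : D.ExtSec q U) :
    D.toTarget q V (extMap q (MultiTor.res (MultiTor.dual D.Q) (preimage_mono ι h)) y) =
      MultiTor.res (D.target q) h (D.toTarget q U y) :=
  extEl_res q (MultiTor.dual D.Q) (preimage_mono ι h) y

/-- The morphism from combinations of tuples to the exterior power, given by wedge products. -/
def wedgeHom : freeP M.presheaf (pushTuples i q) ⟶ (D.target q).val :=
  secHom (G := toPre (D.target q))
    (fun U ↦
      { toFun := fun x ↦ D.toTarget q U.unop (D.wedgeSum q U.unop x)
        map_add' := fun x y ↦ (congrArg (D.toTarget q U.unop) (map_add _ x y)).trans (map_add _ _ _)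
        map_smul' := fun r x ↦ (congrArg (D.toTarget q U.unop) (map_smulₛₗ _ r x)).trans
          (D.toTarget_smul q U.unop r _) })
    (fun {U V} f x ↦ (congrArg (D.toTarget q V.unop) (D.wedgeSum_res q f.unop.le x)).trans
      (D.toTarget_res q f.unop.le _))

lemma secTo_wedgeHom (U : M.Opens) (x : TupleComb i q U) :
    secTo (D.wedgeHom q) U x = D.toTarget q U (D.wedgeSum q U x) := rfl

end QuotData

end Wedge

/-! ### Comparison over a chart -/

section Good

open Opposite TopologicalSpace

variable {M Z : Scheme.{u}} {l : ℕ} {Y : Fin l → Scheme.{u}} {i : ∀ a, Y a ⟶ M} {ι : Z ⟶ M}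

/-- The multitor presheaf of the sheaves `𝒪_{Y a}`. -/
abbrev pushTor (i : ∀ a, Y a ⟶ M) (q : ℕ) : PMod M.presheaf :=
  presheafTor q fun a ↦ toPre (pushO (i a))

/-- The morphism from combinations of tuples to the multitor. -/
abbrev pushWordHom (i : ∀ a, Y a ⟶ M) (q : ℕ) :
    freeP M.presheaf (pushTuples i q) ⟶ pushTor i q :=
  wordHom (F := fun a ↦ toPre (pushO (i a))) (fun a ↦ pushPointed (i a)) q

variable (D : QuotData i ι) (q : ℕ)

namespace QuotData

/-- Over `U`, combinations of tuples map onto the multitor and onto the exterior power, with the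
same kernel. -/
structure IsGood (U : M.Opens) : Prop where
  surjective : Function.Surjective (secMap (pushWordHom i q) (op U))
  eq_zero_iff (x : TupleComb i q U) : secMap (pushWordHom i q) (op U) x = 0 ↔ D.wedgeSum q U x = 0
  wedgeSum_surjective : Function.Surjective (D.wedgeSum q U)

lemma coe_wedgeSum (U : M.Opens) (x : (pushTuples i q).obj (op U) →₀ Γ(M, U)) :
    (D.wedgeSum q U (freeEl (R := M.presheaf) x) :
      ExteriorAlgebra Γ(Z, ι ⁻¹ᵁ U) Γ(MultiTor.dual D.Q, ι ⁻¹ᵁ U)) =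
    ODG.prodComb (ι.app U).hom (fun z : PushCyc i U ↦ D.dualSec z)
      (x.mapDomain (tupleList fun a ↦ pushPointed (i a))) :=
  coe_sum_ιMulti (ι.app U).hom (fun z : PushCyc i U ↦ D.dualSec z) q
    (fun s : (pushTuples i q).obj (op U) ↦ (show Fin q → PushCyc i U from s)) x

lemma homSec_bijective (W : Z.Opens) :
    Function.Bijective (homSec D.Q (structureSheaf Z) W) :=
  toSh_presheafHom_bijective D.Q (structureSheaf Z) W

/-- The sections of the dual of the quotient are the homomorphisms. -/
def dualEquiv (W : Z.Opens) :
    localHom D.Q (structureSheaf Z) W ≃ₗ[Γ(Z, W)] Γ(MultiTor.dual D.Q, W) :=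
  LinearEquiv.ofBijective _ (D.homSec_bijective W)

lemma dualSec_eq {U : M.Opens} (z : PushCyc i U) : D.dualSec z = D.dualEquiv _ (D.cycHom z) := rfl

/-- Evaluation of homomorphisms at a section. -/
def homEval {W : Z.Opens} (t : Γ(D.Q, W)) :
    localHom D.Q (structureSheaf Z) W →ₗ[Γ(Z, W)] Γ(Z, W) where
  toFun φ := φ.1 ⟨W, le_rfl⟩ t
  map_add' _ _ := rfl
  map_smul' r φ := (localHom_smul_apply r φ ⟨W, le_rfl⟩ t).trans
    (congrArg (· • φ.1 ⟨W, le_rfl⟩ t) (rr_self le_rfl r))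

lemma homEval_apply {W : Z.Opens} (t : Γ(D.Q, W)) (φ : localHom D.Q (structureSheaf Z) W) :
    D.homEval t φ = φ.1 ⟨W, le_rfl⟩ t := rfl

variable {U : M.Opens} {J : Type u} [Fintype J] [DecidableEq J] {κ : J → Fin l}
  {f : J → Γ(M, U)} {S : Set J} [DecidablePred (· ∈ S)] {m : J → J → Γ(M, U)}

lemma homEval_frameCyc (h : IsFrame i ι κ f S m) {j : J} (hj : j ∉ S) (j' : J) :
    D.homEval (D.dualClass h j) (D.cycHom (frameCyc h j')) = if j = j' then 1 else 0 := by
  refine (D.cycHom_frameCyc_dualClass h hj j').trans ?_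
  split_ifs
  · exact map_one (ι.app U).hom
  · exact map_zero _

/-- The sections given by families of functions span the dual of the quotient. -/
lemma span_dualSec (h : IsFrame i ι κ f S m) :
    Submodule.span Γ(Z, ι ⁻¹ᵁ U) (Set.range fun z : PushCyc i U ↦ D.dualSec z) = ⊤ := by
  refine eq_top_iff.2 fun t _ ↦ ?_
  obtain ⟨φ, rfl⟩ := (D.dualEquiv (ι ⁻¹ᵁ U)).surjective t
  let b (j : J) : Γ(Z, ι ⁻¹ᵁ U) := D.homEval (D.dualClass h j) φ
  -- The `cycHom (frameCyc h j)` are dual to the classes of the superfluous generators.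
  have hφ : φ - ∑ j' with j' ∉ S, b j' • D.cycHom (frameCyc h j') = 0 := by
    refine D.eq_zero_of_dualClass h fun j hj ↦ ?_
    rw [← homEval_apply, map_sub, map_sum]
    have h2 (j' : J) : D.homEval (D.dualClass h j) (b j' • D.cycHom (frameCyc h j')) =
        if j = j' then b j' else 0 := by
      rw [map_smul, D.homEval_frameCyc h hj, smul_ite, smul_zero, smul_eq_mul, mul_one]
    rw [Finset.sum_congr rfl fun j' _ ↦ h2 j', Finset.sum_ite_eq, if_pos (by simpa using hj)]
    exact sub_self _
  rw [sub_eq_zero.1 hφ, map_sum]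
  refine sum_mem fun j _ ↦ ?_
  rw [map_smul]
  exact Submodule.smul_mem _ _ (Submodule.subset_span ⟨frameCyc h j, rfl⟩)

/-- The multitor and the exterior power over an affine open subset with a chart. -/
lemma isGood_of_isChart (h : IsFrame i ι κ f S m) (hU : IsAffineOpen U)
    {I : Fin l → Ideal Γ(M, U)} (hI : ∀ k a, a ∈ I k ↔ fnRes (i k) U a = 0)
    (hf : IsChart I κ f S) (hσ : Function.Surjective (ι.app U).hom)
    (hker : RingHom.ker (ι.app U).hom = ⨆ k, I k) : D.IsGood q U := by
  have hc (z : PushCyc i U) (a : Fin l) : ∃ c : {x // κ x = a} → Γ(M, U),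
      z.1 a = ∑ x : {x // κ x = a}, c x * f x := by
    obtain ⟨c, hc⟩ := (h.reg a).span ⟨U, hU⟩ le_rfl (z.1 a)
      ((smul_pushPointed (i a) U _).symm.trans (z.2.1 a))
    refine ⟨c, hc.trans (Finset.sum_congr rfl fun x _ ↦ ?_)⟩
    rw [rr_self]
  choose c hc using hc
  have hc' (z : PushCyc i U) (a : Fin l) :
      z.1 a = ∑ x : {x // κ x = a}, c z (κ x) ⟨x, rfl⟩ * f x := by
    refine (hc z a).trans (Finset.sum_congr rfl fun x _ ↦ ?_)
    obtain ⟨x, rfl⟩ := x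
    rfl
  have hδ (j j' : J) : (D.homEval (D.dualClass h j) ∘ₗ (D.dualEquiv (ι ⁻¹ᵁ U)).symm.toLinearMap)
      (D.dualSec (frameCyc h j')) = D.homEval (D.dualClass h j) (D.cycHom (frameCyc h j')) := by
    rw [dualSec_eq, LinearMap.comp_apply, LinearEquiv.coe_coe, LinearEquiv.symm_apply_apply]
  have key := wordHom_chart (F := fun a ↦ toPre (pushO (i a))) (fun a ↦ pushPointed (i a)) q (op U)
    (fun k x ↦ (h.surjective k ⟨U, hU⟩ le_rfl x).imp fun a ha ↦
      ha.symm.trans (smul_pushPointed (i k) U a).symm)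
    (fun k a ↦ (hI k a).trans (by rw [← smul_pushPointed]; rfl)) hf (ι.app U).hom hσ hker
    (fun z j ↦ c z (κ j) ⟨j, rfl⟩)
    (fun z k ↦ (hc' z k).trans (Finset.sum_subtype (Finset.univ.filter fun j ↦ κ j = k) (by simp)
      fun j ↦ c z (κ j) ⟨j, rfl⟩ * f j).symm)
    (fun j ↦ D.dualSec (frameCyc h j))
    (fun j ↦ D.homEval (D.dualClass h j) ∘ₗ (D.dualEquiv (ι ⁻¹ᵁ U)).symm.toLinearMap)
    (fun j hj ↦ by rw [hδ, D.homEval_frameCyc h hj, if_pos rfl])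
    (fun j hj j' _ hjj' ↦ by rw [hδ, D.homEval_frameCyc h hj, if_neg hjj'])
    (fun z ↦ D.dualSec z)
    (fun z ↦ by
      have := D.cycHom_eq_sum_frameCyc h hU z (fun j ↦ c z (κ j) ⟨j, rfl⟩) (hc' z)
      rw [dualSec_eq, this, map_sum]
      exact Finset.sum_congr rfl fun j _ ↦ map_smul _ _ _)
    (fun j _ ↦ ⟨frameCyc h j, rfl⟩)
  refine ⟨key.1, fun x ↦ ?_, fun y ↦ ?_⟩
  · obtain ⟨x, rfl⟩ := (freeEl (R := M.presheaf) (S := pushTuples i q)).surjective x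
    refine (key.2 x).trans ?_
    rw [← Submodule.coe_eq_zero, coe_wedgeSum]
  · obtain ⟨x, hx⟩ := exists_sum_ιMulti hσ (D.span_dualSec h) q y
    exact ⟨freeEl (R := M.presheaf) (S := pushTuples i q) x, hx⟩

end QuotData

end Good

/-! ### Comparison of the sheaves -/

section Compare

open Opposite TopologicalSpace

variable {M Z : Scheme.{u}} {l : ℕ} {Y : Fin l → Scheme.{u}} {i : ∀ a, Y a ⟶ M} {ι : Z ⟶ M}

lemma exists_affine_preimage_le (hι : Topology.IsInducing ι) {U : M.Opens} {W : Z.Opens} {z : Z}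
    (hz : z ∈ W) (hzU : ι z ∈ U) :
    ∃ V : M.affineOpens, V.1 ≤ U ∧ ι z ∈ V.1 ∧ ι ⁻¹ᵁ V.1 ≤ W := by
  obtain ⟨t, ht, htW⟩ := hι.isOpen_iff.1 W.2
  let W' : M.Opens := ⟨t, ht⟩
  have hzt : ι z ∈ W' := by
    change z ∈ ι ⁻¹' t
    rw [htW]
    exact hz
  obtain ⟨V, hV, hzV⟩ := exists_affine_le (U := U ⊓ W') ⟨hzU, hzt⟩
  refine ⟨V, hV.trans inf_le_left, hzV, fun x hx ↦ ?_⟩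
  have hx' : x ∈ ι ⁻¹' t := (hV.trans inf_le_right) hx
  rw [htW] at hx'
  exact hx'

namespace QuotData

variable (D : QuotData i ι) (q : ℕ)

/-- If every point has arbitrarily small neighborhoods over which the multitor and the exterior
power vanish, or below which combinations of tuples compare the two, then the multitor sheaf is
isomorphic to the exterior power of the dual of the quotient. -/
lemma nonempty_iso (hι : Topology.IsInducing ι) (H : ∀ (W : M.Opens), ∀ p ∈ W,
    (∃ U ≤ W, p ∈ U ∧ Subsingleton (Sec (pushTor i q) (op U)) ∧
      Subsingleton Γ(D.target q, U)) ∨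
    (p ∈ Set.range ι ∧ ∃ U : M.affineOpens, U.1 ≤ W ∧ p ∈ U.1 ∧
      ∀ V : M.affineOpens, V.1 ≤ U.1 → D.IsGood q V.1)) :
    Nonempty (sheafify (pushTor i q) ≅ D.target q) := by
  refine nonempty_sheafify_iso (pushWordHom i q) (D.wedgeHom q) ?_ ?_ ?_ ?_
  · intro U y p hp
    obtain ⟨V, hV, hpV, hs, -⟩ | ⟨-, V, hV, hpV, h⟩ := H U p hp
    · exact ⟨V, hV, 0, hpV, hs.elim _ _⟩
    · obtain ⟨x, hx⟩ := (h V le_rfl).surjective (secRes _ (homOfLE hV).op y)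
      exact ⟨V.1, hV, x, hpV, hx⟩
  · intro U t p hp
    obtain ⟨V, hV, hpV, -, hs⟩ | ⟨⟨z, rfl⟩, V, hV, hpV, h⟩ := H U p hp
    · exact ⟨V, hV, 0, hpV, hs.elim _ _⟩
    · obtain ⟨W, hW, y, hzW, hy⟩ := extEl_locally_surjective q (MultiTor.dual D.Q) (W := ι ⁻¹ᵁ U) t
        (p := z) hp
      obtain ⟨V', hV', hzV', hle⟩ := exists_affine_preimage_le hι hzW hpV
      obtain ⟨x, hx⟩ := (h V' hV').wedgeSum_surjective
        (extMap q (MultiTor.res (MultiTor.dual D.Q) hle) y)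
      refine ⟨V'.1, hV'.trans hV, x, hzV', ?_⟩
      rw [secTo_wedgeHom, hx]
      refine (extEl_res q (MultiTor.dual D.Q) hle y).trans ?_
      exact (congrArg (MultiTor.res (extPower q (MultiTor.dual D.Q)) hle) hy).trans
        (res_res (extPower q (MultiTor.dual D.Q)) hW hle t).symm
  · intro U x hx
    refine eq_of_local (D.target q) fun p hp ↦ ?_
    obtain ⟨V, hV, hpV, -, hs⟩ | ⟨-, V, hV, hpV, h⟩ := H U p hp
    · exact ⟨V, hV, hpV, hs.elim _ _⟩
    · refine ⟨V.1, hV, hpV, ?_⟩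
      rw [map_zero, ← secTo_res, secTo_wedgeHom]
      have h1 : secMap (pushWordHom i q) (op V.1) (secRes _ (homOfLE hV).op x) = 0 := by
        rw [← secRes_secMap, hx, map_zero]
      rw [((h V le_rfl).eq_zero_iff _).1 h1, map_zero]
  · intro U x hx p hp
    obtain ⟨V, hV, hpV, hs, -⟩ | ⟨⟨z, rfl⟩, V, hV, hpV, h⟩ := H U p hp
    · exact ⟨V, hV, hpV, hs.elim _ _⟩
    · rw [secTo_wedgeHom] at hx
      obtain ⟨W, hW, hzW, hy⟩ := extEl_locally_injective q (MultiTor.dual D.Q) (W := ι ⁻¹ᵁ U)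
        (D.wedgeSum q U x) hx (p := z) hp
      obtain ⟨V', hV', hzV', hle⟩ := exists_affine_preimage_le hι hzW hpV
      refine ⟨V'.1, hV'.trans hV, hzV', ((h V' hV').eq_zero_iff _).2 ?_⟩
      rw [wedgeSum_res]
      have h1 := extMap_comp q (MultiTor.res (MultiTor.dual D.Q) hW)
        (MultiTor.res (MultiTor.dual D.Q) hle)
        (MultiTor.res (MultiTor.dual D.Q) (hle.trans hW)) (ring_res_res _ _) (res_res _ _ _)
        (D.wedgeSum q U x)
      rw [hy, map_zero] at h1
      exact h1

end QuotData

end Compare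

section Final

open Opposite TopologicalSpace

variable {M : Scheme.{u}} {l : ℕ} (Y : Fin l → M.IdealSheafData)

/-- The quotient of the normal sheaves of a family of closed subschemes, with the classes of
homomorphisms from the ideal sheaves. -/
def quotData : QuotData (fun a ↦ (Y a).subschemeι) (inter Y).subschemeι where
  Q := quot Y
  rho := interRes Y
  rho_fnRes a U x := congrArg (fun φ : structureSheaf M ⟶ pushO (inter Y).subschemeι ↦ φ.app U x)
    (toPushforward_comp (interInclusion Y a) (Y a).subschemeι (inter Y).subschemeι
      (interInclusion_comp Y a))
  incl := interIdeal Y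
  idealIncl_incl a U s := idealIncl_idealSheafMap (Y a).subschemeι (inter Y).subschemeι
    (interInclusion Y a) (interInclusion_comp Y a) U s
  q := quotSec Y
  q_res a _ _ h ν := quotSec_res Y a h ν
  eq_zero _ h := eq_zero_of_quotSec Y h
  sum_q ν μ h := sum_quotSec_eq_zero Y ν μ h
  exists_hom s hs := exists_quotHom Y s hs

lemma subsingleton_pushTor (q : ℕ) (U : M.affineOpens) (w : Fin l → Γ(M, U.1))
    (hw : ∀ a, w a ∈ (Y a).ideal U) (h1 : ∑ a, w a = 1) :
    Subsingleton (Sec (pushTor (fun a ↦ (Y a).subschemeι) q) (op U.1)) :=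
  presheafTor_subsingleton q (op U.1) w (fun a x ↦
    (pushPointed (Y a).subschemeι).ann (op U.1) (w a)
      ((smul_pushPointed _ _ _).trans ((fnRes_eq_zero_iff _ _ _).2 (hw a))) x) h1

lemma app_eq_zero_of_mem {U : M.affineOpens} {a : Fin l} {x : Γ(M, U.1)} (hx : x ∈ (Y a).ideal U) :
    (inter Y).subschemeι.app U.1 x = 0 := by
  refine (fnRes_eq_zero_iff (inter Y) U x).2 ?_
  rw [ideal_iSup_apply]
  exact Ideal.mem_iSup_of_mem a hx

lemma subsingleton_target (q : ℕ) (U : M.affineOpens) (w : Fin l → Γ(M, U.1))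
    (hw : ∀ a, w a ∈ (Y a).ideal U) (h1 : ∑ a, w a = 1) :
    Subsingleton Γ((quotData Y).target q, U.1) := by
  have h0 : (1 : Γ((inter Y).subscheme, (inter Y).subschemeι ⁻¹ᵁ U.1)) = 0 := by
    rw [← map_one ((inter Y).subschemeι.app U.1).hom, ← h1, map_sum]
    exact Finset.sum_eq_zero fun a _ ↦ app_eq_zero_of_mem Y (hw a)
  have : Subsingleton Γ((inter Y).subscheme, (inter Y).subschemeι ⁻¹ᵁ U.1) :=
    subsingleton_of_zero_eq_one h0.symm
  exact Module.subsingleton Γ((inter Y).subscheme, (inter Y).subschemeι ⁻¹ᵁ U.1)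
    Γ(extPower q (dual (quotData Y).Q), (inter Y).subschemeι ⁻¹ᵁ U.1)

/-- A chart that remains one on all smaller affine open subsets makes all of them good. -/
lemma isGood_of_forall_isChart (q : ℕ) {U : M.affineOpens} {J : Type u} [Finite J] {κ : J → Fin l}
    {g : J → Γ(M, U.1)} {S : Set J} (h : ∀ (V : M.affineOpens) (h : V.1 ≤ U.1),
      IsChart (fun a ↦ (Y a).ideal V) κ (fun j ↦ rr h (g j)) S)
    (V : M.affineOpens) (hV : V.1 ≤ U.1) : (quotData Y).IsGood q V.1 := by
  classical
  have := Fintype.ofFinite J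
  let f (j : J) : Γ(M, V.1) := rr hV (g j)
  have hf (W : M.affineOpens) (hW : W.1 ≤ V.1) :
      IsChart (fun a ↦ (Y a).ideal W) κ (fun j ↦ rr hW (f j)) S := by
    have h1 : (fun j ↦ rr hW (f j)) = fun j ↦ rr (hW.trans hV) (g j) :=
      funext fun j ↦ (ring_res_res hV hW (g j)).symm
    rw [h1]
    exact h W (hW.trans hV)
  have reg (a : Fin l) : IsRegGen (Y a).subschemeι fun j : {j // κ j = a} ↦ f j :=
    isRegGen_of_regularOn (Y a) V (κ · = a) f (fun W hW ↦ (hf W hW).span a)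
      fun W hW ↦ (hf W hW).regularOn a
  have regInter : IsRegGen (inter Y).subschemeι fun j : {j // j ∈ S} ↦ f j :=
    isRegGen_of_regularOn (inter Y) V (· ∈ S) f
      (fun W hW ↦ ((hf W hW).span_inter).trans (ideal_iSup_apply Y W).symm)
      fun W hW ↦ (hf W hW).regularOn_inter
  obtain ⟨m, hm⟩ := (quotData Y).exists_isFrame V κ f S reg regInter
    fun a W _ ↦ (Y a).subschemeι_app_surjective W
  refine (quotData Y).isGood_of_isChart q hm V.2 (I := fun a ↦ (Y a).ideal V)
    (fun a x ↦ (fnRes_eq_zero_iff (Y a) V x).symm) (h V hV)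
    ((inter Y).subschemeι_app_surjective V) ?_
  rw [(inter Y).ker_subschemeι_app, ideal_iSup_apply]

end Final

end MultiTor

end

theorem mainTheorem4 {k : Type u} [Field k] (M : Scheme.{u}) (f : M ⟶ Spec (CommRingCat.of k))
    [IsSeparated f] [QuasiCompact f] [Smooth f] {l : ℕ} (Y : Fin l → M.IdealSheafData)
    (hY : ∀ i, Smooth ((Y i).subschemeι ≫ f))
    (hZ : Smooth ((⨆ i, Y i).subschemeι ≫ f)) (q : ℕ) :
    Nonempty
      (MultiTor.torSheaf q (fun i ↦ (Scheme.Modules.pushforward (Y i).subschemeι).obj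
          (MultiTor.structureSheaf (Y i).subscheme)) ≅
        (Scheme.Modules.pushforward (⨆ i, Y i).subschemeι).obj
          (MultiTor.extPower q (MultiTor.dual (MultiTor.normalQuotient Y)))) := by
  refine (MultiTor.quotData Y).nonempty_iso q
    (⨆ i, Y i).subschemeι.isEmbedding.isInducing fun W p hp ↦ ?_
  by_cases hpZ : p ∈ (⨆ i, Y i).support
  · right
    obtain ⟨U, hUW, hpU, J, _, κ, g, S, h⟩ := MultiTor.exists_isChart_affine Y f hY hZ hpZ hp
    refine ⟨?_, U, hUW, hpU, MultiTor.isGood_of_forall_isChart Y q h⟩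
    rw [Scheme.IdealSheafData.range_subschemeι]
    exact hpZ
  · left
    obtain ⟨U, hUW, hpU, w, hw, h1⟩ := MultiTor.exists_sum_eq_one Y hpZ hp
    exact ⟨U.1, hUW, hpU, MultiTor.subsingleton_pushTor Y q U w hw h1,
      MultiTor.subsingleton_target Y q U w hw h1⟩
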